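/- **Setting.** Fix an integer $N\ge 1$. Let $W(x,y)=xy^2+x^{2N+1}$, $w(x)=x^{2N+1}$, with iterated divided differences $w(s_1,\dots,s_k)=\frac{w(s_1,\dots,s_{k-1})-w(s_1,\dots,s_{k-2},s_k)}{s_{k-1}-s_k}$, and grade polynomials by $\deg_q x=2$, $\deg_q y=2N$ (with or without indices). Let $J_W=\mathbb Q[x,y]/(\partial_xW,\partial_yW)$, with basis $1,x,\dots,x^{2N},y$. It is a Frobenius algebra with trace $\mathrm{Tr}=-\frac1{2(2N+1)}(x^{2N})^*$, multiplication $m$ and comultiplication $$\Delta(a)=2\Big(ay\otimes y-(2N+1)\sum_{i=0}^{2N}ax^i\otimes x^{2N-i}\Big).$$ Matrix factorizations are $\mathbb Z/2$- and $q$-graded modules with an odd differential $D$ of $q$-degree $2N+1$ whose square is a fixed polynomial. Morphisms are even linear maps commuting with $D$. Two of them of $q$-degree $k$ are homotopic ($\simeq$) if they differ by $DX+XD$ for an odd linear $X$ of $q$-degree $k-2N-1$. A Koszul row $(a\,|\,b)$ is $R_0\xrightarrow{b}R_1\xrightarrow{a}R_0$, where the generator of $R_0$ has $q$-degree $0$ and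 the one of $R_1$ has $q$-degree $\deg_q a-(2N+1)$; several rows are tensored, $D=D_1\otimes1+(-1)^{\mathrm{parity}}\otimes D_2$, and $e_{\alpha\beta}$ denotes the generators for two rows. The arc joining legs $i,j$ is $$A_{ij}:\quad (y_j+y_i\,|\,x_j(y_j-y_i)),\quad (x_j+x_i\,|\,y_i^2+w(-x_i,x_j)).$$ Joining the legs $i,j$ means dividing by $(x_i+x_j,\,y_i+y_j)$. The unknot space $C$ is the homology of $A_{12}$ with its two legs joined, with the operators $\hat x=x_1$, $\hat y=y_1$ (first leg). **Saddle morphisms.** Over $\mathbb Q[x_1,\dots,x_4,y_1,\dots,y_4]$ put $\Gamma_\parallel=A_{13}\otimes A_{24}$, $\Gamma_\times=A_{14}\otimes A_{23}$, $\Gamma_{=}=A_{12}\otimes A_{34}$, and $p=(x_2+x_4,\,y_2+y_4)$, $q=(x_3+x_4,\,y_3+y_4)$, $r=(x_1+x_4,\,y_1+y_4)$, $$\tilde C=w(x_1,x_2,-x_3,x_4)+w(x_1,-x_1,x_2,x_4)+w(x_1,-x_1,-x_2,x_4),$$ $$B=x_1y_1+x_2y_2+x_3y_3-x_4y_4,$$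 $$\begin{aligned}A={}&-(y_3+y_4)(y_1+y_2+y_4)-y_1y_2+w(-x_1,x_3)+(x_2+x_4)\,w(x_1,x_2,-x_3)\\&-(x_2+x_4)(x_1+x_4)\big(w(x_1,-x_1,x_2,x_4)+w(x_1,-x_1,-x_2,x_4)\big).\end{aligned}$$ Let $K$ have the rows $(\sum_i x_i\,|\,A)$, $(\sum_i y_i\,|\,B)$, and let $T(a;b,c)$ have the rows $(a_1\,|\,b_2c_2+b_1c_1\tilde C)$, $(a_2\,|\,b_2c_1+b_1c_2)$. There are graded isomorphisms $\Gamma_\parallel\cong K\otimes T(p;q,r)$, $\Gamma_\times\cong K\otimes T(r;p,q)$, $\Gamma_{=}\cong K\otimes T(q;p,r)$. For a pair $c=(c_1,c_2)$ let $S_c$ be the map with the matrix $\begin{pmatrix}0&1\\ c_2^2-c_1^2\tilde C&0\end{pmatrix}$ in the bases $e_{00},e_{11}$ and $\begin{pmatrix}c_2&-c_1\\ c_1\tilde C&-c_2\end{pmatrix}$ in the bases $e_{01},e_{10}$. For any choice of these isomorphisms, the maps $$F=\mathrm{id}\otimes S_q:\Gamma_\parallel\to\Gamma_\times,\qquad H=\mathrm{id}\otimes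 S_q:\Gamma_\times\to\Gamma_\parallel,\qquad G=\mathrm{id}\otimes S_p:\Gamma_\times\to\Gamma_{=}$$ are morphisms of $q$-degree $2N$ that are not null-homotopic (saddle morphisms). **Semi-closed saddle morphisms.** Join the legs 2 and 4 and regard everything as modules over $\mathbb Q[x_1,y_1,x_3,y_3]$. There are homotopy equivalences of $q$-degree $0$ of the joined $\Gamma_\parallel$ with $A_{13}\otimes_{\mathbb Q}C$, where $m\otimes[z]$ corresponds, up to homotopy, to $m\otimes z$ for each cycle $z$ of the joined $A_{24}$, and of the joined $\Gamma_\times$ and the joined $\Gamma_{=}$ with $A_{13}$. For any choice of them, let $$F':A_{13}\otimes C\to A_{13},\qquad H':A_{13}\to A_{13}\otimes C,\qquad G':A_{13}\to A_{13}$$ be the morphisms which correspond to $F$, $H$, $G$. Then there is a nonzero $e\in C$ of $q$-degree $-2N$ such that $\hat x^i(e)$ $(0\le i\le 2N)$, $\hat y(e)$ is a basis of $C$ and, with $\hat x=x_1$, $\hat y=y_1$ on $A_{13}$, $$F'\simeq\sum_{i=0}^{2N}\hat x^i\otimes(\hat x^i(e))^*+\hat y\otimes(\hat y(e))^*,$$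 $$H'\simeq2\Big(\hat y\otimes\hat y(e)-(2N+1)\sum_{i=0}^{2N}\hat x^i\otimes\hat x^{2N-i}(e)\Big),\qquad G'\simeq0 .$$ **Closed saddle morphisms.** Join also the legs 1 and 3 and pass to homology. Then $A_{13}$ becomes $C$, and $A_{13}\otimes C$ becomes $C\otimes C$ through the bijection $[z]\otimes c\mapsto[z\otimes c]$. Under the isomorphism $J_W\to C$, $f\mapsto f(\hat x,\hat y)e$ (of $q$-degree $-2N$), the maps induced by $F'$, $H'$, $G'$ become $m:J_W\otimes J_W\to J_W$, $\Delta:J_W\to J_W\otimes J_W$ and $0$. -/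

import Mathlib

open scoped TensorProduct Kronecker

noncomputable section

namespace SaddleMF

/-! ### Polynomials -/

/-- The polynomial ring `ℚ[x₁,…,xₙ,y₁,…,yₙ]` attached to `n` legs (legs are numbered from `0` in
the code: the element `i` of `Fin n` is the leg number `i + 1`). -/
abbrev P (n : ℕ) : Type := MvPolynomial (Fin n ⊕ Fin n) ℚ

/-- The variable `x` of the leg `i`. -/
def xv {n : ℕ} (i : Fin n) : P n := MvPolynomial.X (Sum.inl i)

/-- The variable `y` of the leg `i`. -/
def yv {n : ℕ} (i : Fin n) : P n := MvPolynomial.X (Sum.inr i)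

/-- The `q`-degrees of the variables: `deg x = 2`, `deg y = 2N`. -/
def wt (N n : ℕ) : Fin n ⊕ Fin n → ℤ := Sum.elim (fun _ => 2) (fun _ => 2 * (N : ℤ))

/-- The ring homomorphism that relabels the legs by `f`. -/
def legHom {m n : ℕ} (f : Fin m → Fin n) : P m →ₐ[ℚ] P n := MvPolynomial.rename (Sum.map f f)

/-- The basic polynomial `W(x,y) = x y² + x^(2N+1)`. -/
def basicW {S : Type} [CommRing S] (N : ℕ) (x y : S) : S := x * y ^ 2 + x ^ (2 * N + 1)

/-- The complete homogeneous symmetric polynomial of degree `k`, evaluated at a list. -/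
def hsym {S : Type} [CommRing S] : List S → ℕ → S
  | [], k => if k = 0 then 1 else 0
  | a :: l, k => ∑ i ∈ Finset.range (k + 1), a ^ i * hsym l (k - i)

theorem hsym_zero {S : Type} [CommRing S] (l : List S) : hsym l 0 = 1 := by
  induction l with
  | nil => simp [hsym]
  | cons a l ih => simp [hsym, ih]

theorem hsym_singleton {S : Type} [CommRing S] (a : S) (k : ℕ) : hsym [a] k = a ^ k := by
  simp only [hsym]
  rw [Finset.sum_eq_single k]
  · simp
  · intro i hi hne
    have : k - i ≠ 0 := by
      have := Finset.mem_range.1 hi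
      omega
    simp [this]
  · simp

/-- The iterated divided difference `w(s₁,…,sₖ)` of `w(x) = x^(2N+1)`: it is the complete
homogeneous symmetric polynomial of degree `2N + 2 - k` in `s₁,…,sₖ`. -/
def dd {S : Type} [CommRing S] (N : ℕ) (l : List S) : S := hsym l (2 * N + 2 - l.length)

theorem hsym_append_pair {S : Type} [CommRing S] (l : List S) (a b : S) (k : ℕ) :
    (a - b) * hsym (l ++ [a, b]) k = hsym (l ++ [a]) (k + 1) - hsym (l ++ [b]) (k + 1) := by
  induction l generalizing k with
  | nil =>
    simp only [List.nil_append, hsym_singleton]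
    rw [← Commute.mul_geom_sum₂ (Commute.all a b)]
    simp only [hsym]
    congr 1
    refine Finset.sum_congr rfl fun i hi => ?_
    have := hsym_singleton b (k - i)
    simp only [hsym] at this
    rw [this]
    simp
  | cons c l ih =>
    simp only [List.cons_append, hsym]
    rw [Finset.sum_range_succ _ (k + 1), Finset.sum_range_succ _ (k + 1)]
    simp only [Nat.sub_self, hsym_zero]
    rw [add_sub_add_right_eq_sub, ← Finset.sum_sub_distrib, Finset.mul_sum]
    refine Finset.sum_congr rfl fun i hi => ?_
    have hi' : k + 1 - i = (k - i) + 1 := by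
      have := Finset.mem_range.1 hi
      omega
    rw [hi', ← mul_sub, ← ih]
    ring

/-- `w(s) = s^(2N+1)`. -/
theorem dd_singleton {S : Type} [CommRing S] (N : ℕ) (a : S) : dd N [a] = a ^ (2 * N + 1) := by
  simp [dd, hsym_singleton]

/-- The defining recursion of the divided differences. -/
theorem dd_append_pair {S : Type} [CommRing S] (N : ℕ) (l : List S) (a b : S)
    (hl : l.length ≤ 2 * N) :
    (a - b) * dd N (l ++ [a, b]) = dd N (l ++ [a]) - dd N (l ++ [b]) := by
  have h : 2 * N + 2 - (l.length + 1) = 2 * N + 2 - (l.length + 2) + 1 := by omega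
  simp only [dd, List.length_append, List.length_cons, List.length_nil, zero_add, h]
  exact hsym_append_pair l a b _

/-! ### Matrix factorizations of finite rank -/

/-- The sign `(-1)^p`. -/
def sgn {S : Type} [CommRing S] (p : ZMod 2) : S := if p = 0 then 1 else -1

/-- A matrix factorization with a chosen basis indexed by `ι`: each basis element has a parity and
a `q`-degree, and the odd twisted differential `d` satisfies `d² = pot`. Matrices act on column
vectors, so `d i j` is the coefficient of the `i`-th basis element in the image of the `j`-th. -/
structure MatFact (ι : Type) [Fintype ι] [DecidableEq ι] (S : Type) [CommRing S] where
  par : ι → ZMod 2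
  deg : ι → ℤ
  d : Matrix ι ι S
  pot : S
  odd : ∀ i j, par i = par j → d i j = 0
  sq : d * d = pot • (1 : Matrix ι ι S)

/-- The one-row Koszul matrix factorization `S₀ --b--> S₁ --a--> S₀` of `a b`; the generator of
`S₀` has degree `0`, the generator of `S₁` has degree `k`. -/
def row {S : Type} [CommRing S] (a b : S) (k : ℤ) : MatFact (Fin 2) S where
  par := ![0, 1]
  deg := ![0, k]
  d := !![0, a; b, 0]
  pot := a * b
  odd := by
    intro i j h
    fin_cases i <;> fin_cases j <;> simp_all
  sq := by
    ext i j
    fin_cases i <;> fin_cases j <;> simp [Matrix.mul_apply, Fin.sum_univ_two, mul_comm]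

theorem zmod2_ne {p q : ZMod 2} (h : p ≠ q) : p = q + 1 := by
  revert p q; decide

theorem zmod2_cases (p : ZMod 2) : p = 0 ∨ p = 1 := by
  revert p; decide

theorem zmod2_two : (1 : ZMod 2) + 1 = 0 := by decide

/-- The tensor product over `S`, with differential `d ⊗ 1 + (-1)^par ⊗ d`. -/
def MatFact.tensor {ι κ : Type} [Fintype ι] [DecidableEq ι] [Fintype κ] [DecidableEq κ]
    {S : Type} [CommRing S] (M : MatFact ι S) (M' : MatFact κ S) : MatFact (ι × κ) S where
  par := fun i => M.par i.1 + M'.par i.2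
  deg := fun i => M.deg i.1 + M'.deg i.2
  d := M.d ⊗ₖ (1 : Matrix κ κ S) + Matrix.diagonal (fun i => sgn (M.par i)) ⊗ₖ M'.d
  pot := M.pot + M'.pot
  odd := by
    rintro ⟨i, k⟩ ⟨j, l⟩ h
    simp only at h
    simp only [Matrix.add_apply, Matrix.kroneckerMap_apply, Matrix.one_apply,
      Matrix.diagonal_apply]
    by_cases hij : i = j
    · subst hij
      rw [M'.odd k l (add_left_cancel h), M.odd i i rfl]
      simp
    · by_cases hkl : k = l
      · subst hkl
        rw [M.odd i j (add_right_cancel h)]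
        simp [hij]
      · simp [hij, hkl]
  sq := by
    have h1 : M.d * Matrix.diagonal (fun i => sgn (M.par i))
        + Matrix.diagonal (fun i => sgn (M.par i)) * M.d = 0 := by
      ext i j
      simp only [Matrix.add_apply, Matrix.mul_diagonal, Matrix.diagonal_mul, Matrix.zero_apply]
      by_cases h : M.par i = M.par j
      · rw [M.odd i j h]; simp
      · have h' := zmod2_ne h
        rw [h']
        generalize M.par j = p
        rcases zmod2_cases p with h | h <;> simp [sgn, h, zmod2_two]
    have h2 : Matrix.diagonal (fun i => (sgn (M.par i) : S))
        * Matrix.diagonal (fun i => sgn (M.par i)) = 1 := by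
      rw [Matrix.diagonal_mul_diagonal, ← Matrix.diagonal_one]
      congr 1
      funext i
      rcases zmod2_cases (M.par i) with h | h <;> simp [sgn, h]
    rw [add_mul, mul_add, mul_add, ← Matrix.mul_kronecker_mul, ← Matrix.mul_kronecker_mul,
      ← Matrix.mul_kronecker_mul, ← Matrix.mul_kronecker_mul, M.sq, M'.sq, h2]
    simp only [mul_one, one_mul]
    have h3 : (M.d * Matrix.diagonal (fun i => sgn (M.par i))) ⊗ₖ M'.d
        + (Matrix.diagonal (fun i => sgn (M.par i)) * M.d) ⊗ₖ M'.d = 0 := by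
      rw [← Matrix.add_kronecker, h1, Matrix.zero_kronecker]
    rw [add_assoc, ← add_assoc (_ ⊗ₖ M'.d) _ _, h3, zero_add, Matrix.smul_kronecker,
      Matrix.kronecker_smul, Matrix.one_kronecker_one, add_smul]

/-- The 1-arc Koszul matrix factorization of an arc that connects two outward oriented legs with
variables `x₁,y₁` and `x₂,y₂`:
its rows are `(y₂ + y₁ | x₂ (y₂ - y₁))` and `(x₂ + x₁ | y₁² + w(-x₁,x₂))`. -/
def arc {S : Type} [CommRing S] (N : ℕ) (x₁ y₁ x₂ y₂ : S) : MatFact (Fin 2 × Fin 2) S :=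
  (row (y₂ + y₁) (x₂ * (y₂ - y₁)) (-1)).tensor
    (row (x₂ + x₁) (y₁ ^ 2 + dd N [-x₁, x₂]) (1 - 2 * N))

/-- The arc is a matrix factorization of `W(x₁,y₁) + W(x₂,y₂)`. -/
theorem arc_pot {S : Type} [CommRing S] (N : ℕ) (x₁ y₁ x₂ y₂ : S) :
    (arc N x₁ y₁ x₂ y₂).pot = basicW N x₁ y₁ + basicW N x₂ y₂ := by
  have h := dd_append_pair N [] (-x₁) x₂ (by simp)
  simp only [List.nil_append, dd_singleton] at h
  rw [Odd.neg_pow ⟨N, rfl⟩] at h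
  simp only [arc, MatFact.tensor, row, basicW]
  linear_combination -h

/-- The index set of the bases of 2-arc matrix factorizations. -/
abbrev Idx : Type := (Fin 2 × Fin 2) × (Fin 2 × Fin 2)

/-- The 2-arc matrix factorization of the arcs `1–3` and `2–4`. -/
def parMF (N : ℕ) : MatFact Idx (P 4) :=
  (arc N (xv 0) (yv 0) (xv 2) (yv 2)).tensor (arc N (xv 1) (yv 1) (xv 3) (yv 3))

/-- The 2-arc matrix factorization of the (virtually crossing) arcs `1–4` and `2–3`. -/
def virMF (N : ℕ) : MatFact Idx (P 4) :=
  (arc N (xv 0) (yv 0) (xv 3) (yv 3)).tensor (arc N (xv 1) (yv 1) (xv 2) (yv 2))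

/-- The 2-arc matrix factorization of the arcs `1–2` and `3–4`. -/
def horMF (N : ℕ) : MatFact Idx (P 4) :=
  (arc N (xv 0) (yv 0) (xv 1) (yv 1)).tensor (arc N (xv 2) (yv 2) (xv 3) (yv 3))

/-! ### Proper factorizations and the explicit saddle matrices -/

/-- The polynomial `A` of the common factor. -/
def polyA (N : ℕ) : P 4 :=
  -(yv 2 + yv 3) * (yv 0 + yv 1 + yv 3) - yv 0 * yv 1 + dd N [-xv 0, xv 2]
    + (xv 1 + xv 3) * dd N [xv 0, xv 1, -xv 2]
    - (xv 1 + xv 3) * (xv 0 + xv 3)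
      * (dd N [xv 0, -xv 0, xv 1, xv 3] + dd N [xv 0, -xv 0, -xv 1, xv 3])

/-- The polynomial `B` of the common factor. -/
def polyB : P 4 := xv 0 * yv 0 + xv 1 * yv 1 + xv 2 * yv 2 - xv 3 * yv 3

/-- The polynomial `C̃`. -/
def polyC (N : ℕ) : P 4 :=
  dd N [xv 0, xv 1, -xv 2, xv 3] + dd N [xv 0, -xv 0, xv 1, xv 3]
    + dd N [xv 0, -xv 0, -xv 1, xv 3]

/-- The common 2-row Koszul factor. -/
def commonMF (N : ℕ) : MatFact (Fin 2 × Fin 2) (P 4) :=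
  (row (xv 0 + xv 1 + xv 2 + xv 3) (polyA N) (1 - 2 * N)).tensor
    (row (yv 0 + yv 1 + yv 2 + yv 3) polyB (-1))

/-- The 2-row Koszul matrix factorization with the rows
`(a₁ | b₂ c₂ + b₁ c₁ C)` and `(a₂ | b₂ c₁ + b₁ c₂)`. -/
def properMF {S : Type} [CommRing S] (N : ℕ) (a b c : S × S) (C : S) :
    MatFact (Fin 2 × Fin 2) S :=
  (row a.1 (b.2 * c.2 + b.1 * c.1 * C) (1 - 2 * N)).tensor
    (row a.2 (b.2 * c.1 + b.1 * c.2) (-1))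

/-- `p = (x₂ + x₄, y₂ + y₄)`. -/
def pp : P 4 × P 4 := (xv 1 + xv 3, yv 1 + yv 3)

/-- `q = (x₃ + x₄, y₃ + y₄)`. -/
def qq : P 4 × P 4 := (xv 2 + xv 3, yv 2 + yv 3)

/-- `r = (x₁ + x₄, y₁ + y₄)`. -/
def rr : P 4 × P 4 := (xv 0 + xv 3, yv 0 + yv 3)

/-- The factorization `K_cmn ⊗ γ̃_p` for the arcs `1–3`, `2–4`. -/
def parK (N : ℕ) : MatFact Idx (P 4) := (commonMF N).tensor (properMF N pp qq rr (polyC N))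

/-- The factorization `K_cmn ⊗ γ̃_p` for the arcs `1–4`, `2–3`. -/
def virK (N : ℕ) : MatFact Idx (P 4) := (commonMF N).tensor (properMF N rr pp qq (polyC N))

/-- The factorization `K_cmn ⊗ γ̃_p` for the arcs `1–2`, `3–4`. -/
def horK (N : ℕ) : MatFact Idx (P 4) := (commonMF N).tensor (properMF N qq pp rr (polyC N))

/-- The matrix of the proper saddle morphism: in the basis `e₀₀, e₁₁` of the even part it is
`(0, 1; c₂² - c₁² C, 0)` and in the basis `e₀₁, e₁₀` of the odd part it is
`(c₂, -c₁; c₁ C, -c₂)`. -/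
def properSaddle {S : Type} [CommRing S] (c : S × S) (C : S) :
    Matrix (Fin 2 × Fin 2) (Fin 2 × Fin 2) S :=
  Matrix.of fun i j => match i, j with
    | (0, 0), (1, 1) => 1
    | (1, 1), (0, 0) => c.2 ^ 2 - c.1 ^ 2 * C
    | (0, 1), (0, 1) => c.2
    | (0, 1), (1, 0) => -c.1
    | (1, 0), (0, 1) => c.1 * C
    | (1, 0), (1, 0) => -c.2
    | _, _ => 0

/-- The matrix of `id ⊗ (proper saddle morphism)` on `K_cmn ⊗ γ̃_p`. -/
def saddleMatrix (N : ℕ) (c : P 4 × P 4) : Matrix Idx Idx (P 4) :=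
  (1 : Matrix (Fin 2 × Fin 2) (Fin 2 × Fin 2) (P 4)) ⊗ₖ properSaddle c (polyC N)

/-! ### Graded modules with a twisted differential (possibly of infinite rank) -/

/-- A module over `P n` with subspaces of elements of given parity and `q`-degree, and with an
endomorphism `d`. -/
structure DiffMod (n : ℕ) where
  carrier : Type
  [addCommGroup : AddCommGroup carrier]
  [module : Module (P n) carrier]
  [moduleQ : Module ℚ carrier]
  [tower : IsScalarTower ℚ (P n) carrier]
  gr : ZMod 2 → ℤ → Submodule ℚ carrier
  d : carrier →ₗ[P n] carrier

attribute [instance] DiffMod.addCommGroup DiffMod.module DiffMod.moduleQ DiffMod.tower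

/-- The free module underlying a matrix factorization, with its total grading. -/
def MatFact.toDiffMod {ι : Type} [Fintype ι] [DecidableEq ι] {n : ℕ} (N : ℕ)
    (M : MatFact ι (P n)) : DiffMod n where
  carrier := ι → P n
  gr := fun p k => Submodule.pi Set.univ fun i =>
    if M.par i = p then MvPolynomial.weightedHomogeneousSubmodule ℚ (wt N n) (k - M.deg i) else ⊥
  d := M.d.mulVecLin

/-- `f` is a chain map (it commutes with the differentials). -/
def IsChain {n : ℕ} {X Y : DiffMod n} (f : X.carrier →ₗ[P n] Y.carrier) : Prop :=
  f ∘ₗ X.d = Y.d ∘ₗ f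

/-- `f` is homogeneous of parity `s` and `q`-degree `k`. -/
def HasDeg {n : ℕ} {X Y : DiffMod n} (s : ZMod 2) (k : ℤ)
    (f : X.carrier →ₗ[P n] Y.carrier) : Prop :=
  ∀ p a, ∀ m ∈ X.gr p a, f m ∈ Y.gr (p + s) (a + k)

/-- `f` and `g`, even maps of `q`-degree `k`, are homotopic: `f - g = d h + h d` for an odd
`P n`-linear map `h` of `q`-degree `k - (2N+1)`, where `2N+1` is the degree of `d`. -/
def Homotopic {n : ℕ} {X Y : DiffMod n} (N : ℕ) (k : ℤ)
    (f g : X.carrier →ₗ[P n] Y.carrier) : Prop :=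
  ∃ h : X.carrier →ₗ[P n] Y.carrier, HasDeg 1 (k - (2 * N + 1)) h ∧
    f - g = Y.d ∘ₗ h + h ∘ₗ X.d

/-- A homotopy equivalence between `X` and `Y`: even maps of `q`-degree `0`, which commute with the
differentials and are inverse to each other up to homotopy. -/
structure HtpyEquiv {n : ℕ} (N : ℕ) (X Y : DiffMod n) where
  hom : X.carrier →ₗ[P n] Y.carrier
  inv : Y.carrier →ₗ[P n] X.carrier
  hom_chain : IsChain hom
  inv_chain : IsChain inv
  hom_deg : HasDeg 0 0 hom
  inv_deg : HasDeg 0 0 inv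
  inv_hom : Homotopic (X := X) (Y := X) N 0 (inv ∘ₗ hom) LinearMap.id
  hom_inv : Homotopic (X := Y) (Y := Y) N 0 (hom ∘ₗ inv) LinearMap.id

/-- An isomorphism of graded matrix factorizations. -/
structure GradedIso {n : ℕ} (X Y : DiffMod n) where
  equiv : X.carrier ≃ₗ[P n] Y.carrier
  chain : IsChain equiv.toLinearMap
  deg : HasDeg 0 0 equiv.toLinearMap
  symm_deg : HasDeg (X := Y) (Y := X) 0 0 equiv.symm.toLinearMap

/-- `f` is a non-trivial (not null-homotopic) even morphism of `q`-degree `2N`. -/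
def IsSaddle {n : ℕ} {X Y : DiffMod n} (N : ℕ) (f : X.carrier →ₗ[P n] Y.carrier) : Prop :=
  IsChain f ∧ HasDeg 0 (2 * N) f ∧ ¬ Homotopic N (2 * N) f 0

/-- The ideal `(x_i + x_j, y_i + y_j)`. -/
def joinIdeal {n : ℕ} (i j : Fin n) : Ideal (P n) := Ideal.span {xv i + xv j, yv i + yv j}

/-- Joining the (outward oriented) legs `i` and `j`: the quotient by `(x_i + x_j, y_i + y_j)`. -/
def DiffMod.join {n : ℕ} (X : DiffMod n) (i j : Fin n) : DiffMod n where
  carrier := X.carrier ⧸ (joinIdeal i j • ⊤ : Submodule (P n) X.carrier)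
  gr := fun p k => (X.gr p k).map
    ((joinIdeal i j • ⊤ : Submodule (P n) X.carrier).mkQ.restrictScalars ℚ)
  d := Submodule.mapQ _ _ X.d (Submodule.smul_top_le_comap_smul_top _ _)

/-- The map induced on the quotients by a linear map. -/
def joinMap {n : ℕ} {X Y : DiffMod n} (i j : Fin n) (f : X.carrier →ₗ[P n] Y.carrier) :
    (X.join i j).carrier →ₗ[P n] (Y.join i j).carrier :=
  Submodule.mapQ _ _ f (Submodule.smul_top_le_comap_smul_top _ _)

/-- The class of an element in the quotient. -/
def joinMk {n : ℕ} {X : DiffMod n} (i j : Fin n) (m : X.carrier) : (X.join i j).carrier :=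
  Submodule.Quotient.mk m

/-- A module over `P n` viewed as a module over `P m` through a relabelling of legs. -/
def DiffMod.restrict {m n : ℕ} (X : DiffMod n) (f : Fin m → Fin n) : DiffMod m :=
  letI : Module (P m) X.carrier := Module.compHom X.carrier (legHom f).toRingHom
  haveI : IsScalarTower ℚ (P m) X.carrier := ⟨fun c a z => by
    change legHom f (c • a) • z = c • (legHom f a • z)
    rw [map_smul, smul_assoc]⟩
  { carrier := X.carrier
    gr := X.gr
    d :=
      { toFun := X.d
        map_add' := X.d.map_add
        map_smul' := fun a z => X.d.map_smul (legHom f a) z } }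

/-- A `P n`-linear map viewed as a `P m`-linear map. -/
def restrictMap {m n : ℕ} {X Y : DiffMod n} (f : Fin m → Fin n)
    (g : X.carrier →ₗ[P n] Y.carrier) :
    (X.restrict f).carrier →ₗ[P m] (Y.restrict f).carrier where
  toFun := g
  map_add' := g.map_add
  map_smul' := fun a z => g.map_smul (legHom f a) z

/-- The homology `ker d / im d`. -/
abbrev DiffMod.Homology {n : ℕ} (X : DiffMod n) : Type :=
  ↥(LinearMap.ker X.d) ⧸ (LinearMap.range X.d).submoduleOf (LinearMap.ker X.d)

/-- The homology class of a cycle. -/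
def DiffMod.cls {n : ℕ} (X : DiffMod n) (z : X.carrier) (hz : X.d z = 0) : X.Homology :=
  Submodule.Quotient.mk ⟨z, hz⟩

/-- The elements of parity `p` and degree `k` of the homology. -/
def DiffMod.homologyGr {n : ℕ} (X : DiffMod n) (p : ZMod 2) (k : ℤ) : Submodule ℚ X.Homology :=
  ((X.gr p k).comap ((LinearMap.ker X.d).subtype.restrictScalars ℚ)).map
    (((LinearMap.range X.d).submoduleOf (LinearMap.ker X.d)).mkQ.restrictScalars ℚ)

/-- The map induced on homology by a chain map. -/
def homologyMap {n : ℕ} {X Y : DiffMod n} (f : X.carrier →ₗ[P n] Y.carrier) (hf : IsChain f) :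
    X.Homology →ₗ[P n] Y.Homology :=
  have hf' : ∀ z, f (X.d z) = Y.d (f z) := fun z => LinearMap.congr_fun hf z
  Submodule.mapQ _ _
    (f.restrict (p := LinearMap.ker X.d) (q := LinearMap.ker Y.d) fun z hz => by
      rw [LinearMap.mem_ker] at hz ⊢
      rw [← hf', hz, map_zero])
    (by
      rintro ⟨z, hz⟩ ⟨u, hu⟩
      exact ⟨f u, by rw [← hf', hu]; rfl⟩)

/-- The tensor product over `ℚ` with a graded vector space (with zero differential). -/
def DiffMod.tensorSpace {n : ℕ} (X : DiffMod n) (V : Type) [AddCommGroup V] [Module ℚ V]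
    (grV : ZMod 2 → ℤ → Submodule ℚ V) : DiffMod n where
  carrier := X.carrier ⊗[ℚ] V
  gr := fun p k => Submodule.span ℚ
    {t | ∃ p₁ p₂ k₁ k₂ m v, p₁ + p₂ = p ∧ k₁ + k₂ = k ∧ m ∈ X.gr p₁ k₁ ∧ v ∈ grV p₂ k₂ ∧
      t = m ⊗ₜ[ℚ] v}
  d := TensorProduct.AlgebraTensorModule.map X.d LinearMap.id

/-! ### The 1-arc factorization and the unknot space -/

/-- The 1-arc factorization over `P 2`. -/
def arcD (N : ℕ) : DiffMod 2 := (arc (S := P 2) N (xv 0) (yv 0) (xv 1) (yv 1)).toDiffMod N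

/-- The unknot space: the homology of the 1-arc factorization with its two legs joined. The
operators `x̂`, `ŷ` on it are the multiplications by the variables `xv 0`, `yv 0` of the first
leg. -/
abbrev Unk (N : ℕ) : Type := ((arcD N).join 0 1).Homology

/-- `Unk N`, graded by parity and `q`-degree. -/
def unkGr (N : ℕ) (p : ZMod 2) (k : ℤ) : Submodule ℚ (Unk N) := ((arcD N).join 0 1).homologyGr p k

/-- The tensor product of the 1-arc factorization and the unknot space. -/
def arcUnk (N : ℕ) : DiffMod 2 := (arcD N).tensorSpace (Unk N) (unkGr N)

/-- The map `m ↦ m ⊗ c`. -/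
def tens (N : ℕ) (c : Unk N) : (arcD N).carrier →ₗ[P 2] (arcUnk N).carrier :=
  (TensorProduct.AlgebraTensorModule.mk ℚ (P 2) (arcD N).carrier (Unk N)).flip c

/-- The map `m ⊗ c ↦ f(c) m`. -/
def contract (N : ℕ) (f : Unk N →ₗ[ℚ] ℚ) : (arcUnk N).carrier →ₗ[P 2] (arcD N).carrier :=
  (TensorProduct.AlgebraTensorModule.rid ℚ (P 2) (arcD N).carrier).toLinearMap ∘ₗ
    TensorProduct.AlgebraTensorModule.map LinearMap.id f

/-- `Σᵢ x̂ⁱ ⊗ (x̂ⁱ(e))* + ŷ ⊗ (ŷ(e))*` for a basis `b` made of `x̂ⁱ(e)`, `0 ≤ i ≤ 2N`,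
and `ŷ(e)`. -/
def mapM (N : ℕ) (b : Module.Basis (Fin (2 * N + 1) ⊕ Unit) ℚ (Unk N)) :
    (arcUnk N).carrier →ₗ[P 2] (arcD N).carrier :=
  (∑ i : Fin (2 * N + 1), (xv 0 : P 2) ^ (i : ℕ) • contract N (b.coord (Sum.inl i)))
    + (yv 0 : P 2) • contract N (b.coord (Sum.inr ()))

/-- `2 (ŷ ⊗ ŷ(e) - (2N+1) Σᵢ x̂ⁱ ⊗ x̂²ᴺ⁻ⁱ(e))`. -/
def mapD (N : ℕ) (e : Unk N) : (arcD N).carrier →ₗ[P 2] (arcUnk N).carrier :=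
  (2 : P 2) • ((yv 0 : P 2) • tens N ((yv 0 : P 2) • e)
    - (2 * N + 1 : P 2) • ∑ i ∈ Finset.range (2 * N + 1),
        (xv 0 : P 2) ^ i • tens N ((xv 0 : P 2) ^ (2 * N - i) • e))

/-! ### Semi-closed factorizations -/

/-- The 2-arc factorization of the arcs `1–3`, `2–4`, as a module over `P 4` with a differential. -/
def parD (N : ℕ) : DiffMod 4 := (parMF N).toDiffMod N

/-- Its presentation `K_cmn ⊗ γ̃_p`. -/
def parKD (N : ℕ) : DiffMod 4 := (parK N).toDiffMod N

/-- The 2-arc factorization of the arcs `1–4`, `2–3`, as a module over `P 4` with a differential. -/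
def virD (N : ℕ) : DiffMod 4 := (virMF N).toDiffMod N

/-- Its presentation `K_cmn ⊗ γ̃_p`. -/
def virKD (N : ℕ) : DiffMod 4 := (virK N).toDiffMod N

/-- The 2-arc factorization of the arcs `1–2`, `3–4`, as a module over `P 4` with a differential. -/
def horD (N : ℕ) : DiffMod 4 := (horMF N).toDiffMod N

/-- Its presentation `K_cmn ⊗ γ̃_p`. -/
def horKD (N : ℕ) : DiffMod 4 := (horK N).toDiffMod N

/-- Joining the legs 2 and 4; the result is a module over the polynomial ring of the remaining
legs 1 and 3 (which are the legs `0`, `1` of `P 2`). -/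
def semi (X : DiffMod 4) : DiffMod 2 := (X.join 1 3).restrict ![0, 2]

/-- The map obtained from a linear map by joining the legs 2 and 4. -/
def semiMap {X Y : DiffMod 4} (f : X.carrier →ₗ[P 4] Y.carrier) :
    (semi X).carrier →ₗ[P 2] (semi Y).carrier :=
  restrictMap ![0, 2] (joinMap 1 3 f)

/-- For `v` in the 1-arc factorization with the legs 2, 4: the map `m ↦ m ⊗ v` from the 1-arc
factorization with the legs 1, 3 to the arcs `1–3`, `2–4` with the legs 2 and 4 joined. -/
def glue (N : ℕ) (v : (arcD N).carrier) :
    (arcD N).carrier →ₗ[P 2] (semi (parD N)).carrier where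
  toFun := fun m => joinMk (X := parD N) 1 3
    (fun ij : Idx => legHom ![0, 2] (m ij.1) * legHom ![1, 3] (v ij.2))
  map_add' := fun m m' => by
    refine Eq.trans ?_ (Submodule.Quotient.mk_add _)
    refine congrArg (joinMk (X := parD N) 1 3) ?_
    funext ij
    change legHom _ (m ij.1 + m' ij.1) * _ = _ + _
    rw [map_add, add_mul]
  map_smul' := fun a m => by
    refine Eq.trans ?_ (Submodule.Quotient.mk_smul _ (legHom ![0, 2] a) _)
    refine congrArg (joinMk (X := parD N) 1 3) ?_
    funext ij
    change legHom _ (a * m ij.1) * _ = legHom _ a * _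
    rw [map_mul, mul_assoc]

/-- A choice of the identifications under which the saddle morphisms and their semi-closed versions
are written down. -/
structure Identification (N : ℕ) where
  /-- isomorphisms of the 2-arc factorizations with the products `K_cmn ⊗ γ̃_p` -/
  φpar : GradedIso (parD N) (parKD N)
  φvir : GradedIso (virD N) (virKD N)
  φhor : GradedIso (horD N) (horKD N)
  /-- homotopy equivalences of the semi-closed factorizations with `arc ⊗ Unk`, `arc`, `arc` -/
  α : HtpyEquiv N (semi (parD N)) (arcUnk N)
  β : HtpyEquiv N (semi (virD N)) (arcD N)
  δ : HtpyEquiv N (semi (horD N)) (arcD N)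
  /-- The equivalence `arc ⊗ Unk ≃ (arc 1–3) ⊗ (joined arc 2–4)` is the one that comes from passing
  to homology in the second factor: for each even homogeneous cycle `[v]` of the joined arc `2–4`
  the map `m ↦ α.inv (m ⊗ (class of v))` is homotopic to `m ↦ m ⊗ v`. -/
  α_cycle : ∀ (k : ℤ) (v : (arcD N).carrier), v ∈ (arcD N).gr 0 k →
    ∀ hv : ((arcD N).join 0 1).d (joinMk 0 1 v) = 0,
      Homotopic N k (α.inv ∘ₗ tens N (((arcD N).join 0 1).cls (joinMk 0 1 v) hv)) (glue N v)

namespace Identification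

variable {N : ℕ} (c : Identification N)

/-- The saddle morphism from the arcs `1–3`, `2–4` to the arcs `1–4`, `2–3`. -/
def F : (parD N).carrier →ₗ[P 4] (virD N).carrier :=
  c.φvir.equiv.symm.toLinearMap ∘ₗ (saddleMatrix N qq).mulVecLin ∘ₗ c.φpar.equiv.toLinearMap

/-- The saddle morphism from the arcs `1–4`, `2–3` to the arcs `1–3`, `2–4`. -/
def H : (virD N).carrier →ₗ[P 4] (parD N).carrier :=
  c.φpar.equiv.symm.toLinearMap ∘ₗ (saddleMatrix N qq).mulVecLin ∘ₗ c.φvir.equiv.toLinearMap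

/-- The saddle morphism from the arcs `1–4`, `2–3` to the arcs `1–2`, `3–4`. -/
def G : (virD N).carrier →ₗ[P 4] (horD N).carrier :=
  c.φhor.equiv.symm.toLinearMap ∘ₗ (saddleMatrix N pp).mulVecLin ∘ₗ c.φvir.equiv.toLinearMap

/-- The semi-closed saddle morphism `F'`. -/
def F' : (arcUnk N).carrier →ₗ[P 2] (arcD N).carrier := c.β.hom ∘ₗ semiMap c.F ∘ₗ c.α.inv

/-- The semi-closed saddle morphism `H'`. -/
def H' : (arcD N).carrier →ₗ[P 2] (arcUnk N).carrier := c.α.hom ∘ₗ semiMap c.H ∘ₗ c.β.inv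

/-- The semi-closed saddle morphism `G'`. -/
def G' : (arcD N).carrier →ₗ[P 2] (arcD N).carrier := c.δ.hom ∘ₗ semiMap c.G ∘ₗ c.β.inv

end Identification

/-! ### Closed factorizations and the Jacobi algebra -/

theorem tens_isChain (N : ℕ) (c : Unk N) :
    IsChain (X := arcD N) (Y := arcUnk N) (tens N c) := by
  refine LinearMap.ext fun m => ?_
  rfl

theorem joinMap_isChain {n : ℕ} {X Y : DiffMod n} (i j : Fin n)
    (f : X.carrier →ₗ[P n] Y.carrier) (hf : IsChain f) :
    IsChain (X := X.join i j) (Y := Y.join i j) (joinMap i j f) := by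
  refine LinearMap.ext fun z => ?_
  obtain ⟨m, rfl⟩ := Submodule.Quotient.mk_surjective _ z
  exact congrArg (joinMk i j) (LinearMap.congr_fun hf m)

/-- The Künneth map from `Unk ⊗ Unk` to the homology of `arc ⊗ Unk` with the two legs joined; it
sends `[z] ⊗ c` to `[z ⊗ c]`. -/
def kunneth (N : ℕ) : Unk N ⊗[ℚ] Unk N →ₗ[ℚ] ((arcUnk N).join 0 1).Homology :=
  TensorProduct.lift (LinearMap.mk₂ ℚ
    (fun a c => homologyMap (joinMap 0 1 (tens N c))
      (joinMap_isChain 0 1 _ (tens_isChain N c)) a)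
    (fun a a' c => map_add _ a a')
    (fun r a c => LinearMap.map_smul_of_tower _ r a)
    (fun a c c' => by
      obtain ⟨⟨z, hz⟩, rfl⟩ := Submodule.Quotient.mk_surjective _ a
      obtain ⟨m, rfl⟩ := Submodule.Quotient.mk_surjective _ z
      refine congrArg Submodule.Quotient.mk (Subtype.ext ?_)
      exact congrArg (joinMk (X := arcUnk N) 0 1) (TensorProduct.tmul_add m c c'))
    (fun r a c => by
      obtain ⟨⟨z, hz⟩, rfl⟩ := Submodule.Quotient.mk_surjective _ a
      obtain ⟨m, rfl⟩ := Submodule.Quotient.mk_surjective _ z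
      refine congrArg Submodule.Quotient.mk (Subtype.ext ?_)
      exact congrArg (joinMk (X := arcUnk N) 0 1) (TensorProduct.tmul_smul r m c)))

/-- The Jacobian ideal `(∂W/∂x, ∂W/∂y)` of the basic polynomial. -/
def jacIdeal (N : ℕ) : Ideal (P 1) :=
  Ideal.span {MvPolynomial.pderiv (Sum.inl 0) (basicW N (xv 0 : P 1) (yv 0)),
    MvPolynomial.pderiv (Sum.inr 0) (basicW N (xv 0 : P 1) (yv 0))}

/-- The Jacobi algebra. -/
abbrev Jac (N : ℕ) : Type := P 1 ⧸ jacIdeal N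

/-- The class of `x`. -/
def jx (N : ℕ) : Jac N := Ideal.Quotient.mk (jacIdeal N) (xv 0)

/-- The class of `y`. -/
def jy (N : ℕ) : Jac N := Ideal.Quotient.mk (jacIdeal N) (yv 0)

/-- `tr` is the Frobenius trace `-(x²ᴺ)* / (2(2N+1))` with respect to the basis
`1, x, …, x²ᴺ, y`. -/
def IsFrobeniusTrace (N : ℕ) (tr : Jac N →ₗ[ℚ] ℚ) : Prop :=
  (∀ i < 2 * N, tr (jx N ^ i) = 0) ∧ tr (jy N) = 0 ∧
    tr (jx N ^ (2 * N)) = -1 / (2 * (2 * N + 1))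

/-- `Δ` is the comultiplication of the Frobenius algebra with trace `tr`: it is a map of bimodules
with the counit `tr`. -/
def IsFrobeniusComul {N : ℕ} (tr : Jac N →ₗ[ℚ] ℚ) (Δ : Jac N →ₗ[ℚ] Jac N ⊗[ℚ] Jac N) : Prop :=
  (∀ a b, Δ (a * b) = (a ⊗ₜ[ℚ] 1) * Δ b) ∧ (∀ a b, Δ (a * b) = Δ a * (1 ⊗ₜ[ℚ] b)) ∧
    (∀ a, TensorProduct.lid ℚ (Jac N) (LinearMap.rTensor (Jac N) tr (Δ a)) = a) ∧
    (∀ a, TensorProduct.rid ℚ (Jac N) (LinearMap.lTensor (Jac N) tr (Δ a)) = a)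

/-- The comultiplication `Δ = 2 (ŷ ⊗ y - (2N+1) Σᵢ x̂ⁱ ⊗ x²ᴺ⁻ⁱ)`. -/
def comul (N : ℕ) : Jac N →ₗ[ℚ] Jac N ⊗[ℚ] Jac N :=
  (LinearMap.mul ℚ (Jac N ⊗[ℚ] Jac N)).flip
      (2 * (jy N ⊗ₜ[ℚ] jy N - (2 * N + 1) *
        ∑ i ∈ Finset.range (2 * N + 1), (jx N ^ i) ⊗ₜ[ℚ] (jx N ^ (2 * N - i)))) ∘ₗ
    (Algebra.TensorProduct.includeLeft : Jac N →ₐ[ℚ] Jac N ⊗[ℚ] Jac N).toLinearMap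

/-- The closed version of a semi-closed morphism: the map on homology after joining the two
remaining legs. -/
def closedMap {X Y : DiffMod 2} (f : X.carrier →ₗ[P 2] Y.carrier) (hf : IsChain f) :
    (X.join 0 1).Homology →ₗ[P 2] (Y.join 0 1).Homology :=
  homologyMap (joinMap 0 1 f) (joinMap_isChain 0 1 f hf)

end SaddleMF

end

noncomputable section

set_option linter.unusedSectionVars false

namespace SaddleMF

/-! ### Calculus of homotopies -/

section Calculus

variable {n : ℕ} {X Y Z : DiffMod n}

/-! None of the semi-closed maps is computed from matrices. Compatibility with the variables and the
grading determine each of them up to homotopy and up to one rational scalar, and the composite of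
the two opposite saddles fixes the product of the two scalars.

The homotopical tool is `KoszulPair.exists_nullhomotopy`. If a factorization carries contracting
homotopies for a regular sequence `a, a'`, a twisted chain map into it is null-homotopic as soon as
its lowest component lies in the ideal of `a, a'`. Via `exists_htpyEquiv` this gives the
equivalences of the joined `Γ_×` and `Γ_=` with an arc (a leg is excluded,
`nonempty_htpyEquiv_merge`) and of the joined `Γ_∥` with `A₁₃ ⊗ C` (`exists_htpyEquiv_par`). In the
last case the joined arc has left entries zero, and its right entries are the generators of the
Jacobian ideal, a regular sequence; so its homology is free of rank one over the Jacobi algebra, on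
the class of `e₁₁`. The tool also shows that an endomorphism of an arc is homotopic to
multiplication by a polynomial in the first leg (`arc_end`). In degree 0 that polynomial is a
constant.

The isomorphisms with `K ⊗ T` exist because Koszul factorizations with the same regular left entries
and the same potential are conjugate (`Clifford.equiv_of_sum_eq`). Row operations give both sides
the same left entries, and `proper_potential` compares the potentials.

The saddle for `c`, followed by the saddle back, is multiplication by `c₂² - c₁²C̃`. At the point `x
= 0`, `y = (ε₁, ε₂, -ε₂, -ε₁)` over `ℚ[ε₁,ε₂]/(ε₁²,ε₂²)` the differential of `Γ_×` vanishes, while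
this scalar becomes `±2ε₁ε₂`. Hence no saddle is null-homotopic.

On the joined `Γ_×` the middle leg acts, up to homotopy, like leg 1. So `F'` on `x̂ⁱ(e)` is `x̂ⁱ`
times `F'` on the class of `e₁₁`, and the latter has degree 0, hence is a constant. Dually, all
components of `H'` are multiples of the one at the socle coordinate `(x²ᴺ)*`, again a constant. Thus
`F' ≃ a·m` and `H' ≃ r·Δ` with `m`, `Δ` written in terms of the class of `e₁₁`. Now `F'H'` is
multiplication by `4(y² - N(2N+1)x²ᴺ)`, and `mΔ` is multiplication by `2(y² - (2N+1)²x²ᴺ)`. Modulo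
`y² = -(2N+1)x²ᴺ` both are `-4(N+1)(2N+1)x²ᴺ`, so `ar = 1`. Replacing the class of `e₁₁` by its
`r`-fold multiple `e` absorbs both scalars, since `m` scales inversely and `Δ` directly.

`G'` is multiplication by some `f` of degree `2N`. Leg 2 acts as `+x₁` on the joined `Γ_×` and as
`-x₁` on the joined `Γ_=`, and likewise for `y`; so `2xf = 2yf = 0` in the Jacobi algebra. Thus `f`
lies in the socle, which has degree `4N`, and therefore `f = 0`.

The closed statements follow by passing to homology, where homotopic maps agree. -/

theorem IsChain.apply {f : X.carrier →ₗ[P n] Y.carrier} (hf : IsChain f) (z : X.carrier) :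
    f (X.d z) = Y.d (f z) := LinearMap.congr_fun hf z

theorem IsChain.comp {g : Y.carrier →ₗ[P n] Z.carrier} {f : X.carrier →ₗ[P n] Y.carrier}
    (hg : IsChain g) (hf : IsChain f) : IsChain (X := X) (Y := Z) (g ∘ₗ f) := by
  refine LinearMap.ext fun z => ?_
  simp only [LinearMap.comp_apply, hf.apply, hg.apply]

theorem IsChain.smul {f : X.carrier →ₗ[P n] Y.carrier} (hf : IsChain f) (a : P n) :
    IsChain (X := X) (Y := Y) (a • f) := by
  refine LinearMap.ext fun z => ?_
  simp [hf.apply]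

theorem IsChain.add {f g : X.carrier →ₗ[P n] Y.carrier} (hf : IsChain f) (hg : IsChain g) :
    IsChain (X := X) (Y := Y) (f + g) := by
  refine LinearMap.ext fun z => ?_
  simp [hf.apply, hg.apply]

theorem IsChain.sub {f g : X.carrier →ₗ[P n] Y.carrier} (hf : IsChain f) (hg : IsChain g) :
    IsChain (X := X) (Y := Y) (f - g) := by
  refine LinearMap.ext fun z => ?_
  simp [hf.apply, hg.apply]

theorem IsChain.sum {ι : Type} (s : Finset ι) {f : ι → X.carrier →ₗ[P n] Y.carrier}
    (hf : ∀ i ∈ s, IsChain (f i)) : IsChain (X := X) (Y := Y) (∑ i ∈ s, f i) := by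
  refine LinearMap.ext fun z => ?_
  simp only [LinearMap.comp_apply, LinearMap.sum_apply, map_sum]
  exact Finset.sum_congr rfl fun i hi => (hf i hi).apply z

theorem IsChain.id : IsChain (X := X) (Y := X) LinearMap.id := rfl

theorem HasDeg.comp {s t r : ZMod 2} {k j l : ℤ} {g : Y.carrier →ₗ[P n] Z.carrier}
    {f : X.carrier →ₗ[P n] Y.carrier} (hg : HasDeg t j g) (hf : HasDeg s k f) (hr : s + t = r)
    (hl : k + j = l) : HasDeg (X := X) (Y := Z) r l (g ∘ₗ f) := by
  subst hr hl
  intro p a m hm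
  have := hg _ _ _ (hf p a m hm)
  rwa [add_assoc, add_assoc] at this

theorem HasDeg.id : HasDeg (X := X) (Y := X) 0 0 LinearMap.id := by
  intro p a m hm
  simpa using hm

theorem HasDeg.zero {s : ZMod 2} {k : ℤ} : HasDeg (X := X) (Y := Y) s k 0 :=
  fun _ _ _ _ => Submodule.zero_mem _

theorem HasDeg.add {s : ZMod 2} {k : ℤ} {f g : X.carrier →ₗ[P n] Y.carrier}
    (hf : HasDeg s k f) (hg : HasDeg s k g) : HasDeg (X := X) (Y := Y) s k (f + g) :=
  fun p a m hm => Submodule.add_mem _ (hf p a m hm) (hg p a m hm)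

theorem HasDeg.sub {s : ZMod 2} {k : ℤ} {f g : X.carrier →ₗ[P n] Y.carrier}
    (hf : HasDeg s k f) (hg : HasDeg s k g) : HasDeg (X := X) (Y := Y) s k (f - g) :=
  fun p a m hm => Submodule.sub_mem _ (hf p a m hm) (hg p a m hm)

theorem HasDeg.neg {s : ZMod 2} {k : ℤ} {f : X.carrier →ₗ[P n] Y.carrier}
    (hf : HasDeg s k f) : HasDeg (X := X) (Y := Y) s k (-f) :=
  fun p a m hm => Submodule.neg_mem _ (hf p a m hm)

theorem HasDeg.sum {ι : Type} (t : Finset ι) {s : ZMod 2} {k : ℤ}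
    {f : ι → X.carrier →ₗ[P n] Y.carrier} (hf : ∀ i ∈ t, HasDeg s k (f i)) :
    HasDeg (X := X) (Y := Y) s k (∑ i ∈ t, f i) := by
  intro p a m hm
  rw [LinearMap.sum_apply]
  exact Submodule.sum_mem _ fun i hi => hf i hi p a m hm

theorem algebraMap_smul_carrier (r : ℚ) (z : X.carrier) : (MvPolynomial.C r : P n) • z = r • z :=
  algebraMap_smul (P n) r z

theorem Homotopic.of_eq {N : ℕ} {k : ℤ} {f g : X.carrier →ₗ[P n] Y.carrier} (h : f = g) :
    Homotopic (X := X) (Y := Y) N k f g :=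
  ⟨0, HasDeg.zero, by rw [h]; simp⟩

theorem Homotopic.refl {N : ℕ} {k : ℤ} (f : X.carrier →ₗ[P n] Y.carrier) :
    Homotopic (X := X) (Y := Y) N k f f := .of_eq rfl

theorem Homotopic.symm {N : ℕ} {k : ℤ} {f g : X.carrier →ₗ[P n] Y.carrier}
    (h : Homotopic N k f g) : Homotopic (X := X) (Y := Y) N k g f := by
  obtain ⟨u, hu, e⟩ := h
  refine ⟨-u, hu.neg, ?_⟩
  rw [← neg_sub, e, LinearMap.comp_neg, LinearMap.neg_comp, neg_add]

theorem Homotopic.add {N : ℕ} {k : ℤ} {f g f' g' : X.carrier →ₗ[P n] Y.carrier}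
    (h : Homotopic N k f g) (h' : Homotopic N k f' g') :
    Homotopic (X := X) (Y := Y) N k (f + f') (g + g') := by
  obtain ⟨u, hu, e⟩ := h
  obtain ⟨u', hu', e'⟩ := h'
  refine ⟨u + u', hu.add hu', ?_⟩
  rw [add_sub_add_comm, e, e', LinearMap.comp_add, LinearMap.add_comp]
  abel

theorem Homotopic.trans {N : ℕ} {k : ℤ} {f g f' : X.carrier →ₗ[P n] Y.carrier}
    (h : Homotopic N k f g) (h' : Homotopic N k g f') :
    Homotopic (X := X) (Y := Y) N k f f' := by
  obtain ⟨u, hu, e⟩ := h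
  obtain ⟨u', hu', e'⟩ := h'
  refine ⟨u + u', hu.add hu', ?_⟩
  rw [← sub_add_sub_cancel f g f', e, e', LinearMap.comp_add, LinearMap.add_comp]
  abel

theorem Homotopic.sum {ι : Type} (t : Finset ι) {N : ℕ} {k : ℤ}
    {f g : ι → X.carrier →ₗ[P n] Y.carrier} (h : ∀ i ∈ t, Homotopic N k (f i) (g i)) :
    Homotopic (X := X) (Y := Y) N k (∑ i ∈ t, f i) (∑ i ∈ t, g i) := by
  classical
  induction t using Finset.induction_on with
  | empty => simpa using Homotopic.refl _
  | insert a s ha ih =>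
    rw [Finset.sum_insert ha, Finset.sum_insert ha]
    exact (h a (Finset.mem_insert_self a s)).add
      (ih fun i hi => h i (Finset.mem_insert_of_mem hi))

theorem Homotopic.comp_left {N : ℕ} {k j l : ℤ} {f g : X.carrier →ₗ[P n] Y.carrier}
    (h : Homotopic N k f g) {v : Y.carrier →ₗ[P n] Z.carrier} (hv : IsChain v)
    (hd : HasDeg 0 j v) (hl : k + j = l) :
    Homotopic (X := X) (Y := Z) N l (v ∘ₗ f) (v ∘ₗ g) := by
  obtain ⟨u, hu, e⟩ := h
  refine ⟨v ∘ₗ u, hd.comp hu (by simp) (by omega), ?_⟩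
  rw [← LinearMap.comp_sub, e]
  refine LinearMap.ext fun z => ?_
  simp [hv.apply]

theorem Homotopic.comp_right {N : ℕ} {k j l : ℤ} {f g : Y.carrier →ₗ[P n] Z.carrier}
    (h : Homotopic N k f g) {v : X.carrier →ₗ[P n] Y.carrier} (hv : IsChain v)
    (hd : HasDeg 0 j v) (hl : k + j = l) :
    Homotopic (X := X) (Y := Z) N l (f ∘ₗ v) (g ∘ₗ v) := by
  obtain ⟨u, hu, e⟩ := h
  refine ⟨u ∘ₗ v, hu.comp hd (by simp) (by omega), ?_⟩
  rw [← LinearMap.sub_comp, e]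
  refine LinearMap.ext fun z => ?_
  simp [hv.apply]

/-- The square of the differential is multiplication by `W`. -/
def Curved (X : DiffMod n) (W : P n) : Prop := ∀ z, X.d (X.d z) = W • z

/-- A degree-`0` isomorphism of twisted modules is a homotopy equivalence. -/
def HtpyEquiv.ofIso (N : ℕ) (f : X.carrier →ₗ[P n] Y.carrier) (g : Y.carrier →ₗ[P n] X.carrier)
    (hf : IsChain f) (hfd : HasDeg 0 0 f) (hgd : HasDeg 0 0 g) (hgf : g ∘ₗ f = LinearMap.id)
    (hfg : f ∘ₗ g = LinearMap.id) : HtpyEquiv N X Y where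
  hom := f
  inv := g
  hom_chain := hf
  inv_chain := by
    refine LinearMap.ext fun z => ?_
    have h1 := LinearMap.congr_fun hfg z
    simp only [LinearMap.comp_apply, LinearMap.id_apply] at h1 ⊢
    conv_lhs => rw [← h1]
    rw [← hf.apply]
    exact LinearMap.congr_fun hgf _
  hom_deg := hfd
  inv_deg := hgd
  inv_hom := .of_eq hgf
  hom_inv := .of_eq hfg

/-- Composition of homotopy equivalences. -/
def HtpyEquiv.trans {N : ℕ} (u : HtpyEquiv N X Y) (v : HtpyEquiv N Y Z) : HtpyEquiv N X Z where
  hom := v.hom ∘ₗ u.hom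
  inv := u.inv ∘ₗ v.inv
  hom_chain := v.hom_chain.comp u.hom_chain
  inv_chain := u.inv_chain.comp v.inv_chain
  hom_deg := v.hom_deg.comp u.hom_deg rfl rfl
  inv_deg := u.inv_deg.comp v.inv_deg rfl rfl
  inv_hom := ((v.inv_hom.comp_left (k := 0) (j := 0) (l := 0) u.inv_chain u.inv_deg rfl).comp_right
      (k := 0) (j := 0) u.hom_chain u.hom_deg rfl).trans u.inv_hom
  hom_inv := ((u.hom_inv.comp_left (k := 0) (j := 0) (l := 0) v.hom_chain v.hom_deg rfl).comp_right
      (k := 0) (j := 0) v.inv_chain v.inv_deg rfl).trans v.hom_inv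

/-- Data which exhibit a module with twisted differential as a Koszul construction on two
elements: `c`, `c'` are odd contracting homotopies for the multiplications `a`, `a'`, and `p` is
an annihilation operator dual to `c`. -/
structure KoszulPair (N : ℕ) (Y : DiffMod n) (δ δ' : ℤ) where
  a : Module.End (P n) Y.carrier
  a' : Module.End (P n) Y.carrier
  c : Module.End (P n) Y.carrier
  c' : Module.End (P n) Y.carrier
  p : Module.End (P n) Y.carrier
  p' : Module.End (P n) Y.carrier
  dc : ∀ y, Y.d (c y) = a y - c (Y.d y)
  dc' : ∀ y, Y.d (c' y) = a' y - c' (Y.d y)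
  cc : ∀ y, c (c y) = 0
  cc' : ∀ y, c' (c' y) = 0
  cc'c : ∀ y, c' (c y) = - c (c' y)
  pc : ∀ y, p (c y) = y - c (p y)
  pc' : ∀ y, p' (c' y) = y - c' (p' y)
  p'c : ∀ y, p' (c y) = - c (p' y)
  ac : ∀ y, a (c y) = c (a y)
  ac' : ∀ y, a (c' y) = c' (a y)
  ap : ∀ y, a (p y) = p (a y)
  a'c : ∀ y, a' (c y) = c (a' y)
  a'c' : ∀ y, a' (c' y) = c' (a' y)
  ad : ∀ y, Y.d (a y) = a (Y.d y)
  a'd : ∀ y, Y.d (a' y) = a' (Y.d y)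
  -- `inj` and `div` together say that `a, a'` is a regular sequence on the module; `a_deg` lets
  -- quotients by `a` inherit their degree.
  inj : Function.Injective a
  div : ∀ y z, a' y = a z → ∃ t, y = a t
  c_deg : HasDeg (X := Y) (Y := Y) 1 (δ - (2 * N + 1)) c
  c'_deg : HasDeg (X := Y) (Y := Y) 1 (δ' - (2 * N + 1)) c'
  p_deg : HasDeg (X := Y) (Y := Y) 1 (2 * N + 1 - δ) p
  p'_deg : HasDeg (X := Y) (Y := Y) 1 (2 * N + 1 - δ') p'
  d_deg : HasDeg (X := Y) (Y := Y) 1 (2 * N + 1) Y.d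
  a_deg : ∀ s k y, a y ∈ Y.gr s (k + δ) → y ∈ Y.gr s k

/-- The projection onto the part annihilated by both annihilation operators. -/
def KoszulPair.bot {N : ℕ} {δ δ' : ℤ} (K : KoszulPair N Y δ δ') : Module.End (P n) Y.carrier :=
  K.p ∘ₗ K.c ∘ₗ K.p' ∘ₗ K.c'

/-- Insert `1 = p'c' + c'p'` and, in the first summand, `1 = pc + cp`. -/
theorem KoszulPair.eq_bot_add {N : ℕ} {δ δ' : ℤ} (K : KoszulPair N Y δ δ') (y : Y.carrier) :
    y = K.bot y + K.c (K.p (K.p' (K.c' y))) + K.c' (K.p' y) := by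
  have h1 := K.pc' y
  have h2 := K.pc (K.p' (K.c' y))
  simp only [KoszulPair.bot, LinearMap.comp_apply]
  rw [h2, h1]
  abel

/-- A twisted chain map whose lowest component lies in the ideal generated by the two elements of
a Koszul pair is null-homotopic. -/
theorem KoszulPair.exists_nullhomotopy {N : ℕ} {δ δ' : ℤ} (K : KoszulPair N Y δ δ')
    {W : P n} (hY : Curved Y W) (d' : Module.End (P n) X.carrier) (hX : ∀ x, d' (d' x) = W • x)
    (hd' : HasDeg (X := X) (Y := X) 1 (2 * N + 1) d')
    {s : ZMod 2} {k : ℤ} {u : X.carrier →ₗ[P n] Y.carrier} (hu : HasDeg s k u)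
    (hchain : ∀ x, Y.d (u x) = u (d' x)) (v v' : X.carrier →ₗ[P n] Y.carrier)
    (hv : HasDeg s (k - δ) v) (hv' : HasDeg s (k - δ') v')
    (hbot : ∀ x, K.bot (u x) = K.a (v x) + K.a' (v' x)) :
    ∃ h : X.carrier →ₗ[P n] Y.carrier, HasDeg (s + 1) (k - (2 * N + 1)) h ∧
      (∀ x, u x = Y.d (h x) + h (d' x)) ∧ ∀ x, K.bot (h x) = 0 := by
  obtain ⟨w, hw⟩ : ∃ w, w = K.p ∘ₗ K.p' ∘ₗ K.c' ∘ₗ u := ⟨_, rfl⟩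
  obtain ⟨w', hw'⟩ : ∃ w', w' = K.p' ∘ₗ u := ⟨_, rfl⟩
  -- The lowest component is in the ideal by hypothesis; all the rest begins with `c` or `c'`.
  have hux : ∀ x, u x = K.a (v x) + K.a' (v' x) + K.c (w x) + K.c' (w' x) := by
    intro x
    rw [hw, hw', ← hbot]
    exact K.eq_bot_add (u x)
  have hw'd : HasDeg (X := X) (Y := Y) (s + 1) (k - δ' + (2 * N + 1)) w' := by
    rw [hw']
    exact K.p'_deg.comp hu rfl (by ring)
  -- Subtracting the homotopy `c'v'` cancels `a'v'` and changes the `c'`-part from `c'w'` to `c'V`.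
  obtain ⟨V, hV⟩ : ∃ V : X.carrier →ₗ[P n] Y.carrier, V = w' + Y.d ∘ₗ v' - v' ∘ₗ d' := ⟨_, rfl⟩
  have hVd : HasDeg (X := X) (Y := Y) (s + 1) (k - δ' + (2 * N + 1)) V := by
    rw [hV]
    exact (hw'd.add (K.d_deg.comp hv' rfl rfl)).sub (hv'.comp hd' (add_comm _ _) (by ring))
  have hVx : ∀ x, V x = w' x + Y.d (v' x) - v' (d' x) := fun x => by rw [hV]; rfl
  -- Applying `cc'` to the chain map equation kills every term that begins with `c` or `c'`. What
  -- survives is a relation between `a'` and `a`, and regularity makes `cc'V` divisible by `a`.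
  have hcc : ∀ x, K.a' (K.c (K.c' (V x)))
      = K.a (-(K.c (K.c' (Y.d (v x) - v (d' x) + w x)))) := by
    intro x
    have h := hchain x
    rw [hux, hux] at h
    simp only [map_add, K.ad, K.a'd, K.dc, K.dc'] at h
    have h2 := congrArg (fun y => K.c (K.c' y)) h
    simp only [map_add, map_sub, K.cc'c, K.cc, K.cc', map_neg, map_zero] at h2
    simp only [hVx, K.a'c, K.a'c', K.ac, K.ac', map_add, map_sub, map_neg]
    simp only [neg_zero, sub_zero, add_zero] at h2
    linear_combination (norm := module) h2
  choose t ht using fun x => K.div _ _ (hcc x)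
  -- The quotient is unique because `a` is injective, hence it depends linearly on `x`.
  have htl : ∃ T : X.carrier →ₗ[P n] Y.carrier, ∀ x, K.c (K.c' (V x)) = K.a (T x) := by
    refine ⟨⟨⟨t, ?_⟩, ?_⟩, ht⟩
    · intro x y
      apply K.inj
      rw [map_add, ← ht, ← ht, ← ht]
      simp
    · intro r x
      apply K.inj
      rw [RingHom.id_apply, map_smul, ← ht, ← ht]
      simp
  clear ht t
  obtain ⟨t, ht⟩ := htl
  have htd : HasDeg (X := X) (Y := Y) (s + 1) (k - (2 * N + 1)) t := by
    intro r a m hm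
    apply K.a_deg
    rw [← ht]
    have := K.c_deg _ _ _ (K.c'_deg _ _ _ (hVd r a m hm))
    have e1 : r + (s + 1) + 1 + 1 = r + (s + 1) := by
      rw [add_assoc, zmod2_two, add_zero]
    rw [e1] at this
    convert this using 2
    ring
  -- From `c'V = p(cc'V) + c(pc'V) = a(pT) + c(pc'V)` the whole `c'`-part is absorbed into the terms
  -- `av` and `cw`.
  obtain ⟨v₁, hv₁⟩ : ∃ v₁ : X.carrier →ₗ[P n] Y.carrier, v₁ = v + K.p ∘ₗ t := ⟨_, rfl⟩
  have hv₁x : ∀ x, v₁ x = v x + K.p (t x) := fun x => by rw [hv₁]; rfl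
  have hv₁d : HasDeg (X := X) (Y := Y) s (k - δ) v₁ := by
    rw [hv₁]
    refine hv.add (K.p_deg.comp htd ?_ (by ring))
    rw [add_assoc, zmod2_two, add_zero]
  obtain ⟨w₁, hw₁⟩ : ∃ w₁ : X.carrier →ₗ[P n] Y.carrier, w₁ = w + K.p ∘ₗ K.c' ∘ₗ V := ⟨_, rfl⟩
  have hw₁x : ∀ x, w₁ x = w x + K.p (K.c' (V x)) := fun x => by rw [hw₁]; rfl
  -- the map obtained after the first correction
  have hu₁ : ∀ x, u x - (Y.d (K.c' (v' x)) + K.c' (v' (d' x))) = K.a (v₁ x) + K.c (w₁ x) := by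
    intro x
    have h1 := K.pc (K.c' (V x))
    rw [ht, ← K.ap] at h1
    rw [hux, K.dc', hv₁x, hw₁x, map_add, map_add, h1]
    rw [hVx]
    simp only [map_add, map_sub]
    abel
  -- The corrected map is again a twisted chain map, since both squares are multiplication by the
  -- same `W`. Applying `c` to that equation leaves `a` times the claim, and `a` is injective.
  have hch₁ : ∀ x, K.c (w₁ x + Y.d (v₁ x) - v₁ (d' x)) = 0 := by
    intro x
    have h1 := congrArg Y.d (hu₁ x)
    have h2 := hu₁ (d' x)
    have h3 : Y.d (u x - (Y.d (K.c' (v' x)) + K.c' (v' (d' x))))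
        = u (d' x) - (Y.d (K.c' (v' (d' x))) + K.c' (v' (d' (d' x)))) := by
      simp only [map_sub, map_add, hchain, hX, map_smul]
      rw [hY]
      abel
    rw [h3, h2] at h1
    simp only [map_add, K.ad, K.dc] at h1
    have h4 := congrArg K.c h1
    apply K.inj
    simp only [map_add, map_sub, K.cc, map_zero, ← K.ac] at h4 ⊢
    linear_combination (norm := module) -h4
  -- `c'v'` removes `a'v'` and `cv₁` removes `av₁`; by `hch₁` the remaining `cw₁` is exactly what
  -- `cv₁` contributes besides. The homotopy begins with `c` or `c'`, so it has no lowest component.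
  refine ⟨K.c' ∘ₗ v' + K.c ∘ₗ v₁, ?_, fun x => ?_, fun x => ?_⟩
  · exact (K.c'_deg.comp hv' rfl (by ring)).add (K.c_deg.comp hv₁d rfl (by ring))
  · have h1 := hu₁ x
    have h2 := hch₁ x
    simp only [map_add, map_sub] at h2
    simp only [LinearMap.add_apply, LinearMap.comp_apply, map_add]
    rw [K.dc (v₁ x)]
    linear_combination (norm := module) h1 + h2
  · simp [KoszulPair.bot, K.cc, K.cc', K.cc'c, K.p'c]

/-- A chain map with a section, such that twisted chain maps into its kernel are null-homotopic,
is a homotopy equivalence. -/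
theorem exists_htpyEquiv {N : ℕ} {W : P n} (hX : Curved X W) (hY : Curved Y W)
    (hXd : HasDeg (X := X) (Y := X) 1 (2 * N + 1) X.d)
    (hYd : HasDeg (X := Y) (Y := Y) 1 (2 * N + 1) Y.d)
    (π : X.carrier →ₗ[P n] Y.carrier) (σ : Y.carrier →ₗ[P n] X.carrier)
    (hπ : IsChain π) (hπd : HasDeg 0 0 π) (hσd : HasDeg 0 0 σ) (hπσ : ∀ y, π (σ y) = y)
    (null : ∀ (Z : DiffMod n) (d' : Module.End (P n) Z.carrier) (s : ZMod 2) (k : ℤ)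
      (u : Z.carrier →ₗ[P n] X.carrier), (∀ z, d' (d' z) = W • z) →
      HasDeg (X := Z) (Y := Z) 1 (2 * N + 1) d' → HasDeg (X := Z) (Y := X) s k u →
      (∀ z, X.d (u z) = u (d' z)) → (∀ z, π (u z) = 0) →
      ∃ h : Z.carrier →ₗ[P n] X.carrier, HasDeg (X := Z) (Y := X) (s + 1) (k - (2 * N + 1)) h ∧
        (∀ z, u z = X.d (h z) + h (d' z)) ∧ ∀ z, π (h z) = 0) :
    ∃ e : HtpyEquiv N X Y, e.hom = π := by
  -- The defect `dσ - σd` of the section lies in `ker π` and anticommutes with the differentials. It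
  -- is a twisted chain map for `-d` on the source, which is why `null` allows an arbitrary `d'` and
  -- an arbitrary parity.
  obtain ⟨h, hh, hhx, hπh⟩ := null Y (-Y.d) 1 (2 * N + 1) (X.d ∘ₗ σ - σ ∘ₗ Y.d)
    (fun z => by simpa using hY z) hYd.neg
    ((hXd.comp hσd (by simp) (by ring)).sub (hσd.comp hYd (by simp) (by ring)))
    (fun z => by simp [hX (σ z), hY z, neg_add_eq_sub]) (fun z => by simp [hπ.apply, hπσ])
  simp only [LinearMap.sub_apply, LinearMap.comp_apply, LinearMap.neg_apply, map_neg] at hhx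
  rw [zmod2_two, sub_self] at hh
  -- Subtracting the homotopy turns `σ` into a chain map, and it remains a section because `h` has
  -- values in `ker π`.
  obtain ⟨ι, hι⟩ : ∃ ι : Y.carrier →ₗ[P n] X.carrier, ι = σ - h := ⟨_, rfl⟩
  have hιd : HasDeg (X := Y) (Y := X) 0 0 ι := hι ▸ hσd.sub hh
  have hιc : IsChain (X := Y) (Y := X) ι := by
    refine LinearMap.ext fun y => ?_
    simp only [hι, LinearMap.comp_apply, LinearMap.sub_apply, map_sub]
    linear_combination (norm := module) -hhx y
  have hπι : ∀ y, π (ι y) = y := fun y => by simp [hι, hπσ, hπh]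
  -- `id - ιπ` is now a chain map into `ker π`.
  obtain ⟨h', hh', hhx', -⟩ := null X X.d 0 0 (LinearMap.id - ι ∘ₗ π) hX hXd
    (HasDeg.id.sub (hιd.comp hπd rfl rfl)) (fun z => by simp [hιc.apply, hπ.apply])
    (fun z => by simp [hπι])
  exact ⟨{ hom := π
           inv := ι
           hom_chain := hπ
           inv_chain := hιc
           hom_deg := hπd
           inv_deg := hιd
           inv_hom := Homotopic.symm ⟨h', hh', LinearMap.ext hhx'⟩
           hom_inv := .of_eq (LinearMap.ext hπι) }, rfl⟩

end Calculus

/-! ### Weighted homogeneous polynomials -/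

section Weighted

open MvPolynomial

variable {σ τ : Type} {w : σ → ℤ} {w' : τ → ℤ}

/-- Homogeneous components commute with multiplication by a homogeneous polynomial, up to the shift.
This is what makes the divisions and ideal memberships below homogeneous. -/
theorem weightedComponent_mul {a : MvPolynomial σ ℚ} {δ : ℤ} (ha : IsWeightedHomogeneous w a δ)
    (k : ℤ) (f : MvPolynomial σ ℚ) :
    weightedHomogeneousComponent w (k + δ) (a * f) = a * weightedHomogeneousComponent w k f := by
  classical
  induction f using MvPolynomial.induction_on' with
  | add p q hp hq => rw [mul_add, map_add, hp, hq, map_add, mul_add]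
  | monomial s r =>
    have hs := isWeightedHomogeneous_monomial w s r rfl
    by_cases h : Finsupp.weight w s = k
    · subst h
      rw [hs.weightedHomogeneousComponent_same,
        IsWeightedHomogeneous.weightedHomogeneousComponent_same]
      rw [add_comm]
      exact ha.mul hs
    · rw [hs.weightedHomogeneousComponent_ne _ (Ne.symm h), mul_zero,
        (ha.mul hs).weightedHomogeneousComponent_ne]
      omega

theorem isWeightedHomogeneous_of_mul {a f : MvPolynomial σ ℚ} {δ k : ℤ} (h0 : a ≠ 0)
    (ha : IsWeightedHomogeneous w a δ) (h : IsWeightedHomogeneous w (a * f) (k + δ)) :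
    IsWeightedHomogeneous w f k := by
  have h1 := weightedComponent_mul ha k f
  rw [h.weightedHomogeneousComponent_same] at h1
  rw [mul_left_cancel₀ h0 h1]
  exact weightedHomogeneousComponent_isWeightedHomogeneous k f

theorem IsWeightedHomogeneous.aeval {g : σ → MvPolynomial τ ℚ}
    (hg : ∀ v, IsWeightedHomogeneous w' (g v) (w v)) {f : MvPolynomial σ ℚ} {k : ℤ}
    (hf : IsWeightedHomogeneous w f k) : IsWeightedHomogeneous w' (MvPolynomial.aeval g f) k := by
  rw [f.as_sum, map_sum]
  refine IsWeightedHomogeneous.sum _ _ _ fun s hs => ?_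
  rw [aeval_monomial, ← hf (mem_support_iff.1 hs), ← zero_add (Finsupp.weight w s)]
  refine (isWeightedHomogeneous_C w' _).mul ?_
  rw [Finsupp.weight_apply, Finsupp.prod]
  exact IsWeightedHomogeneous.prod _ _ (fun i => s i • w i) fun i _ => (hg i).pow _

/-- The remainder theorem for the divisor `X v - g`, by induction on the polynomial. -/
theorem exists_sub_aeval_update [DecidableEq σ] (v : σ) (g f : MvPolynomial σ ℚ) :
    ∃ q, f = MvPolynomial.aeval (Function.update X v g) f + (X v - g) * q := by
  induction f using MvPolynomial.induction_on with
  | C r => exact ⟨0, by simp⟩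
  | add p q hp hq =>
    obtain ⟨a, ha⟩ := hp
    obtain ⟨b, hb⟩ := hq
    exact ⟨a + b, by rw [map_add]; linear_combination ha + hb⟩
  | mul_X p i hp =>
    obtain ⟨a, ha⟩ := hp
    rw [map_mul, aeval_X]
    by_cases h : i = v
    · subst h
      rw [Function.update_self]
      exact ⟨aeval (Function.update X i g) p + a * X i, by linear_combination X i * ha⟩
    · rw [Function.update_of_ne h]
      exact ⟨a * X i, by linear_combination X i * ha⟩

theorem exists_homogeneous_sub_aeval_update [DecidableEq σ] (v : σ) {g f : MvPolynomial σ ℚ} {k : ℤ}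
    (hvg : X v - g ≠ 0) (hg : IsWeightedHomogeneous w g (w v)) (hf : IsWeightedHomogeneous w f k) :
    ∃ q, IsWeightedHomogeneous w q (k - w v) ∧
      f = MvPolynomial.aeval (Function.update X v g) f + (X v - g) * q := by
  obtain ⟨q, hq⟩ := exists_sub_aeval_update v g f
  refine ⟨q, ?_, hq⟩
  refine isWeightedHomogeneous_of_mul hvg ((isWeightedHomogeneous_X ℚ w v).sub hg) ?_
  rw [sub_add_cancel, ← sub_eq_iff_eq_add'.2 hq]
  refine hf.sub (IsWeightedHomogeneous.aeval (fun i => ?_) hf)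
  by_cases h : i = v
  · subst h; rwa [Function.update_self]
  · rw [Function.update_of_ne h]; exact isWeightedHomogeneous_X ℚ w i

theorem X_dvd_of_dvd_mul {v : σ} {b f : MvPolynomial σ ℚ} (hb : ¬ (X v ∣ b))
    (h : X v ∣ b * f) : X v ∣ f :=
  ((X_dvd_mul_iff).1 h).resolve_left hb

/-- Variables are prime, so they are cancelled one after the other. With `b = y² + (2N+1)x²ᴺ` this
gives the regularity of the sequence `2xy, b`. -/
theorem dvd_of_X_mul_X_dvd_mul {u v : σ} {b f : MvPolynomial σ ℚ} (hu : ¬ (X u ∣ b))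
    (hv : ¬ (X v ∣ b)) (h : X u * X v ∣ b * f) : X u * X v ∣ f := by
  obtain ⟨f', rfl⟩ := X_dvd_of_dvd_mul hu ((Dvd.intro _ rfl).trans h)
  refine mul_dvd_mul_left _ (X_dvd_of_dvd_mul hv ?_)
  rw [mul_left_comm] at h
  exact (mul_dvd_mul_iff_left (X_ne_zero u)).1 h

end Weighted

/-! ### Relabelling and substitution of legs -/

section Legs

open MvPolynomial

variable {m n : ℕ} {N : ℕ}

/-- Weighted homogeneity for the weights `deg x = 2`, `deg y = 2N`. -/
abbrev IsWH (N : ℕ) {n : ℕ} (f : P n) (k : ℤ) : Prop := IsWeightedHomogeneous (wt N n) f k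

theorem isWH_xv (i : Fin n) : IsWH N (xv i) 2 := isWeightedHomogeneous_X ℚ (wt N n) (Sum.inl i)

theorem isWH_yv (i : Fin n) : IsWH N (yv i) (2 * N) :=
  isWeightedHomogeneous_X ℚ (wt N n) (Sum.inr i)

theorem IsWH.cast {f : P n} {k l : ℤ} (h : IsWH N f k) (e : k = l) : IsWH N f l := e ▸ h

theorem isWH_C (r : ℚ) : IsWH N (C r : P n) 0 := isWeightedHomogeneous_C _ r

theorem isWH_natCast (r : ℕ) : IsWH N (r : P n) 0 := by
  have := isWH_C (N := N) (n := n) (r : ℚ)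
  rwa [map_natCast] at this

theorem legHom_X (f : Fin m → Fin n) (v : Fin m ⊕ Fin m) : legHom f (X v) = X (Sum.map f f v) :=
  rename_X _ _

@[simp] theorem legHom_xv (f : Fin m → Fin n) (i : Fin m) : legHom f (xv i) = xv (f i) :=
  rename_X _ _

@[simp] theorem legHom_yv (f : Fin m → Fin n) (i : Fin m) : legHom f (yv i) = yv (f i) :=
  rename_X _ _

/-- The ring homomorphism which sends the variables of the legs to given polynomials. -/
def subst (gx gy : Fin m → P n) : P m →ₐ[ℚ] P n := MvPolynomial.aeval (Sum.elim gx gy)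

@[simp] theorem subst_xv (gx gy : Fin m → P n) (i : Fin m) : subst gx gy (xv i) = gx i := by
  simp [subst, xv]

@[simp] theorem subst_yv (gx gy : Fin m → P n) (i : Fin m) : subst gx gy (yv i) = gy i := by
  simp [subst, yv]

theorem IsWH.subst {gx gy : Fin m → P n} (hx : ∀ i, IsWH N (gx i) 2)
    (hy : ∀ i, IsWH N (gy i) (2 * N)) {f : P m} {k : ℤ} (hf : IsWH N f k) :
    IsWH N (SaddleMF.subst gx gy f) k :=
  IsWeightedHomogeneous.aeval (by rintro (i | i); exacts [hx i, hy i]) hf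

theorem algHom_ext_legs {S : Type} [CommSemiring S] [Algebra ℚ S] {f g : P n →ₐ[ℚ] S}
    (hx : ∀ i, f (xv i) = g (xv i)) (hy : ∀ i, f (yv i) = g (yv i)) : f = g := by
  refine MvPolynomial.algHom_ext ?_
  rintro (i | i)
  exacts [hx i, hy i]

theorem legHom_eq_subst (f : Fin m → Fin n) :
    legHom f = subst (fun i => xv (f i)) (fun i => yv (f i)) :=
  algHom_ext_legs (by simp) (by simp)

theorem IsWH.legHom (f : Fin m → Fin n) {p : P m} {k : ℤ} (hp : IsWH N p k) :
    IsWH N (SaddleMF.legHom f p) k := by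
  rw [legHom_eq_subst]
  exact IsWH.subst (fun i => isWH_xv _) (fun i => isWH_yv _) hp

/-- The substitution `x_j ↦ ε x_i`, `y_j ↦ ε y_i`, which fixes the variables of the other legs. -/
def substLeg (ε : ℚ) (i j : Fin n) : P n →ₐ[ℚ] P n :=
  subst (Function.update xv j (C ε * xv i)) (Function.update yv j (C ε * yv i))

theorem substLeg_xv_same (ε : ℚ) (i j : Fin n) : substLeg ε i j (xv j) = C ε * xv i := by
  rw [substLeg, subst_xv, Function.update_self]

theorem substLeg_yv_same (ε : ℚ) (i j : Fin n) : substLeg ε i j (yv j) = C ε * yv i := by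
  rw [substLeg, subst_yv, Function.update_self]

theorem substLeg_xv_of_ne (ε : ℚ) {i j l : Fin n} (h : l ≠ j) : substLeg ε i j (xv l) = xv l := by
  rw [substLeg, subst_xv, Function.update_of_ne h]

theorem substLeg_yv_of_ne (ε : ℚ) {i j l : Fin n} (h : l ≠ j) : substLeg ε i j (yv l) = yv l := by
  rw [substLeg, subst_yv, Function.update_of_ne h]

theorem X_sub_C_mul_X_ne_zero {σ : Type} (ε : ℚ) {i j : σ} (h : i ≠ j) :
    (X j - C ε * X i : MvPolynomial σ ℚ) ≠ 0 := by
  classical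
  intro h0
  have := congrArg (MvPolynomial.eval (Function.update (fun _ => (0 : ℚ)) j 1)) h0
  simp [Function.update_of_ne h] at this

/-- A polynomial differs from its image under a substitution of a leg by a homogeneous combination
of the two differences of variables. -/
theorem exists_substLeg (ε : ℚ) {i j : Fin n} (hij : i ≠ j) {f : P n} {k : ℤ} (hf : IsWH N f k) :
    ∃ q q', IsWH N q (k - 2) ∧ IsWH N q' (k - 2 * N) ∧
      f = substLeg ε i j f + (xv j - C ε * xv i) * q + (yv j - C ε * yv i) * q' := by
  have hx : (X (Sum.inl j) - C ε * X (Sum.inl i) : P n) ≠ 0 :=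
    X_sub_C_mul_X_ne_zero ε (by simpa using hij)
  have hy : (X (Sum.inr j) - C ε * X (Sum.inr i) : P n) ≠ 0 :=
    X_sub_C_mul_X_ne_zero ε (by simpa using hij)
  have hgx : IsWH N (C ε * X (Sum.inl i) : P n) 2 := (isWH_xv i).C_mul ε
  have hgy : IsWH N (C ε * X (Sum.inr i) : P n) (2 * N) := (isWH_yv i).C_mul ε
  obtain ⟨q, hq, hq'⟩ := exists_homogeneous_sub_aeval_update (Sum.inl j) hx hgx hf
  have hf1 : IsWH N (MvPolynomial.aeval
      (Function.update X (Sum.inl j) (C ε * X (Sum.inl i) : P n)) f) k := by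
    refine IsWeightedHomogeneous.aeval (fun l => ?_) hf
    by_cases h : l = Sum.inl j
    · subst h; rw [Function.update_self]; exact hgx
    · rw [Function.update_of_ne h]; exact isWeightedHomogeneous_X ℚ _ l
  obtain ⟨q', hq1, hq2⟩ := exists_homogeneous_sub_aeval_update (Sum.inr j) hy hgy hf1
  refine ⟨q, q', hq, hq1, ?_⟩
  have e : MvPolynomial.aeval (Function.update X (Sum.inr j) (C ε * X (Sum.inr i) : P n))
      (MvPolynomial.aeval (Function.update X (Sum.inl j) (C ε * X (Sum.inl i) : P n)) f)
      = substLeg ε i j f := by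
    rw [← AlgHom.comp_apply]
    congr 1
    refine algHom_ext_legs (fun l => ?_) (fun l => ?_)
    · by_cases h : l = j
      · subst h
        rw [substLeg_xv_same, AlgHom.comp_apply, xv, aeval_X, Function.update_self, map_mul,
          aeval_X, Function.update_of_ne (by simp)]
        simp [xv]
      · rw [substLeg_xv_of_ne _ h, AlgHom.comp_apply, xv, aeval_X,
          Function.update_of_ne (by simpa using h), aeval_X, Function.update_of_ne (by simp)]
    · by_cases h : l = j
      · subst h
        rw [substLeg_yv_same, AlgHom.comp_apply, yv, aeval_X, Function.update_of_ne (by simp),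
          aeval_X, Function.update_self]
        rfl
      · rw [substLeg_yv_of_ne _ h, AlgHom.comp_apply, yv, aeval_X,
          Function.update_of_ne (by simp), aeval_X, Function.update_of_ne (by simpa using h)]
  rw [← e]
  change f = _ + (X (Sum.inl j) - C ε * X (Sum.inl i)) * q
    + (X (Sum.inr j) - C ε * X (Sum.inr i)) * q'
  linear_combination hq' + hq2

/-! ### Linear operators on polynomials in three legs -/

theorem inj_outer : Function.Injective (Sum.map (![0, 2] : Fin 2 → Fin 3) (![0, 2] : Fin 2 → Fin 3)) := by
  decide

theorem inj_inner : Function.Injective (Sum.map (![1] : Fin 1 → Fin 3) (![1] : Fin 1 → Fin 3)) := by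
  decide

/-- The part of an exponent vector which belongs to the outer legs. -/
def outerExp (t : Fin 3 ⊕ Fin 3 →₀ ℕ) : Fin 2 ⊕ Fin 2 →₀ ℕ :=
  t.comapDomain (Sum.map ![0, 2] ![0, 2]) inj_outer.injOn

/-- The part of an exponent vector which belongs to the middle leg. -/
def innerExp (t : Fin 3 ⊕ Fin 3 →₀ ℕ) : Fin 1 ⊕ Fin 1 →₀ ℕ :=
  t.comapDomain (Sum.map ![1] ![1]) inj_inner.injOn

/-- The polynomials in three legs are free over those in the outer legs, with the monomials in the
middle leg as a basis. Operators on joined factorizations, which have infinite rank over the outer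
legs, are defined on this basis. -/
theorem monomial_eq_outer_mul_inner (t : Fin 3 ⊕ Fin 3 →₀ ℕ) :
    (monomial t 1 : P 3) = legHom ![0, 2] (monomial (outerExp t) 1)
      * legHom ![1] (monomial (innerExp t) 1) := by
  simp only [legHom, rename_monomial, monomial_mul, mul_one]
  have e1 : ∀ a, (Finsupp.mapDomain (Sum.map ![0, 2] ![0, 2]) (outerExp t) :
      Fin 3 ⊕ Fin 3 →₀ ℕ) (Sum.map ![0, 2] ![0, 2] a) = t (Sum.map ![0, 2] ![0, 2] a) :=
    fun a => by rw [Finsupp.mapDomain_apply inj_outer]; rfl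
  have e2 : ∀ a, (Finsupp.mapDomain (Sum.map ![1] ![1]) (innerExp t) :
      Fin 3 ⊕ Fin 3 →₀ ℕ) (Sum.map ![1] ![1] a) = t (Sum.map ![1] ![1] a) :=
    fun a => by rw [Finsupp.mapDomain_apply inj_inner]; rfl
  have n1 : ∀ a, (Finsupp.mapDomain (Sum.map ![0, 2] ![0, 2]) (outerExp t) :
      Fin 3 ⊕ Fin 3 →₀ ℕ) (Sum.map ![1] ![1] a) = 0 :=
    fun a => Finsupp.mapDomain_of_notMem_range _ _ (by revert a; decide)
  have n2 : ∀ a, (Finsupp.mapDomain (Sum.map ![1] ![1]) (innerExp t) :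
      Fin 3 ⊕ Fin 3 →₀ ℕ) (Sum.map ![0, 2] ![0, 2] a) = 0 :=
    fun a => Finsupp.mapDomain_of_notMem_range _ _ (by revert a; decide)
  refine congrArg (fun e => monomial e (1 : ℚ)) (Finsupp.ext fun a => ?_)
  have : (∃ b, a = Sum.map ![0, 2] ![0, 2] b) ∨ ∃ b, a = Sum.map ![1] ![1] b := by
    revert a; decide
  rcases this with ⟨b, rfl⟩ | ⟨b, rfl⟩
  · rw [Finsupp.add_apply, e1, n2, add_zero]
  · rw [Finsupp.add_apply, e2, n1, zero_add]

/-- Operators on polynomials in three legs, linear over the polynomials in the outer legs, can be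
prescribed on the monomials in the middle leg. -/
theorem exists_outer_linear {m : ℕ} (θ : P 2 →ₐ[ℚ] P m) (δ : ℤ)
    (hθ : ∀ f k, IsWH N f k → IsWH N (θ f) k)
    (R : (Fin 1 ⊕ Fin 1 →₀ ℕ) → P m → Prop)
    (h : ∀ s, ∃ g, IsWH N g (Finsupp.weight (wt N 1) s + δ) ∧ R s g) :
    ∃ Q : P 3 →ₗ[ℚ] P m, (∀ a f, Q (legHom ![0, 2] a * f) = θ a * Q f) ∧
      (∀ f k, IsWH N f k → IsWH N (Q f) (k + δ)) ∧
      ∀ s, R s (Q (legHom ![1] (monomial s 1))) := by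
  choose g hg hR using h
  let Q : P 3 →ₗ[ℚ] P m := (MvPolynomial.basisMonomials (Fin 3 ⊕ Fin 3) ℚ).constr ℚ
    fun t => θ (monomial (outerExp t) 1) * g (innerExp t)
  have hQ : ∀ t, Q (monomial t 1) = θ (monomial (outerExp t) 1) * g (innerExp t) := fun t => by
    have := (MvPolynomial.basisMonomials (Fin 3 ⊕ Fin 3) ℚ).constr_basis ℚ
      (fun t => θ (monomial (outerExp t) 1) * g (innerExp t)) t
    rwa [coe_basisMonomials] at this
  have hmon : ∀ {l : ℕ} (t : Fin l ⊕ Fin l →₀ ℕ) (r : ℚ), (monomial t r : P l) = r • monomial t 1 :=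
    fun t r => by rw [smul_monomial, smul_eq_mul, mul_one]
  refine ⟨Q, fun a f => ?_, fun f k hf => ?_, fun s => ?_⟩
  · induction a using MvPolynomial.induction_on' with
    | add p q hp hq => rw [map_add, add_mul, map_add, hp, hq, map_add, add_mul]
    | monomial s r =>
      rw [hmon s r, map_smul, map_smul, smul_mul_assoc, smul_mul_assoc, map_smul]
      congr 1
      induction f using MvPolynomial.induction_on' with
      | add p q hp hq => rw [mul_add, map_add, hp, hq, map_add, mul_add]
      | monomial t r' =>
        rw [hmon t r', mul_smul_comm, map_smul, map_smul, mul_smul_comm, hQ]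
        congr 1
        rw [← mul_assoc, ← map_mul, monomial_mul, one_mul]
        simp only [legHom, rename_monomial, monomial_mul, mul_one]
        have h1 : outerExp (Finsupp.mapDomain (Sum.map ![0, 2] ![0, 2]) s + t)
            = s + outerExp t := by
          ext b
          change (Finsupp.mapDomain (Sum.map ![0, 2] ![0, 2]) s + t : Fin 3 ⊕ Fin 3 →₀ ℕ)
            (Sum.map ![0, 2] ![0, 2] b) = s b + t _
          rw [Finsupp.add_apply, Finsupp.mapDomain_apply inj_outer]
        have h2 : innerExp (Finsupp.mapDomain (Sum.map ![0, 2] ![0, 2]) s + t)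
            = innerExp t := by
          ext b
          change (Finsupp.mapDomain (Sum.map ![0, 2] ![0, 2]) s + t : Fin 3 ⊕ Fin 3 →₀ ℕ)
            (Sum.map ![1] ![1] b) = t _
          rw [Finsupp.add_apply, Finsupp.mapDomain_of_notMem_range _ _ (by revert b; decide),
            zero_add]
        rw [hQ, h1, h2]
  · rw [f.as_sum, map_sum]
    refine IsWeightedHomogeneous.sum _ _ _ fun t ht => ?_
    rw [hmon, map_smul, hQ, MvPolynomial.smul_eq_C_mul]
    refine IsWeightedHomogeneous.C_mul ?_ _
    refine IsWH.cast ((hθ _ _ (isWeightedHomogeneous_monomial _ _ _ rfl)).mul (hg _)) ?_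
    rw [← hf (mem_support_iff.1 ht), ← add_assoc]
    congr 1
    -- The degree of a monomial is the sum of the degrees of its two parts; it is read off by
    -- comparing two homogeneity statements about the same nonzero monomial.
    have h1 := (isWeightedHomogeneous_monomial (wt N 2) (outerExp t) (1 : ℚ) rfl)
    have h2 := (isWeightedHomogeneous_monomial (wt N 1) (innerExp t) (1 : ℚ) rfl)
    have h3 := (IsWH.legHom (n := 3) ![0, 2] h1).mul (IsWH.legHom (n := 3) ![1] h2)
    rw [← monomial_eq_outer_mul_inner] at h3
    exact (IsWeightedHomogeneous.inj_right (by simp) h3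
      (isWeightedHomogeneous_monomial _ _ _ rfl))
  · convert hR s using 1
    simp only [legHom, rename_monomial]
    rw [hQ]
    have h1 : outerExp (Finsupp.mapDomain (Sum.map ![1] ![1]) s) = 0 := by
      ext b
      exact Finsupp.mapDomain_of_notMem_range _ _ (by revert b; decide)
    have h2 : innerExp (Finsupp.mapDomain (Sum.map ![1] ![1]) s) = s := by
      ext b
      exact Finsupp.mapDomain_apply inj_inner _ _
    rw [h1, h2, monomial_zero', map_one, map_one, one_mul]

/-- Two outer-linear maps which agree on the monomials in the middle leg agree. -/
theorem outer_linear_ext {m : ℕ} (θ : P 2 →ₐ[ℚ] P m) {Q Q' : P 3 →ₗ[ℚ] P m}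
    (hQ : ∀ a f, Q (legHom ![0, 2] a * f) = θ a * Q f)
    (hQ' : ∀ a f, Q' (legHom ![0, 2] a * f) = θ a * Q' f)
    (h : ∀ s, Q (legHom ![1] (monomial s 1)) = Q' (legHom ![1] (monomial s 1))) : Q = Q' := by
  refine (MvPolynomial.basisMonomials (Fin 3 ⊕ Fin 3) ℚ).ext fun t => ?_
  rw [coe_basisMonomials]
  change Q (monomial t 1) = Q' (monomial t 1)
  rw [monomial_eq_outer_mul_inner, hQ, hQ', h]

end Legs

/-! ### Homogeneous matrices -/

section Matrices

open MvPolynomial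

variable {m n N : ℕ} {ι κ μ : Type} [Fintype ι] [DecidableEq ι] [Fintype κ] [DecidableEq κ]
  [Fintype μ] [DecidableEq μ]

theorem mem_toDiffMod_gr {M : MatFact ι (P n)} {p : ZMod 2} {k : ℤ} {z : ι → P n} :
    z ∈ (M.toDiffMod N).gr p k ↔
      ∀ i, (M.par i = p → IsWH N (z i) (k - M.deg i)) ∧ (M.par i ≠ p → z i = 0) := by
  change z ∈ Submodule.pi Set.univ _ ↔ _
  simp only [Submodule.mem_pi, Set.mem_univ, true_implies]
  refine forall_congr' fun i => ?_
  by_cases h : M.par i = p <;> simp [h, IsWH]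

/-- The matrix `U` describes a map of parity `s` and `q`-degree `k`. -/
def MatDeg (N : ℕ) (M : MatFact ι (P n)) (M' : MatFact κ (P n)) (s : ZMod 2) (k : ℤ)
    (U : Matrix κ ι (P n)) : Prop :=
  ∀ i j, (M'.par i ≠ M.par j + s → U i j = 0) ∧ IsWH N (U i j) (M.deg j + k - M'.deg i)

theorem MatDeg.hasDeg {M : MatFact ι (P n)} {M' : MatFact κ (P n)} {s : ZMod 2} {k : ℤ}
    {U : Matrix κ ι (P n)} (hU : MatDeg N M M' s k U) :
    HasDeg (X := M.toDiffMod N) (Y := M'.toDiffMod N) s k U.mulVecLin := by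
  intro p a z hz
  have hz := mem_toDiffMod_gr.1 hz
  refine mem_toDiffMod_gr.2 fun i => ⟨fun hi => ?_, fun hi => ?_⟩
  · change IsWH N (∑ j, U i j * z j) _
    refine IsWeightedHomogeneous.sum _ _ _ fun j _ => ?_
    by_cases hj : M.par j = p
    · exact IsWH.cast ((hU i j).2.mul ((hz j).1 hj)) (by ring)
    · rw [(hz j).2 hj, mul_zero]
      exact isWeightedHomogeneous_zero _ _ _
  · change ∑ j, U i j * z j = 0
    refine Finset.sum_eq_zero fun j _ => ?_
    by_cases hj : M.par j = p
    · rw [(hU i j).1 (by rw [hj]; exact hi), zero_mul]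
    · rw [(hz j).2 hj, mul_zero]

theorem MatDeg.add {M : MatFact ι (P n)} {M' : MatFact κ (P n)} {s : ZMod 2} {k : ℤ}
    {U V : Matrix κ ι (P n)} (hU : MatDeg N M M' s k U) (hV : MatDeg N M M' s k V) :
    MatDeg N M M' s k (U + V) := fun i j =>
  ⟨fun h => by rw [Matrix.add_apply, (hU i j).1 h, (hV i j).1 h, add_zero],
    (hU i j).2.add (hV i j).2⟩

theorem MatDeg.neg {M : MatFact ι (P n)} {M' : MatFact κ (P n)} {s : ZMod 2} {k : ℤ}
    {U : Matrix κ ι (P n)} (hU : MatDeg N M M' s k U) : MatDeg N M M' s k (-U) := fun i j =>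
  ⟨fun h => by rw [Matrix.neg_apply, (hU i j).1 h, neg_zero], (hU i j).2.neg⟩

theorem MatDeg.smul {M : MatFact ι (P n)} {M' : MatFact κ (P n)} {s : ZMod 2} {k l r : ℤ}
    {U : Matrix κ ι (P n)} (hU : MatDeg N M M' s k U) {a : P n} (ha : IsWH N a l)
    (hr : k + l = r) : MatDeg N M M' s r (a • U) := fun i j =>
  ⟨fun h => by rw [Matrix.smul_apply, (hU i j).1 h, smul_zero],
    IsWH.cast (ha.mul (hU i j).2) (by rw [← hr]; ring)⟩

theorem MatDeg.mul {M : MatFact ι (P n)} {M' : MatFact κ (P n)} {M'' : MatFact μ (P n)}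
    {s t r : ZMod 2} {k l j : ℤ} {U : Matrix κ ι (P n)} {V : Matrix μ κ (P n)}
    (hV : MatDeg N M' M'' t l V) (hU : MatDeg N M M' s k U) (hr : s + t = r) (hj : k + l = j) :
    MatDeg N M M'' r j (V * U) := by
  subst hr hj
  refine fun a b => ⟨fun h => ?_, ?_⟩
  · rw [Matrix.mul_apply]
    refine Finset.sum_eq_zero fun c _ => ?_
    by_cases hc : M'.par c = M.par b + s
    · rw [(hV a c).1 (by rw [hc, add_assoc]; exact h), zero_mul]
    · rw [(hU c b).1 hc, mul_zero]
  · exact IsWeightedHomogeneous.sum _ _ _ fun c _ =>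
      IsWH.cast ((hV a c).2.mul (hU c b).2) (by ring)

theorem isWH_zero {k : ℤ} : IsWH N (0 : P n) k := isWeightedHomogeneous_zero _ _ _

theorem isWH_one : IsWH N (1 : P n) 0 := isWeightedHomogeneous_one _ _

theorem MatDeg.one (M : MatFact ι (P n)) : MatDeg N M M 0 0 1 := fun i j => by
  by_cases h : i = j
  · subst h
    refine ⟨fun h => absurd (add_zero _).symm h, ?_⟩
    rw [Matrix.one_apply_eq]
    exact isWH_one.cast (by ring)
  · rw [Matrix.one_apply_ne h]
    exact ⟨fun _ => rfl, isWH_zero⟩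

theorem isWH_sgn (p : ZMod 2) : IsWH N (sgn p : P n) 0 := by
  unfold sgn
  split_ifs
  exacts [isWH_one, isWH_one.neg]

/-- The sign operator of a matrix factorization. -/
def MatFact.sign {S : Type} [CommRing S] (M : MatFact ι S) : Matrix ι ι S :=
  Matrix.diagonal fun i => sgn (M.par i)

theorem MatDeg.sign (M : MatFact ι (P n)) : MatDeg N M M 0 0 M.sign := fun i j => by
  unfold MatFact.sign
  by_cases h : i = j
  · subst h
    refine ⟨fun h => absurd (add_zero _).symm h, ?_⟩
    rw [Matrix.diagonal_apply_eq]
    exact (isWH_sgn _).cast (by ring)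
  · rw [Matrix.diagonal_apply_ne _ h]
    exact ⟨fun _ => rfl, isWH_zero⟩

theorem MatDeg.kronecker {ι' κ' : Type} [Fintype ι'] [DecidableEq ι'] [Fintype κ'] [DecidableEq κ']
    {M : MatFact ι (P n)} {M' : MatFact κ (P n)} {L : MatFact ι' (P n)} {L' : MatFact κ' (P n)}
    {s t r : ZMod 2} {k l j : ℤ} {U : Matrix κ ι (P n)} {V : Matrix κ' ι' (P n)}
    (hU : MatDeg N M M' s k U) (hV : MatDeg N L L' t l V) (hr : s + t = r) (hj : k + l = j) :
    MatDeg N (M.tensor L) (M'.tensor L') r j (U ⊗ₖ V) := by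
  subst hr hj
  rintro ⟨a, a'⟩ ⟨b, b'⟩
  refine ⟨fun h => ?_, ?_⟩
  · change U a b * V a' b' = 0
    by_cases h1 : M'.par a = M.par b + s
    · rw [(hV a' b').1, mul_zero]
      intro h2
      refine h ?_
      change M'.par a + L'.par a' = M.par b + L.par b' + (s + t)
      rw [h1, h2]
      ring
    · rw [(hU a b).1 h1, zero_mul]
  · refine IsWH.cast ((hU a b).2.mul (hV a' b').2) ?_
    change _ = M.deg b + L.deg b' + (k + l) - (M'.deg a + L'.deg a')
    ring

theorem MatDeg.tensor_d {M : MatFact ι (P n)} {M' : MatFact κ (P n)}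
    (h : MatDeg N M M 1 (2 * N + 1) M.d) (h' : MatDeg N M' M' 1 (2 * N + 1) M'.d) :
    MatDeg N (M.tensor M') (M.tensor M') 1 (2 * N + 1) (M.tensor M').d :=
  (h.kronecker (MatDeg.one M') (by simp) (by simp)).add
    ((MatDeg.sign M).kronecker h' (by simp) (by simp))

theorem matDeg_row {a b : P n} {k : ℤ} (ha : IsWH N a (k + (2 * N + 1)))
    (hb : IsWH N b (2 * N + 1 - k)) :
    MatDeg N (row a b k) (row a b k) 1 (2 * N + 1) (row a b k).d := by
  intro i j
  fin_cases i <;> fin_cases j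
  · exact ⟨fun _ => rfl, isWH_zero⟩
  · refine ⟨fun h => absurd (by simp [row, zmod2_two]) h, ?_⟩
    exact ha.cast (by simp [row])
  · refine ⟨fun h => absurd (by simp [row, zmod2_two]) h, ?_⟩
    exact hb.cast (by simp [row])
  · exact ⟨fun _ => rfl, isWH_zero⟩

theorem MatFact.sign_sq {S : Type} [CommRing S] (M : MatFact ι S) : M.sign * M.sign = 1 := by
  unfold MatFact.sign
  rw [Matrix.diagonal_mul_diagonal, ← Matrix.diagonal_one]
  congr 1
  funext i
  rcases zmod2_cases (M.par i) with h | h <;> simp [sgn, h]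

theorem MatFact.d_mul_sign {S : Type} [CommRing S] (M : MatFact ι S) :
    M.d * M.sign = - (M.sign * M.d) := by
  unfold MatFact.sign
  ext i j
  simp only [Matrix.mul_diagonal, Matrix.diagonal_mul, Matrix.neg_apply]
  by_cases h : M.par i = M.par j
  · rw [M.odd i j h]; simp
  · have h' := zmod2_ne h
    rw [h']
    generalize M.par j = p
    rcases zmod2_cases p with h | h <;> simp [sgn, h, zmod2_two]

theorem MatFact.tensor_d {S : Type} [CommRing S] (M : MatFact ι S) (M' : MatFact κ S) :
    (M.tensor M').d = M.d ⊗ₖ 1 + M.sign ⊗ₖ M'.d := rfl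

theorem mulVec_mulVec_anti {U V : Matrix ι ι (P n)} {r : P n}
    (h : U * V + V * U = r • (1 : Matrix ι ι (P n))) (y : ι → P n) :
    U.mulVec (V.mulVec y) = r • y - V.mulVec (U.mulVec y) := by
  rw [Matrix.mulVec_mulVec, Matrix.mulVec_mulVec, eq_sub_iff_add_eq, ← Matrix.add_mulVec, h,
    Matrix.smul_mulVec, Matrix.one_mulVec]

theorem mulVec_mulVec_zero {U V : Matrix ι ι (P n)} (h : U * V = 0) (y : ι → P n) :
    U.mulVec (V.mulVec y) = 0 := by
  rw [Matrix.mulVec_mulVec, h, Matrix.zero_mulVec]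

theorem mulVec_mulVec_neg {U V : Matrix ι ι (P n)} (h : U * V = -(V * U)) (y : ι → P n) :
    U.mulVec (V.mulVec y) = - V.mulVec (U.mulVec y) := by
  rw [Matrix.mulVec_mulVec, Matrix.mulVec_mulVec, h, Matrix.neg_mulVec]

theorem mulVec_mulVec_one {U V : Matrix ι ι (P n)} (h : U * V + V * U = 1) (y : ι → P n) :
    U.mulVec (V.mulVec y) = y - V.mulVec (U.mulVec y) := by
  rw [mulVec_mulVec_anti (r := 1) (by rw [h, one_smul]), one_smul]

theorem mulVec_smul_comm (U : Matrix ι ι (P n)) (r : P n) (y : ι → P n) :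
    r • U.mulVec y = U.mulVec (r • y) := (Matrix.mulVec_smul _ _ _).symm

theorem MatFact.d_d_mulVec (M : MatFact ι (P n)) (z : ι → P n) :
    M.d.mulVec (M.d.mulVec z) = M.pot • z := by
  rw [Matrix.mulVec_mulVec, M.sq, Matrix.smul_mulVec, Matrix.one_mulVec]

theorem MatFact.curved (M : MatFact ι (P n)) : Curved (M.toDiffMod N) M.pot :=
  fun z => M.d_d_mulVec z

theorem Curved.restrict {X : DiffMod n} {W : P m} {f : Fin m → Fin n} (h : Curved X (legHom f W)) :
    Curved (X.restrict f) W := h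

/-! ### Koszul pairs from matrices -/

/-- Matrices which exhibit a matrix factorization as a Koszul construction on two elements. -/
structure MatKoszul (N : ℕ) (M : MatFact ι (P n)) (a a' : P n) (δ δ' : ℤ) where
  c : Matrix ι ι (P n)
  c' : Matrix ι ι (P n)
  p : Matrix ι ι (P n)
  p' : Matrix ι ι (P n)
  dc : M.d * c + c * M.d = a • (1 : Matrix ι ι (P n))
  dc' : M.d * c' + c' * M.d = a' • (1 : Matrix ι ι (P n))
  cc : c * c = 0
  cc' : c' * c' = 0
  cc'c : c' * c = -(c * c')
  pc : p * c + c * p = 1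
  pc' : p' * c' + c' * p' = 1
  p'c : p' * c = -(c * p')
  d_deg : MatDeg N M M 1 (2 * N + 1) M.d
  c_deg : MatDeg N M M 1 (δ - (2 * N + 1)) c
  c'_deg : MatDeg N M M 1 (δ' - (2 * N + 1)) c'
  p_deg : MatDeg N M M 1 (2 * N + 1 - δ) p
  p'_deg : MatDeg N M M 1 (2 * N + 1 - δ') p'

theorem exists_smul_of_smul_eq {a a' : P n} (hdiv : ∀ f g, a' * f = a * g → a ∣ f)
    (y z : ι → P n) (h : a' • y = a • z) : ∃ t : ι → P n, y = a • t := by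
  choose t ht using fun i => hdiv (y i) (z i) (by simpa using congrFun h i)
  exact ⟨t, funext ht⟩

theorem mem_gr_of_smul_mem {M : MatFact ι (P n)} {a : P n} {δ : ℤ} (h0 : a ≠ 0) (ha : IsWH N a δ)
    (s : ZMod 2) (k : ℤ) (y : ι → P n) (h : a • y ∈ (M.toDiffMod N).gr s (k + δ)) :
    y ∈ (M.toDiffMod N).gr s k := by
  rw [mem_toDiffMod_gr] at h ⊢
  refine fun i => ⟨fun hi => ?_, fun hi => ?_⟩
  · exact isWeightedHomogeneous_of_mul h0 ha (IsWH.cast ((h i).1 hi) (by ring))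
  · exact (mul_eq_zero.1 ((h i).2 hi)).resolve_left h0

/-- The Koszul pair defined by matrices. -/
def MatKoszul.toPair {M : MatFact ι (P n)} {a a' : P n} {δ δ' : ℤ} (K : MatKoszul N M a a' δ δ')
    (h0 : a ≠ 0) (ha : IsWH N a δ) (hdiv : ∀ f g, a' * f = a * g → a ∣ f) :
    KoszulPair N (M.toDiffMod N) δ δ' where
  a := LinearMap.lsmul (P n) (ι → P n) a
  a' := LinearMap.lsmul (P n) (ι → P n) a'
  c := K.c.mulVecLin
  c' := K.c'.mulVecLin
  p := K.p.mulVecLin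
  p' := K.p'.mulVecLin
  dc := fun y => mulVec_mulVec_anti K.dc (show ι → P n from y)
  dc' := fun y => mulVec_mulVec_anti K.dc' (show ι → P n from y)
  cc := fun y => mulVec_mulVec_zero K.cc (show ι → P n from y)
  cc' := fun y => mulVec_mulVec_zero K.cc' (show ι → P n from y)
  cc'c := fun y => mulVec_mulVec_neg K.cc'c (show ι → P n from y)
  pc := fun y => mulVec_mulVec_one K.pc (show ι → P n from y)
  pc' := fun y => mulVec_mulVec_one K.pc' (show ι → P n from y)
  p'c := fun y => mulVec_mulVec_neg K.p'c (show ι → P n from y)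
  ac := fun y => mulVec_smul_comm K.c a (show ι → P n from y)
  ac' := fun y => mulVec_smul_comm K.c' a (show ι → P n from y)
  ap := fun y => mulVec_smul_comm K.p a (show ι → P n from y)
  a'c := fun y => mulVec_smul_comm K.c a' (show ι → P n from y)
  a'c' := fun y => mulVec_smul_comm K.c' a' (show ι → P n from y)
  ad := fun y => (mulVec_smul_comm M.d a (show ι → P n from y)).symm
  a'd := fun y => (mulVec_smul_comm M.d a' (show ι → P n from y)).symm
  inj := smul_right_injective (ι → P n) h0
  div := exists_smul_of_smul_eq hdiv
  c_deg := K.c_deg.hasDeg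
  c'_deg := K.c'_deg.hasDeg
  p_deg := K.p_deg.hasDeg
  p'_deg := K.p'_deg.hasDeg
  d_deg := K.d_deg.hasDeg
  a_deg := mem_gr_of_smul_mem h0 ha

/-- Koszul pairs survive relabelling of the legs. -/
def KoszulPair.restrict {Y : DiffMod n} {δ δ' : ℤ} (K : KoszulPair N Y δ δ') (f : Fin m → Fin n) :
    KoszulPair N (Y.restrict f) δ δ' where
  a := restrictMap f K.a
  a' := restrictMap f K.a'
  c := restrictMap f K.c
  c' := restrictMap f K.c'
  p := restrictMap f K.p
  p' := restrictMap f K.p'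
  dc := K.dc
  dc' := K.dc'
  cc := K.cc
  cc' := K.cc'
  cc'c := K.cc'c
  pc := K.pc
  pc' := K.pc'
  p'c := K.p'c
  ac := K.ac
  ac' := K.ac'
  ap := K.ap
  a'c := K.a'c
  a'c' := K.a'c'
  ad := K.ad
  a'd := K.a'd
  inj := K.inj
  div := K.div
  c_deg := K.c_deg
  c'_deg := K.c'_deg
  p_deg := K.p_deg
  p'_deg := K.p'_deg
  d_deg := K.d_deg
  a_deg := K.a_deg

/-- A tensor product inherits the Koszul structure of its second factor. -/
def MatKoszul.tensor (M : MatFact κ (P n)) (hM : MatDeg N M M 1 (2 * N + 1) M.d)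
    {M' : MatFact ι (P n)} {a a' : P n} {δ δ' : ℤ} (K : MatKoszul N M' a a' δ δ') :
    MatKoszul N (M.tensor M') a a' δ δ' :=
  have hd : ∀ (x : Matrix ι ι (P n)) (r : P n), M'.d * x + x * M'.d = r • (1 : Matrix ι ι (P n)) →
      (M.tensor M').d * (M.sign ⊗ₖ x) + (M.sign ⊗ₖ x) * (M.tensor M').d
        = r • (1 : Matrix (κ × ι) (κ × ι) (P n)) := fun x r h => by
    rw [MatFact.tensor_d, add_mul, mul_add, ← Matrix.mul_kronecker_mul, ← Matrix.mul_kronecker_mul,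
      ← Matrix.mul_kronecker_mul, ← Matrix.mul_kronecker_mul, M.sign_sq, M.d_mul_sign, one_mul,
      mul_one, ← Matrix.one_kronecker_one, ← Matrix.kronecker_smul, ← h, Matrix.kronecker_add,
      ← neg_one_smul (P n) (M.sign * M.d), Matrix.smul_kronecker, neg_one_smul]
    abel
  have hm : ∀ x y : Matrix ι ι (P n), (M.sign ⊗ₖ x) * (M.sign ⊗ₖ y) = 1 ⊗ₖ (x * y) := fun x y => by
    rw [← Matrix.mul_kronecker_mul, M.sign_sq]
  have hneg : ∀ x : Matrix ι ι (P n), (1 : Matrix κ κ (P n)) ⊗ₖ (-x) = -(1 ⊗ₖ x) := fun x => by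
    rw [← neg_one_smul (P n) x, Matrix.kronecker_smul, neg_one_smul]
  { c := M.sign ⊗ₖ K.c
    c' := M.sign ⊗ₖ K.c'
    p := M.sign ⊗ₖ K.p
    p' := M.sign ⊗ₖ K.p'
    dc := hd _ _ K.dc
    dc' := hd _ _ K.dc'
    cc := by rw [hm, K.cc, Matrix.kronecker_zero]
    cc' := by rw [hm, K.cc', Matrix.kronecker_zero]
    cc'c := by rw [hm, hm, K.cc'c, hneg]
    pc := by rw [hm, hm, ← Matrix.kronecker_add, K.pc, Matrix.one_kronecker_one]
    pc' := by rw [hm, hm, ← Matrix.kronecker_add, K.pc', Matrix.one_kronecker_one]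
    p'c := by rw [hm, hm, K.p'c, hneg]
    d_deg := hM.tensor_d K.d_deg
    c_deg := (MatDeg.sign M).kronecker K.c_deg (by simp) (by ring)
    c'_deg := (MatDeg.sign M).kronecker K.c'_deg (by simp) (by ring)
    p_deg := (MatDeg.sign M).kronecker K.p_deg (by simp) (by ring)
    p'_deg := (MatDeg.sign M).kronecker K.p'_deg (by simp) (by ring) }

/-- The creation matrix of one row. -/
def cre (S : Type) [CommRing S] : Matrix (Fin 2) (Fin 2) S := !![0, 0; 1, 0]

/-- The annihilation matrix of one row. -/
def ann (S : Type) [CommRing S] : Matrix (Fin 2) (Fin 2) S := !![0, 1; 0, 0]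

theorem row_d {S : Type} [CommRing S] (a b : S) (k : ℤ) :
    (row a b k).d = a • ann S + b • cre S := by
  ext i j
  fin_cases i <;> fin_cases j <;> simp [row, ann, cre]

theorem cre_sq (S : Type) [CommRing S] : cre S * cre S = 0 := by
  ext i j
  fin_cases i <;> fin_cases j <;> simp [cre, Matrix.mul_apply]

theorem ann_sq (S : Type) [CommRing S] : ann S * ann S = 0 := by
  ext i j
  fin_cases i <;> fin_cases j <;> simp [ann, Matrix.mul_apply]

theorem ann_cre (S : Type) [CommRing S] : ann S * cre S + cre S * ann S = 1 := by
  ext i j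
  fin_cases i <;> fin_cases j <;> simp [ann, cre, Matrix.mul_apply]

/-- Through this formula the anticommutation of the sign with `cre` and `ann` follows from `cre² =
ann² = 0`. -/
theorem sign_row {S : Type} [CommRing S] (a b : S) (k : ℤ) :
    (row a b k).sign = ann S * cre S - cre S * ann S := by
  ext i j
  fin_cases i <;> fin_cases j <;>
    simp [ann, cre, Matrix.mul_apply, MatFact.sign, row, sgn, Matrix.diagonal]

end Matrices

/-! ### Koszul structures on products of rows -/

section Rows

open MvPolynomial

variable {m n N : ℕ} {ι κ : Type} [Fintype ι] [DecidableEq ι] [Fintype κ] [DecidableEq κ]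

theorem matDeg_cre {a b : P n} {k : ℤ} :
    MatDeg N (row a b k) (row a b k) 1 k (cre (P n)) := by
  intro i j
  fin_cases i <;> fin_cases j
  · exact ⟨fun _ => rfl, isWH_zero⟩
  · exact ⟨fun _ => rfl, isWH_zero⟩
  · exact ⟨fun h => absurd (by simp [row]) h, isWH_one.cast (by simp [row])⟩
  · exact ⟨fun _ => rfl, isWH_zero⟩

theorem matDeg_ann {a b : P n} {k : ℤ} :
    MatDeg N (row a b k) (row a b k) 1 (-k) (ann (P n)) := by
  intro i j
  fin_cases i <;> fin_cases j
  · exact ⟨fun _ => rfl, isWH_zero⟩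
  · exact ⟨fun h => absurd (by simp [row, zmod2_two]) h,
      isWH_one.cast (by simp [row])⟩
  · exact ⟨fun _ => rfl, isWH_zero⟩
  · exact ⟨fun _ => rfl, isWH_zero⟩

theorem sign_row_mul_cre {S : Type} [CommRing S] (a b : S) (k : ℤ) :
    (row a b k).sign * cre S = -(cre S * (row a b k).sign) := by
  rw [sign_row, sub_mul, mul_sub, mul_assoc, mul_assoc, ← mul_assoc (cre S) (cre S), cre_sq]
  simp [mul_assoc]

theorem sign_row_mul_ann {S : Type} [CommRing S] (a b : S) (k : ℤ) :
    (row a b k).sign * ann S = -(ann S * (row a b k).sign) := by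
  rw [sign_row, sub_mul, mul_sub, mul_assoc, mul_assoc, ← mul_assoc (ann S) (ann S), ann_sq]
  simp [mul_assoc]

/-- The source of the explicit null-homotopies: the creation operator contracts the left entry of a
row, and the annihilation operator contracts the right one. -/
theorem row_d_anti_cre {S : Type} [CommRing S] (a b : S) (k : ℤ) :
    (row a b k).d * cre S + cre S * (row a b k).d = a • (1 : Matrix (Fin 2) (Fin 2) S) := by
  rw [row_d, add_mul, mul_add, smul_mul_assoc, smul_mul_assoc, mul_smul_comm, mul_smul_comm,
    cre_sq, smul_zero, add_zero, add_zero, ← smul_add, ann_cre]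

theorem row_d_anti_ann {S : Type} [CommRing S] (a b : S) (k : ℤ) :
    (row a b k).d * ann S + ann S * (row a b k).d = b • (1 : Matrix (Fin 2) (Fin 2) S) := by
  rw [row_d, add_mul, mul_add, smul_mul_assoc, smul_mul_assoc, mul_smul_comm, mul_smul_comm,
    ann_sq, smul_zero, zero_add, zero_add, ← smul_add, add_comm, ann_cre]

theorem kronecker_neg_right {S : Type} [CommRing S] (x : Matrix κ κ S) (y : Matrix ι ι S) :
    x ⊗ₖ (-y) = -(x ⊗ₖ y) := by
  rw [← neg_one_smul S y, Matrix.kronecker_smul, neg_one_smul]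

theorem kronecker_neg_left {S : Type} [CommRing S] (x : Matrix κ κ S) (y : Matrix ι ι S) :
    (-x) ⊗ₖ y = -(x ⊗ₖ y) := by
  rw [← neg_one_smul S x, Matrix.smul_kronecker, neg_one_smul]

/-- An odd operator on the first factor which anticommutes to a scalar with the differential. -/
theorem tensor_anti_left {S : Type} [CommRing S] (M : MatFact κ S) (M' : MatFact ι S)
    {x : Matrix κ κ S} {r : S} (hs : M.sign * x = -(x * M.sign))
    (h : M.d * x + x * M.d = r • (1 : Matrix κ κ S)) :
    (M.tensor M').d * (x ⊗ₖ 1) + (x ⊗ₖ 1) * (M.tensor M').d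
      = r • (1 : Matrix (κ × ι) (κ × ι) S) := by
  rw [MatFact.tensor_d, add_mul, mul_add, ← Matrix.mul_kronecker_mul, ← Matrix.mul_kronecker_mul,
    ← Matrix.mul_kronecker_mul, ← Matrix.mul_kronecker_mul, hs, kronecker_neg_left, mul_one,
    one_mul, mul_one, ← Matrix.one_kronecker_one, ← Matrix.smul_kronecker, ← h,
    Matrix.add_kronecker]
  abel

/-- An odd operator on the second factor which anticommutes to a scalar with the differential. -/
theorem tensor_anti_right {S : Type} [CommRing S] (M : MatFact κ S) (M' : MatFact ι S)
    {x : Matrix ι ι S} {r : S} (h : M'.d * x + x * M'.d = r • (1 : Matrix ι ι S)) :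
    (M.tensor M').d * (M.sign ⊗ₖ x) + (M.sign ⊗ₖ x) * (M.tensor M').d
      = r • (1 : Matrix (κ × ι) (κ × ι) S) := by
  rw [MatFact.tensor_d, add_mul, mul_add, ← Matrix.mul_kronecker_mul, ← Matrix.mul_kronecker_mul,
    ← Matrix.mul_kronecker_mul, ← Matrix.mul_kronecker_mul, M.sign_sq, M.d_mul_sign, one_mul,
    mul_one, ← Matrix.one_kronecker_one, ← Matrix.kronecker_smul, ← h, Matrix.kronecker_add,
    kronecker_neg_left]
  abel

/-- The Koszul structure of a product of two rows defined by operators `x`, `xd` on a row. -/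
def MatKoszul.ofRows {a b a' b' : P n} {k k' : ℤ} (x xd : Matrix (Fin 2) (Fin 2) (P n))
    (hx : x * x = 0) (hxd : xd * x + x * xd = 1)
    (hsx : (row a b k).sign * x = -(x * (row a b k).sign))
    {α α' : P n} {δ δ' : ℤ}
    (hα : (row a b k).d * x + x * (row a b k).d = α • (1 : Matrix (Fin 2) (Fin 2) (P n)))
    (hα' : (row a' b' k').d * x + x * (row a' b' k').d = α' • (1 : Matrix (Fin 2) (Fin 2) (P n)))
    (hd : MatDeg N (row a b k) (row a b k) 1 (2 * N + 1) (row a b k).d)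
    (hd' : MatDeg N (row a' b' k') (row a' b' k') 1 (2 * N + 1) (row a' b' k').d)
    (dx : MatDeg N (row a b k) (row a b k) 1 (δ - (2 * N + 1)) x)
    (dx' : MatDeg N (row a' b' k') (row a' b' k') 1 (δ' - (2 * N + 1)) x)
    (dxd : MatDeg N (row a b k) (row a b k) 1 (2 * N + 1 - δ) xd)
    (dxd' : MatDeg N (row a' b' k') (row a' b' k') 1 (2 * N + 1 - δ') xd) :
    MatKoszul N ((row a b k).tensor (row a' b' k')) α α' δ δ' where
  c := x ⊗ₖ 1
  c' := (row a b k).sign ⊗ₖ x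
  p := xd ⊗ₖ 1
  p' := (row a b k).sign ⊗ₖ xd
  dc := tensor_anti_left _ _ hsx hα
  dc' := tensor_anti_right _ _ hα'
  cc := by rw [← Matrix.mul_kronecker_mul, hx, Matrix.zero_kronecker]
  cc' := by rw [← Matrix.mul_kronecker_mul, hx, Matrix.kronecker_zero]
  cc'c := by
    rw [← Matrix.mul_kronecker_mul, ← Matrix.mul_kronecker_mul, hsx, kronecker_neg_left, one_mul,
      mul_one]
  pc := by
    rw [← Matrix.mul_kronecker_mul, ← Matrix.mul_kronecker_mul, ← Matrix.add_kronecker, hxd,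
      mul_one, Matrix.one_kronecker_one]
  pc' := by
    rw [← Matrix.mul_kronecker_mul, ← Matrix.mul_kronecker_mul, MatFact.sign_sq,
      ← Matrix.kronecker_add, hxd, Matrix.one_kronecker_one]
  p'c := by
    rw [← Matrix.mul_kronecker_mul, ← Matrix.mul_kronecker_mul, hsx, kronecker_neg_left, one_mul,
      mul_one]
  d_deg := hd.tensor_d hd'
  c_deg := dx.kronecker (MatDeg.one _) (by simp) (by ring)
  c'_deg := (MatDeg.sign _).kronecker dx' (by simp) (by ring)
  p_deg := dxd.kronecker (MatDeg.one _) (by simp) (by ring)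
  p'_deg := (MatDeg.sign _).kronecker dxd' (by simp) (by ring)

/-- The matrix of the projection onto the lowest component. -/
def MatKoszul.bot {M : MatFact ι (P n)} {a a' : P n} {δ δ' : ℤ} (K : MatKoszul N M a a' δ δ') :
    Matrix ι ι (P n) := K.p * K.c * (K.p' * K.c')

theorem MatKoszul.toPair_bot {M : MatFact ι (P n)} {a a' : P n} {δ δ' : ℤ}
    (K : MatKoszul N M a a' δ δ') (h0 : a ≠ 0) (ha : IsWH N a δ)
    (hdiv : ∀ f g, a' * f = a * g → a ∣ f) (y : ι → P n) :
    (K.toPair h0 ha hdiv).bot y = K.bot.mulVec y := by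
  change K.p.mulVec (K.c.mulVec (K.p'.mulVec (K.c'.mulVec y))) = _
  rw [Matrix.mulVec_mulVec, Matrix.mulVec_mulVec, Matrix.mulVec_mulVec, MatKoszul.bot]
  simp only [mul_assoc]

/-- The Koszul structure of a product of two rows given by the creation operators. -/
def MatKoszul.creation {a b a' b' : P n} {k k' : ℤ} (ha : IsWH N a (k + (2 * N + 1)))
    (hb : IsWH N b (2 * N + 1 - k)) (ha' : IsWH N a' (k' + (2 * N + 1)))
    (hb' : IsWH N b' (2 * N + 1 - k')) :
    MatKoszul N ((row a b k).tensor (row a' b' k')) a a' (k + (2 * N + 1)) (k' + (2 * N + 1)) :=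
  .ofRows (cre (P n)) (ann (P n)) (cre_sq _) (ann_cre _) (sign_row_mul_cre _ _ _)
    (row_d_anti_cre _ _ _) (row_d_anti_cre _ _ _) (matDeg_row ha hb) (matDeg_row ha' hb')
    (by simpa using matDeg_cre) (by simpa using matDeg_cre) (by simpa using matDeg_ann)
    (by simpa using matDeg_ann)

/-- The Koszul structure of a product of two rows given by the annihilation operators. -/
def MatKoszul.annihilation {a b a' b' : P n} {k k' : ℤ} (ha : IsWH N a (k + (2 * N + 1)))
    (hb : IsWH N b (2 * N + 1 - k)) (ha' : IsWH N a' (k' + (2 * N + 1)))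
    (hb' : IsWH N b' (2 * N + 1 - k')) :
    MatKoszul N ((row a b k).tensor (row a' b' k')) b b' (2 * N + 1 - k) (2 * N + 1 - k') :=
  .ofRows (ann (P n)) (cre (P n)) (ann_sq _) (by rw [add_comm]; exact ann_cre _)
    (sign_row_mul_ann _ _ _)
    (row_d_anti_ann _ _ _) (row_d_anti_ann _ _ _) (matDeg_row ha hb) (matDeg_row ha' hb')
    (by simpa using matDeg_ann) (by simpa using matDeg_ann) (by simpa using matDeg_cre)
    (by simpa using matDeg_cre)

theorem MatKoszul.tensor_bot (M : MatFact κ (P n)) (hM : MatDeg N M M 1 (2 * N + 1) M.d)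
    {M' : MatFact ι (P n)} {a a' : P n} {δ δ' : ℤ} (K : MatKoszul N M' a a' δ δ') :
    (K.tensor M hM).bot = 1 ⊗ₖ K.bot := by
  change (M.sign ⊗ₖ K.p) * (M.sign ⊗ₖ K.c) * ((M.sign ⊗ₖ K.p') * (M.sign ⊗ₖ K.c')) = _
  rw [← Matrix.mul_kronecker_mul, ← Matrix.mul_kronecker_mul, ← Matrix.mul_kronecker_mul,
    M.sign_sq, one_mul]
  rfl

theorem one_kronecker_mulVec_apply (U : Matrix ι ι (P n)) (y : κ × ι → P n) (i : κ) (j : ι) :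
    ((1 : Matrix κ κ (P n)) ⊗ₖ U).mulVec y (i, j) = U.mulVec (fun l => y (i, l)) j := by
  simp only [Matrix.mulVec, dotProduct, Fintype.sum_prod_type, Matrix.kronecker_apply]
  rw [Finset.sum_eq_single i]
  · simp
  · intro b _ hb
    simp [Matrix.one_apply_ne hb.symm]
  · simp

theorem MatKoszul.creation_bot_mulVec {a b a' b' : P n} {k k' : ℤ} (ha : IsWH N a (k + (2 * N + 1)))
    (hb : IsWH N b (2 * N + 1 - k)) (ha' : IsWH N a' (k' + (2 * N + 1)))
    (hb' : IsWH N b' (2 * N + 1 - k')) (y : Fin 2 × Fin 2 → P n) :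
    (MatKoszul.creation ha hb ha' hb').bot.mulVec y = Pi.single (0, 0) (y (0, 0)) := by
  have h : (MatKoszul.creation ha hb ha' hb').bot
      = (ann (P n) * cre (P n)) ⊗ₖ (ann (P n) * cre (P n)) := by
    change (ann (P n) ⊗ₖ 1) * (cre (P n) ⊗ₖ 1)
      * (((row a b k).sign ⊗ₖ ann (P n)) * ((row a b k).sign ⊗ₖ cre (P n))) = _
    rw [← Matrix.mul_kronecker_mul, ← Matrix.mul_kronecker_mul, ← Matrix.mul_kronecker_mul,
      MatFact.sign_sq, mul_one, mul_one, one_mul]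
  have h2 : ann (P n) * cre (P n) = !![1, 0; 0, 0] := by
    ext i j
    fin_cases i <;> fin_cases j <;> simp [ann, cre, Matrix.mul_apply]
  rw [h, h2]
  funext ⟨i, j⟩
  fin_cases i <;> fin_cases j <;>
    simp [Matrix.mulVec, dotProduct, Fintype.sum_prod_type, Pi.single_apply]

theorem MatKoszul.annihilation_bot_mulVec {a b a' b' : P n} {k k' : ℤ}
    (ha : IsWH N a (k + (2 * N + 1)))
    (hb : IsWH N b (2 * N + 1 - k)) (ha' : IsWH N a' (k' + (2 * N + 1)))
    (hb' : IsWH N b' (2 * N + 1 - k')) (y : Fin 2 × Fin 2 → P n) :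
    (MatKoszul.annihilation ha hb ha' hb').bot.mulVec y = Pi.single (1, 1) (y (1, 1)) := by
  have h : (MatKoszul.annihilation ha hb ha' hb').bot
      = (cre (P n) * ann (P n)) ⊗ₖ (cre (P n) * ann (P n)) := by
    change (cre (P n) ⊗ₖ 1) * (ann (P n) ⊗ₖ 1)
      * (((row a b k).sign ⊗ₖ cre (P n)) * ((row a b k).sign ⊗ₖ ann (P n))) = _
    rw [← Matrix.mul_kronecker_mul, ← Matrix.mul_kronecker_mul, ← Matrix.mul_kronecker_mul,
      MatFact.sign_sq, mul_one, mul_one, one_mul]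
  have h2 : cre (P n) * ann (P n) = !![0, 0; 0, 1] := by
    ext i j
    fin_cases i <;> fin_cases j <;> simp [ann, cre, Matrix.mul_apply]
  rw [h, h2]
  funext ⟨i, j⟩
  fin_cases i <;> fin_cases j <;>
    simp [Matrix.mulVec, dotProduct, Fintype.sum_prod_type, Pi.single_apply]

/-! ### Degrees of the arc factorization -/

theorem IsWH.hsym {l : List (P n)} (hl : ∀ a ∈ l, IsWH N a 2) (k : ℕ) :
    IsWH N (SaddleMF.hsym l k) (2 * k) := by
  induction l generalizing k with
  | nil =>
    unfold SaddleMF.hsym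
    split_ifs with h
    · subst h; exact isWH_one.cast (by simp)
    · exact isWH_zero
  | cons a l ih =>
    unfold SaddleMF.hsym
    refine IsWeightedHomogeneous.sum _ _ _ fun i hi => ?_
    have h1 := (hl a (by simp)).pow i
    have h2 := ih (fun b hb => hl b (by simp [hb])) (k - i)
    refine IsWH.cast (h1.mul h2) ?_
    have : i ≤ k := by
      have := Finset.mem_range.1 hi
      omega
    push_cast [this]
    simp
    ring

theorem IsWH.dd {l : List (P n)} (hl : ∀ a ∈ l, IsWH N a 2) {k : ℤ} (h : l.length ≤ 2 * N + 2)
    (hk : k = 2 * (2 * N + 2 - l.length)) : IsWH N (SaddleMF.dd N l) k := by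
  refine IsWH.cast (IsWH.hsym hl _) ?_
  rw [hk]
  push_cast [h]
  ring

/-- The homogeneity of the second entries of an arc. -/
theorem isWH_arc_b {x₁ x₂ y₁ : P n} (hx₁ : IsWH N x₁ 2) (hx₂ : IsWH N x₂ 2)
    (hy₁ : IsWH N y₁ (2 * N)) : IsWH N (y₁ ^ 2 + dd N [-x₁, x₂]) (2 * N + 1 - (1 - 2 * N)) := by
  refine (IsWH.cast (hy₁.pow 2) ?_).add (IsWH.dd ?_ (by simp) ?_)
  · simp; ring
  · intro a ha
    simp only [List.mem_cons, List.not_mem_nil, or_false] at ha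
    rcases ha with rfl | rfl
    exacts [hx₁.neg, hx₂]
  · simp; ring

variable {x₁ y₁ x₂ y₂ : P n}

/-- The Koszul structure of an arc given by the creation operators. -/
def arcCreation (hx₁ : IsWH N x₁ 2) (hy₁ : IsWH N y₁ (2 * N)) (hx₂ : IsWH N x₂ 2)
    (hy₂ : IsWH N y₂ (2 * N)) :
    MatKoszul N (arc N x₁ y₁ x₂ y₂) (y₂ + y₁) (x₂ + x₁) (-1 + (2 * N + 1))
      (1 - 2 * N + (2 * N + 1)) :=
  .creation (IsWH.cast (hy₂.add hy₁) (by ring)) (IsWH.cast (hx₂.mul (hy₂.sub hy₁)) (by ring))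
    (IsWH.cast (hx₂.add hx₁) (by ring)) (isWH_arc_b hx₁ hx₂ hy₁)

/-- The Koszul structure of an arc given by the annihilation operators. -/
def arcAnnihilation (hx₁ : IsWH N x₁ 2) (hy₁ : IsWH N y₁ (2 * N)) (hx₂ : IsWH N x₂ 2)
    (hy₂ : IsWH N y₂ (2 * N)) :
    MatKoszul N (arc N x₁ y₁ x₂ y₂) (x₂ * (y₂ - y₁)) (y₁ ^ 2 + dd N [-x₁, x₂]) (2 * N + 1 - -1)
      (2 * N + 1 - (1 - 2 * N)) :=
  .annihilation (IsWH.cast (hy₂.add hy₁) (by ring)) (IsWH.cast (hx₂.mul (hy₂.sub hy₁)) (by ring))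
    (IsWH.cast (hx₂.add hx₁) (by ring)) (isWH_arc_b hx₁ hx₂ hy₁)

theorem arcCreation_bot_mulVec (hx₁ : IsWH N x₁ 2) (hy₁ : IsWH N y₁ (2 * N)) (hx₂ : IsWH N x₂ 2)
    (hy₂ : IsWH N y₂ (2 * N)) (y : Fin 2 × Fin 2 → P n) :
    (arcCreation hx₁ hy₁ hx₂ hy₂).bot.mulVec y = Pi.single (0, 0) (y (0, 0)) :=
  MatKoszul.creation_bot_mulVec _ _ _ _ y

theorem arcAnnihilation_bot_mulVec (hx₁ : IsWH N x₁ 2) (hy₁ : IsWH N y₁ (2 * N))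
    (hx₂ : IsWH N x₂ 2) (hy₂ : IsWH N y₂ (2 * N)) (y : Fin 2 × Fin 2 → P n) :
    (arcAnnihilation hx₁ hy₁ hx₂ hy₂).bot.mulVec y = Pi.single (1, 1) (y (1, 1)) :=
  MatKoszul.annihilation_bot_mulVec _ _ _ _ y

theorem arc_d_deg (hx₁ : IsWH N x₁ 2) (hy₁ : IsWH N y₁ (2 * N)) (hx₂ : IsWH N x₂ 2)
    (hy₂ : IsWH N y₂ (2 * N)) :
    MatDeg N (arc N x₁ y₁ x₂ y₂) (arc N x₁ y₁ x₂ y₂) 1 (2 * N + 1) (arc N x₁ y₁ x₂ y₂).d :=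
  (arcCreation hx₁ hy₁ hx₂ hy₂).d_deg

end Rows

/-! ### Endomorphisms of an arc -/

section ArcEnd

open MvPolynomial

variable {m n N : ℕ} {ι κ : Type} [Fintype ι] [DecidableEq ι] [Fintype κ] [DecidableEq κ]

theorem arc_mulVec {S : Type} [CommRing S] (x₁ y₁ x₂ y₂ : S) (z : Fin 2 × Fin 2 → S) :
    (arc N x₁ y₁ x₂ y₂).d.mulVec z (0, 0) = (y₂ + y₁) * z (1, 0) + (x₂ + x₁) * z (0, 1) ∧
    (arc N x₁ y₁ x₂ y₂).d.mulVec z (0, 1)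
      = (y₂ + y₁) * z (1, 1) + (y₁ ^ 2 + dd N [-x₁, x₂]) * z (0, 0) ∧
    (arc N x₁ y₁ x₂ y₂).d.mulVec z (1, 0)
      = x₂ * (y₂ - y₁) * z (0, 0) - (x₂ + x₁) * z (1, 1) ∧
    (arc N x₁ y₁ x₂ y₂).d.mulVec z (1, 1)
      = x₂ * (y₂ - y₁) * z (0, 1) - (y₁ ^ 2 + dd N [-x₁, x₂]) * z (1, 0) := by
  generalize hb : y₁ ^ 2 + dd N [-x₁, x₂] = b
  simp only [arc, hb]
  refine ⟨?_, ?_, ?_, ?_⟩ <;>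
  simp [MatFact.tensor, row, Matrix.mulVec, dotProduct, Fintype.sum_prod_type,
    Matrix.one_apply, sgn, Matrix.diagonal] <;> ring

theorem tensor_mulVec {S : Type} [CommRing S] (M : MatFact ι S) (M' : MatFact κ S)
    (z : ι × κ → S) (i : ι) (k : κ) :
    (M.tensor M').d.mulVec z (i, k)
      = M.d.mulVec (fun j => z (j, k)) i + sgn (M.par i) * M'.d.mulVec (fun l => z (i, l)) k := by
  simp only [MatFact.tensor, Matrix.add_mulVec, Pi.add_apply]
  congr 1
  · simp only [Matrix.mulVec, dotProduct, Fintype.sum_prod_type, Matrix.kronecker_apply]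
    refine Finset.sum_congr rfl fun j _ => ?_
    rw [Finset.sum_eq_single k]
    · simp
    · intro l _ hl
      simp [Matrix.one_apply_ne hl.symm]
    · simp
  · simp only [Matrix.mulVec, dotProduct, Fintype.sum_prod_type, Matrix.kronecker_apply]
    rw [Finset.sum_eq_single i]
    · simp [Finset.mul_sum, mul_assoc]
    · intro j _ hj
      simp [Matrix.diagonal_apply_ne _ hj.symm]
    · simp

/-- `X v - g` generates the kernel of the substitution `X v ↦ g`, whose target is a domain; a factor
with nonzero image can be cancelled. -/
theorem dvd_of_dvd_mul_of_subst {σ : Type} [DecidableEq σ] {v : σ} {g a f : MvPolynomial σ ℚ}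
    (hg : MvPolynomial.aeval (Function.update X v g) g = g)
    (ha : MvPolynomial.aeval (Function.update X v g) a ≠ 0) (h : (X v - g) ∣ a * f) :
    (X v - g) ∣ f := by
  obtain ⟨q, hq⟩ := exists_sub_aeval_update v g f
  obtain ⟨t, ht⟩ := h
  have h1 := congrArg (MvPolynomial.aeval (Function.update X v g)) ht
  rw [map_mul, map_mul, map_sub, hg, aeval_X, Function.update_self, sub_self, zero_mul] at h1
  rw [(mul_eq_zero.1 h1).resolve_left ha, zero_add] at hq
  exact ⟨q, hq⟩

/-- `a, a'` with `a = y_j - ε y_i`, `a' = x_j - ε x_i` is a regular sequence. -/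
theorem leg_sub_dvd (ε : ℚ) {i j : Fin n} (hij : i ≠ j) {f : P n}
    (h : (yv j - C ε * yv i) ∣ (xv j - C ε * xv i) * f) : (yv j - C ε * yv i) ∣ f := by
  refine dvd_of_dvd_mul_of_subst (v := Sum.inr j) (g := C ε * X (Sum.inr i)) ?_ ?_ h
  · rw [map_mul, aeval_X, Function.update_of_ne (by simpa using hij)]
    simp
  · rw [xv, xv, map_sub, map_mul, aeval_X, aeval_X, Function.update_of_ne (by simp),
      Function.update_of_ne (by simp), MvPolynomial.algHom_C]
    exact X_sub_C_mul_X_ne_zero ε (by simpa using hij)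

theorem xv_add_ne_zero {i j : Fin n} (h : i ≠ j) : (xv j + xv i : P n) ≠ 0 := by
  have := X_sub_C_mul_X_ne_zero (-1) (i := (Sum.inl i : Fin n ⊕ Fin n)) (j := Sum.inl j)
    (by simpa using h)
  simpa [sub_eq_add_neg, xv] using this

theorem yv_add_ne_zero {i j : Fin n} (h : i ≠ j) : (yv j + yv i : P n) ≠ 0 := by
  have := X_sub_C_mul_X_ne_zero (-1) (i := (Sum.inr i : Fin n ⊕ Fin n)) (j := Sum.inr j)
    (by simpa using h)
  simpa [sub_eq_add_neg, yv] using this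

/-- The second entry of an arc after joining its legs. -/
theorem dd_neg_neg {S : Type} [CommRing S] (x : S) : dd N [x, x] = (2 * N + 1) * x ^ (2 * N) := by
  have h : ∀ k, hsym [x, x] k = (k + 1) * x ^ k := by
    intro k
    rw [hsym]
    simp only [hsym_singleton]
    rw [Finset.sum_congr rfl (g := fun _ => x ^ k)]
    · simp
    · intro i hi
      rw [← pow_add]
      congr 1
      have := Finset.mem_range.1 hi
      omega
  rw [dd, h]
  simp

theorem map_hsym {S T : Type} [CommRing S] [CommRing T] (f : S →+* T) (l : List S) (k : ℕ) :
    f (hsym l k) = hsym (l.map f) k := by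
  induction l generalizing k with
  | nil => simp only [hsym, List.map_nil]; split_ifs <;> simp
  | cons a l ih => simp [hsym, ih]

theorem map_dd {S T : Type} [CommRing S] [CommRing T] (f : S →+* T) (l : List S) :
    f (dd N l) = dd N (l.map f) := by
  rw [dd, map_hsym, dd, List.length_map]

theorem arc_d_map {S T : Type} [CommRing S] [CommRing T] (f : S →+* T) (x₁ y₁ x₂ y₂ : S) :
    (arc N x₁ y₁ x₂ y₂).d.map f = (arc N (f x₁) (f y₁) (f x₂) (f y₂)).d := by
  have h : f (dd N [-x₁, x₂]) = dd N [-f x₁, f x₂] := by simp [map_dd]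
  ext ⟨i, j⟩ ⟨k, l⟩
  rw [Matrix.map_apply]
  fin_cases i <;> fin_cases j <;> fin_cases k <;> fin_cases l <;>
    simp [arc, MatFact.tensor, row, sgn, h]

theorem tensor_d_map {S T : Type} [CommRing S] [CommRing T] (f : S →+* T) (M : MatFact ι S)
    (M' : MatFact κ S) (L : MatFact ι T) (L' : MatFact κ T) (hp : L.par = M.par)
    (h : L.d = M.d.map f) (h' : L'.d = M'.d.map f) :
    (L.tensor L').d = (M.tensor M').d.map f := by
  ext ⟨i, j⟩ ⟨k, l⟩
  rw [Matrix.map_apply]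
  simp only [MatFact.tensor, Matrix.add_apply, Matrix.kronecker_apply, h, h', hp, Matrix.map_apply,
    map_add, map_mul, Matrix.one_apply, Matrix.diagonal_apply]
  congr 2
  · split_ifs <;> simp
  · split_ifs <;> simp [sgn, apply_ite f]

/-- Every endomorphism of the 1-arc factorization is homotopic to the multiplication by a
polynomial in the variables of the first leg. -/
theorem arc_end {k : ℤ} {g : (arcD N).carrier →ₗ[P 2] (arcD N).carrier} (hg : IsChain g)
    (hgd : HasDeg 0 k g) : ∃ f : P 1, IsWH N f k ∧
      Homotopic N k g ((legHom ![0] f : P 2) • LinearMap.id) := by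
  let M := arc N (xv 0 : P 2) (yv 0) (xv 1) (yv 1)
  let K := (arcCreation (isWH_xv (N := N) (0 : Fin 2)) (isWH_yv 0) (isWH_xv 1) (isWH_yv 1)).toPair
    (yv_add_ne_zero (by decide)) (IsWH.cast ((isWH_yv 1).add (isWH_yv 0)) (by ring))
    (fun f g h => by
      have := leg_sub_dvd (-1) (i := (0 : Fin 2)) (j := 1) (by decide) (f := f)
        ⟨g, by simpa [sub_eq_add_neg] using h⟩
      simpa [sub_eq_add_neg] using this)
  let e : Fin 2 × Fin 2 → (Fin 2 × Fin 2 → P 2) := fun j => Pi.single j 1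
  have he : ∀ j, e j ∈ (M.toDiffMod N).gr (M.par j) (M.deg j) := by
    intro j
    refine mem_toDiffMod_gr.2 fun i => ?_
    by_cases h : i = j
    · subst h
      refine ⟨fun _ => ?_, fun h => absurd rfl h⟩
      simp only [e, Pi.single_eq_same]
      exact isWH_one.cast (by ring)
    · simp only [e, Pi.single_eq_of_ne h]
      exact ⟨fun _ => isWH_zero, fun _ => trivial⟩
  let G : (Fin 2 × Fin 2 → P 2) →ₗ[P 2] (Fin 2 × Fin 2 → P 2) := g
  have hGe : ∀ j, (M.par (0, 0) = M.par j + 0 → IsWH N (G (e j) (0, 0)) (M.deg j + k - M.deg (0, 0))) ∧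
      (M.par (0, 0) ≠ M.par j + 0 → G (e j) (0, 0) = 0) := fun j =>
    mem_toDiffMod_gr.1 (hgd _ _ _ (he j)) (0, 0)
  have hchain : ∀ z : Fin 2 × Fin 2 → P 2, G (M.d.mulVec z) = M.d.mulVec (G z) :=
    fun z => hg.apply z
  -- Reduction modulo the left entries `y₂ + y₁`, `x₂ + x₁`, realized as an idempotent endomorphism
  -- of `P 2`; it factors through `P 1` by `hst`.
  obtain ⟨s, hs⟩ : ∃ s : P 2 →ₐ[ℚ] P 2, s = substLeg (-1) 0 1 := ⟨_, rfl⟩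
  have sx1 : s (xv 1) = - xv 0 := by rw [hs, substLeg_xv_same]; simp
  have sy1 : s (yv 1) = - yv 0 := by rw [hs, substLeg_yv_same]; simp
  have sx0 : s (xv 0) = xv 0 := by rw [hs, substLeg_xv_of_ne _ (by decide)]
  have sy0 : s (yv 0) = yv 0 := by rw [hs, substLeg_yv_of_ne _ (by decide)]
  let t : P 2 →ₐ[ℚ] P 1 := subst ![xv 0, -xv 0] ![yv 0, -yv 0]
  have hst : (legHom ![0]).comp t = s := by
    refine algHom_ext_legs (fun i => ?_) (fun i => ?_) <;> fin_cases i <;>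
      simp [t, sx0, sx1, sy0, sy1]
  have hss : s.comp s = s := by
    refine algHom_ext_legs (fun i => ?_) (fun i => ?_) <;> fin_cases i <;>
      simp [sx0, sx1, sy0, sy1]
  have h00 : M.par (0, 0) = 0 := rfl
  have d00 : M.deg (0, 0) = 0 := rfl
  -- the component at the top generator vanishes after the substitution
  have h11 : s (G (e (1, 1)) (0, 0)) = 0 := by
    have h1 : M.d.mulVec (e (1, 0)) = (yv 1 + yv 0 : P 2) • e (0, 0)
        - (yv 0 ^ 2 + dd N [-xv 0, xv 1] : P 2) • e (1, 1) := by
      obtain ⟨c1, c2, c3, c4⟩ := arc_mulVec (N := N) (xv 0 : P 2) (yv 0) (xv 1) (yv 1) (e (1, 0))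
      funext ⟨i, j⟩
      fin_cases i <;> fin_cases j
      · exact c1.trans (by simp [e])
      · exact c2.trans (by simp [e])
      · exact c3.trans (by simp [e])
      · exact c4.trans (by simp [e])
    have h2 := congrFun (hchain (e (1, 0))) (0, 0)
    rw [h1, (arc_mulVec _ _ _ _ _).1, map_sub, map_smul, map_smul] at h2
    have h3 := congrArg s h2
    simp only [Pi.sub_apply, Pi.smul_apply, smul_eq_mul, map_sub, map_mul, map_add, sx0, sx1, sy0,
      sy1, neg_add_cancel, zero_mul, add_zero, zero_sub, neg_eq_zero, mul_eq_zero] at h3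
    -- The other factor is the reduced right entry `y² + (2N+1)x²ᴺ`, whose value at `x = 1`, `y = 0`
    -- is `2N + 1 ≠ 0`.
    refine h3.resolve_left fun h4 => ?_
    rw [map_pow, sy0] at h4
    have h5 : s (dd N [-xv 0, xv 1]) = (2 * (N : P 2) + 1) * (-xv 0) ^ (2 * N) := by
      have := map_dd (N := N) s.toRingHom [-xv 0, xv 1]
      simp only [AlgHom.toRingHom_eq_coe, RingHom.coe_coe, List.map_cons, List.map_nil, map_neg,
        sx0, sx1] at this
      rw [this, dd_neg_neg]
    rw [h5] at h4
    have h6 := congrArg (MvPolynomial.aeval (Sum.elim (fun _ => (1 : ℚ)) (fun _ => 0))) h4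
    simp [xv, yv] at h6
    norm_cast at h6
  have hfk : IsWH N (t (G (e (0, 0)) (0, 0))) k := by
    refine IsWH.subst (fun i => ?_) (fun i => ?_) (IsWH.cast ((hGe (0, 0)).1 (by simp)) (by simp))
    · fin_cases i; exacts [isWH_xv _, (isWH_xv _).neg]
    · fin_cases i; exacts [isWH_yv _, (isWH_yv _).neg]
  refine ⟨t (G (e (0, 0)) (0, 0)), hfk, ?_⟩
  have hst' : ∀ q, legHom ![0] (t q) = s q := fun q => DFunLike.congr_fun hst q
  rw [hst']
  have hsk : IsWH N (s (G (e (0, 0)) (0, 0))) k := by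
    rw [← hst']; exact IsWH.legHom _ hfk
  -- After subtracting the multiplication, the lowest component of the image of each basis vector
  -- vanishes under `s`: at `e₀₀` by construction, at `e₁₁` by `h11`, at the odd generators by
  -- parity.
  let u : (M.toDiffMod N).carrier →ₗ[P 2] (M.toDiffMod N).carrier :=
    g - (s (G (e (0, 0)) (0, 0))) • LinearMap.id
  have hu0 : ∀ j, s ((u (e j) : Fin 2 × Fin 2 → P 2) (0, 0)) = 0 ∧
      (M.par j = 0 → IsWH N ((u (e j) : Fin 2 × Fin 2 → P 2) (0, 0)) (M.deg j + k)) ∧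
      (M.par j ≠ 0 → (u (e j) : Fin 2 × Fin 2 → P 2) (0, 0) = 0) := by
    intro j
    have hu : (u (e j) : Fin 2 × Fin 2 → P 2) (0, 0)
        = G (e j) (0, 0) - s (G (e (0, 0)) (0, 0)) * e j (0, 0) := rfl
    rw [hu]
    by_cases hj : j = (0, 0)
    · subst hj
      have e1 : e (0, 0) (0, 0) = 1 := Pi.single_eq_same _ _
      rw [e1, mul_one, map_sub]
      refine ⟨sub_eq_zero.2 (DFunLike.congr_fun hss _).symm, fun _ => ?_, fun h => absurd h00 h⟩
      refine IsWeightedHomogeneous.sub (IsWH.cast ((hGe _).1 (by simp)) (by simp [d00])) ?_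
      exact hsk.cast (by simp [d00])
    · have e1 : e j (0, 0) = 0 := Pi.single_eq_of_ne (Ne.symm hj) _
      rw [e1, mul_zero, sub_zero]
      refine ⟨?_, fun h => ?_, fun h => ?_⟩
      · rcases j with ⟨j1, j2⟩
        fin_cases j1 <;> fin_cases j2
        · exact absurd rfl hj
        · exact (congrArg s ((hGe (0, 1)).2
            (show (0 : ZMod 2) ≠ 0 + 1 + 0 by decide))).trans (map_zero s)
        · exact (congrArg s ((hGe (1, 0)).2
            (show (0 : ZMod 2) ≠ 1 + 0 + 0 by decide))).trans (map_zero s)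
        · exact h11
      · exact IsWH.cast ((hGe j).1 (by rw [h, h00, add_zero])) (by simp [d00])
      · exact (hGe j).2 (by rw [h00, add_zero]; exact Ne.symm h)
  -- Vanishing under `s` means lying in the ideal of the left entries, with homogeneous
  -- coefficients. These are the maps `v`, `v'` of the null-homotopy criterion.
  have hV : ∀ j, ∃ V V' : P 2, IsWH N V (M.deg j + k - 2 * N) ∧ IsWH N V' (M.deg j + k - 2) ∧
      (M.par j ≠ 0 → V = 0 ∧ V' = 0) ∧
      (u (e j) : Fin 2 × Fin 2 → P 2) (0, 0) = (yv 1 + yv 0) * V + (xv 1 + xv 0) * V' := by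
    intro j
    obtain ⟨c1, c2, c3⟩ := hu0 j
    by_cases hj : M.par j = 0
    · obtain ⟨q, q', hq, hq', hqq⟩ := exists_substLeg (-1) (i := 0) (j := 1) (by decide) (c2 hj)
      refine ⟨q', q, hq', hq, fun h => absurd hj h, ?_⟩
      rw [← hs, c1] at hqq
      rw [hqq]
      simp only [C_neg, C_1]
      ring
    · exact ⟨0, 0, isWH_zero, isWH_zero, fun _ => ⟨rfl, rfl⟩, by rw [c3 hj]; ring⟩
  choose V V' hVd hVd' hV0 hVe using hV
  have hmat : ∀ (T : Fin 2 × Fin 2 → P 2) (l : ℤ), (∀ j, IsWH N (T j) (M.deg j + k - l)) →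
      (∀ j, M.par j ≠ 0 → T j = 0) →
      MatDeg N M M 0 (k - l) (Matrix.of (Pi.single (0, 0) T)) := by
    intro T l h1 h2 i j
    rw [Matrix.of_apply]
    by_cases hi : i = (0, 0)
    · subst hi
      rw [Pi.single_eq_same]
      refine ⟨fun h => h2 j (fun h' => h (by rw [h', h00, add_zero])), (h1 j).cast ?_⟩
      rw [d00]; ring
    · rw [Pi.single_eq_of_ne hi]
      exact ⟨fun _ => rfl, isWH_zero⟩
  have hud : HasDeg (X := M.toDiffMod N) (Y := M.toDiffMod N) 0 k u := by
    refine HasDeg.sub hgd fun p a m hm => ?_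
    refine mem_toDiffMod_gr.2 fun i => ⟨fun hi => ?_, fun hi => ?_⟩
    · refine IsWH.cast (hsk.mul ((mem_toDiffMod_gr.1 hm i).1 (by rw [hi, add_zero]))) (by ring)
    · change s (G (e (0, 0)) (0, 0)) * (m i) = 0
      rw [(mem_toDiffMod_gr.1 hm i).2 (by rwa [add_zero] at hi), mul_zero]
  have huc : IsChain (X := M.toDiffMod N) (Y := M.toDiffMod N) u :=
    IsChain.sub hg (IsChain.smul IsChain.id _)
  obtain ⟨h, hh, hhx, -⟩ := K.exists_nullhomotopy (X := M.toDiffMod N) M.curved (M.toDiffMod N).d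
    M.curved K.d_deg hud (fun x => (huc.apply x).symm)
    (Matrix.of (Pi.single (0, 0) V)).mulVecLin (Matrix.of (Pi.single (0, 0) V')).mulVecLin
    (hmat V _ (fun j => (hVd j).cast (by ring)) fun j hj => (hV0 j hj).1).hasDeg
    (hmat V' _ (fun j => (hVd' j).cast (by ring)) fun j hj => (hV0 j hj).2).hasDeg
    (fun x => by
      refine (MatKoszul.toPair_bot _ _ _ _ _).trans ?_
      refine (arcCreation_bot_mulVec _ _ _ _ _).trans ?_
      funext i
      change _ = (yv 1 + yv 0) * (Matrix.of (Pi.single (0, 0) V)).mulVec (show Fin 2 × Fin 2 → P 2 from x) i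
        + (xv 1 + xv 0) * (Matrix.of (Pi.single (0, 0) V')).mulVec (show Fin 2 × Fin 2 → P 2 from x) i
      by_cases hi : i = (0, 0)
      · subst hi
        rw [Pi.single_eq_same]
        have hsum := LinearMap.pi_apply_eq_sum_univ
          ((LinearMap.proj (0, 0) : (Fin 2 × Fin 2 → P 2) →ₗ[P 2] P 2) ∘ₗ
            (show (Fin 2 × Fin 2 → P 2) →ₗ[P 2] (Fin 2 × Fin 2 → P 2) from u))
          (show Fin 2 × Fin 2 → P 2 from x)
        refine hsum.trans ?_
        simp only [Matrix.mulVec, dotProduct, Matrix.of_apply, Pi.single_eq_same, Finset.mul_sum]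
        rw [← Finset.sum_add_distrib]
        refine Finset.sum_congr rfl fun j _ => ?_
        have h1 : (fun l => if j = l then (1 : P 2) else 0) = e j := by
          funext l
          simp only [e, Pi.single_apply, eq_comm]
        rw [h1]
        change x j * (u (e j) : Fin 2 × Fin 2 → P 2) (0, 0) = _
        rw [hVe]
        ring
      · rw [Pi.single_eq_of_ne hi]
        simp [Matrix.mulVec, dotProduct, Pi.single_eq_of_ne hi])
  refine ⟨h, ?_, LinearMap.ext hhx⟩
  rwa [zero_add] at hh

end ArcEnd

/-! ### Exclusion of a leg -/

section Exclusion

open MvPolynomial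

variable {N : ℕ} {ι κ : Type} [Fintype ι] [DecidableEq ι] [Fintype κ] [DecidableEq κ]

/-- A matrix factorization over polynomials in three legs, as a module over the polynomials in the
two outer legs. -/
abbrev outerMod (N : ℕ) (M : MatFact ι (P 3)) : DiffMod 2 := (M.toDiffMod N).restrict ![0, 2]

/-- An outer-linear operator acts on the components with index in `S`. -/
def outerOp (M : MatFact ι (P 3)) (S : ι → Prop) [DecidablePred S] (Q : P 3 →ₗ[ℚ] P 3)
    (hQ : ∀ a f, Q (legHom ![0, 2] a * f) = legHom ![0, 2] a * Q f) :
    Module.End (P 2) (outerMod N M).carrier where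
  toFun := fun (z : ι → P 3) i => if S i then Q (z i) else 0
  map_add' := fun (z z' : ι → P 3) => by
    funext i
    change (if S i then Q (z i + z' i) else 0) = (if S i then Q (z i) else 0)
      + (if S i then Q (z' i) else 0)
    split_ifs <;> simp
  map_smul' := fun a (z : ι → P 3) => by
    funext i
    change (if S i then Q (legHom ![0, 2] a * z i) else 0)
      = legHom ![0, 2] a * (if S i then Q (z i) else 0)
    split_ifs
    · exact hQ _ _
    · rw [mul_zero]

theorem outerOp_hasDeg (M : MatFact ι (P 3)) (S : ι → Prop) [DecidablePred S]
    (Q : P 3 →ₗ[ℚ] P 3) (hQ : ∀ a f, Q (legHom ![0, 2] a * f) = legHom ![0, 2] a * Q f) {δ : ℤ}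
    (hd : ∀ f k, IsWH N f k → IsWH N (Q f) (k + δ)) :
    HasDeg (X := outerMod N M) (Y := outerMod N M) 0 δ (outerOp M S Q hQ) := by
  intro p a (z : ι → P 3) hz
  have hz := mem_toDiffMod_gr.1 hz
  refine mem_toDiffMod_gr.2 fun i => ?_
  change (_ → IsWH N (if S i then Q (z i) else 0) _) ∧ (_ → (if S i then Q (z i) else 0) = 0)
  rw [add_zero]
  refine ⟨fun h => ?_, fun h => ?_⟩
  · split_ifs
    · exact (hd _ _ ((hz i).1 h)).cast (by ring)
    · exact isWH_zero
  · rw [(hz i).2 h, map_zero, ite_self]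

variable (ε : ℚ)

/-- The substitution which replaces the middle leg by `ε` times the last one. -/
def mergeHom : P 3 →ₐ[ℚ] P 2 := subst ![xv 0, C ε * xv 1, xv 1] ![yv 0, C ε * yv 1, yv 1]

theorem mergeHom_legHom (f : P 2) : mergeHom ε (legHom ![0, 2] f) = f := by
  have : (mergeHom ε).comp (legHom ![0, 2]) = AlgHom.id ℚ (P 2) := by
    refine algHom_ext_legs (fun i => ?_) (fun i => ?_) <;> fin_cases i <;> simp [mergeHom]
  exact DFunLike.congr_fun this f

theorem legHom_mergeHom (f : P 3) : legHom ![0, 2] (mergeHom ε f) = substLeg ε 2 1 f := by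
  have : (legHom (![0, 2] : Fin 2 → Fin 3)).comp (mergeHom ε) = substLeg ε 2 1 := by
    refine algHom_ext_legs (fun i => ?_) (fun i => ?_) <;> fin_cases i
    · simp [mergeHom, substLeg_xv_of_ne]
    · simp [mergeHom, substLeg_xv_same]
    · simp [mergeHom, substLeg_xv_of_ne]
    · simp [mergeHom, substLeg_yv_of_ne]
    · simp [mergeHom, substLeg_yv_same]
    · simp [mergeHom, substLeg_yv_of_ne]
  exact DFunLike.congr_fun this f

theorem IsWH.mergeHom {f : P 3} {k : ℤ} (hf : IsWH N f k) : IsWH N (SaddleMF.mergeHom ε f) k := by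
  refine IsWH.subst (fun i => ?_) (fun i => ?_) hf <;> fin_cases i
  exacts [isWH_xv _, (isWH_xv _).C_mul ε, isWH_xv _, isWH_yv _, (isWH_yv _).C_mul ε, isWH_yv _]

/-- Outer-linear division with remainder by the two differences of variables. -/
theorem exists_division :
    ∃ Q Q' : P 3 →ₗ[ℚ] P 3, (∀ a f, Q (legHom ![0, 2] a * f) = legHom ![0, 2] a * Q f) ∧
      (∀ a f, Q' (legHom ![0, 2] a * f) = legHom ![0, 2] a * Q' f) ∧
      (∀ f k, IsWH N f k → IsWH N (Q f) (k + -2)) ∧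
      (∀ f k, IsWH N f k → IsWH N (Q' f) (k + -(2 * N))) ∧
      ∀ f, f = legHom ![0, 2] (mergeHom ε f) + (xv 1 - C ε * xv 2) * Q f
        + (yv 1 - C ε * yv 2) * Q' f := by
  have h : ∀ s : Fin 1 ⊕ Fin 1 →₀ ℕ, ∃ q q' : P 3,
      IsWH N q (Finsupp.weight (wt N 1) s + -2) ∧ IsWH N q' (Finsupp.weight (wt N 1) s + -(2 * N)) ∧
      (legHom ![1] (monomial s 1) : P 3) = substLeg ε 2 1 (legHom ![1] (monomial s 1))
        + (xv 1 - C ε * xv 2) * q + (yv 1 - C ε * yv 2) * q' := by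
    intro s
    have h1 : IsWH N (legHom ![1] (monomial s 1) : P 3) (Finsupp.weight (wt N 1) s) :=
      IsWH.legHom _ (isWeightedHomogeneous_monomial _ _ _ rfl)
    exact exists_substLeg ε (by decide) h1
  choose q q' hq hq' he using h
  obtain ⟨Q, hQl, hQd, hQ⟩ := exists_outer_linear (legHom ![0, 2]) (-2)
    (fun f k hf => IsWH.legHom _ hf) (fun s g => g = q s) (fun s => ⟨q s, hq s, rfl⟩)
  obtain ⟨Q', hQl', hQd', hQ'⟩ := exists_outer_linear (legHom ![0, 2]) (-(2 * N))
    (fun f k hf => IsWH.legHom _ hf) (fun s g => g = q' s) (fun s => ⟨q' s, hq' s, rfl⟩)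
  refine ⟨Q, Q', hQl, hQl', hQd, hQd', fun f => ?_⟩
  let R : P 3 →ₗ[ℚ] P 3 := (legHom ![0, 2]).toLinearMap ∘ₗ (mergeHom ε).toLinearMap
    + LinearMap.mulLeft ℚ (xv 1 - C ε * xv 2) ∘ₗ Q
    + LinearMap.mulLeft ℚ (yv 1 - C ε * yv 2) ∘ₗ Q'
  have hR : ∀ f, R f = legHom ![0, 2] (mergeHom ε f) + (xv 1 - C ε * xv 2) * Q f
        + (yv 1 - C ε * yv 2) * Q' f := fun f => rfl
  have : LinearMap.id = R := by
    refine outer_linear_ext (legHom ![0, 2]) (fun a f => rfl) (fun a f => ?_) fun s => ?_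
    · rw [hR, hR, hQl, hQl', map_mul, mergeHom_legHom, map_mul]
      ring
    · rw [hR, hQ, hQ', legHom_mergeHom]
      exact he s
  rw [← hR, ← this]
  rfl

variable (M : MatFact ι (P 3)) (M' : MatFact (Fin 2 × Fin 2) (P 3)) (M₀ : MatFact ι (P 2))

/-- The projection to the lowest component of the second factor, followed by the merging of the
middle leg. -/
def mergeProj : (outerMod N (M.tensor M')).carrier →ₗ[P 2] (M₀.toDiffMod N).carrier where
  toFun := fun (z : ι × (Fin 2 × Fin 2) → P 3) i => mergeHom ε (z (i, (0, 0)))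
  map_add' := fun (z z' : ι × (Fin 2 × Fin 2) → P 3) => funext fun i => by
    change mergeHom ε (z (i, (0, 0)) + z' (i, (0, 0)))
      = mergeHom ε (z (i, (0, 0))) + mergeHom ε (z' (i, (0, 0)))
    rw [map_add]
  map_smul' := fun a (z : ι × (Fin 2 × Fin 2) → P 3) => funext fun i => by
    change mergeHom ε (legHom ![0, 2] a * z (i, (0, 0))) = a * mergeHom ε (z (i, (0, 0)))
    rw [map_mul, mergeHom_legHom]

/-- The section of `mergeProj` given by the inclusion of polynomials. -/
def mergeSect : (M₀.toDiffMod N).carrier →ₗ[P 2] (outerMod N (M.tensor M')).carrier where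
  toFun := fun (y : ι → P 2) i => if i.2 = (0, 0) then legHom ![0, 2] (y i.1) else 0
  map_add' := fun (y y' : ι → P 2) => funext fun i => by
    change (if i.2 = (0, 0) then legHom ![0, 2] (y i.1 + y' i.1) else 0)
      = (if i.2 = (0, 0) then legHom ![0, 2] (y i.1) else 0)
        + (if i.2 = (0, 0) then legHom ![0, 2] (y' i.1) else 0)
    split_ifs <;> simp
  map_smul' := fun a (y : ι → P 2) => funext fun i => by
    change (if i.2 = (0, 0) then legHom ![0, 2] (a * y i.1) else 0)
      = legHom ![0, 2] a * (if i.2 = (0, 0) then legHom ![0, 2] (y i.1) else 0)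
    split_ifs <;> simp

theorem mergeProj_mergeSect (y : ι → P 2) :
    mergeProj (N := N) ε M M' M₀ (mergeSect M M' M₀ y) = y := by
  funext i
  change mergeHom ε (if (0, 0) = ((0, 0) : Fin 2 × Fin 2) then legHom ![0, 2] (y i) else 0) = y i
  rw [if_pos rfl, mergeHom_legHom]

/-- The part of `M'.d` that ends in the lowest generator consists of the left entries of the
excluded arc, and these vanish when the legs are merged. -/
theorem mergeProj_isChain (hd : M₀.d = M.d.map (mergeHom ε))
    (h : ∀ j, mergeHom ε (M'.d (0, 0) j) = 0) :
    IsChain (X := outerMod N (M.tensor M')) (Y := M₀.toDiffMod N) (mergeProj ε M M' M₀) := by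
  refine LinearMap.ext fun (z : ι × (Fin 2 × Fin 2) → P 3) => funext fun i => ?_
  change mergeHom ε ((M.tensor M').d.mulVec z (i, (0, 0)))
    = M₀.d.mulVec (fun j => mergeHom ε (z (j, (0, 0)))) i
  rw [tensor_mulVec, map_add, map_mul, hd]
  have h1 : mergeHom ε (M'.d.mulVec (fun l => z (i, l)) (0, 0)) = 0 := by
    simp only [Matrix.mulVec, dotProduct, map_sum, map_mul, h, zero_mul, Finset.sum_const_zero]
  rw [h1, mul_zero, add_zero]
  simp only [Matrix.mulVec, dotProduct, map_sum, map_mul, Matrix.map_apply]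

theorem mergeProj_hasDeg (hpar : M.par = M₀.par) (hdeg : M.deg = M₀.deg) (h0 : M'.par (0, 0) = 0)
    (h0' : M'.deg (0, 0) = 0) :
    HasDeg (X := outerMod N (M.tensor M')) (Y := M₀.toDiffMod N) 0 0 (mergeProj ε M M' M₀) := by
  intro p a z hz
  have hz := mem_toDiffMod_gr.1 hz
  refine mem_toDiffMod_gr.2 fun i => ?_
  have hzi := hz (i, (0, 0))
  rw [show (M.tensor M').par (i, (0, 0)) = M₀.par i by simp [MatFact.tensor, hpar, h0],
    show (M.tensor M').deg (i, (0, 0)) = M₀.deg i by simp [MatFact.tensor, hdeg, h0']] at hzi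
  rw [add_zero, add_zero]
  exact ⟨fun h => IsWH.mergeHom ε (hzi.1 h),
    fun h => (congrArg (mergeHom ε) (hzi.2 h)).trans (map_zero _)⟩

theorem mergeSect_hasDeg (hpar : M.par = M₀.par) (hdeg : M.deg = M₀.deg) (h0 : M'.par (0, 0) = 0)
    (h0' : M'.deg (0, 0) = 0) :
    HasDeg (X := M₀.toDiffMod N) (Y := outerMod N (M.tensor M')) 0 0 (mergeSect M M' M₀) := by
  rintro p a (z : ι → P 2) hz
  have hz := mem_toDiffMod_gr.1 hz
  refine mem_toDiffMod_gr.2 ?_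
  rintro ⟨i, j⟩
  change (_ → IsWH N (if j = (0, 0) then legHom ![0, 2] (z i) else 0) _) ∧
    (_ → (if j = (0, 0) then legHom ![0, 2] (z i) else 0) = 0)
  by_cases hj : j = (0, 0)
  · subst hj
    rw [if_pos rfl,
      show (M.tensor M').par (i, (0, 0)) = M₀.par i by simp [MatFact.tensor, hpar, h0],
      show (M.tensor M').deg (i, (0, 0)) = M₀.deg i by simp [MatFact.tensor, hdeg, h0'],
      add_zero, add_zero]
    exact ⟨fun h => IsWH.legHom _ ((hz i).1 h), fun h => by rw [(hz i).2 h, map_zero]⟩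
  · rw [if_neg hj]
    exact ⟨fun _ => isWH_zero, fun _ => rfl⟩

theorem tensor_arcCreation_bot (hM : MatDeg N M M 1 (2 * N + 1) M.d)
    {x₁ y₁ x₂ y₂ : P 3} (hx₁ : IsWH N x₁ 2) (hy₁ : IsWH N y₁ (2 * N)) (hx₂ : IsWH N x₂ 2)
    (hy₂ : IsWH N y₂ (2 * N)) (z : ι × (Fin 2 × Fin 2) → P 3) (i : ι × (Fin 2 × Fin 2)) :
    ((arcCreation hx₁ hy₁ hx₂ hy₂).tensor M hM).bot.mulVec z i
      = if i.2 = (0, 0) then z i else 0 := by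
  rw [MatKoszul.tensor_bot, one_kronecker_mulVec_apply, arcCreation_bot_mulVec, Pi.single_apply]
  rcases i with ⟨i, j⟩
  by_cases hj : j = (0, 0)
  · subst hj; simp
  · simp [hj]

theorem tensor_arcAnnihilation_bot (hM : MatDeg N M M 1 (2 * N + 1) M.d)
    {x₁ y₁ x₂ y₂ : P 3} (hx₁ : IsWH N x₁ 2) (hy₁ : IsWH N y₁ (2 * N)) (hx₂ : IsWH N x₂ 2)
    (hy₂ : IsWH N y₂ (2 * N)) (z : ι × (Fin 2 × Fin 2) → P 3) (i : ι × (Fin 2 × Fin 2)) :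
    ((arcAnnihilation hx₁ hy₁ hx₂ hy₂).tensor M hM).bot.mulVec z i
      = if i.2 = (1, 1) then z i else 0 := by
  rw [MatKoszul.tensor_bot, one_kronecker_mulVec_apply, arcAnnihilation_bot_mulVec, Pi.single_apply]
  rcases i with ⟨i, j⟩
  by_cases hj : j = (1, 1)
  · subst hj; simp
  · simp [hj]

/-- A twisted chain map into a Koszul construction over three legs is null-homotopic if its lowest
component is divided by the two elements by outer-linear operators. -/
theorem outer_nullhomotopy {T : MatFact ι (P 3)} {a a' : P 3} {δ δ' : ℤ}
    (K : MatKoszul N T a a' δ δ') (h0 : a ≠ 0) (ha : IsWH N a δ)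
    (hdiv : ∀ f g, a' * f = a * g → a ∣ f) {S : ι → Prop} [DecidablePred S]
    (hbot : ∀ (z : ι → P 3) i, K.bot.mulVec z i = if S i then z i else 0)
    {Q Q' : P 3 →ₗ[ℚ] P 3} (hQ : ∀ a f, Q (legHom ![0, 2] a * f) = legHom ![0, 2] a * Q f)
    (hQ' : ∀ a f, Q' (legHom ![0, 2] a * f) = legHom ![0, 2] a * Q' f)
    (hQd : ∀ f k, IsWH N f k → IsWH N (Q f) (k + -δ))
    (hQd' : ∀ f k, IsWH N f k → IsWH N (Q' f) (k + -δ')) {W : P 2}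
    (hW : Curved (outerMod N T) W) {Z : DiffMod 2} {d' : Module.End (P 2) Z.carrier} {s : ZMod 2}
    {k : ℤ} {u : Z.carrier →ₗ[P 2] (outerMod N T).carrier} (hd' : ∀ z, d' (d' z) = W • z)
    (hd'd : HasDeg (X := Z) (Y := Z) 1 (2 * N + 1) d') (hu : HasDeg s k u)
    (hchain : ∀ z, (outerMod N T).d (u z) = u (d' z))
    (hker : ∀ z i, S i → (u z : ι → P 3) i
      = a * Q ((u z : ι → P 3) i) + a' * Q' ((u z : ι → P 3) i)) :
    ∃ h : Z.carrier →ₗ[P 2] (outerMod N T).carrier, HasDeg (s + 1) (k - (2 * N + 1)) h ∧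
      (∀ z, u z = (outerMod N T).d (h z) + h (d' z)) ∧
      ∀ z i, S i → (h z : ι → P 3) i = 0 := by
  have hb : ∀ y i, (((K.toPair h0 ha hdiv).restrict ![0, 2]).bot y : ι → P 3) i
      = if S i then (y : ι → P 3) i else 0 := fun y i =>
    (congrFun (MatKoszul.toPair_bot K h0 ha hdiv y) i).trans (hbot y i)
  obtain ⟨h, h1, h2, h3⟩ := ((K.toPair h0 ha hdiv).restrict ![0, 2]).exists_nullhomotopy hW d' hd'
    hd'd hu hchain (outerOp T S Q hQ ∘ₗ u) (outerOp T S Q' hQ' ∘ₗ u)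
    ((outerOp_hasDeg T S Q hQ hQd).comp hu (add_zero s) (by ring))
    ((outerOp_hasDeg T S Q' hQ' hQd').comp hu (add_zero s) (by ring))
    (fun z => by
      funext i
      refine (hb _ _).trans ?_
      change _ = a * (if S i then Q ((u z : ι → P 3) i) else 0)
        + a' * (if S i then Q' ((u z : ι → P 3) i) else 0)
      split_ifs with hi
      · exact hker z i hi
      · ring)
  refine ⟨h, h1, h2, fun z i hi => ?_⟩
  have := (hb (h z) i).symm.trans (congrFun (h3 z) i)
  rwa [if_pos hi] at this

/-- Exclusion of a variable leg: a product of a matrix factorization with an arc which joins the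
middle leg with the last one is homotopy equivalent to the factorization with the middle leg
replaced by the last one. -/
theorem nonempty_htpyEquiv_merge
    (hpar : M.par = M₀.par) (hdeg : M.deg = M₀.deg) (hd : M₀.d = M.d.map (mergeHom ε))
    (hM : MatDeg N M M 1 (2 * N + 1) M.d) (hM₀ : MatDeg N M₀ M₀ 1 (2 * N + 1) M₀.d)
    {x₁ y₁ x₂ y₂ : P 3} (hx₁ : IsWH N x₁ 2) (hy₁ : IsWH N y₁ (2 * N)) (hx₂ : IsWH N x₂ 2)
    (hy₂ : IsWH N y₂ (2 * N)) {η : ℚ} (hη : η ≠ 0) (hx : x₂ + x₁ = C η * (xv 1 - C ε * xv 2))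
    (hy : y₂ + y₁ = C η * (yv 1 - C ε * yv 2))
    (hW : (M.tensor (arc N x₁ y₁ x₂ y₂)).pot = legHom ![0, 2] M₀.pot) :
    Nonempty (HtpyEquiv N (outerMod N (M.tensor (arc N x₁ y₁ x₂ y₂))) (M₀.toDiffMod N)) := by
  obtain ⟨Q, Q', hQl, hQl', hQd, hQd', hQ⟩ := exists_division (N := N) ε
  have hCη : (C η : P 3) ≠ 0 := by simpa using hη
  have hinv : (C η : P 3) * C η⁻¹ = 1 := by rw [← C_mul, mul_inv_cancel₀ hη, C_1]
  have hKx : mergeHom ε (x₂ + x₁) = 0 := by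
    rw [hx]; simp [mergeHom]
  have hKy : mergeHom ε (y₂ + y₁) = 0 := by
    rw [hy]; simp [mergeHom]
  have hya : y₂ + y₁ ≠ 0 := by
    rw [hy]
    exact mul_ne_zero hCη (X_sub_C_mul_X_ne_zero ε (by decide))
  have hdiv : ∀ f g, (x₂ + x₁) * f = (y₂ + y₁) * g → (y₂ + y₁) ∣ f := by
    intro f g h
    rw [hx, hy, mul_assoc, mul_assoc] at h
    obtain ⟨t, ht⟩ := leg_sub_dvd (n := 3) ε (i := 2) (j := 1) (by decide)
      ⟨g, mul_left_cancel₀ hCη h⟩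
    rw [hy]
    refine ⟨C η⁻¹ * t, ?_⟩
    rw [ht]
    linear_combination (-(yv 1 - C ε * yv 2) * t) * hinv
  have hcurvX : Curved (outerMod N (M.tensor (arc N x₁ y₁ x₂ y₂))) M₀.pot := by
    refine Curved.restrict ?_
    rw [← hW]
    exact MatFact.curved _
  have hrow : ∀ j, mergeHom ε ((arc N x₁ y₁ x₂ y₂).d (0, 0) j) = 0 := by
    intro j
    have h1 := (arc_mulVec (N := N) x₁ y₁ x₂ y₂ (Pi.single j 1)).1
    rw [Matrix.mulVec_single_one] at h1
    change (arc N x₁ y₁ x₂ y₂).d (0, 0) j = _ at h1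
    rw [h1, map_add, map_mul, map_mul, hKx, hKy, zero_mul, zero_mul, add_zero]
  have hXd := ((arcCreation hx₁ hy₁ hx₂ hy₂).tensor M hM).d_deg.hasDeg
  obtain ⟨e, -⟩ := exists_htpyEquiv (X := outerMod N (M.tensor (arc N x₁ y₁ x₂ y₂)))
    (Y := M₀.toDiffMod N) hcurvX M₀.curved hXd hM₀.hasDeg (mergeProj ε M _ M₀) (mergeSect M _ M₀)
    (mergeProj_isChain ε M _ M₀ hd hrow) (mergeProj_hasDeg ε M _ M₀ hpar hdeg rfl rfl)
    (mergeSect_hasDeg M _ M₀ hpar hdeg rfl rfl) (mergeProj_mergeSect ε M _ M₀) (by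
      intro Z d' s k u hd' hd'd hu hchain hker
      obtain ⟨h, h1, h2, h3⟩ := outer_nullhomotopy ((arcCreation hx₁ hy₁ hx₂ hy₂).tensor M hM) hya
        (IsWH.cast (hy₂.add hy₁) (by ring)) hdiv (S := fun i => i.2 = (0, 0))
        (tensor_arcCreation_bot M hM hx₁ hy₁ hx₂ hy₂)
        -- The roles are exchanged because the `y`-row of an arc comes first, while the division
        -- lists the `x`-difference first. The factor `η⁻¹` undoes the sign with which the
        -- differences occur in the left entries.
        (Q := (C η⁻¹ : P 3) • Q') (Q' := (C η⁻¹ : P 3) • Q)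
        (fun a f => by simp only [LinearMap.smul_apply, hQl', smul_eq_mul]; ring)
        (fun a f => by simp only [LinearMap.smul_apply, hQl, smul_eq_mul]; ring)
        (fun f k hf => IsWH.cast ((hQd' f k hf).C_mul η⁻¹) (by ring))
        (fun f k hf => IsWH.cast ((hQd f k hf).C_mul η⁻¹) (by ring))
        hcurvX hd' hd'd hu hchain
        (fun z i hi => by
          generalize hf : (u z : ι × (Fin 2 × Fin 2) → P 3) i = f
          have h0 : mergeHom ε f = 0 := by
            rcases i with ⟨i, j⟩
            obtain rfl : j = (0, 0) := hi
            rw [← hf]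
            exact congrFun (hker z) i
          have h1 := hQ f
          rw [h0, map_zero, zero_add] at h1
          rw [LinearMap.smul_apply, LinearMap.smul_apply, smul_eq_mul, smul_eq_mul, hx, hy]
          linear_combination h1 - ((yv 1 - C ε * yv 2) * Q' f + (xv 1 - C ε * xv 2) * Q f) * hinv)
      refine ⟨h, h1, h2, fun z => funext fun i => ?_⟩
      exact (congrArg (mergeHom ε) (h3 z (i, (0, 0)) rfl)).trans (map_zero _))
  exact ⟨e⟩

end Exclusion

/-! ### Joining two legs -/

section Join

open MvPolynomial

variable {m n N : ℕ} {ι κ : Type} [Fintype ι] [DecidableEq ι] [Fintype κ] [DecidableEq κ]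

/-- Two substitutions which agree on the variables modulo an ideal agree modulo this ideal. -/
theorem algHom_sub_mem {I : Ideal (P n)} (f g : P m →ₐ[ℚ] P n)
    (hx : ∀ i, f (xv i) - g (xv i) ∈ I) (hy : ∀ i, f (yv i) - g (yv i) ∈ I) (p : P m) :
    f p - g p ∈ I := by
  have : (Ideal.Quotient.mkₐ ℚ I).comp f = (Ideal.Quotient.mkₐ ℚ I).comp g :=
    algHom_ext_legs (fun i => Ideal.Quotient.eq.2 (hx i)) (fun i => Ideal.Quotient.eq.2 (hy i))
  exact Ideal.Quotient.eq.1 (DFunLike.congr_fun this p)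

theorem mem_ideal_smul_top {R : Type} [CommRing R] (I : Ideal R) (z : ι → R) :
    z ∈ (I • ⊤ : Submodule R (ι → R)) ↔ ∀ i, z i ∈ I := by
  constructor
  · intro h i
    refine Submodule.smul_induction_on h (fun r hr y _ => ?_) (fun x y hx hy => ?_)
    · exact I.mul_mem_right _ hr
    · exact I.add_mem hx hy
  · intro h
    rw [pi_eq_sum_univ' z]
    exact Submodule.sum_mem _ fun i _ => Submodule.smul_mem_smul (h i) trivial

theorem joinMk_eq_iff (M : MatFact ι (P n)) (i j : Fin n) (z z' : ι → P n) :
    (joinMk (X := M.toDiffMod N) i j z : ((M.toDiffMod N).join i j).carrier)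
      = joinMk (X := M.toDiffMod N) i j z' ↔ ∀ l, z l - z' l ∈ joinIdeal i j :=
  (Submodule.Quotient.eq _).trans (mem_ideal_smul_top _ (z - z'))

theorem xv_add_mem (i j : Fin n) : xv i + xv j ∈ joinIdeal i j :=
  Ideal.subset_span (Set.mem_insert _ _)

theorem yv_add_mem (i j : Fin n) : yv i + yv j ∈ joinIdeal i j :=
  Ideal.subset_span (Set.mem_insert_of_mem _ rfl)

theorem algHom_eq_zero_of_mem (i j : Fin n) {S : Type} [CommRing S] [Algebra ℚ S]
    (f : P n →ₐ[ℚ] S) (hx : f (xv i + xv j) = 0) (hy : f (yv i + yv j) = 0) {p : P n}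
    (hp : p ∈ joinIdeal i j) : f p = 0 := by
  have : joinIdeal i j ≤ RingHom.ker f := by
    refine Ideal.span_le.2 ?_
    rintro _ (rfl | rfl)
    exacts [hx, hy]
  exact this hp

/-- The substitution `x₄ ↦ -x₂`, `y₄ ↦ -y₂`. -/
def joinHom : P 4 →ₐ[ℚ] P 3 := subst ![xv 0, xv 1, xv 2, -xv 1] ![yv 0, yv 1, yv 2, -yv 1]

theorem joinHom_xv (i : Fin 4) : joinHom (xv i) = ![xv 0, xv 1, xv 2, -xv 1] i := subst_xv _ _ _

theorem joinHom_yv (i : Fin 4) : joinHom (yv i) = ![yv 0, yv 1, yv 2, -yv 1] i := subst_yv _ _ _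

theorem joinHom_legHom (f : P 3) : joinHom (legHom ![0, 1, 2] f) = f := by
  have : joinHom.comp (legHom ![0, 1, 2]) = AlgHom.id ℚ (P 3) := by
    refine algHom_ext_legs (fun i => ?_) (fun i => ?_) <;> fin_cases i <;>
      simp [joinHom_xv, joinHom_yv]
  exact DFunLike.congr_fun this f

theorem joinHom_outer (f : P 2) : joinHom (legHom ![0, 2] f) = legHom ![0, 2] f := by
  have : joinHom.comp (legHom ![0, 2]) = legHom ![0, 2] := by
    refine algHom_ext_legs (fun i => ?_) (fun i => ?_) <;> fin_cases i <;>
      simp [joinHom_xv, joinHom_yv]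
  exact DFunLike.congr_fun this f

theorem legHom_outer (f : P 2) :
    (legHom ![0, 1, 2] (legHom ![0, 2] f : P 3) : P 4) = legHom ![0, 2] f := by
  have : (legHom (![0, 1, 2] : Fin 3 → Fin 4)).comp (legHom ![0, 2]) = legHom ![0, 2] := by
    refine algHom_ext_legs (fun i => ?_) (fun i => ?_) <;> fin_cases i <;> simp
  exact DFunLike.congr_fun this f

/-- With `joinHom_legHom` this identifies the quotient by the joining ideal with the polynomials in
the legs 1, 2, 3, so that a joined factorization becomes a matrix factorization over `P 3`. -/
theorem sub_joinHom_mem (f : P 4) : f - legHom ![0, 1, 2] (joinHom f) ∈ joinIdeal (1 : Fin 4) 3 := by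
  refine algHom_sub_mem (AlgHom.id ℚ (P 4)) ((legHom ![0, 1, 2]).comp joinHom) (fun i => ?_)
    (fun i => ?_) f <;> fin_cases i
  · simp [joinHom_xv]
  · simp [joinHom_xv]
  · simp [joinHom_xv]
  · simpa [joinHom_xv, add_comm] using xv_add_mem (1 : Fin 4) 3
  · simp [joinHom_yv]
  · simp [joinHom_yv]
  · simp [joinHom_yv]
  · simpa [joinHom_yv, add_comm] using yv_add_mem (1 : Fin 4) 3

theorem joinHom_eq_zero {f : P 4} (h : f ∈ joinIdeal (1 : Fin 4) 3) : joinHom f = 0 :=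
  algHom_eq_zero_of_mem 1 3 joinHom (by simp [joinHom_xv]) (by simp [joinHom_yv]) h

theorem IsWH.joinHom {f : P 4} {k : ℤ} (hf : IsWH N f k) : IsWH N (SaddleMF.joinHom f) k := by
  refine IsWH.subst (fun i => ?_) (fun i => ?_) hf <;> fin_cases i
  exacts [isWH_xv _, isWH_xv _, isWH_xv _, (isWH_xv _).neg, isWH_yv _, isWH_yv _, isWH_yv _,
    (isWH_yv _).neg]

variable (N) (M : MatFact ι (P 4)) (M' : MatFact ι (P 3))

/-- The comparison map from the model over three legs to the factorization with two joined legs. -/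
def fromOuter : (outerMod N M').carrier →ₗ[P 2] (semi (M.toDiffMod N)).carrier where
  toFun := fun z : ι → P 3 => joinMk (X := M.toDiffMod N) 1 3 (fun i => legHom ![0, 1, 2] (z i))
  map_add' := fun (z z' : ι → P 3) => by
    refine Eq.trans ?_ (Submodule.Quotient.mk_add _)
    refine congrArg (joinMk (X := M.toDiffMod N) 1 3) (funext fun i => ?_)
    change legHom _ (z i + z' i) = _ + _
    rw [map_add]
  map_smul' := fun a (z : ι → P 3) => by
    refine Eq.trans ?_ (Submodule.Quotient.mk_smul _ (legHom ![0, 2] a) _)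
    refine congrArg (joinMk (X := M.toDiffMod N) 1 3) (funext fun i => ?_)
    change legHom _ (legHom ![0, 2] a * z i) = legHom _ a * _
    rw [map_mul, legHom_outer]

theorem joinMk_eq_fromOuter (z : ι → P 4) : joinMk (X := M.toDiffMod N) 1 3 z
    = fromOuter N M M' (fun i => joinHom (z i)) :=
  (joinMk_eq_iff M 1 3 _ _).2 fun i => sub_joinHom_mem (z i)

theorem fromOuter_bijective : Function.Bijective (fromOuter N M M') := by
  constructor
  · intro (z : ι → P 3) (z' : ι → P 3) h
    funext i
    have h1 := joinHom_eq_zero ((joinMk_eq_iff M 1 3 _ _).1 h i)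
    rw [map_sub, joinHom_legHom, joinHom_legHom] at h1
    exact sub_eq_zero.1 h1
  · intro y
    obtain ⟨z, rfl⟩ := Submodule.Quotient.mk_surjective _ y
    exact ⟨_, (joinMk_eq_fromOuter N M M' z).symm⟩

theorem fromOuter_isChain (hd : M'.d = M.d.map joinHom) :
    IsChain (X := outerMod N M') (Y := semi (M.toDiffMod N)) (fromOuter N M M') := by
  refine LinearMap.ext fun (z : ι → P 3) => ?_
  refine (joinMk_eq_iff M 1 3 _ (M.d.mulVec fun i => legHom ![0, 1, 2] (z i))).2 fun i => ?_
  have : M'.d.mulVec z i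
      = joinHom (M.d.mulVec (fun i => legHom ![0, 1, 2] (z i)) i) := by
    simp only [hd, Matrix.mulVec, dotProduct, map_sum, map_mul, joinHom_legHom, Matrix.map_apply]
  change legHom ![0, 1, 2] (M'.d.mulVec z i) - _ ∈ _
  rw [this, ← neg_sub]
  exact Ideal.neg_mem_iff _ |>.2 (sub_joinHom_mem _)

theorem fromOuter_hasDeg (hpar : M'.par = M.par) (hdeg : M'.deg = M.deg) :
    HasDeg (X := outerMod N M') (Y := semi (M.toDiffMod N)) 0 0 (fromOuter N M M') := by
  intro p a (z : ι → P 3) hz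
  have hz := mem_toDiffMod_gr.1 hz
  refine ⟨fun i => legHom ![0, 1, 2] (z i), mem_toDiffMod_gr.2 fun i => ?_, rfl⟩
  rw [← hpar, ← hdeg, add_zero, add_zero]
  exact ⟨fun h => IsWH.legHom _ ((hz i).1 h), fun h => by rw [(hz i).2 h, map_zero]⟩

theorem fromOuter_symm_hasDeg (hpar : M'.par = M.par) (hdeg : M'.deg = M.deg) :
    HasDeg (X := semi (M.toDiffMod N)) (Y := outerMod N M') 0 0
      (LinearEquiv.ofBijective (fromOuter N M M') (fromOuter_bijective N M M')).symm.toLinearMap := by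
  rintro p a _ ⟨z, hz, rfl⟩
  have hz := mem_toDiffMod_gr.1 hz
  have h : (LinearEquiv.ofBijective (fromOuter N M M') (fromOuter_bijective N M M')).symm
      (joinMk (X := M.toDiffMod N) 1 3 z) = fun i => joinHom (z i) :=
    (LinearEquiv.symm_apply_eq _).2 (joinMk_eq_fromOuter N M M' z)
  refine (congrArg (· ∈ (outerMod N M').gr (p + 0) (a + 0)) h).mpr ?_
  refine mem_toDiffMod_gr.2 fun i => ?_
  rw [hpar, hdeg, add_zero, add_zero]
  exact ⟨fun h => IsWH.joinHom ((hz i).1 h), fun h => by rw [(hz i).2 h, map_zero]⟩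

variable {N M M'}

/-- The factorization with two joined legs is isomorphic to its model over three legs. -/
def semiEquiv (hpar : M'.par = M.par) (hdeg : M'.deg = M.deg) (hd : M'.d = M.d.map joinHom) :
    HtpyEquiv N (outerMod N M') (semi (M.toDiffMod N)) :=
  .ofIso N (fromOuter N M M')
    (LinearEquiv.ofBijective (fromOuter N M M') (fromOuter_bijective N M M')).symm.toLinearMap
    (fromOuter_isChain N M M' hd) (fromOuter_hasDeg N M M' hpar hdeg)
    (fromOuter_symm_hasDeg N M M' hpar hdeg)
    (LinearEquiv.ofBijective (fromOuter N M M') (fromOuter_bijective N M M')).symm_comp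
    (LinearEquiv.ofBijective (fromOuter N M M') (fromOuter_bijective N M M')).comp_symm

/-- The inverse homotopy equivalence. -/
def HtpyEquiv.symm {X Y : DiffMod n} (e : HtpyEquiv N X Y) : HtpyEquiv N Y X where
  hom := e.inv
  inv := e.hom
  hom_chain := e.inv_chain
  inv_chain := e.hom_chain
  hom_deg := e.inv_deg
  inv_deg := e.hom_deg
  inv_hom := e.hom_inv
  hom_inv := e.inv_hom

theorem arc_par {S T : Type} [CommRing S] [CommRing T] (x₁ y₁ x₂ y₂ : S) (x₁' y₁' x₂' y₂' : T) :
    (arc N x₁ y₁ x₂ y₂).par = (arc N x₁' y₁' x₂' y₂').par := rfl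

theorem arc_deg {S T : Type} [CommRing S] [CommRing T] (x₁ y₁ x₂ y₂ : S) (x₁' y₁' x₂' y₂' : T) :
    (arc N x₁ y₁ x₂ y₂).deg = (arc N x₁' y₁' x₂' y₂').deg := rfl

theorem joinHom_arc (a b : Fin 4) :
    (arc N (xv a) (yv a) (xv b) (yv b)).d.map joinHom = (arc N (joinHom (xv a)) (joinHom (yv a))
      (joinHom (xv b)) (joinHom (yv b))).d :=
  arc_d_map joinHom.toRingHom _ _ _ _

/-- The virtual crossing with joined legs is homotopy equivalent to an arc. -/
theorem nonempty_htpyEquiv_vir : Nonempty (HtpyEquiv N (semi (virD N)) (arcD N)) := by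
  have hd : ((arc N (xv 0 : P 3) (yv 0) (-xv 1) (-yv 1)).tensor
      (arc N (xv 1) (yv 1) (xv 2) (yv 2))).d = (virMF N).d.map joinHom :=
    tensor_d_map joinHom.toRingHom _ _ _ _ rfl
      (by refine Eq.trans ?_ (joinHom_arc 0 3).symm; simp [joinHom_xv, joinHom_yv])
      (by refine Eq.trans ?_ (joinHom_arc 1 2).symm; simp [joinHom_xv, joinHom_yv])
  -- The arc 2–3 has the left entries `x₃ + x₂`, `y₃ + y₂`, so leg 2 is replaced by the negative of
  -- leg 3.
  obtain ⟨e⟩ := nonempty_htpyEquiv_merge (N := N) (-1 : ℚ)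
    (arc N (xv 0 : P 3) (yv 0) (-xv 1) (-yv 1)) (arc N (xv 0 : P 2) (yv 0) (xv 1) (yv 1))
    (arc_par _ _ _ _ _ _ _ _) (arc_deg _ _ _ _ _ _ _ _)
    (by
      refine Eq.trans ?_ (arc_d_map (mergeHom (-1)).toRingHom _ _ _ _).symm
      simp [mergeHom])
    (arc_d_deg (isWH_xv 0) (isWH_yv 0) (isWH_xv 1).neg (isWH_yv 1).neg)
    (arc_d_deg (isWH_xv 0) (isWH_yv 0) (isWH_xv 1) (isWH_yv 1))
    (isWH_xv 1) (isWH_yv 1) (isWH_xv 2) (isWH_yv 2) (η := 1) one_ne_zero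
    (by simp [add_comm]) (by simp [add_comm])
    (by
      simp only [MatFact.tensor, arc_pot, basicW, map_add, map_mul, map_pow, legHom_xv, legHom_yv]
      rw [Odd.neg_pow ⟨N, rfl⟩]
      simp
      ring)
  exact ⟨(semiEquiv (N := N) (M := virMF N) rfl rfl hd).symm.trans e⟩

/-- The two horizontal arcs with joined legs are homotopy equivalent to an arc. -/
theorem nonempty_htpyEquiv_hor : Nonempty (HtpyEquiv N (semi (horD N)) (arcD N)) := by
  have hd : ((arc N (xv 0 : P 3) (yv 0) (xv 1) (yv 1)).tensor
      (arc N (xv 2) (yv 2) (-xv 1) (-yv 1))).d = (horMF N).d.map joinHom :=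
    tensor_d_map joinHom.toRingHom _ _ _ _ rfl
      (by refine Eq.trans ?_ (joinHom_arc 0 1).symm; simp [joinHom_xv, joinHom_yv])
      (by refine Eq.trans ?_ (joinHom_arc 2 3).symm; simp [joinHom_xv, joinHom_yv])
  -- After joining, the arc 3–4 has the left entries `-x₂ + x₃`, `-y₂ + y₃`. So leg 2 is replaced by
  -- leg 3, and the entries are `η = -1` times the differences.
  obtain ⟨e⟩ := nonempty_htpyEquiv_merge (N := N) (1 : ℚ)
    (arc N (xv 0 : P 3) (yv 0) (xv 1) (yv 1)) (arc N (xv 0 : P 2) (yv 0) (xv 1) (yv 1))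
    (arc_par _ _ _ _ _ _ _ _) (arc_deg _ _ _ _ _ _ _ _)
    (by
      refine Eq.trans ?_ (arc_d_map (mergeHom 1).toRingHom _ _ _ _).symm
      simp [mergeHom])
    (arc_d_deg (isWH_xv 0) (isWH_yv 0) (isWH_xv 1) (isWH_yv 1))
    (arc_d_deg (isWH_xv 0) (isWH_yv 0) (isWH_xv 1) (isWH_yv 1))
    (isWH_xv 2) (isWH_yv 2) (isWH_xv 1).neg (isWH_yv 1).neg (η := -1) (by norm_num)
    (by simp; ring) (by simp; ring)
    (by
      simp only [MatFact.tensor, arc_pot, basicW, map_add, map_mul, map_pow, legHom_xv, legHom_yv]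
      rw [Odd.neg_pow ⟨N, rfl⟩]
      simp
      ring)
  exact ⟨(semiEquiv (N := N) (M := horMF N) rfl rfl hd).symm.trans e⟩

end Join

/-! ### The Jacobi algebra and its basis -/

section Jacobi

open MvPolynomial

variable {N : ℕ}

/-- The first generator of the Jacobian ideal, the derivative by `y`. -/
def jac₁ : P 1 := 2 * (xv 0 * yv 0)

/-- The second generator of the Jacobian ideal, the derivative by `x`. -/
def jac₂ (N : ℕ) : P 1 := yv 0 ^ 2 + (2 * (N : P 1) + 1) * xv 0 ^ (2 * N)

theorem jacIdeal_eq (N : ℕ) : jacIdeal N = Ideal.span {jac₁, jac₂ N} := by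
  rw [jacIdeal, Set.pair_comm]
  congr 2
  · simp [basicW, xv, yv, pderiv_X, jac₁, Derivation.leibniz_pow, Pi.single_apply]
    ring
  · simp [basicW, xv, yv, pderiv_X, jac₂, Derivation.leibniz_pow, Pi.single_apply]

theorem jac₁_mem : jac₁ ∈ jacIdeal N := by
  rw [jacIdeal_eq]; exact Ideal.subset_span (Set.mem_insert _ _)

theorem jac₂_mem : jac₂ N ∈ jacIdeal N := by
  rw [jacIdeal_eq]; exact Ideal.subset_span (Set.mem_insert_of_mem _ rfl)

theorem isWH_jac₁ : IsWH N jac₁ (2 * N + 2) := by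
  have h : IsWH N (2 : P 1) 0 := by exact_mod_cast isWH_natCast (N := N) (n := 1) 2
  exact IsWH.cast (h.mul ((isWH_xv 0).mul (isWH_yv 0))) (by ring)

theorem isWH_jac₂ : IsWH N (jac₂ N) (4 * N) := by
  have h : IsWH N (2 * N + 1 : P 1) 0 := by
    exact_mod_cast isWH_natCast (N := N) (n := 1) (2 * N + 1)
  refine IsWeightedHomogeneous.add (IsWH.cast ((isWH_yv 0).pow 2) ?_)
    (IsWH.cast (h.mul ((isWH_xv 0).pow (2 * N))) ?_)
  · simp; ring
  · simp; ring

theorem isWH_xv_pow_mul_yv_pow {n : ℕ} (i : Fin n) (a b : ℕ) :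
    IsWH N (xv i ^ a * yv i ^ b : P n) (2 * a + 2 * N * b) :=
  IsWH.cast (((isWH_xv i).pow a).mul ((isWH_yv i).pow b)) (by simp; ring)

theorem monomial_eq_pow (s : Fin 1 ⊕ Fin 1 →₀ ℕ) :
    (monomial s 1 : P 1) = xv 0 ^ s (Sum.inl 0) * yv 0 ^ s (Sum.inr 0) := by
  rw [monomial_eq, C_1, one_mul, Finsupp.prod_fintype _ _ (by simp)]
  simp [Fintype.sum_sum_type, xv, yv]

/-- Linear maps on polynomials in one leg are determined by the values on monomials. -/
theorem legOne_ext {V : Type} [AddCommGroup V] [Module ℚ V] {f g : P 1 →ₗ[ℚ] V}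
    (h : ∀ a b, f (xv 0 ^ a * yv 0 ^ b) = g (xv 0 ^ a * yv 0 ^ b)) : f = g := by
  refine (MvPolynomial.basisMonomials (Fin 1 ⊕ Fin 1) ℚ).ext fun s => ?_
  rw [coe_basisMonomials]
  change f (monomial s 1) = g (monomial s 1)
  rw [monomial_eq_pow, h]

/-- The basis elements of the Jacobi algebra. -/
def jacMon (N : ℕ) : Fin (2 * N + 1) ⊕ Unit → P 1 :=
  Sum.elim (fun i => xv 0 ^ (i : ℕ)) (fun _ => yv 0)

/-- The degrees of the basis elements of the Jacobi algebra. -/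
def jacDeg (N : ℕ) : Fin (2 * N + 1) ⊕ Unit → ℤ :=
  Sum.elim (fun i => 2 * ((i : ℕ) : ℤ)) (fun _ => 2 * (N : ℤ))

theorem isWH_jacMon (i : Fin (2 * N + 1) ⊕ Unit) : IsWH N (jacMon N i) (jacDeg N i) := by
  rcases i with i | i
  · exact IsWH.cast ((isWH_xv 0).pow _) (by simp [jacDeg]; ring)
  · exact isWH_yv 0

/-- The coordinates of the monomial `x^a y^b` in the Jacobi algebra. -/
def jacCoeff (N : ℕ) : Fin (2 * N + 1) ⊕ Unit → ℕ → ℕ → ℚ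
  | Sum.inl i, a, b => if b = 0 ∧ a = i then 1 else
      -- From `y² = -(2N+1)x²ᴺ`; all other monomials outside the basis vanish because of `xy = 0`,
      -- `x²ᴺ⁺¹ = 0` and `y³ = 0`.
      if a = 0 ∧ b = 2 ∧ (i : ℕ) = 2 * N then -(2 * N + 1) else 0
  | Sum.inr _, a, b => if a = 0 ∧ b = 1 then 1 else 0

/-- The coordinate functionals of the Jacobi algebra, on polynomials. -/
def jacCoord (N : ℕ) (i : Fin (2 * N + 1) ⊕ Unit) : P 1 →ₗ[ℚ] ℚ :=
  (MvPolynomial.basisMonomials (Fin 1 ⊕ Fin 1) ℚ).constr ℚ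
    fun s => jacCoeff N i (s (Sum.inl 0)) (s (Sum.inr 0))

theorem jacCoord_monomial (i : Fin (2 * N + 1) ⊕ Unit) (s : Fin 1 ⊕ Fin 1 →₀ ℕ) :
    jacCoord N i (monomial s 1) = jacCoeff N i (s (Sum.inl 0)) (s (Sum.inr 0)) := by
  have := (MvPolynomial.basisMonomials (Fin 1 ⊕ Fin 1) ℚ).constr_basis ℚ
      (fun s => jacCoeff N i (s (Sum.inl 0)) (s (Sum.inr 0))) s
  rwa [coe_basisMonomials] at this

theorem jacCoord_pow (i : Fin (2 * N + 1) ⊕ Unit) (a b : ℕ) :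
    jacCoord N i (xv 0 ^ a * yv 0 ^ b) = jacCoeff N i a b := by
  have h := jacCoord_monomial (N := N) i
    (Finsupp.single (Sum.inl 0) a + Finsupp.single (Sum.inr 0) b)
  rw [monomial_eq_pow] at h
  simpa using h

theorem jacCoord_jacMon (i j : Fin (2 * N + 1) ⊕ Unit) :
    jacCoord N i (jacMon N j) = if i = j then 1 else 0 := by
  rcases j with j | j
  · have h := jacCoord_pow (N := N) i j 0
    rw [pow_zero, mul_one] at h
    refine h.trans ?_
    rcases i with i | i
    · by_cases h : i = j
      · subst h; simp [jacCoeff]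
      · have h' : (j : ℕ) ≠ i := fun e => h (Fin.ext e.symm)
        simp [jacCoeff, h, h']
    · simp [jacCoeff]
  · have h := jacCoord_pow (N := N) i 0 1
    rw [pow_zero, one_mul, pow_one] at h
    refine h.trans ?_
    rcases i with i | i <;> simp [jacCoeff]

/-- A coordinate sees only monomials of one degree; the two monomials on which the last one is
nonzero, `x²ᴺ` and `y²`, both have degree `4N`. -/
theorem jacCoord_eq_zero_of_isWH {i : Fin (2 * N + 1) ⊕ Unit} {f : P 1} {k : ℤ}
    (hf : IsWH N f k) (hk : k ≠ jacDeg N i) : jacCoord N i f = 0 := by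
  rw [f.as_sum, map_sum]
  refine Finset.sum_eq_zero fun s hs => ?_
  have hs := hf (mem_support_iff.1 hs)
  have h1 : (monomial s (coeff s f) : P 1) = coeff s f • monomial s 1 := by
    rw [smul_monomial, smul_eq_mul, mul_one]
  have h2 := IsWH.cast (isWeightedHomogeneous_monomial (wt N 1) s (1 : ℚ) rfl) hs
  rw [monomial_eq_pow] at h2
  have h3 := IsWeightedHomogeneous.inj_right
    (by rw [← monomial_eq_pow]; simp) h2 (isWH_xv_pow_mul_yv_pow 0 _ _)
  rw [h1, map_smul, jacCoord_monomial]
  suffices jacCoeff N i (s (Sum.inl 0)) (s (Sum.inr 0)) = 0 by rw [this, smul_zero]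
  generalize s (Sum.inl 0) = a at *
  generalize s (Sum.inr 0) = b at *
  subst h3
  rcases i with i | i
  · simp only [jacDeg, Sum.elim_inl] at hk
    simp only [jacCoeff]
    rw [if_neg, if_neg]
    · rintro ⟨rfl, rfl, h⟩
      rw [h] at hk
      exact hk (by push_cast; ring)
    · rintro ⟨rfl, rfl⟩
      exact hk (by push_cast; ring)
  · simp only [jacDeg, Sum.elim_inr] at hk
    simp only [jacCoeff]
    rw [if_neg]
    rintro ⟨rfl, rfl⟩
    exact hk (by push_cast; ring)

variable (hN : 1 ≤ N)
include hN

/-- By linearity it is enough to test the products of monomials with the two generators against the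
table. The coordinates therefore descend to the quotient, which gives the independence of the basis;
spanning is `jac_mk_eq_sum`. -/
theorem jacCoord_eq_zero_of_mem {i : Fin (2 * N + 1) ⊕ Unit} {f : P 1} (hf : f ∈ jacIdeal N) :
    jacCoord N i f = 0 := by
  rw [jacIdeal_eq] at hf
  obtain ⟨g, g', rfl⟩ := Ideal.mem_span_pair.1 hf
  have h1 : jacCoord N i ∘ₗ LinearMap.mulRight ℚ jac₁ = 0 := by
    refine legOne_ext fun a b => ?_
    have : (xv 0 ^ a * yv 0 ^ b * jac₁ : P 1) = (2 : ℚ) • (xv 0 ^ (a + 1) * yv 0 ^ (b + 1)) := by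
      rw [jac₁, MvPolynomial.smul_eq_C_mul, map_ofNat]; ring
    simp only [LinearMap.comp_apply, LinearMap.mulRight_apply, LinearMap.zero_apply]
    rw [this, map_smul, jacCoord_pow]
    rcases i with i | i <;> simp [jacCoeff]
  have h2 : jacCoord N i ∘ₗ LinearMap.mulRight ℚ (jac₂ N) = 0 := by
    refine legOne_ext fun a b => ?_
    have : (xv 0 ^ a * yv 0 ^ b * jac₂ N : P 1) = (xv 0 ^ a * yv 0 ^ (b + 2))
        + (2 * N + 1 : ℚ) • (xv 0 ^ (a + 2 * N) * yv 0 ^ b) := by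
      rw [jac₂, MvPolynomial.smul_eq_C_mul, map_add, map_mul, map_ofNat, map_natCast, map_one]
      ring
    simp only [LinearMap.comp_apply, LinearMap.mulRight_apply, LinearMap.zero_apply]
    rw [this, map_add, map_smul, jacCoord_pow, jacCoord_pow]
    rcases i with i | i
    · have := i.2
      simp only [jacCoeff, smul_eq_mul]
      rw [if_neg (by omega)]
      by_cases h : a = 0 ∧ b = 0
      · obtain ⟨rfl, rfl⟩ := h
        by_cases hi : (i : ℕ) = 2 * N
        · rw [if_pos (by omega), if_pos (by omega)]; ring
        · rw [if_neg (by omega), if_neg (by omega), if_neg (by omega)]; ring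
      · rw [if_neg (by omega), if_neg (by omega), if_neg (by omega)]; ring
    · simp only [jacCoeff, smul_eq_mul]
      rw [if_neg (by omega), if_neg (by omega)]; ring
  have h1 := LinearMap.congr_fun h1 g
  have h2 := LinearMap.congr_fun h2 g'
  simp only [LinearMap.comp_apply, LinearMap.mulRight_apply, LinearMap.zero_apply] at h1 h2
  rw [map_add, h1, h2, add_zero]

omit hN in
theorem jac_xy : (Ideal.Quotient.mk (jacIdeal N) (xv 0 * yv 0)) = 0 := by
  refine Ideal.Quotient.eq_zero_iff_mem.2 ?_
  have h : (xv 0 * yv 0 : P 1) = C (1 / 2) * jac₁ := by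
    have : (C (1 / 2) * 2 : P 1) = 1 := by
      rw [← map_ofNat C 2, ← C_mul]; norm_num
    rw [jac₁]; linear_combination (-(xv 0 * yv 0)) * this
  rw [h]
  exact Ideal.mul_mem_left _ _ jac₁_mem

omit hN in
theorem jac_yy : Ideal.Quotient.mk (jacIdeal N) (yv 0 ^ 2)
    = -(2 * (N : Jac N) + 1) * Ideal.Quotient.mk (jacIdeal N) (xv 0 ^ (2 * N)) := by
  have h := Ideal.Quotient.eq_zero_iff_mem.2 (jac₂_mem (N := N))
  rw [jac₂, map_add, map_mul] at h
  simp only [map_add, map_mul, map_ofNat, map_natCast, map_one] at h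
  linear_combination h

omit hN in
-- `x·∂ₓW = y·xy + (2N+1)x²ᴺ⁺¹`, and both `xy` and `∂ₓW` vanish in the quotient.
theorem jac_x_pow : Ideal.Quotient.mk (jacIdeal N) ((xv 0 : P 1) ^ (2 * N + 1)) = 0 := by
  have hu : (C (2 * N + 1 : ℚ)⁻¹ * (2 * (N : P 1) + 1) : P 1) = 1 := by
    have e : C (2 * N + 1 : ℚ) = (2 * (N : P 1) + 1) := by
      rw [map_add, map_mul, map_ofNat, map_natCast, map_one]
    rw [← e, ← C_mul, inv_mul_cancel₀ (by positivity), C_1]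
  have h : (xv 0 ^ (2 * N + 1) : P 1)
      = C (2 * N + 1 : ℚ)⁻¹ * (xv 0 * jac₂ N) - C (2 * N + 1 : ℚ)⁻¹ * (yv 0 * (xv 0 * yv 0)) := by
    rw [jac₂]
    linear_combination (-(xv 0 ^ (2 * N + 1))) * hu
  have h1 := Ideal.Quotient.eq_zero_iff_mem.2 (jac₂_mem (N := N))
  rw [h, map_sub, map_mul, map_mul, map_mul, map_mul, h1, jac_xy]
  ring

/-- The reduction of polynomials to the basis of the Jacobi algebra. -/
theorem jac_mk_eq_sum (f : P 1) : Ideal.Quotient.mk (jacIdeal N) f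
    = ∑ i, jacCoord N i f • Ideal.Quotient.mk (jacIdeal N) (jacMon N i) := by
  let R : P 1 →ₗ[ℚ] Jac N :=
    ∑ i, (jacCoord N i).smulRight (Ideal.Quotient.mk (jacIdeal N) (jacMon N i))
  have h : (Ideal.Quotient.mkₐ ℚ (jacIdeal N)).toLinearMap = R := by
    refine legOne_ext fun a b => ?_
    have hR : R (xv 0 ^ a * yv 0 ^ b)
        = ∑ i, jacCoeff N i a b • Ideal.Quotient.mk (jacIdeal N) (jacMon N i) := by
      rw [LinearMap.sum_apply]
      exact Finset.sum_congr rfl fun i _ => by rw [← jacCoord_pow]; rfl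
    rw [hR, Fintype.sum_sum_type, AlgHom.toLinearMap_apply, Ideal.Quotient.mkₐ_eq_mk,
      Finset.univ_unique (α := Unit), Finset.sum_singleton]
    clear hR
    rcases b with _ | _ | _ | b
    · rw [pow_zero, mul_one]
      by_cases ha : a < 2 * N + 1
      · rw [Finset.sum_eq_single ⟨a, ha⟩]
        · simp [jacCoeff, jacMon]
        · rintro i - hi
          have hi' : a ≠ (i : ℕ) := fun h => hi (Fin.ext h.symm)
          simp [jacCoeff, hi']
        · simp
      · rw [Finset.sum_eq_zero]
        · obtain ⟨c, rfl⟩ := Nat.exists_eq_add_of_le (Nat.not_lt.1 ha)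
          rw [pow_add, map_mul, jac_x_pow]
          simp [jacCoeff]
        · rintro i -
          have hi' : a ≠ (i : ℕ) := by have := i.2; omega
          simp [jacCoeff, hi']
    · rw [Finset.sum_eq_zero (fun i _ => by simp [jacCoeff]), zero_add, zero_add, pow_one]
      rcases a with _ | a
      · simp [jacCoeff, jacMon]
      · have : (xv 0 ^ (a + 1) * yv 0 : P 1) = xv 0 ^ a * (xv 0 * yv 0) := by ring
        rw [this, map_mul, jac_xy]
        simp [jacCoeff]
    · rcases a with _ | a
      · rw [Finset.sum_eq_single (Fin.last (2 * N))]
        · have h1 : jacCoeff N (Sum.inl (Fin.last (2 * N))) 0 (0 + 1 + 1) = -(2 * N + 1) := by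
            simp [jacCoeff]
          have h2 : jacCoeff N (Sum.inr default) 0 (0 + 1 + 1) = 0 := by simp [jacCoeff]
          rw [h1, h2, zero_smul, add_zero]
          refine Ideal.Quotient.eq.2 ?_
          convert jac₂_mem (N := N) using 1
          have h3 : (C (2 : ℚ) : P 1) = 2 := map_ofNat C 2
          simp [jac₂, jacMon, MvPolynomial.smul_eq_C_mul]
          rw [h3]
          ring
        · rintro i - hi
          have hi' : (i : ℕ) ≠ 2 * N := fun h => hi (Fin.ext h)
          simp [jacCoeff, hi']
        · simp
      · have : (xv 0 ^ (a + 1) * yv 0 ^ (0 + 1 + 1) : P 1) = xv 0 ^ a * yv 0 * (xv 0 * yv 0) := by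
          ring
        rw [this, map_mul, jac_xy, Finset.sum_eq_zero (fun i _ => by simp [jacCoeff])]
        simp [jacCoeff]
    · have : (xv 0 ^ a * yv 0 ^ (b + 1 + 1 + 1) : P 1)
          = xv 0 ^ a * yv 0 ^ b * (yv 0 * yv 0 ^ 2) := by ring
      -- `y³ = -(2N+1)x²ᴺ⁻¹·xy`; here `N ≥ 1` is needed.
      have h1 : Ideal.Quotient.mk (jacIdeal N) (yv 0 * yv 0 ^ 2) = 0 := by
        rw [map_mul, jac_yy]
        have h2 : (xv 0 ^ (2 * N) : P 1) = xv 0 ^ (2 * N - 1) * xv 0 := by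
          rw [← pow_succ]; congr 1; omega
        have h3 := jac_xy (N := N)
        rw [map_mul] at h3
        rw [h2, map_mul]
        linear_combination (-(2 * N + 1) * Ideal.Quotient.mk (jacIdeal N) (xv 0 ^ (2 * N - 1))) * h3
      rw [this, map_mul, h1, Finset.sum_eq_zero (fun i _ => by simp [jacCoeff])]
      simp [jacCoeff]
  have := LinearMap.congr_fun h f
  simpa [R] using this

theorem mem_jacIdeal_iff (f : P 1) : f ∈ jacIdeal N ↔ ∀ i, jacCoord N i f = 0 := by
  refine ⟨fun h i => jacCoord_eq_zero_of_mem hN h, fun h => ?_⟩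
  rw [← Ideal.Quotient.eq_zero_iff_mem, jac_mk_eq_sum hN]
  exact Finset.sum_eq_zero fun i _ => by rw [h, zero_smul]

omit hN in
/-- The coordinate functionals on the Jacobi algebra. -/
def jacDual (hN : 1 ≤ N) (i : Fin (2 * N + 1) ⊕ Unit) : Jac N →ₗ[ℚ] ℚ :=
  Submodule.liftQ ((jacIdeal N).restrictScalars ℚ) (jacCoord N i)
    (fun f hf => jacCoord_eq_zero_of_mem hN hf)

omit hN in
theorem jacDual_mk (hN : 1 ≤ N) (i : Fin (2 * N + 1) ⊕ Unit) (f : P 1) :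
    jacDual hN i (Ideal.Quotient.mk (jacIdeal N) f) = jacCoord N i f := rfl

omit hN in
/-- The basis `1, x, …, x²ᴺ, y` of the Jacobi algebra. -/
def jacBasis (hN : 1 ≤ N) : Module.Basis (Fin (2 * N + 1) ⊕ Unit) ℚ (Jac N) :=
  .ofEquivFun
    { toFun := fun a i => jacDual hN i a
      map_add' := fun a b => funext fun i => map_add _ a b
      map_smul' := fun r a => funext fun i => map_smul _ r a
      invFun := fun v => ∑ i, v i • Ideal.Quotient.mk (jacIdeal N) (jacMon N i)
      left_inv := fun a => by
        obtain ⟨f, rfl⟩ := Ideal.Quotient.mk_surjective a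
        exact (jac_mk_eq_sum hN f).symm
      right_inv := fun v => funext fun i => by
        change jacDual hN i (∑ j, v j • Ideal.Quotient.mk (jacIdeal N) (jacMon N j)) = _
        rw [map_sum]
        simp [jacDual_mk, jacCoord_jacMon] }

omit hN in
theorem jacBasis_apply (hN : 1 ≤ N) (i : Fin (2 * N + 1) ⊕ Unit) :
    jacBasis hN i = Ideal.Quotient.mk (jacIdeal N) (jacMon N i) := by
  refine (congrFun (Module.Basis.coe_ofEquivFun _) i).trans ?_
  change ∑ j, (Pi.single i (1 : ℚ) : _ → ℚ) j • Ideal.Quotient.mk (jacIdeal N) (jacMon N j) = _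
  rw [Finset.sum_eq_single i] <;> simp +contextual [Pi.single_apply]

omit hN in
theorem jacBasis_coord (hN : 1 ≤ N) (i : Fin (2 * N + 1) ⊕ Unit) (f : P 1) :
    (jacBasis hN).coord i (Ideal.Quotient.mk (jacIdeal N) f) = jacCoord N i f := rfl

end Jacobi

/-! ### The unknot space -/

section Unknot

open MvPolynomial

variable {N : ℕ}

/-- The substitution `x₂ ↦ -x₁`, `y₂ ↦ -y₁`. -/
def closeHom : P 2 →ₐ[ℚ] P 1 := subst ![xv 0, -xv 0] ![yv 0, -yv 0]

theorem closeHom_xv (i : Fin 2) : closeHom (xv i) = ![xv 0, -xv 0] i := subst_xv _ _ _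

theorem closeHom_yv (i : Fin 2) : closeHom (yv i) = ![yv 0, -yv 0] i := subst_yv _ _ _

theorem closeHom_legHom (f : P 1) : closeHom (legHom ![0] f) = f := by
  have : closeHom.comp (legHom ![0]) = AlgHom.id ℚ (P 1) := by
    refine algHom_ext_legs (fun i => ?_) (fun i => ?_) <;> fin_cases i <;>
      simp [closeHom_xv, closeHom_yv]
  exact DFunLike.congr_fun this f

theorem IsWH.closeHom {f : P 2} {k : ℤ} (hf : IsWH N f k) : IsWH N (SaddleMF.closeHom f) k := by
  refine IsWH.subst (fun i => ?_) (fun i => ?_) hf <;> fin_cases i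
  exacts [isWH_xv _, (isWH_xv _).neg, isWH_yv _, (isWH_yv _).neg]

theorem sub_closeHom_mem (f : P 2) : f - legHom ![0] (closeHom f) ∈ joinIdeal (0 : Fin 2) 1 := by
  refine algHom_sub_mem (AlgHom.id ℚ (P 2)) ((legHom ![0]).comp closeHom) (fun i => ?_)
    (fun i => ?_) f <;> fin_cases i
  · simp [closeHom_xv]
  · simpa [closeHom_xv, add_comm] using xv_add_mem (0 : Fin 2) 1
  · simp [closeHom_yv]
  · simpa [closeHom_yv, add_comm] using yv_add_mem (0 : Fin 2) 1

theorem mem_joinIdeal_iff (f : P 2) : f ∈ joinIdeal (0 : Fin 2) 1 ↔ closeHom f = 0 := by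
  refine ⟨algHom_eq_zero_of_mem 0 1 closeHom (by simp [closeHom_xv]) (by simp [closeHom_yv]),
    fun h => ?_⟩
  have := sub_closeHom_mem f
  rwa [h, map_zero, sub_zero] at this

/-- The differential of the arc with joined legs. -/
theorem closeHom_arc_mulVec (z : Fin 2 × Fin 2 → P 2) :
    closeHom ((arc N (xv 0 : P 2) (yv 0) (xv 1) (yv 1)).d.mulVec z (0, 0)) = 0 ∧
    closeHom ((arc N (xv 0 : P 2) (yv 0) (xv 1) (yv 1)).d.mulVec z (0, 1))
      = jac₂ N * closeHom (z (0, 0)) ∧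
    closeHom ((arc N (xv 0 : P 2) (yv 0) (xv 1) (yv 1)).d.mulVec z (1, 0))
      = jac₁ * closeHom (z (0, 0)) ∧
    closeHom ((arc N (xv 0 : P 2) (yv 0) (xv 1) (yv 1)).d.mulVec z (1, 1))
      = jac₁ * closeHom (z (0, 1)) - jac₂ N * closeHom (z (1, 0)) := by
  obtain ⟨h1, h2, h3, h4⟩ := arc_mulVec (N := N) (xv 0 : P 2) (yv 0) (xv 1) (yv 1) z
  have hdd : closeHom (dd N [-xv 0, xv 1]) = (2 * (N : P 1) + 1) * xv 0 ^ (2 * N) := by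
    have := map_dd (N := N) closeHom.toRingHom [-xv 0, xv 1]
    simp only [AlgHom.toRingHom_eq_coe, RingHom.coe_coe, List.map_cons, List.map_nil, map_neg,
      closeHom_xv] at this
    refine this.trans ((dd_neg_neg _).trans ?_)
    rw [Even.neg_pow ⟨N, by ring⟩]
    rfl
  refine ⟨?_, ?_, ?_, ?_⟩
  · rw [h1]; simp [closeHom_xv, closeHom_yv]
  · rw [h2]; simp [closeHom_yv, hdd, jac₂]
  · rw [h3]; simp [closeHom_xv, closeHom_yv, jac₁]; ring
  · rw [h4]; simp [closeHom_xv, closeHom_yv, jac₁, jac₂, hdd]; ring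

/-- The two generators of the Jacobian ideal form a regular sequence. -/
theorem jac₁_dvd_of_dvd {f : P 1} (hN : 1 ≤ N) (h : jac₁ ∣ jac₂ N * f) : jac₁ ∣ f := by
  have h2 : IsUnit (2 : P 1) := by
    have : IsUnit (C (2 : ℚ) : P 1) := (IsUnit.mk0 (2 : ℚ) two_ne_zero).map C
    rwa [map_ofNat] at this
  have hassoc : ∀ g : P 1, jac₁ ∣ g ↔ xv 0 * yv 0 ∣ g := fun g => by
    rw [jac₁]; exact h2.mul_left_dvd
  rw [hassoc] at h ⊢
  -- Neither variable divides `y² + (2N+1)x²ᴺ`: evaluate at `(x, y) = (0, 1)` and at `(1, 0)`.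
  refine dvd_of_X_mul_X_dvd_mul (fun h0 => ?_) (fun h0 => ?_) h
  · obtain ⟨t, ht⟩ := h0
    have := congrArg (MvPolynomial.aeval (Sum.elim (fun _ => (0 : ℚ)) (fun _ => 1))) ht
    have hN' : 2 * N ≠ 0 := by omega
    simp [jac₂, xv, yv, hN'] at this
  · obtain ⟨t, ht⟩ := h0
    have := congrArg (MvPolynomial.aeval (Sum.elim (fun _ => (1 : ℚ)) (fun _ => 0))) ht
    simp [jac₂, xv, yv] at this
    norm_cast at this

/-- The top generator of the arc. -/
def topGen : Fin 2 × Fin 2 → P 2 := Pi.single (1, 1) 1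

variable (N) in
theorem topGen_cycle : ((arcD N).join 0 1).d (joinMk (X := arcD N) 0 1 topGen) = 0 := by
  refine (joinMk_eq_iff (N := N) (arc N (xv 0 : P 2) (yv 0) (xv 1) (yv 1)) 0 1 _ 0).2 fun l => ?_
  rw [mem_joinIdeal_iff, Pi.zero_apply, sub_zero]
  obtain ⟨h1, h2, h3, h4⟩ := closeHom_arc_mulVec (N := N) topGen
  rcases l with ⟨i, j⟩
  fin_cases i <;> fin_cases j
  exacts [h1, h2.trans (by simp [topGen]), h3.trans (by simp [topGen]), h4.trans (by simp [topGen])]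

variable (N) in
/-- The class of the top generator. -/
def topCls : Unk N := ((arcD N).join 0 1).cls (joinMk 0 1 topGen) (topGen_cycle N)

theorem isWH_mem_topGen (f : P 2) {k : ℤ} (hf : IsWH N f k) :
    f • topGen ∈ (arcD N).gr 0 (k - 2 * N) := by
  refine mem_toDiffMod_gr.2 fun l => ?_
  rcases l with ⟨i, j⟩
  change (_ → IsWH N (f * topGen (i, j)) _) ∧ (_ → f * topGen (i, j) = 0)
  by_cases h : (i, j) = ((1, 1) : Fin 2 × Fin 2)
  · rw [h]
    rw [show topGen (1, 1) = 1 by simp [topGen], mul_one]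
    refine ⟨fun _ => hf.cast ?_, fun h => absurd ?_ h⟩
    · simp [arc, MatFact.tensor, row]; ring
    · simp [arc, MatFact.tensor, row, zmod2_two]
  · rw [show topGen (i, j) = 0 from Pi.single_eq_of_ne h _, mul_zero]
    exact ⟨fun _ => isWH_zero, fun _ => rfl⟩

/-- Every cycle of the arc with joined legs is homologous to a multiple of the top generator. -/
theorem cls_eq_smul_topCls (hN : 1 ≤ N) (z : Fin 2 × Fin 2 → P 2)
    (hz : ((arcD N).join 0 1).d (joinMk (X := arcD N) 0 1 z) = 0) :
    ((arcD N).join 0 1).cls (joinMk 0 1 z) hz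
      = (legHom ![0] (closeHom (z (1, 1))) : P 2) • topCls N := by
  have hz' : ∀ l, closeHom ((arc N (xv 0 : P 2) (yv 0) (xv 1) (yv 1)).d.mulVec z l) = 0 := by
    intro l
    have := (joinMk_eq_iff (N := N) (arc N (xv 0 : P 2) (yv 0) (xv 1) (yv 1)) 0 1 _ 0).1 hz l
    rwa [mem_joinIdeal_iff, Pi.zero_apply, sub_zero] at this
  obtain ⟨h1, h2, h3, h4⟩ := closeHom_arc_mulVec (N := N) z
  rw [hz'] at h2 h3 h4
  have hj : (jac₁ : P 1) ≠ 0 := by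
    intro h
    have := congrArg (MvPolynomial.aeval (fun _ => (1 : ℚ))) h
    simp [jac₁, xv, yv] at this
  have h00 : closeHom (z (0, 0)) = 0 := (mul_eq_zero.1 h3.symm).resolve_left hj
  -- Exactness of the Koszul complex: the cycle condition gives `jac₁ z₀₁ = jac₂ z₁₀`, so `z₁₀ =
  -- jac₁ t`, `z₀₁ = jac₂ t`, and this is the boundary of `t e₀₀`.
  obtain ⟨t, ht⟩ := jac₁_dvd_of_dvd (N := N) hN ⟨_, (sub_eq_zero.1 h4.symm).symm⟩
  have ht' : closeHom (z (0, 1)) = jac₂ N * t := by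
    rw [ht] at h4
    apply mul_left_cancel₀ hj
    linear_combination -h4
  refine (Submodule.Quotient.eq _).2 ?_
  refine ⟨joinMk (X := arcD N) 0 1 (Pi.single (0, 0) (legHom ![0] t)), ?_⟩
  refine (joinMk_eq_iff (N := N) (arc N (xv 0 : P 2) (yv 0) (xv 1) (yv 1)) 0 1 _
    (z - (legHom ![0] (closeHom (z (1, 1))) : P 2) • topGen)).2 fun l => ?_
  rw [mem_joinIdeal_iff, map_sub, Pi.sub_apply, map_sub, Pi.smul_apply, smul_eq_mul, map_mul,
    closeHom_legHom]
  obtain ⟨k1, k2, k3, k4⟩ := closeHom_arc_mulVec (N := N) (Pi.single (0, 0) (legHom ![0] t))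
  rcases l with ⟨i, j⟩
  fin_cases i <;> fin_cases j
  · refine (congrArg (· - _) k1).trans ?_
    simp [topGen, h00]
  · refine (congrArg (· - _) k2).trans ?_
    simp [topGen, ht', closeHom_legHom]
  · refine (congrArg (· - _) k3).trans ?_
    simp [topGen, ht, closeHom_legHom]
  · refine (congrArg (· - _) k4).trans ?_
    simp [topGen]

/-- The `e₁₁`-components of boundaries are exactly the elements of the Jacobian ideal; each is
attained by a vector supported on `e₀₁`, `e₁₀`, whose boundary has no other component. -/
theorem smul_topCls_eq_zero_iff (f : P 1) :
    (legHom ![0] f : P 2) • topCls N = 0 ↔ f ∈ jacIdeal N := by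
  have key : (legHom ![0] f : P 2) • topCls N = 0 ↔ ∃ u : Fin 2 × Fin 2 → P 2, ∀ l,
      (arc N (xv 0 : P 2) (yv 0) (xv 1) (yv 1)).d.mulVec u l - (legHom ![0] f * topGen l)
        ∈ joinIdeal (0 : Fin 2) 1 := by
    refine (Submodule.Quotient.mk_eq_zero _).trans ⟨?_, ?_⟩
    · rintro ⟨u, hu⟩
      obtain ⟨u, rfl⟩ := Submodule.Quotient.mk_surjective _ u
      exact ⟨u, (joinMk_eq_iff (N := N) (arc N (xv 0 : P 2) (yv 0) (xv 1) (yv 1)) 0 1 _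
        ((legHom ![0] f : P 2) • topGen)).1 hu⟩
    · rintro ⟨u, hu⟩
      exact ⟨joinMk (X := arcD N) 0 1 u, (joinMk_eq_iff (N := N)
        (arc N (xv 0 : P 2) (yv 0) (xv 1) (yv 1)) 0 1 _ ((legHom ![0] f : P 2) • topGen)).2 hu⟩
  rw [key]
  constructor
  · rintro ⟨u, hu⟩
    have h1 := (mem_joinIdeal_iff _).1 (hu (1, 1))
    rw [map_sub, (closeHom_arc_mulVec u).2.2.2, map_mul, closeHom_legHom,
      show topGen (1, 1) = 1 by simp [topGen], map_one, mul_one, sub_eq_zero] at h1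
    rw [← h1]
    exact Ideal.sub_mem _ (Ideal.mul_mem_right _ _ jac₁_mem) (Ideal.mul_mem_right _ _ jac₂_mem)
  · intro h
    rw [jacIdeal_eq] at h
    obtain ⟨g, g', rfl⟩ := Ideal.mem_span_pair.1 h
    refine ⟨Pi.single (0, 1) (legHom ![0] g) - Pi.single (1, 0) (legHom ![0] g'), fun l => ?_⟩
    rw [mem_joinIdeal_iff, map_sub, map_mul, closeHom_legHom]
    obtain ⟨k1, k2, k3, k4⟩ := closeHom_arc_mulVec (N := N)
      (Pi.single (0, 1) (legHom ![0] g) - Pi.single (1, 0) (legHom ![0] g'))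
    rcases l with ⟨i, j⟩
    fin_cases i <;> fin_cases j
    · refine (congrArg (· - _) k1).trans ?_
      simp [topGen]
    · refine (congrArg (· - _) k2).trans ?_
      simp [topGen]
    · refine (congrArg (· - _) k3).trans ?_
      simp [topGen]
    · refine (congrArg (· - _) k4).trans ?_
      simp [topGen, closeHom_legHom]
      ring

variable (N) in
/-- The action of polynomials on the class of the top generator. -/
def topAct : Jac N →ₛₗ[(legHom ![0] : P 1 →ₐ[ℚ] P 2).toRingHom] Unk N :=
  Submodule.liftQ (jacIdeal N)
    { toFun := fun f => (legHom ![0] f : P 2) • topCls N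
      map_add' := fun f g => by rw [map_add, add_smul]
      map_smul' := fun f g => by rw [smul_eq_mul, map_mul, mul_smul]; rfl }
    (fun f hf => (smul_topCls_eq_zero_iff f).2 hf)

/-- The unknot space is a free module of rank one over the Jacobi algebra. -/
def unkEquiv (hN : 1 ≤ N) : Jac N ≃ₗ[ℚ] Unk N :=
  .ofBijective (topAct N).toAddMonoidHom.toRatLinearMap
    ⟨by
      rw [injective_iff_map_eq_zero]
      intro a ha
      obtain ⟨f, rfl⟩ := Ideal.Quotient.mk_surjective a
      exact Ideal.Quotient.eq_zero_iff_mem.2 ((smul_topCls_eq_zero_iff f).1 ha), by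
      intro c
      obtain ⟨⟨z, hz⟩, rfl⟩ := Submodule.Quotient.mk_surjective _ c
      obtain ⟨z, rfl⟩ := Submodule.Quotient.mk_surjective _ z
      exact ⟨Ideal.Quotient.mk (jacIdeal N) (closeHom ((z : Fin 2 × Fin 2 → P 2) (1, 1))),
        (cls_eq_smul_topCls hN z hz).symm⟩⟩

theorem unkEquiv_mk (hN : 1 ≤ N) (f : P 1) :
    unkEquiv hN (Ideal.Quotient.mk (jacIdeal N) f) = (legHom ![0] f : P 2) • topCls N := rfl

/-- The basis of the unknot space made of the multiples of the top class. -/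
def unkBasis (hN : 1 ≤ N) : Module.Basis (Fin (2 * N + 1) ⊕ Unit) ℚ (Unk N) :=
  (jacBasis hN).map (unkEquiv hN)

theorem unkBasis_apply (hN : 1 ≤ N) (i : Fin (2 * N + 1) ⊕ Unit) :
    unkBasis hN i = (legHom ![0] (jacMon N i) : P 2) • topCls N := by
  rw [unkBasis, Module.Basis.map_apply, jacBasis_apply, unkEquiv_mk]

theorem unkBasis_coord (hN : 1 ≤ N) (i : Fin (2 * N + 1) ⊕ Unit) (f : P 1) :
    (unkBasis hN).coord i ((legHom ![0] f : P 2) • topCls N) = jacCoord N i f := by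
  rw [← unkEquiv_mk hN]
  simp only [unkBasis, Module.Basis.coord_apply, Module.Basis.map_repr, LinearEquiv.trans_apply,
    LinearEquiv.symm_apply_apply]
  exact jacBasis_coord hN i f

theorem smul_topCls_mem {f : P 1} {k : ℤ} (hf : IsWH N f k) :
    (legHom ![0] f : P 2) • topCls N ∈ unkGr N 0 (k - 2 * N) := by
  refine ⟨(legHom ![0] f : P 2) • ⟨joinMk (X := arcD N) 0 1 topGen, topGen_cycle N⟩, ?_, rfl⟩
  exact ⟨(legHom ![0] f : P 2) • topGen, isWH_mem_topGen _ (IsWH.legHom _ hf), rfl⟩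

theorem topCls_mem : topCls N ∈ unkGr N 0 (-(2 * N)) := by
  have := smul_topCls_mem (N := N) (f := 1) isWH_one
  rwa [map_one, one_smul, zero_sub] at this

theorem unkBasis_mem (hN : 1 ≤ N) (i : Fin (2 * N + 1) ⊕ Unit) :
    unkBasis hN i ∈ unkGr N 0 (jacDeg N i - 2 * N) := by
  rw [unkBasis_apply]
  exact smul_topCls_mem (isWH_jacMon i)

/-- The coordinate functionals of the unknot space are homogeneous. -/
theorem unkBasis_coord_eq_zero (hN : 1 ≤ N) {i : Fin (2 * N + 1) ⊕ Unit} {p : ZMod 2} {k : ℤ}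
    {c : Unk N} (hc : c ∈ unkGr N p k) (h : p ≠ 0 ∨ k ≠ jacDeg N i - 2 * N) :
    (unkBasis hN).coord i c = 0 := by
  obtain ⟨⟨w, hw⟩, ⟨z, hz, rfl⟩, rfl⟩ := hc
  refine (congrArg ((unkBasis hN).coord i) (cls_eq_smul_topCls hN z hw)).trans ?_
  rw [unkBasis_coord]
  have h1 := mem_toDiffMod_gr.1 hz (1, 1)
  by_cases hp : p = 0
  · refine jacCoord_eq_zero_of_isWH (IsWH.closeHom (h1.1 ?_)) ?_
    · rw [hp]; exact zmod2_two
    · have := h.resolve_left (fun h => h hp)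
      rw [show (arc N (xv 0 : P 2) (yv 0) (xv 1) (yv 1)).deg (1, 1) = -(2 * N) by
        simp [arc, MatFact.tensor, row]; ring]
      omega
  · refine (congrArg (fun f => jacCoord N i (closeHom f)) (h1.2 ?_)).trans (by simp)
    intro h2
    exact hp (h2.symm.trans zmod2_two)

end Unknot

/-! ### The product of an arc with the unknot space -/

section ArcUnk

open MvPolynomial

variable {N : ℕ}

theorem contract_tmul (f : Unk N →ₗ[ℚ] ℚ) (m : (arcD N).carrier) (c : Unk N) :
    contract N f (m ⊗ₜ[ℚ] c) = f c • m := rfl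

theorem contract_tens (f : Unk N →ₗ[ℚ] ℚ) (m : (arcD N).carrier) (c : Unk N) :
    contract N f (tens N c m) = f c • m := rfl

theorem tens_smul (r : ℚ) (c : Unk N) : tens N (r • c) = (C r : P 2) • tens N c := by
  refine LinearMap.ext fun m => ?_
  change m ⊗ₜ[ℚ] (r • c) = ((C r : P 2) • m) ⊗ₜ[ℚ] c
  rw [algebraMap_smul_carrier, TensorProduct.smul_tmul]

theorem tens_sum {ι : Type} (s : Finset ι) (c : ι → Unk N) :
    tens N (∑ i ∈ s, c i) = ∑ i ∈ s, tens N (c i) :=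
  map_sum (TensorProduct.AlgebraTensorModule.mk ℚ (P 2) (arcD N).carrier (Unk N)).flip c s

/-- The resolution of the identity along a finite basis of the unknot space. It reduces maps into
and out of `arc ⊗ Unk` to endomorphisms of an arc. -/
theorem arcUnk_eq_sum {ι : Type} [Fintype ι] (b : Module.Basis ι ℚ (Unk N))
    (t : (arcUnk N).carrier) : t = ∑ i, tens N (b i) (contract N (b.coord i) t) := by
  let R : (arcUnk N).carrier →ₗ[P 2] (arcUnk N).carrier :=
    ∑ i, tens N (b i) ∘ₗ contract N (b.coord i)
  have hR : ∀ t, R t = ∑ i, tens N (b i) (contract N (b.coord i) t) := fun t => by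
    simp [R]
  rw [← hR]
  refine TensorProduct.induction_on (motive := fun t => t = R t) t (map_zero R).symm
    (fun m c => ?_) (fun t t' h h' => ?_)
  · refine Eq.trans ?_ (hR _).symm
    have h1 : ∀ i, tens N (b i) (contract N (b.coord i) (m ⊗ₜ[ℚ] c))
        = m ⊗ₜ[ℚ] (b.repr c i • b i) := fun i => by
      refine (TensorProduct.smul_tmul (R := ℚ) (b.repr c i) m (b i))
    refine Eq.trans ?_ (Finset.sum_congr rfl fun i _ => h1 i).symm
    exact (congrArg (m ⊗ₜ[ℚ] ·) (b.sum_repr c).symm).trans (TensorProduct.tmul_sum m _ _)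
  · exact (congrArg₂ (· + ·) h h').trans (map_add R t t').symm

theorem contract_isChain (f : Unk N →ₗ[ℚ] ℚ) :
    IsChain (X := arcUnk N) (Y := arcD N) (contract N f) := by
  refine LinearMap.ext fun t => ?_
  refine TensorProduct.induction_on (motive := fun t => contract N f ((arcUnk N).d t)
    = (arcD N).d (contract N f t)) t ?_ (fun m c => ?_) (fun t t' h h' => ?_)
  · exact (congrArg _ (map_zero _)).trans ((map_zero _).trans
      ((congrArg _ (map_zero _)).trans (map_zero _)).symm)
  · change f c • (arcD N).d m = (arcD N).d (f c • m)
    rw [← algebraMap_smul_carrier, ← algebraMap_smul_carrier, map_smul]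
  · refine ((congrArg _ (map_add (arcUnk N).d t t')).trans (map_add (contract N f) _ _)).trans ?_
    refine Eq.trans ?_ ((congrArg _ (map_add (contract N f) t t')).trans
      (map_add (arcD N).d _ _)).symm
    exact congrArg₂ (· + ·) h h'

theorem arcD_curved : Curved (arcD N) (arc N (xv 0 : P 2) (yv 0) (xv 1) (yv 1)).pot :=
  MatFact.curved _

theorem arcD_d_deg : HasDeg (X := arcD N) (Y := arcD N) 1 (2 * N + 1) (arcD N).d :=
  (arc_d_deg (isWH_xv 0) (isWH_yv 0) (isWH_xv 1) (isWH_yv 1)).hasDeg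

theorem arcUnk_curved : Curved (arcUnk N) (arc N (xv 0 : P 2) (yv 0) (xv 1) (yv 1)).pot := by
  intro t
  refine TensorProduct.induction_on (motive := fun t => (arcUnk N).d ((arcUnk N).d t)
    = (arc N (xv 0 : P 2) (yv 0) (xv 1) (yv 1)).pot • t) t ?_ (fun m c => ?_) (fun t t' h h' => ?_)
  · exact ((congrArg _ (map_zero _)).trans (map_zero _)).trans (smul_zero _).symm
  · exact congrArg (· ⊗ₜ[ℚ] c) (arcD_curved m)
  · refine ((congrArg _ (map_add (arcUnk N).d t t')).trans (map_add (arcUnk N).d _ _)).trans ?_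
    exact (congrArg₂ (· + ·) h h').trans (smul_add _ _ _).symm

theorem hasDeg_tensorSpace {n : ℕ} {X Y : DiffMod n} {V : Type} [AddCommGroup V] [Module ℚ V]
    {grV : ZMod 2 → ℤ → Submodule ℚ V} {s : ZMod 2} {k : ℤ}
    {f : (X.tensorSpace V grV).carrier →ₗ[P n] Y.carrier}
    (h : ∀ p₁ p₂ k₁ k₂ m v, m ∈ X.gr p₁ k₁ → v ∈ grV p₂ k₂ →
      f (show (X.tensorSpace V grV).carrier from m ⊗ₜ[ℚ] v) ∈ Y.gr (p₁ + p₂ + s) (k₁ + k₂ + k)) :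
    HasDeg (X := X.tensorSpace V grV) (Y := Y) s k f := by
  intro p a
  have : (X.tensorSpace V grV).gr p a
      ≤ (Y.gr (p + s) (a + k)).comap (f.restrictScalars ℚ) := by
    refine Submodule.span_le.2 ?_
    rintro _ ⟨p₁, p₂, k₁, k₂, m, v, rfl, rfl, hm, hv, rfl⟩
    exact h p₁ p₂ k₁ k₂ m v hm hv
  exact this

theorem tmul_mem_tensorSpace {n : ℕ} {X : DiffMod n} {V : Type} [AddCommGroup V] [Module ℚ V]
    {grV : ZMod 2 → ℤ → Submodule ℚ V} {p p₁ p₂ : ZMod 2} {k k₁ k₂ : ℤ} {m : X.carrier} {v : V}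
    (hm : m ∈ X.gr p₁ k₁) (hv : v ∈ grV p₂ k₂) (hp : p₁ + p₂ = p) (hk : k₁ + k₂ = k) :
    (show (X.tensorSpace V grV).carrier from m ⊗ₜ[ℚ] v) ∈ (X.tensorSpace V grV).gr p k :=
  Submodule.subset_span (R := ℚ) (M := X.carrier ⊗[ℚ] V)
    ⟨p₁, p₂, k₁, k₂, m, v, hp, hk, hm, hv, rfl⟩

theorem arcUnk_d_deg : HasDeg (X := arcUnk N) (Y := arcUnk N) 1 (2 * N + 1) (arcUnk N).d := by
  refine hasDeg_tensorSpace fun p₁ p₂ k₁ k₂ m v hm hv => ?_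
  exact tmul_mem_tensorSpace (arcD_d_deg _ _ _ hm) hv (by ring) (by ring)

theorem tens_hasDeg {c : Unk N} {k : ℤ} (hc : c ∈ unkGr N 0 k) :
    HasDeg (X := arcD N) (Y := arcUnk N) 0 k (tens N c) := fun p a m hm =>
  tmul_mem_tensorSpace hm hc rfl rfl

theorem contract_hasDeg {f : Unk N →ₗ[ℚ] ℚ} {k : ℤ}
    (hf : ∀ p l, ∀ c ∈ unkGr N p l, p ≠ 0 ∨ l ≠ k → f c = 0) :
    HasDeg (X := arcUnk N) (Y := arcD N) 0 (-k) (contract N f) := by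
  refine hasDeg_tensorSpace fun p₁ p₂ k₁ k₂ m v hm hv => ?_
  change f v • m ∈ _
  by_cases h : p₂ ≠ 0 ∨ k₂ ≠ k
  · rw [hf _ _ _ hv h, zero_smul]; exact Submodule.zero_mem _
  · push Not at h
    obtain ⟨rfl, rfl⟩ := h
    rw [add_zero, add_zero, add_neg_cancel_right]
    exact Submodule.smul_mem _ _ hm

theorem contract_coord_hasDeg (hN : 1 ≤ N) (i : Fin (2 * N + 1) ⊕ Unit) :
    HasDeg (X := arcUnk N) (Y := arcD N) 0 (-(jacDeg N i - 2 * N))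
      (contract N ((unkBasis hN).coord i)) :=
  contract_hasDeg fun _ _ _ hc h => unkBasis_coord_eq_zero hN hc h

/-- The joined legs 2 and 4 of the arcs `1–3` and `2–4`, over three legs. -/
def parOuter (N : ℕ) : MatFact Idx (P 3) :=
  (arc N (xv 0 : P 3) (yv 0) (xv 2) (yv 2)).tensor (arc N (xv 1) (yv 1) (-xv 1) (-yv 1))

theorem parOuter_d : (parOuter N).d = (parMF N).d.map joinHom :=
  tensor_d_map joinHom.toRingHom _ _ _ _ rfl
    (by refine Eq.trans ?_ (joinHom_arc 0 2).symm; simp [joinHom_xv, joinHom_yv])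
    (by refine Eq.trans ?_ (joinHom_arc 1 3).symm; simp [joinHom_xv, joinHom_yv])

/-- The product of the arc `1–3` with a vector of the joined arc. -/
def outerGlue (f : Fin 2 × Fin 2 → P 1) :
    (arcD N).carrier →ₗ[P 2] (outerMod N (parOuter N)).carrier where
  toFun := fun (m : Fin 2 × Fin 2 → P 2) l => legHom ![0, 2] (m l.1) * legHom ![1] (f l.2)
  map_add' := fun (m m' : Fin 2 × Fin 2 → P 2) => by
    funext l
    change legHom ![0, 2] (m l.1 + m' l.1) * legHom ![1] (f l.2) = legHom ![0, 2] (m l.1) * legHom ![1] (f l.2)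
      + legHom ![0, 2] (m' l.1) * legHom ![1] (f l.2)
    rw [map_add, add_mul]
  map_smul' := fun a (m : Fin 2 × Fin 2 → P 2) => by
    funext l
    change legHom ![0, 2] (a * m l.1) * legHom ![1] (f l.2)
      = legHom ![0, 2] a * (legHom ![0, 2] (m l.1) * legHom ![1] (f l.2))
    rw [map_mul, mul_assoc]

theorem outerGlue_hasDeg {f : Fin 2 × Fin 2 → P 1} {k : ℤ}
    (hf : ∀ j, ((arc N (xv 0 : P 2) (yv 0) (xv 1) (yv 1)).par j = 0 →
        IsWH N (f j) (k - (arc N (xv 0 : P 2) (yv 0) (xv 1) (yv 1)).deg j)) ∧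
      ((arc N (xv 0 : P 2) (yv 0) (xv 1) (yv 1)).par j ≠ 0 → f j = 0)) :
    HasDeg (X := arcD N) (Y := outerMod N (parOuter N)) 0 k (outerGlue f) := by
  intro p a (m : Fin 2 × Fin 2 → P 2) hm
  have hm := mem_toDiffMod_gr.1 hm
  refine mem_toDiffMod_gr.2 ?_
  rintro ⟨l, j⟩
  change ((arc N (xv 0 : P 2) (yv 0) (xv 1) (yv 1)).par l
      + (arc N (xv 0 : P 2) (yv 0) (xv 1) (yv 1)).par j = _ →
      IsWH N (legHom ![0, 2] (m l) * legHom ![1] (f j))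
        (_ - ((arc N (xv 0 : P 2) (yv 0) (xv 1) (yv 1)).deg l
          + (arc N (xv 0 : P 2) (yv 0) (xv 1) (yv 1)).deg j))) ∧
    ((arc N (xv 0 : P 2) (yv 0) (xv 1) (yv 1)).par l
      + (arc N (xv 0 : P 2) (yv 0) (xv 1) (yv 1)).par j ≠ _ →
      legHom ![0, 2] (m l) * legHom ![1] (f j) = 0)
  by_cases hj : (arc N (xv 0 : P 2) (yv 0) (xv 1) (yv 1)).par j = 0
  · rw [hj, add_zero, add_zero]
    refine ⟨fun h => ?_, fun h => ?_⟩
    · exact IsWH.cast ((IsWH.legHom _ ((hm l).1 h)).mul (IsWH.legHom _ ((hf j).1 hj))) (by ring)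
    · rw [(hm l).2 h, map_zero, zero_mul]
  · rw [(hf j).2 hj, map_zero, mul_zero]
    exact ⟨fun _ => isWH_zero, fun _ => rfl⟩

theorem arc_outer_d : (arc N (xv 0 : P 3) (yv 0) (xv 2) (yv 2)).d
    = (arc N (xv 0 : P 2) (yv 0) (xv 1) (yv 1)).d.map (legHom ![0, 2]) := by
  refine Eq.trans ?_ (arc_d_map (legHom (![0, 2] : Fin 2 → Fin 3)).toRingHom _ _ _ _).symm
  simp

theorem joined_arc_mulVec (v : Fin 2 × Fin 2 → P 2) (j : Fin 2 × Fin 2) (r : P 3) :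
    (arc N (xv 1 : P 3) (yv 1) (-xv 1) (-yv 1)).d.mulVec
      (fun i => r * legHom ![1] (closeHom (v i))) j
      = r * legHom ![1] (closeHom ((arc N (xv 0 : P 2) (yv 0) (xv 1) (yv 1)).d.mulVec v j)) := by
  have h : (arc N (xv 1 : P 3) (yv 1) (-xv 1) (-yv 1)).d
      = (arc N (xv 0 : P 2) (yv 0) (xv 1) (yv 1)).d.map ((legHom ![1]).comp closeHom) := by
    refine Eq.trans ?_ (arc_d_map ((legHom (![1] : Fin 1 → Fin 3)).comp closeHom).toRingHom _ _ _ _).symm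
    simp [closeHom_xv, closeHom_yv]
  rw [h]
  simp only [Matrix.mulVec, dotProduct, Matrix.map_apply, map_sum, map_mul, AlgHom.comp_apply,
    Finset.mul_sum]
  exact Finset.sum_congr rfl fun i _ => by ring

theorem outerGlue_isChain {v : Fin 2 × Fin 2 → P 2}
    (hv : ((arcD N).join 0 1).d (joinMk (X := arcD N) 0 1 v) = 0) :
    IsChain (X := arcD N) (Y := outerMod N (parOuter N)) (outerGlue fun j => closeHom (v j)) := by
  refine LinearMap.ext fun (m : Fin 2 × Fin 2 → P 2) => funext fun ⟨l, j⟩ => ?_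
  change legHom ![0, 2] ((arc N (xv 0 : P 2) (yv 0) (xv 1) (yv 1)).d.mulVec m l)
      * legHom ![1] (closeHom (v j))
    = (parOuter N).d.mulVec
      (fun l => legHom ![0, 2] (m l.1) * legHom ![1] (closeHom (v l.2))) (l, j)
  have hz : closeHom ((arc N (xv 0 : P 2) (yv 0) (xv 1) (yv 1)).d.mulVec v j) = 0 := by
    have := (joinMk_eq_iff (N := N) (arc N (xv 0 : P 2) (yv 0) (xv 1) (yv 1)) 0 1 _ 0).1 hv j
    rwa [mem_joinIdeal_iff, Pi.zero_apply, sub_zero] at this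
  rw [parOuter, tensor_mulVec]
  change _ = _ + _ * (arc N (xv 1 : P 3) (yv 1) (-xv 1) (-yv 1)).d.mulVec
    (fun i => legHom ![0, 2] (m l) * legHom ![1] (closeHom (v i))) j
  rw [joined_arc_mulVec, hz, map_zero, mul_zero, mul_zero, add_zero,
    arc_outer_d]
  simp only [Matrix.mulVec, dotProduct, Matrix.map_apply, map_sum, map_mul, Finset.sum_mul,
    mul_assoc]

theorem glue_eq (v : Fin 2 × Fin 2 → P 2) : glue N v
    = fromOuter N (parMF N) (parOuter N) ∘ₗ outerGlue (fun j => closeHom (v j)) := by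
  refine LinearMap.ext fun (m : Fin 2 × Fin 2 → P 2) => ?_
  refine (joinMk_eq_fromOuter N (parMF N) (parOuter N) _).trans ?_
  refine congrArg (fromOuter N (parMF N) (parOuter N)) (funext fun l => ?_)
  have h : joinHom.comp (legHom ![1, 3]) = (legHom ![1]).comp closeHom := by
    refine algHom_ext_legs (fun i => ?_) (fun i => ?_) <;> fin_cases i <;>
      simp [joinHom_xv, joinHom_yv, closeHom_xv, closeHom_yv]
  rw [map_mul, joinHom_outer]
  exact congrArg (legHom ![0, 2] (m l.1) * ·) (DFunLike.congr_fun h (v l.2))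

/-- Homogeneous division by two homogeneous polynomials. -/
theorem exists_homogeneous_of_mem_span_pair {n : ℕ} {f a a' : P n} {k δ δ' : ℤ} (hf : IsWH N f k)
    (ha : IsWH N a δ) (ha' : IsWH N a' δ') (h : f ∈ Ideal.span {a, a'}) :
    ∃ g g', IsWH N g (k - δ) ∧ IsWH N g' (k - δ') ∧ f = a * g + a' * g' := by
  obtain ⟨g, g', rfl⟩ := Ideal.mem_span_pair.1 h
  refine ⟨weightedHomogeneousComponent (wt N n) (k - δ) g,
    weightedHomogeneousComponent (wt N n) (k - δ') g',
    weightedHomogeneousComponent_isWeightedHomogeneous _ _,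
    weightedHomogeneousComponent_isWeightedHomogeneous _ _, ?_⟩
  conv_lhs => rw [← hf.weightedHomogeneousComponent_same]
  rw [map_add, mul_comm g, mul_comm g', ← weightedComponent_mul ha, ← weightedComponent_mul ha',
    sub_add_cancel, sub_add_cancel]

/-- Division with remainder by the two Jacobian generators in the middle leg, linear over the outer
legs. `Ψ i` extends the `i`-th coordinate of the Jacobi algebra; `Q` and `Q'` are homogeneous
quotients, chosen on the monomials in the middle leg. They are operators because the null-homotopy
criterion requires coefficients that depend linearly on the vector. -/
theorem exists_reduction (hN : 1 ≤ N) :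
    ∃ (Ψ : Fin (2 * N + 1) ⊕ Unit → P 3 →ₗ[ℚ] P 2) (Q Q' : P 3 →ₗ[ℚ] P 3),
      (∀ i a f, Ψ i (legHom ![0, 2] a * f) = a * Ψ i f) ∧
      (∀ i f k, IsWH N f k → IsWH N (Ψ i f) (k + -jacDeg N i)) ∧
      (∀ i f, Ψ i (legHom ![1] f) = C (jacCoord N i f)) ∧
      (∀ a f, Q (legHom ![0, 2] a * f) = legHom ![0, 2] a * Q f) ∧
      (∀ a f, Q' (legHom ![0, 2] a * f) = legHom ![0, 2] a * Q' f) ∧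
      (∀ f k, IsWH N f k → IsWH N (Q f) (k + -(2 * N + 2))) ∧
      (∀ f k, IsWH N f k → IsWH N (Q' f) (k + -(4 * N))) ∧
      ∀ f, (∀ i, Ψ i f = 0) → f = legHom ![1] jac₁ * Q f + legHom ![1] (jac₂ N) * Q' f := by
  have hΨ : ∀ i, ∃ Ψ : P 3 →ₗ[ℚ] P 2, (∀ a f, Ψ (legHom ![0, 2] a * f) = AlgHom.id ℚ (P 2) a * Ψ f) ∧
      (∀ f k, IsWH N f k → IsWH N (Ψ f) (k + -jacDeg N i)) ∧
      ∀ s, Ψ (legHom ![1] (monomial s 1)) = C (jacCoord N i (monomial s 1)) := by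
    intro i
    refine exists_outer_linear (AlgHom.id ℚ (P 2)) (-jacDeg N i) (fun f k h => h)
      (fun s g => g = C (jacCoord N i (monomial s 1))) fun s => ⟨_, ?_, rfl⟩
    by_cases h : Finsupp.weight (wt N 1) s = jacDeg N i
    · rw [h]
      exact (isWH_C _).cast (by ring)
    · rw [jacCoord_eq_zero_of_isWH (isWeightedHomogeneous_monomial _ _ _ rfl) h, C_0]
      exact isWH_zero
  choose Ψ hΨl hΨd hΨs using hΨ
  have hΨ1 : ∀ i f, Ψ i (legHom ![1] f) = C (jacCoord N i f) := by
    intro i f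
    have : Ψ i ∘ₗ (legHom ![1] : P 1 →ₐ[ℚ] P 3).toLinearMap
        = (Algebra.linearMap ℚ (P 2)) ∘ₗ jacCoord N i :=
      (MvPolynomial.basisMonomials (Fin 1 ⊕ Fin 1) ℚ).ext fun s => by
        rw [coe_basisMonomials]; exact hΨs i s
    exact LinearMap.congr_fun this f
  have h : ∀ s : Fin 1 ⊕ Fin 1 →₀ ℕ, ∃ q q' : P 3,
      IsWH N q (Finsupp.weight (wt N 1) s + -(2 * N + 2)) ∧
      IsWH N q' (Finsupp.weight (wt N 1) s + -(4 * N)) ∧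
      (legHom ![1] (monomial s 1) : P 3)
        = ∑ i, legHom ![0, 2] (Ψ i (legHom ![1] (monomial s 1))) * legHom ![1] (jacMon N i)
          + (legHom ![1] jac₁ * q + legHom ![1] (jac₂ N) * q') := by
    intro s
    have h1 : IsWH N (monomial s 1 : P 1) (Finsupp.weight (wt N 1) s) :=
      isWeightedHomogeneous_monomial _ _ _ rfl
    have h2 : IsWH N (monomial s 1 - ∑ i, C (jacCoord N i (monomial s 1)) * jacMon N i : P 1)
        (Finsupp.weight (wt N 1) s) := by
      refine h1.sub (IsWeightedHomogeneous.sum _ _ _ fun i _ => ?_)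
      by_cases h : Finsupp.weight (wt N 1) s = jacDeg N i
      · rw [h]
        exact (isWH_jacMon i).C_mul _
      · rw [jacCoord_eq_zero_of_isWH h1 h, C_0, zero_mul]
        exact isWH_zero
    -- Subtracting the remainder with respect to the basis leaves an element of the Jacobian ideal.
    have h3 : monomial s 1 - ∑ i, C (jacCoord N i (monomial s 1)) * jacMon N i ∈ jacIdeal N := by
      rw [← Ideal.Quotient.eq, jac_mk_eq_sum hN, map_sum]
      exact Finset.sum_congr rfl fun i _ => by rw [← MvPolynomial.smul_eq_C_mul]; rfl
    rw [jacIdeal_eq] at h3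
    obtain ⟨g, g', hg, hg', e⟩ := exists_homogeneous_of_mem_span_pair h2 isWH_jac₁ isWH_jac₂ h3
    refine ⟨legHom ![1] g, legHom ![1] g', IsWH.legHom _ (hg.cast (by ring)),
      IsWH.legHom _ (hg'.cast (by ring)), ?_⟩
    have e' := congrArg (legHom (![1] : Fin 1 → Fin 3)) (sub_eq_iff_eq_add'.1 e)
    refine e'.trans ?_
    rw [map_add, map_add, map_mul, map_mul, map_sum]
    congr 1
    refine Finset.sum_congr rfl fun i _ => ?_
    rw [hΨs, map_mul]
    congr 1
    exact (AlgHom.commutes (legHom ![1] : P 1 →ₐ[ℚ] P 3) _).trans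
      (AlgHom.commutes (legHom ![0, 2] : P 2 →ₐ[ℚ] P 3) _).symm
  choose q q' hq hq' he using h
  obtain ⟨Q, hQl, hQd, hQ⟩ := exists_outer_linear (legHom ![0, 2]) (-(2 * N + 2))
    (fun f k hf => IsWH.legHom _ hf) (fun s g => g = q s) (fun s => ⟨q s, hq s, rfl⟩)
  obtain ⟨Q', hQl', hQd', hQ'⟩ := exists_outer_linear (legHom ![0, 2]) (-(4 * N))
    (fun f k hf => IsWH.legHom _ hf) (fun s g => g = q' s) (fun s => ⟨q' s, hq' s, rfl⟩)
  refine ⟨Ψ, Q, Q', hΨl, hΨd, hΨ1, hQl, hQl', hQd, hQd', fun f hf => ?_⟩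
  let R : P 3 →ₗ[ℚ] P 3 := ∑ i, LinearMap.mulRight ℚ (legHom ![1] (jacMon N i)) ∘ₗ
      (legHom ![0, 2]).toLinearMap ∘ₗ Ψ i
    + (LinearMap.mulLeft ℚ (legHom ![1] jac₁) ∘ₗ Q + LinearMap.mulLeft ℚ (legHom ![1] (jac₂ N)) ∘ₗ Q')
  have hR : ∀ f, R f = ∑ i, legHom ![0, 2] (Ψ i f) * legHom ![1] (jacMon N i)
      + (legHom ![1] jac₁ * Q f + legHom ![1] (jac₂ N) * Q' f) := fun f => by
    simp [R]
  have : LinearMap.id = R := by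
    refine outer_linear_ext (legHom ![0, 2]) (fun a f => rfl) (fun a f => ?_) fun s => ?_
    · rw [hR, hR, hQl, hQl', mul_add, Finset.mul_sum]
      congr 1
      · refine Finset.sum_congr rfl fun i _ => ?_
        rw [hΨl, map_mul]
        exact mul_assoc _ _ _
      · ring
    · rw [hR, hQ, hQ']
      exact he s
  have h1 := hR f
  rw [← this] at h1
  refine h1.trans ?_
  rw [Finset.sum_eq_zero (fun i _ => by rw [hf i, map_zero, zero_mul]), zero_add]

end ArcUnk

/-! ### Splitting off the closed component of the joined parallel arcs -/

section Alpha

open MvPolynomial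

variable {N : ℕ}

/-- The map which applies an outer-linear operator to the components over the top generator of the
joined arc. -/
def topMap (Ψ : P 3 →ₗ[ℚ] P 2) (hΨ : ∀ a f, Ψ (legHom ![0, 2] a * f) = a * Ψ f) :
    (outerMod N (parOuter N)).carrier →ₗ[P 2] (arcD N).carrier where
  toFun := fun (z : Idx → P 3) l => Ψ (z (l, (1, 1)))
  map_add' := fun (z z' : Idx → P 3) => by
    funext l
    change Ψ (z (l, (1, 1)) + z' (l, (1, 1))) = Ψ (z (l, (1, 1))) + Ψ (z' (l, (1, 1)))
    rw [map_add]
  map_smul' := fun a (z : Idx → P 3) => by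
    funext l
    exact hΨ a (z (l, (1, 1)))

theorem legHom_two {m n : ℕ} (f : Fin m → Fin n) : legHom f (2 : P m) = 2 := map_ofNat _ 2

theorem legHom_jac₂ (N : ℕ) : (legHom ![1] (jac₂ N) : P 3)
    = yv 1 ^ 2 + (2 * (N : P 3) + 1) * xv 1 ^ (2 * N) := by
  simp [jac₂, legHom_two]

theorem dd_joined (N : ℕ) : (yv 1 : P 3) ^ 2 + dd N [-xv 1, -xv 1] = legHom ![1] (jac₂ N) := by
  rw [dd_neg_neg, Even.neg_pow ⟨N, by ring⟩, legHom_jac₂]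

theorem joined_b : (-xv 1 : P 3) * (-yv 1 - yv 1) = legHom ![1] jac₁ := by
  simp [jac₁, legHom_two]; ring

/-- The joined arc 2–4 maps into its top generator only by its right entries, which are the Jacobian
generators up to sign, and `Ψ` annihilates their multiples. What remains is the differential of the
arc 1–3, over which `Ψ` is linear. -/
theorem topMap_isChain (hN : 1 ≤ N) {Ψ : P 3 →ₗ[ℚ] P 2}
    (hΨ : ∀ a f, Ψ (legHom ![0, 2] a * f) = a * Ψ f) (i : Fin (2 * N + 1) ⊕ Unit)
    (hi : ∀ f, Ψ (legHom ![1] f) = C (jacCoord N i f)) :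
    IsChain (X := outerMod N (parOuter N)) (Y := arcD N) (topMap Ψ hΨ) := by
  have hzero : ∀ g ∈ jacIdeal N, ∀ f, Ψ (legHom ![1] g * f) = 0 := by
    intro g hg f
    have : Ψ ∘ₗ LinearMap.mulLeft ℚ (legHom ![1] g) = 0 := by
      refine outer_linear_ext (AlgHom.id ℚ (P 2)) (fun a f => ?_) (fun a f => ?_) fun s => ?_
      · simp only [LinearMap.comp_apply, LinearMap.mulLeft_apply, AlgHom.id_apply]
        rw [mul_left_comm, hΨ]
      · simp
      · simp only [LinearMap.comp_apply, LinearMap.mulLeft_apply, LinearMap.zero_apply]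
        rw [← map_mul, hi, jacCoord_eq_zero_of_mem hN (Ideal.mul_mem_right _ _ hg), C_0]
    exact LinearMap.congr_fun this f
  refine LinearMap.ext fun (z : Idx → P 3) => funext fun l => ?_
  change Ψ ((parOuter N).d.mulVec z (l, (1, 1)))
    = (arc N (xv 0 : P 2) (yv 0) (xv 1) (yv 1)).d.mulVec (fun j => Ψ (z (j, (1, 1)))) l
  rw [parOuter, tensor_mulVec, (arc_mulVec _ _ _ _ _).2.2.2, dd_joined, joined_b, arc_outer_d]
  have h1 : ∀ (f : P 3) p, Ψ (sgn p * f) = sgn p * Ψ f := by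
    intro f p
    unfold sgn
    split_ifs <;> simp
  rw [map_add, h1, map_sub, hzero _ jac₁_mem, hzero _ jac₂_mem, sub_zero, mul_zero, add_zero]
  simp only [Matrix.mulVec, dotProduct, Matrix.map_apply, map_sum, hΨ]

/-- The shift `2N` compensates the degree `-2N` of the top generator. -/
theorem topMap_hasDeg {Ψ : P 3 →ₗ[ℚ] P 2} (hΨ : ∀ a f, Ψ (legHom ![0, 2] a * f) = a * Ψ f) {δ : ℤ}
    (hd : ∀ f k, IsWH N f k → IsWH N (Ψ f) (k + δ)) :
    HasDeg (X := outerMod N (parOuter N)) (Y := arcD N) 0 (2 * N + δ) (topMap Ψ hΨ) := by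
  intro p a (z : Idx → P 3) hz
  have hz := mem_toDiffMod_gr.1 hz
  refine mem_toDiffMod_gr.2 fun l => ?_
  have h := hz (l, (1, 1))
  rw [show (parOuter N).par (l, (1, 1)) = (arc N (xv 0 : P 2) (yv 0) (xv 1) (yv 1)).par l by
      simp [parOuter, MatFact.tensor, arc, row, zmod2_two],
    show (parOuter N).deg (l, (1, 1)) = (arc N (xv 0 : P 2) (yv 0) (xv 1) (yv 1)).deg l - 2 * N by
      simp [parOuter, MatFact.tensor, arc, row]; ring] at h
  rw [add_zero]
  exact ⟨fun hl => IsWH.cast (hd _ _ (h.1 hl)) (by ring),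
    fun hl => (congrArg Ψ (h.2 hl)).trans (map_zero Ψ)⟩

/-- The vector with a single component at the top generator. -/
theorem isWH_topVec {f : P 1} {k : ℤ} (hf : IsWH N f k) (j : Fin 2 × Fin 2) :
    ((arc N (xv 0 : P 2) (yv 0) (xv 1) (yv 1)).par j = 0 →
        IsWH N ((Pi.single (1, 1) f : Fin 2 × Fin 2 → P 1) j)
          (k - 2 * N - (arc N (xv 0 : P 2) (yv 0) (xv 1) (yv 1)).deg j)) ∧
      ((arc N (xv 0 : P 2) (yv 0) (xv 1) (yv 1)).par j ≠ 0 →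
        (Pi.single (1, 1) f : Fin 2 × Fin 2 → P 1) j = 0) := by
  by_cases h : j = (1, 1)
  · subst h
    rw [Pi.single_eq_same]
    refine ⟨fun _ => hf.cast ?_, fun h => absurd ?_ h⟩
    · simp [arc, MatFact.tensor, row]; ring
    · simp [arc, MatFact.tensor, row, zmod2_two]
  · rw [Pi.single_eq_of_ne h]
    exact ⟨fun _ => isWH_zero, fun _ => rfl⟩

theorem topMap_outerGlue {Ψ : P 3 →ₗ[ℚ] P 2} (hΨ : ∀ a f, Ψ (legHom ![0, 2] a * f) = a * Ψ f)
    {i : Fin (2 * N + 1) ⊕ Unit} (hi : ∀ f, Ψ (legHom ![1] f) = C (jacCoord N i f))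
    (f : Fin 2 × Fin 2 → P 1) (m : Fin 2 × Fin 2 → P 2) :
    topMap (N := N) Ψ hΨ (outerGlue f m) = (C (jacCoord N i (f (1, 1))) : P 2) • m := by
  funext l
  change Ψ (legHom ![0, 2] (m l) * legHom ![1] (f (1, 1))) = C (jacCoord N i (f (1, 1))) * m l
  rw [hΨ, hi, mul_comm]

theorem parOuter_pot : (parOuter N).pot
    = legHom ![0, 2] (arc N (xv 0 : P 2) (yv 0) (xv 1) (yv 1)).pot := by
  simp only [parOuter, MatFact.tensor, arc_pot, basicW, map_add, map_mul, map_pow, legHom_xv,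
    legHom_yv]
  rw [Odd.neg_pow ⟨N, rfl⟩]
  simp
  ring

/-- The homotopy equivalence of the semi-closed arcs `1–3`, `2–4` with the product of an arc and
the unknot space. -/
theorem exists_htpyEquiv_par (hN : 1 ≤ N) : ∃ α : HtpyEquiv N (semi (parD N)) (arcUnk N),
    ∀ (k : ℤ) (v : (arcD N).carrier), v ∈ (arcD N).gr 0 k →
    ∀ hv : ((arcD N).join 0 1).d (joinMk 0 1 v) = 0,
      Homotopic N k (α.inv ∘ₗ tens N (((arcD N).join 0 1).cls (joinMk 0 1 v) hv)) (glue N v) := by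
  obtain ⟨Ψ, Q, Q', hΨ, hΨd, hΨ1, hQ, hQ', hQd, hQd', hdiv⟩ := exists_reduction hN
  let b := unkBasis hN
  let π : (outerMod N (parOuter N)).carrier →ₗ[P 2] (arcUnk N).carrier :=
    ∑ i, tens N (b i) ∘ₗ topMap (Ψ i) (hΨ i)
  let σ : (arcUnk N).carrier →ₗ[P 2] (outerMod N (parOuter N)).carrier :=
    ∑ i, outerGlue (Pi.single (1, 1) (jacMon N i)) ∘ₗ contract N (b.coord i)
  have hπ : ∀ z, π z = ∑ i, tens N (b i) (topMap (Ψ i) (hΨ i) z) := fun z => by simp [π]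
  have hσ : ∀ t, σ t = ∑ i, outerGlue (Pi.single (1, 1) (jacMon N i)) (contract N (b.coord i) t) :=
    fun t => by simp [σ]
  have hπi : ∀ i z, contract N (b.coord i) (π z) = topMap (Ψ i) (hΨ i) z := by
    intro i z
    rw [hπ, map_sum, Finset.sum_eq_single i]
    · rw [contract_tens]; simp
    · intro j _ hj
      rw [contract_tens]; simp [Finsupp.single_apply, hj]
    · simp
  have hπc : IsChain π := IsChain.sum _ fun i _ =>
    (tens_isChain N (b i)).comp (topMap_isChain hN (hΨ i) i (hΨ1 i))
  have hπd : HasDeg 0 0 π := HasDeg.sum _ fun i _ =>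
    (tens_hasDeg (unkBasis_mem hN i)).comp (topMap_hasDeg (hΨ i) (hΨd i)) rfl (by ring)
  have hσd : HasDeg 0 0 σ := HasDeg.sum _ fun i _ =>
    (outerGlue_hasDeg (isWH_topVec (isWH_jacMon i))).comp (contract_coord_hasDeg hN i) rfl (by ring)
  have hM : MatDeg N (arc N (xv 0 : P 3) (yv 0) (xv 2) (yv 2)) _ 1 (2 * N + 1) _ :=
    arc_d_deg (isWH_xv 0) (isWH_yv 0) (isWH_xv 2) (isWH_yv 2)
  -- Joining makes the left entries of the arc 2–4 zero, so the regular sequence consists of its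
  -- right entries. These are contracted by the annihilation operators, and the lowest component is
  -- the one at `e₁₁`.
  let K := (arcAnnihilation (N := N) (isWH_xv (1 : Fin 3)) (isWH_yv 1) (isWH_xv 1).neg
    (isWH_yv 1).neg).tensor _ hM
  have hcurv : Curved (outerMod N (parOuter N)) (arc N (xv 0 : P 2) (yv 0) (xv 1) (yv 1)).pot := by
    refine Curved.restrict ?_
    rw [← parOuter_pot]
    exact MatFact.curved _
  have hj0 : (-xv 1 : P 3) * (-yv 1 - yv 1) ≠ 0 := by
    intro h
    have := congrArg (MvPolynomial.aeval (fun _ => (1 : ℚ))) h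
    norm_num [xv, yv] at this
  have hreg : ∀ f g : P 3, ((yv 1 : P 3) ^ 2 + dd N [-xv 1, -xv 1]) * f
      = ((-xv 1 : P 3) * (-yv 1 - yv 1)) * g → ((-xv 1 : P 3) * (-yv 1 - yv 1)) ∣ f := by
    intro f g h
    have h2 : IsUnit (2 : P 3) := by
      have : IsUnit (C (2 : ℚ) : P 3) := (IsUnit.mk0 (2 : ℚ) two_ne_zero).map C
      rwa [map_ofNat] at this
    have e : (-xv 1 : P 3) * (-yv 1 - yv 1) = 2 * (xv 1 * yv 1) := by ring
    rw [dd_joined, e] at h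
    rw [e, h2.mul_left_dvd]
    refine dvd_of_X_mul_X_dvd_mul (b := legHom ![1] (jac₂ N)) (fun h0 => ?_) (fun h0 => ?_)
      ⟨2 * g, by rw [h, xv, yv]; ring⟩
    · obtain ⟨t, ht⟩ := h0
      have := congrArg (MvPolynomial.aeval (Sum.elim (fun _ => (0 : ℚ)) (fun _ => 1))) ht
      have hN' : 2 * N ≠ 0 := by omega
      simp [legHom_jac₂, xv, yv, hN'] at this
    · obtain ⟨t, ht⟩ := h0
      have := congrArg (MvPolynomial.aeval (Sum.elim (fun _ => (1 : ℚ)) (fun _ => 0))) ht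
      simp [legHom_jac₂, xv, yv] at this
      norm_cast at this
  obtain ⟨e, he⟩ := exists_htpyEquiv hcurv arcUnk_curved K.d_deg.hasDeg arcUnk_d_deg π σ hπc hπd hσd
    (fun t => by
      refine Eq.trans ?_ (arcUnk_eq_sum b t).symm
      rw [hπ]
      refine Finset.sum_congr rfl fun i _ => congrArg _ ?_
      rw [hσ, map_sum, Finset.sum_eq_single i]
      · refine (topMap_outerGlue (hΨ i) (hΨ1 i) _ _).trans ?_
        rw [Pi.single_eq_same, jacCoord_jacMon, if_pos rfl, C_1]
        exact one_smul (P 2) _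
      · intro j _ hj
        refine (topMap_outerGlue (hΨ i) (hΨ1 i) _ _).trans ?_
        rw [Pi.single_eq_same, jacCoord_jacMon, if_neg hj.symm, C_0]
        exact zero_smul (P 2) _
      · simp)
    (by
      intro Z d' s k u hd' hd'd hu hchain hker
      obtain ⟨h, h1, h2, h3⟩ := outer_nullhomotopy K hj0
        (by rw [joined_b]; exact IsWH.legHom _ (isWH_jac₁.cast (by ring))) hreg
        (S := fun i => i.2 = (1, 1))
        (tensor_arcAnnihilation_bot _ hM _ _ _ _) hQ hQ'
        (fun f k hf => (hQd f k hf).cast (by ring)) (fun f k hf => (hQd' f k hf).cast (by ring))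
        hcurv hd' hd'd hu hchain
        -- A vector in the kernel of `π` has vanishing remainders `Ψ j` at `e₁₁`, hence it is
        -- divided there by the two Jacobian generators.
        (fun z i hi => by
          rw [joined_b, dd_joined]
          refine hdiv _ fun j => ?_
          have h1 := hπi j (u z)
          rw [hker, map_zero] at h1
          rcases i with ⟨i, l⟩
          obtain rfl : l = (1, 1) := hi
          exact (congrFun h1 i).symm)
      refine ⟨h, h1, h2, fun z => ?_⟩
      rw [hπ]
      refine Finset.sum_eq_zero fun i _ => ?_
      have : topMap (N := N) (Ψ i) (hΨ i) (h z) = 0 := by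
        funext l
        exact (congrArg (Ψ i) (h3 z (l, (1, 1)) rfl)).trans (map_zero _)
      exact (congrArg (tens N (b i)) this).trans (map_zero _))
  let S : HtpyEquiv N (outerMod N (parOuter N)) (semi (parD N)) :=
    semiEquiv (M := parMF N) rfl rfl parOuter_d
  refine ⟨S.symm.trans e, fun k v hv hvc => ?_⟩
  have hg : IsChain (X := arcD N) (Y := outerMod N (parOuter N)) (outerGlue fun j => closeHom (v j)) :=
    outerGlue_isChain hvc
  have hgd : HasDeg (X := arcD N) (Y := outerMod N (parOuter N)) 0 k
      (outerGlue fun j => closeHom (v j)) := outerGlue_hasDeg fun j =>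
    ⟨fun h => IsWH.closeHom ((mem_toDiffMod_gr.1 hv j).1 h),
      fun h => (congrArg closeHom ((mem_toDiffMod_gr.1 hv j).2 h)).trans (map_zero _)⟩
  -- The class of `v` is its reduced `e₁₁`-component times the top class, so its coordinates are the
  -- ones which `π` extracts from `m ⊗ v`. The claim then follows from `inv ∘ hom ≃ id`.
  have h1 : tens N (((arcD N).join 0 1).cls (joinMk 0 1 v) hvc)
      = e.hom ∘ₗ outerGlue fun j => closeHom (v j) := by
    refine (congrArg (tens N) ((cls_eq_smul_topCls hN v hvc).trans (b.sum_repr _).symm)).trans ?_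
    rw [tens_sum, he]
    refine LinearMap.ext fun m => ?_
    rw [LinearMap.comp_apply, hπ, LinearMap.sum_apply]
    refine Finset.sum_congr rfl fun i _ => ?_
    have h2 := topMap_outerGlue (hΨ i) (hΨ1 i) (fun j => closeHom (v j)) m
    refine Eq.trans ?_ (congrArg (tens N (b i)) h2).symm
    rw [tens_smul]
    refine Eq.trans ?_ ((tens N (b i)).map_smul (C (jacCoord N i (closeHom
      ((show Fin 2 × Fin 2 → P 2 from v) (1, 1)))) : P 2) m).symm
    refine congrArg (fun r : ℚ => ((C r : P 2) • tens N (b i)) m) ?_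
    exact unkBasis_coord hN i _
  have h3 := (e.inv_hom.comp_right (j := k) (l := k) hg hgd (zero_add k)).comp_left (j := 0) (l := k)
    S.hom_chain S.hom_deg (add_zero k)
  refine Homotopic.trans ?_ (Homotopic.of_eq (glue_eq v).symm)
  rw [h1]
  exact h3

end Alpha

/-! ### Clifford operators and row operations -/

section Isomorphisms

open MvPolynomial

variable {n N : ℕ} {ι κ ι' κ' μ : Type} [Fintype ι] [DecidableEq ι] [Fintype κ] [DecidableEq κ]
  [Fintype ι'] [DecidableEq ι'] [Fintype κ'] [DecidableEq κ'] [Fintype μ] [DecidableEq μ]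

/-- Two matrix factorizations are isomorphic by homogeneous matrices of degree `0`. -/
def MatIso (N : ℕ) (M : MatFact ι (P n)) (M' : MatFact κ (P n)) : Prop :=
  ∃ (U : Matrix κ ι (P n)) (V : Matrix ι κ (P n)), U * V = 1 ∧ V * U = 1 ∧ U * M.d = M'.d * U ∧
    MatDeg N M M' 0 0 U ∧ MatDeg N M' M 0 0 V

theorem MatIso.trans {M : MatFact ι (P n)} {M' : MatFact κ (P n)} {M'' : MatFact μ (P n)}
    (h : MatIso N M M') (h' : MatIso N M' M'') : MatIso N M M'' := by
  obtain ⟨U, V, h1, h2, h3, h4, h5⟩ := h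
  obtain ⟨U', V', h1', h2', h3', h4', h5'⟩ := h'
  refine ⟨U' * U, V * V', ?_, ?_, ?_, h4'.mul h4 rfl rfl, h5.mul h5' rfl rfl⟩
  · rw [Matrix.mul_assoc, ← Matrix.mul_assoc U, h1, Matrix.one_mul, h1']
  · rw [Matrix.mul_assoc, ← Matrix.mul_assoc V', h2', Matrix.one_mul, h2]
  · rw [Matrix.mul_assoc, h3, ← Matrix.mul_assoc, h3', Matrix.mul_assoc]

theorem MatDeg.mul_sign {M : MatFact ι (P n)} {M' : MatFact κ (P n)} {U : Matrix κ ι (P n)} {k : ℤ}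
    (h : MatDeg N M M' 0 k U) : U * M.sign = M'.sign * U := by
  ext i j
  simp only [MatFact.sign, Matrix.mul_diagonal, Matrix.diagonal_mul]
  by_cases hp : M'.par i = M.par j
  · rw [hp, mul_comm]
  · rw [(h i j).1 (by rwa [add_zero]), zero_mul, mul_zero]

theorem MatIso.tensor {M : MatFact ι (P n)} {M' : MatFact κ (P n)} {L : MatFact ι' (P n)}
    {L' : MatFact κ' (P n)} (h : MatIso N M M') (h' : MatIso N L L') :
    MatIso N (M.tensor L) (M'.tensor L') := by
  obtain ⟨U, V, h1, h2, h3, h4, h5⟩ := h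
  obtain ⟨U', V', h1', h2', h3', h4', h5'⟩ := h'
  refine ⟨U ⊗ₖ U', V ⊗ₖ V', ?_, ?_, ?_, h4.kronecker h4' rfl rfl, h5.kronecker h5' rfl rfl⟩
  · rw [← Matrix.mul_kronecker_mul, h1, h1', Matrix.one_kronecker_one]
  · rw [← Matrix.mul_kronecker_mul, h2, h2', Matrix.one_kronecker_one]
  · rw [MatFact.tensor_d, MatFact.tensor_d, Matrix.mul_add, Matrix.add_mul,
      ← Matrix.mul_kronecker_mul, ← Matrix.mul_kronecker_mul, ← Matrix.mul_kronecker_mul,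
      ← Matrix.mul_kronecker_mul, h3, h3', h4.mul_sign, Matrix.mul_one, Matrix.one_mul]

theorem MatIso.nonempty_gradedIso {M : MatFact ι (P n)} {M' : MatFact κ (P n)}
    (h : MatIso N M M') : Nonempty (GradedIso (M.toDiffMod N) (M'.toDiffMod N)) := by
  obtain ⟨U, V, h1, h2, h3, h4, h5⟩ := h
  exact ⟨{
    equiv := LinearEquiv.ofLinearMap U.mulVecLin V.mulVecLin
      ((Matrix.mulVecLin_mul U V).symm.trans
        ((congrArg Matrix.mulVecLin h1).trans Matrix.mulVecLin_one))
      ((Matrix.mulVecLin_mul V U).symm.trans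
        ((congrArg Matrix.mulVecLin h2).trans Matrix.mulVecLin_one))
    chain := by
      refine Eq.trans ?_ ((Matrix.mulVecLin_mul _ _).symm.trans
        ((congrArg Matrix.mulVecLin h3).trans (Matrix.mulVecLin_mul _ _)))
      rfl
    deg := h4.hasDeg
    symm_deg := h5.hasDeg }⟩

/-- The exchange of two rows. -/
theorem matIso_swap {a b a' b' : P n} {k k' : ℤ} :
    MatIso N ((row a b k).tensor (row a' b' k')) ((row a' b' k').tensor (row a b k)) := by
  -- The sign at `e₁₁` is the Koszul sign for exchanging two odd generators.
  let U : Matrix (Fin 2 × Fin 2) (Fin 2 × Fin 2) (P n) := Matrix.of fun i j =>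
    if i.1 = j.2 ∧ i.2 = j.1 then (if i = (1, 1) then -1 else 1) else 0
  have hU : U * U = 1 := by
    ext ⟨i, j⟩ ⟨k, l⟩
    fin_cases i <;> fin_cases j <;> fin_cases k <;> fin_cases l <;>
      simp [U, Matrix.mul_apply, Fintype.sum_prod_type, Matrix.one_apply]
  have hd : ∀ (a b a' b' : P n) (k k' : ℤ),
      MatDeg N ((row a b k).tensor (row a' b' k')) ((row a' b' k').tensor (row a b k)) 0 0 U := by
    rintro a b a' b' k k' ⟨i, j⟩ ⟨i', j'⟩
    by_cases h : i = j' ∧ j = i'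
    · obtain ⟨rfl, rfl⟩ := h
      refine ⟨fun h => absurd ?_ h, ?_⟩
      · change (row a' b' k').par i + (row a b k).par j
          = (row a b k).par j + (row a' b' k').par i + 0
        ring
      · refine IsWH.cast (k := 0) ?_ ?_
        · simp only [U, Matrix.of_apply, and_self, if_true]
          split_ifs
          exacts [isWH_one.neg, isWH_one]
        · change 0 = (row a b k).deg j + (row a' b' k').deg i + 0
            - ((row a' b' k').deg i + (row a b k).deg j)
          ring
    · have : U (i, j) (i', j') = 0 := by simp only [U, Matrix.of_apply, if_neg h]
      rw [this]
      exact ⟨fun _ => rfl, isWH_zero⟩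
  refine ⟨U, U, hU, hU, ?_, hd _ _ _ _ _ _, hd _ _ _ _ _ _⟩
  ext ⟨i, j⟩ ⟨k, l⟩
  fin_cases i <;> fin_cases j <;> fin_cases k <;> fin_cases l <;>
    simp [U, Matrix.mul_apply, Fintype.sum_prod_type, MatFact.tensor, row, Matrix.one_apply, sgn]

/-- Exponentials of products of two odd operators which anticommute with each other, and with the
differential up to scalars. -/
theorem exp_mul_comm {S : Type} [CommRing S] {D α β : Matrix ι ι S} {u v : S}
    (hα : α * α = 0) (hβ : β * β = 0) (hαβ : α * β = -(β * α))
    (hDα : D * α + α * D = u • (1 : Matrix ι ι S)) (hDβ : D * β + β * D = v • (1 : Matrix ι ι S)) :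
    (1 + α * β) * (1 - α * β) = 1 ∧ (1 - α * β) * (1 + α * β) = 1 ∧
      (1 + α * β) * D = (D + v • α - u • β) * (1 + α * β) := by
  have h0 : α * β * (α * β) = 0 := by
    rw [hαβ, neg_mul, mul_neg, neg_neg, mul_assoc, ← mul_assoc α β, hαβ, neg_mul, mul_neg,
      mul_assoc, hα, mul_zero, mul_zero, neg_zero]
  have h1 : α * (α * β) = 0 := by rw [← mul_assoc, hα, zero_mul]
  have h2 : β * (α * β) = 0 := by rw [hαβ, mul_neg, ← mul_assoc, hβ, zero_mul, neg_zero]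
  -- Moving `D` to the left past the two odd operators produces the two scalars.
  have h3 : α * β * D = v • α - u • β + D * (α * β) := by
    have e1 : β * D = v • (1 : Matrix ι ι S) - D * β := by rw [← hDβ]; abel
    have e2 : α * D = u • (1 : Matrix ι ι S) - D * α := by rw [← hDα]; abel
    rw [mul_assoc, e1, mul_sub, ← mul_assoc, e2, mul_smul_comm, mul_one, sub_mul, smul_mul_assoc,
      one_mul, mul_assoc]
    abel
  refine ⟨?_, ?_, ?_⟩
  · rw [add_mul, mul_sub, mul_sub, h0]; simp
  · rw [sub_mul, mul_add, mul_add, h0]; simp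
  · have hR : (D + v • α - u • β) * (α * β) = D * (α * β) := by
      rw [sub_mul, add_mul, smul_mul_assoc, smul_mul_assoc, h1, h2, smul_zero, smul_zero, add_zero,
        sub_zero]
    rw [add_mul, mul_add (D + v • α - u • β), h3, hR, mul_one, one_mul]
    abel

/-- Creation and annihilation operators on a graded basis. -/
structure Clifford (N : ℕ) (M : MatFact ι (P n)) (I : Type) [DecidableEq I] where
  θ : I → Matrix ι ι (P n)
  p : I → Matrix ι ι (P n)
  deg : I → ℤ
  θθ : ∀ i j, θ i * θ j = -(θ j * θ i)
  θθ_self : ∀ i, θ i * θ i = 0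
  pp_self : ∀ i, p i * p i = 0
  pp : ∀ i j, p i * p j = -(p j * p i)
  pθ : ∀ i j, p i * θ j + θ j * p i = if i = j then 1 else 0
  sθ : ∀ i, M.sign * θ i = -(θ i * M.sign)
  sp : ∀ i, M.sign * p i = -(p i * M.sign)
  θ_deg : ∀ i, MatDeg N M M 1 (deg i) (θ i)
  p_deg : ∀ i, MatDeg N M M 1 (-deg i) (p i)

theorem tensor_sign (M : MatFact ι (P n)) (M' : MatFact κ (P n)) :
    (M.tensor M').sign = M.sign ⊗ₖ M'.sign := by
  have h : ∀ p q : ZMod 2, (sgn (p + q) : P n) = sgn p * sgn q := by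
    intro p q
    rcases zmod2_cases p with rfl | rfl <;> rcases zmod2_cases q with rfl | rfl <;>
      simp [sgn, zmod2_two]
  simp only [MatFact.sign, Matrix.diagonal_kronecker_diagonal]
  congr 1
  funext i
  exact h _ _

/-- The operators of one row. -/
def Clifford.row (a b : P n) (k : ℤ) : Clifford N (SaddleMF.row a b k) Unit where
  θ := fun _ => cre (P n)
  p := fun _ => ann (P n)
  deg := fun _ => k
  θθ := fun _ _ => by rw [cre_sq, neg_zero]
  θθ_self := fun _ => cre_sq _
  pp_self := fun _ => ann_sq _
  pp := fun _ _ => by rw [ann_sq, neg_zero]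
  pθ := fun _ _ => by rw [ann_cre]; simp
  sθ := fun _ => sign_row_mul_cre _ _ _
  sp := fun _ => sign_row_mul_ann _ _ _
  θ_deg := fun _ => matDeg_cre
  p_deg := fun _ => matDeg_ann

/-- The operators of a tensor product. -/
def Clifford.tensor {M : MatFact ι (P n)} {M' : MatFact κ (P n)} {I J : Type} [DecidableEq I]
    [DecidableEq J] (K : Clifford N M I) (K' : Clifford N M' J) :
    Clifford N (M.tensor M') (I ⊕ J) where
  θ := Sum.elim (fun i => K.θ i ⊗ₖ 1) (fun j => M.sign ⊗ₖ K'.θ j)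
  p := Sum.elim (fun i => K.p i ⊗ₖ 1) (fun j => M.sign ⊗ₖ K'.p j)
  deg := Sum.elim K.deg K'.deg
  θθ := by
    rintro (i | i) (j | j) <;> simp only [Sum.elim_inl, Sum.elim_inr, ← Matrix.mul_kronecker_mul,
      mul_one, one_mul, M.sign_sq, K.sθ, kronecker_neg_left, neg_neg]
    · rw [K.θθ, kronecker_neg_left]
    · rw [K'.θθ, kronecker_neg_right]
  θθ_self := by
    rintro (i | i) <;> simp only [Sum.elim_inl, Sum.elim_inr, ← Matrix.mul_kronecker_mul,
      K.θθ_self, K'.θθ_self, Matrix.zero_kronecker, Matrix.kronecker_zero]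
  pp_self := by
    rintro (i | i) <;> simp only [Sum.elim_inl, Sum.elim_inr, ← Matrix.mul_kronecker_mul,
      K.pp_self, K'.pp_self, Matrix.zero_kronecker, Matrix.kronecker_zero]
  pp := by
    rintro (i | i) (j | j) <;> simp only [Sum.elim_inl, Sum.elim_inr, ← Matrix.mul_kronecker_mul,
      mul_one, one_mul, M.sign_sq, K.sp, kronecker_neg_left, neg_neg]
    · rw [K.pp, kronecker_neg_left]
    · rw [K'.pp, kronecker_neg_right]
  pθ := by
    rintro (i | i) (j | j) <;> simp only [Sum.elim_inl, Sum.elim_inr, ← Matrix.mul_kronecker_mul,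
      mul_one, one_mul, M.sign_sq, K.sθ, K.sp, kronecker_neg_left, ← Matrix.add_kronecker,
      ← Matrix.kronecker_add, K.pθ, K'.pθ, Sum.inl.injEq, Sum.inr.injEq, reduceCtorEq, if_false,
      add_neg_cancel, neg_add_cancel]
    · split_ifs
      exacts [Matrix.one_kronecker_one, Matrix.zero_kronecker _]
    · split_ifs
      exacts [Matrix.one_kronecker_one, Matrix.kronecker_zero _]
  sθ := by
    rintro (i | i) <;> simp only [Sum.elim_inl, Sum.elim_inr, tensor_sign,
      ← Matrix.mul_kronecker_mul, mul_one, one_mul, K.sθ, K'.sθ, M.sign_sq, kronecker_neg_left,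
      kronecker_neg_right]
  sp := by
    rintro (i | i) <;> simp only [Sum.elim_inl, Sum.elim_inr, tensor_sign,
      ← Matrix.mul_kronecker_mul, mul_one, one_mul, K.sp, K'.sp, M.sign_sq, kronecker_neg_left,
      kronecker_neg_right]
  θ_deg := by
    rintro (i | i)
    · exact (K.θ_deg i).kronecker (MatDeg.one _) (by simp) (by simp)
    · exact (MatDeg.sign _).kronecker (K'.θ_deg i) (by simp) (by simp)
  p_deg := by
    rintro (i | i)
    · exact (K.p_deg i).kronecker (MatDeg.one _) (by simp) (by simp)
    · exact (MatDeg.sign _).kronecker (K'.p_deg i) (by simp) (by simp)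

/-- Restriction of the operators along an injective map of indices. -/
def Clifford.comap {M : MatFact ι (P n)} {I J : Type} [DecidableEq I] [DecidableEq J]
    (K : Clifford N M I) (f : J → I) (hf : Function.Injective f) : Clifford N M J where
  θ := fun i => K.θ (f i)
  p := fun i => K.p (f i)
  deg := fun i => K.deg (f i)
  θθ := fun _ _ => K.θθ _ _
  θθ_self := fun _ => K.θθ_self _
  pp_self := fun _ => K.pp_self _
  pp := fun _ _ => K.pp _ _
  pθ := fun i j => by rw [K.pθ]; simp [hf.eq_iff]
  sθ := fun _ => K.sθ _
  sp := fun _ => K.sp _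
  θ_deg := fun _ => K.θ_deg _
  p_deg := fun _ => K.p_deg _

variable {M : MatFact ι (P n)} {I : Type} [DecidableEq I] [Fintype I]

/-- The Koszul differential. -/
def Clifford.D (K : Clifford N M I) (a b : I → P n) : Matrix ι ι (P n) :=
  ∑ i, (a i • K.p i + b i • K.θ i)

theorem Clifford.D_θ (K : Clifford N M I) (a b : I → P n) (i : I) :
    K.D a b * K.θ i + K.θ i * K.D a b = a i • (1 : Matrix ι ι (P n)) := by
  rw [Clifford.D, Finset.sum_mul, Finset.mul_sum, ← Finset.sum_add_distrib,
    Finset.sum_eq_single i]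
  · simp only [add_mul, mul_add, smul_mul_assoc, mul_smul_comm, K.θθ_self, smul_zero, add_zero,
      ← smul_add, K.pθ, if_true]
  · intro j _ hj
    have h1 := K.pθ j i
    rw [if_neg hj] at h1
    simp only [add_mul, mul_add, smul_mul_assoc, mul_smul_comm]
    rw [add_add_add_comm, ← smul_add, ← smul_add, h1, K.θθ j i]
    simp
  · simp

theorem Clifford.D_p (K : Clifford N M I) (a b : I → P n) (i : I) :
    K.D a b * K.p i + K.p i * K.D a b = b i • (1 : Matrix ι ι (P n)) := by
  rw [Clifford.D, Finset.sum_mul, Finset.mul_sum, ← Finset.sum_add_distrib,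
    Finset.sum_eq_single i]
  · have h1 := K.pθ i i
    rw [if_pos rfl, add_comm] at h1
    simp only [add_mul, mul_add, smul_mul_assoc, mul_smul_comm, K.pp_self, smul_zero, zero_add,
      ← smul_add, h1]
  · intro j _ hj
    have h1 := K.pθ i j
    rw [if_neg hj.symm, add_comm] at h1
    simp only [add_mul, mul_add, smul_mul_assoc, mul_smul_comm]
    rw [add_add_add_comm, ← smul_add, ← smul_add, h1, K.pp j i]
    simp
  · simp

theorem Clifford.D_add (K : Clifford N M I) (a b a' b' : I → P n) :
    K.D (a + a') (b + b') = K.D a b + K.D a' b' := by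
  rw [Clifford.D, Clifford.D, Clifford.D, ← Finset.sum_add_distrib]
  refine Finset.sum_congr rfl fun i _ => ?_
  rw [Pi.add_apply, Pi.add_apply, add_smul, add_smul]
  abel

theorem Clifford.D_single_left (K : Clifford N M I) (i : I) (r : P n) :
    K.D (Pi.single i r) 0 = r • K.p i := by
  rw [Clifford.D, Finset.sum_eq_single i]
  · simp
  · intro j _ hj
    simp [Pi.single_eq_of_ne hj]
  · simp

theorem Clifford.D_zero_left (K : Clifford N M I) (b : I → P n) :
    K.D 0 b = ∑ i, b i • K.θ i := by
  simp [Clifford.D]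

/-- Koszul differentials which are conjugate by homogeneous matrices of degree `0`. -/
def Clifford.Equiv (K : Clifford N M I) (a b a' b' : I → P n) : Prop :=
  ∃ U V : Matrix ι ι (P n), U * V = 1 ∧ V * U = 1 ∧ U * K.D a b = K.D a' b' * U ∧
    MatDeg N M M 0 0 U ∧ MatDeg N M M 0 0 V

theorem Clifford.Equiv.trans {K : Clifford N M I} {a b a' b' a'' b'' : I → P n}
    (h : K.Equiv a b a' b') (h' : K.Equiv a' b' a'' b'') : K.Equiv a b a'' b'' := by
  obtain ⟨U, V, h1, h2, h3, h4, h5⟩ := h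
  obtain ⟨U', V', h1', h2', h3', h4', h5'⟩ := h'
  refine ⟨U' * U, V * V', ?_, ?_, ?_, h4'.mul h4 rfl rfl, h5.mul h5' rfl rfl⟩
  · rw [Matrix.mul_assoc, ← Matrix.mul_assoc U, h1, Matrix.one_mul, h1']
  · rw [Matrix.mul_assoc, ← Matrix.mul_assoc V', h2', Matrix.one_mul, h2]
  · rw [Matrix.mul_assoc, h3, ← Matrix.mul_assoc, h3', Matrix.mul_assoc]

theorem Clifford.Equiv.refl (K : Clifford N M I) (a b : I → P n) : K.Equiv a b a b :=
  ⟨1, 1, one_mul _, one_mul _, by rw [one_mul, mul_one], MatDeg.one M, MatDeg.one M⟩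

/-- Since `(αβ)² = 0`, the matrix `1 + αβ` is the exponential of `αβ`. Conjugation by it adds `vα -
uβ` to the differential; opposite degrees of `α`, `β` keep it of degree 0. -/
theorem Clifford.equiv_exp (K : Clifford N M I) {a b a' b' : I → P n} {α β : Matrix ι ι (P n)}
    {u v : P n} (hα : α * α = 0) (hβ : β * β = 0) (hαβ : α * β = -(β * α))
    (hDα : K.D a b * α + α * K.D a b = u • (1 : Matrix ι ι (P n)))
    (hDβ : K.D a b * β + β * K.D a b = v • (1 : Matrix ι ι (P n)))
    (hD : K.D a' b' = K.D a b + v • α - u • β) {k l : ℤ} (hkl : k + l = 0)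
    (hαd : MatDeg N M M 1 k α) (hβd : MatDeg N M M 1 l β) : K.Equiv a b a' b' := by
  obtain ⟨h1, h2, h3⟩ := exp_mul_comm hα hβ hαβ hDα hDβ
  have hd : MatDeg N M M 0 0 (α * β) := hαd.mul hβd zmod2_two (by omega)
  refine ⟨1 + α * β, 1 - α * β, h1, h2, by rw [hD, h3], (MatDeg.one M).add hd, ?_⟩
  rw [sub_eq_add_neg]
  exact (MatDeg.one M).add hd.neg

/-- Adding a multiple of one row to another one. -/
theorem Clifford.equiv_addRow (K : Clifford N M I) (a b : I → P n) {i j : I} (hij : i ≠ j) {t : ℚ}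
    (hdeg : K.deg i = K.deg j) :
    K.Equiv a b (a - Pi.single j (C t * a i)) (b + Pi.single i (C t * b j)) := by
  have hD : K.D (a - Pi.single j (C t * a i)) (b + Pi.single i (C t * b j))
      = K.D a b + b j • ((C t : P n) • K.θ i) - ((C t : P n) * a i) • K.p j := by
    have h1 := K.D_add (a - Pi.single j (C t * a i)) b 0 (Pi.single i (C t * b j))
    have h2 := K.D_add (a - Pi.single j (C t * a i)) b (Pi.single j (C t * a i)) 0
    rw [sub_add_cancel, add_zero, K.D_single_left] at h2
    rw [add_zero] at h1
    rw [h1, h2, K.D_zero_left, Finset.sum_eq_single i]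
    · rw [Pi.single_eq_same, smul_smul, mul_comm (b j)]; abel
    · intro l _ hl
      rw [Pi.single_eq_of_ne hl, zero_smul]
    · simp
  -- The conjugating matrix is `1 + tθᵢpⱼ`. The two operators anticommute because `i ≠ j`, and equal
  -- row degrees make their product of degree 0.
  refine K.equiv_exp (α := (C t : P n) • K.θ i) (β := K.p j) (k := K.deg i) (l := -K.deg j) ?_
    (K.pp_self j) ?_ ?_ (K.D_p a b j) hD (by omega) ?_ (K.p_deg j)
  · rw [smul_mul_smul_comm, K.θθ_self, smul_zero]
  · have h := K.pθ j i
    rw [if_neg hij.symm] at h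
    rw [smul_mul_assoc, mul_smul_comm, ← smul_neg, eq_neg_of_add_eq_zero_right h]
  · rw [mul_smul_comm, smul_mul_assoc, ← smul_add, K.D_θ, smul_smul]
  · exact (K.θ_deg i).smul (isWH_C t) (add_zero _)

/-- Changing the signs of the entries of a row. -/
theorem Clifford.equiv_negRow (K : Clifford N M I) (a b : I → P n) (i : I) :
    K.Equiv a b (a - Pi.single i (2 * a i)) (b - Pi.single i (2 * b i)) := by
  have hD : K.D (a - Pi.single i (2 * a i)) (b - Pi.single i (2 * b i))
      = K.D a b - (2 * a i) • K.p i - (2 * b i) • K.θ i := by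
    have h1 := K.D_add (a - Pi.single i (2 * a i)) (b - Pi.single i (2 * b i)) 0
      (Pi.single i (2 * b i))
    have h2 := K.D_add (a - Pi.single i (2 * a i)) b (Pi.single i (2 * a i)) 0
    rw [sub_add_cancel, add_zero, K.D_single_left] at h2
    rw [sub_add_cancel, add_zero, K.D_zero_left, Finset.sum_eq_single i] at h1
    · rw [h2, h1, Pi.single_eq_same]; abel
    · intro l _ hl
      rw [Pi.single_eq_of_ne hl, zero_smul]
    · simp
  have h1 := K.pθ i i
  rw [if_pos rfl] at h1
  have e1 : K.p i * K.θ i = 1 - K.θ i * K.p i := eq_sub_of_add_eq h1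
  have e2 : K.θ i * K.p i * (K.θ i * K.p i) = K.θ i * K.p i := by
    rw [mul_assoc, ← mul_assoc (K.p i), e1, sub_mul, one_mul, mul_assoc, K.pp_self, mul_zero,
      sub_zero]
  have e3 : K.θ i * (K.θ i * K.p i) = 0 := by rw [← mul_assoc, K.θθ_self, zero_mul]
  have e4 : K.p i * (K.θ i * K.p i) = K.p i := by
    rw [← mul_assoc, e1, sub_mul, one_mul, mul_assoc, K.pp_self, mul_zero, sub_zero]
  have e5 : K.θ i * K.p i * K.D a b
      = b i • K.θ i - a i • K.p i + K.D a b * (K.θ i * K.p i) := by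
    have f1 : K.p i * K.D a b = b i • (1 : Matrix ι ι (P n)) - K.D a b * K.p i := by
      rw [← K.D_p]; abel
    have f2 : K.θ i * K.D a b = a i • (1 : Matrix ι ι (P n)) - K.D a b * K.θ i := by
      rw [← K.D_θ]; abel
    rw [mul_assoc, f1, mul_sub, ← mul_assoc, f2, mul_smul_comm, mul_one, sub_mul, smul_mul_assoc,
      one_mul, mul_assoc]
    abel
  -- `θᵢpᵢ` is an idempotent, so `1 - 2θᵢpᵢ` is the reflection that changes the sign of the
  -- generator of row `i`.
  have hsq : (1 - (2 : P n) • (K.θ i * K.p i)) * (1 - (2 : P n) • (K.θ i * K.p i)) = 1 := by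
    simp only [sub_mul, mul_sub, one_mul, mul_one, smul_mul_assoc, mul_smul_comm, e2]
    module
  have hd : MatDeg N M M 0 0 (1 - (2 : P n) • (K.θ i * K.p i)) := by
    rw [sub_eq_add_neg]
    have h2 : IsWH N (2 : P n) 0 := by exact_mod_cast isWH_natCast (N := N) (n := n) 2
    exact (MatDeg.one M).add (((K.θ_deg i).mul (K.p_deg i) zmod2_two (neg_add_cancel _)).smul h2
      (add_zero 0)).neg
  refine ⟨_, _, hsq, hsq, ?_, hd, hd⟩
  rw [hD]
  simp only [sub_mul, mul_sub, one_mul, mul_one, smul_mul_assoc, mul_smul_comm, e3, e4, e5]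
  module

end Isomorphisms

/-! ### Koszul factorizations with regular left entries -/

section Syzygies

open MvPolynomial

variable {n N : ℕ} {ι κ : Type} [Fintype ι] [DecidableEq ι] [Fintype κ] [DecidableEq κ]
  {M : MatFact ι (P n)} {I : Type} [DecidableEq I] [Fintype I]

theorem exists_homogeneous_of_mem_span_image {f : P n} {a : I → P n} {s : Finset I} {δ : I → ℤ}
    {k : ℤ} (hf : IsWH N f k) (ha : ∀ i, IsWH N (a i) (δ i)) (h : f ∈ Ideal.span (a '' s)) :
    ∃ m : I → P n, (∀ i, IsWH N (m i) (k - δ i)) ∧ f = ∑ i ∈ s, m i * a i := by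
  obtain ⟨m, rfl⟩ := (Submodule.mem_span_image_finset_iff_exists_fun' (P n)).1 h
  refine ⟨fun i => weightedHomogeneousComponent (wt N n) (k - δ i) (m i), fun i =>
    weightedHomogeneousComponent_isWeightedHomogeneous _ _, ?_⟩
  conv_lhs => rw [← hf.weightedHomogeneousComponent_same]
  rw [map_sum]
  refine Finset.sum_congr rfl fun i _ => ?_
  rw [smul_eq_mul, mul_comm, mul_comm _ (a i), ← weightedComponent_mul (ha i), sub_add_cancel]

/-- The double sum is antisymmetric, hence equal to its negative, and 2 can be cancelled in a
polynomial ring over `ℚ`. -/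
theorem Clifford.sum_smul_θ_sq (K : Clifford N M I) (s : Finset I) (m : I → P n) :
    (∑ i ∈ s, m i • K.θ i) * (∑ i ∈ s, m i • K.θ i) = 0 := by
  have h : (∑ i ∈ s, m i • K.θ i) * (∑ i ∈ s, m i • K.θ i)
      = -((∑ i ∈ s, m i • K.θ i) * (∑ i ∈ s, m i • K.θ i)) := by
    conv_lhs => rw [Finset.sum_mul_sum]
    conv_rhs => rw [Finset.sum_mul_sum, Finset.sum_comm, ← Finset.sum_neg_distrib]
    refine Finset.sum_congr rfl fun i _ => ?_
    rw [← Finset.sum_neg_distrib]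
    refine Finset.sum_congr rfl fun j _ => ?_
    rw [smul_mul_smul_comm, smul_mul_smul_comm, K.θθ i j, smul_neg, mul_comm (m i)]
  have h2 := add_eq_zero_iff_eq_neg.2 h
  rw [← two_smul (P n)] at h2
  refine Matrix.ext fun i j => ?_
  have h3 := congrFun (congrFun h2 i) j
  rw [Matrix.smul_apply, smul_eq_mul] at h3
  exact (mul_eq_zero.1 h3).resolve_left two_ne_zero

theorem MatDeg.sum {M' : MatFact κ (P n)} {s : Finset I} {U : I → Matrix κ ι (P n)} {t : ZMod 2}
    {k : ℤ} (h : ∀ i ∈ s, MatDeg N M M' t k (U i)) : MatDeg N M M' t k (∑ i ∈ s, U i) := by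
  refine Finset.sum_induction U (MatDeg N M M' t k) (fun _ _ => MatDeg.add) (fun i j => ?_) h
  exact ⟨fun _ => rfl, isWH_zero⟩

/-- Koszul differentials with the same weakly regular sequence of right entries are conjugate. -/
theorem Clifford.equiv_of_sum_eq {r : ℕ} (K : Clifford N M (Fin r)) {a b b' : Fin r → P n}
    (ha : ∀ i, IsWH N (a i) (2 * N + 1 + K.deg i)) (hb : ∀ i, IsWH N (b i) (2 * N + 1 - K.deg i))
    (hb' : ∀ i, IsWH N (b' i) (2 * N + 1 - K.deg i))
    (hreg : ∀ k f, a k * f ∈ Ideal.span (a '' Finset.Iio k) → f ∈ Ideal.span (a '' Finset.Iio k))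
    (h : ∑ i, a i * b i = ∑ i, a i * b' i) : K.Equiv a b a b' := by
  -- Induction on the number of leading rows in which the right entries may still differ.
  suffices H : ∀ k ≤ r, ∀ b, (∀ i, IsWH N (b i) (2 * N + 1 - K.deg i)) →
      ∑ i, a i * b i = ∑ i, a i * b' i → (∀ i : Fin r, k ≤ i → b i = b' i) → K.Equiv a b a b' from
    H r le_rfl b hb h fun i hi => absurd i.2 (by omega)
  intro k
  induction k with
  | zero =>
    intro _ b _ _ h
    rw [funext fun i => h i (Nat.zero_le _)]
    exact Clifford.Equiv.refl K a b'
  | succ k ih =>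
    intro hk b hb hs h
    set x : Fin r := ⟨k, hk⟩ with hx
    have hx' : x ∉ Finset.Iio x := by simp
    -- All rows after `x` agree, so equality of the potentials puts `a x * (b' x - b x)` into the
    -- ideal of the earlier left entries; regularity removes the factor `a x`.
    have hmem : b' x - b x ∈ Ideal.span (a '' Finset.Iio x) := by
      refine hreg x _ ?_
      have h1 : a x * (b' x - b x) = ∑ i ∈ Finset.Iio x, a i * (b i - b' i) := by
        have h2 : ∑ i ∈ insert x (Finset.Iio x), a i * (b i - b' i) = 0 := by
          rw [Finset.sum_subset (Finset.subset_univ _) fun i _ hi => ?_]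
          · simp only [mul_sub, Finset.sum_sub_distrib, hs, sub_self]
          · have : k + 1 ≤ i := by
              simp only [Finset.mem_insert, Finset.mem_Iio, not_or, not_lt] at hi
              exact lt_of_le_of_ne hi.2 fun e => hi.1 e.symm
            rw [h i this, sub_self, mul_zero]
        rw [Finset.sum_insert hx'] at h2
        linear_combination -h2
      rw [h1]
      exact Ideal.sum_mem _ fun i hi => Ideal.mul_mem_right _ _
        (Ideal.subset_span (Set.mem_image_of_mem a hi))
    obtain ⟨m, hm, e⟩ := exists_homogeneous_of_mem_span_image ((hb' x).sub (hb x)) ha hmem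
    have hanti : K.θ x * (∑ i ∈ Finset.Iio x, m i • K.θ i)
        = -((∑ i ∈ Finset.Iio x, m i • K.θ i) * K.θ x) := by
      rw [Finset.mul_sum, Finset.sum_mul, ← Finset.sum_neg_distrib]
      refine Finset.sum_congr rfl fun i _ => ?_
      rw [mul_smul_comm, smul_mul_assoc, K.θθ, smul_neg]
    have hDβ : K.D a b * (∑ i ∈ Finset.Iio x, m i • K.θ i)
        + (∑ i ∈ Finset.Iio x, m i • K.θ i) * K.D a b
        = (b' x - b x) • (1 : Matrix ι ι (P n)) := by
      rw [Finset.mul_sum, Finset.sum_mul, ← Finset.sum_add_distrib, e, Finset.sum_smul]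
      refine Finset.sum_congr rfl fun i _ => ?_
      rw [mul_smul_comm, smul_mul_assoc, ← smul_add, K.D_θ, smul_smul]
    -- The right entries after conjugation with the exponential of `θₓ · Σ mᵢθᵢ`: row `x` becomes
    -- correct, the earlier rows pay with `-aₓmᵢ`, and the potential is unchanged.
    let b₁ : Fin r → P n := fun i =>
      b i + ((if i = x then b' x - b x else 0) - if i ∈ Finset.Iio x then a x * m i else 0)
    have hb₁ : K.D a b₁ = K.D a b + (b' x - b x) • K.θ x
        - a x • (∑ i ∈ Finset.Iio x, m i • K.θ i) := by
      have h1 := K.D_add a b 0 fun i =>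
        (if i = x then b' x - b x else 0) - if i ∈ Finset.Iio x then a x * m i else 0
      rw [add_zero, K.D_zero_left] at h1
      refine h1.trans ?_
      simp only [sub_smul, Finset.sum_sub_distrib, ite_smul, zero_smul, Finset.sum_ite_eq',
        Finset.mem_univ, if_true, Finset.sum_ite_mem, Finset.univ_inter, Finset.smul_sum, smul_smul]
      abel
    refine (K.equiv_exp (k := K.deg x) (l := -K.deg x) (K.θθ_self x) (K.sum_smul_θ_sq _ m)
      hanti (K.D_θ a b x) hDβ hb₁ (by omega) (K.θ_deg x)
      (MatDeg.sum fun i _ => (K.θ_deg i).smul (hm i) (by ring))).trans (ih (by omega) b₁ ?_ ?_ ?_)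
    · intro i
      refine (hb i).add (IsWeightedHomogeneous.sub ?_ ?_)
      · split_ifs with hi
        · rw [hi]
          exact (hb' x).sub (hb x)
        · exact isWH_zero
      · split_ifs with hi
        · exact IsWH.cast ((ha x).mul (hm i)) (by ring)
        · exact isWH_zero
    · rw [← hs]
      simp only [b₁, mul_add, Finset.sum_add_distrib, mul_sub, Finset.sum_sub_distrib, mul_ite,
        mul_zero, Finset.sum_ite_eq', Finset.mem_univ, if_true, Finset.sum_ite_mem,
        Finset.univ_inter]
      rw [← mul_sub, e, Finset.mul_sum, ← Finset.sum_sub_distrib, add_eq_left]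
      exact Finset.sum_eq_zero fun i _ => by ring
    · intro i hi
      have h1 : i ∉ Finset.Iio x := by
        rw [Finset.mem_Iio, not_lt]
        exact hi
      by_cases hix : i = x
      · subst hix
        simp only [b₁, if_true, if_neg h1]
        ring
      · simp only [b₁, if_neg hix, if_neg h1, sub_zero, add_zero]
        exact h i (lt_of_le_of_ne hi fun e => hix (Fin.ext e.symm))

/-- The Koszul matrix factorization with four rows. -/
def kos (N : ℕ) (a b : Fin 4 → P n) : MatFact Idx (P n) :=
  ((row (a 0) (b 0) (1 - 2 * N)).tensor (row (a 1) (b 1) (-1))).tensor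
    ((row (a 2) (b 2) (1 - 2 * N)).tensor (row (a 3) (b 3) (-1)))

/-- The operators of the Koszul matrix factorization with four rows. -/
def kosClifford (N n : ℕ) : Clifford N (kos N (0 : Fin 4 → P n) 0) (Fin 4) :=
  Clifford.comap (((Clifford.row _ _ _).tensor (Clifford.row _ _ _)).tensor
    ((Clifford.row _ _ _).tensor (Clifford.row _ _ _)))
    ![Sum.inl (Sum.inl ()), Sum.inl (Sum.inr ()), Sum.inr (Sum.inl ()), Sum.inr (Sum.inr ())]
    (by decide)

theorem kosClifford_deg : (kosClifford N n).deg = ![1 - 2 * (N : ℤ), -1, 1 - 2 * N, -1] := by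
  funext i
  fin_cases i <;> rfl

theorem kos_d (a b : Fin 4 → P n) : (kos N a b).d = (kosClifford N n).D a b := by
  have h : ∀ a b : P n, ∀ k, (row a b k).sign = (row (0 : P n) 0 0).sign := fun _ _ _ => rfl
  simp only [kos, MatFact.tensor_d, row_d, tensor_sign, Clifford.D, Fin.sum_univ_four,
    Matrix.add_kronecker, Matrix.kronecker_add, Matrix.smul_kronecker, Matrix.kronecker_smul, h]
  change _ = a 0 • ((ann (P n) ⊗ₖ 1) ⊗ₖ 1) + b 0 • ((cre (P n) ⊗ₖ 1) ⊗ₖ 1)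
    + (a 1 • (((row (0 : P n) 0 0).sign ⊗ₖ ann (P n)) ⊗ₖ 1)
      + b 1 • (((row (0 : P n) 0 0).sign ⊗ₖ cre (P n)) ⊗ₖ 1))
    + (a 2 • (((row (0 : P n) 0 0).tensor (row (0 : P n) 0 0)).sign ⊗ₖ (ann (P n) ⊗ₖ 1))
      + b 2 • (((row (0 : P n) 0 0).tensor (row (0 : P n) 0 0)).sign ⊗ₖ (cre (P n) ⊗ₖ 1)))
    + (a 3 • (((row (0 : P n) 0 0).tensor (row (0 : P n) 0 0)).sign ⊗ₖ
        ((row (0 : P n) 0 0).sign ⊗ₖ ann (P n)))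
      + b 3 • (((row (0 : P n) 0 0).tensor (row (0 : P n) 0 0)).sign ⊗ₖ
        ((row (0 : P n) 0 0).sign ⊗ₖ cre (P n))))
  simp only [tensor_sign]
  abel

theorem MatDeg.congr {M' : MatFact κ (P n)} {L : MatFact ι (P n)} {L' : MatFact κ (P n)} {s : ZMod 2}
    {k : ℤ} {U : Matrix κ ι (P n)} (h : MatDeg N M M' s k U) (h1 : M.par = L.par)
    (h2 : M.deg = L.deg) (h3 : M'.par = L'.par) (h4 : M'.deg = L'.deg) : MatDeg N L L' s k U := by
  intro i j
  rw [← h1, ← h2, ← h3, ← h4]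
  exact h i j

theorem tensor_par (M : MatFact ι (P n)) (M' : MatFact κ (P n)) :
    (M.tensor M').par = fun i => M.par i.1 + M'.par i.2 := rfl

theorem tensor_deg (M : MatFact ι (P n)) (M' : MatFact κ (P n)) :
    (M.tensor M').deg = fun i => M.deg i.1 + M'.deg i.2 := rfl

theorem row_par (a b : P n) (k : ℤ) : (row a b k).par = ![0, 1] := rfl

theorem row_deg (a b : P n) (k : ℤ) : (row a b k).deg = ![0, k] := rfl

theorem kos_par (a b : Fin 4 → P n) : (kos N (0 : Fin 4 → P n) 0).par = (kos N a b).par := by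
  simp only [kos, tensor_par, row_par]

theorem kos_deg (a b : Fin 4 → P n) : (kos N (0 : Fin 4 → P n) 0).deg = (kos N a b).deg := by
  simp only [kos, tensor_deg, row_deg]

theorem matIso_kos {a b a' b' : Fin 4 → P n} (h : (kosClifford N n).Equiv a b a' b') :
    MatIso N (kos N a b) (kos N a' b') := by
  obtain ⟨U, V, h1, h2, h3, h4, h5⟩ := h
  refine ⟨U, V, h1, h2, ?_, h4.congr (kos_par _ _) (kos_deg _ _) (kos_par _ _) (kos_deg _ _),
    h5.congr (kos_par _ _) (kos_deg _ _) (kos_par _ _) (kos_deg _ _)⟩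
  rw [kos_d, kos_d, h3]

end Syzygies

/-! ### Symmetries of divided differences and the potential of K ⊗ T -/

section ProperFactorizations

open MvPolynomial

variable {N : ℕ}

/-- Both sides are the same double sum in the two orders of summation. -/
theorem hsym_swap {S : Type} [CommRing S] (a b : S) (l : List S) (k : ℕ) :
    hsym (a :: b :: l) k = hsym (b :: a :: l) k := by
  simp only [hsym, Finset.mul_sum, Finset.range_eq_Ico]
  rw [Finset.sum_sigma', Finset.sum_sigma']
  refine Finset.sum_bij' (fun p _ => ⟨p.2, p.1⟩) (fun p _ => ⟨p.2, p.1⟩) ?_ ?_ ?_ ?_ ?_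
  · rintro ⟨i, j⟩ h
    simp only [Finset.mem_sigma, Finset.mem_Ico] at h ⊢
    omega
  · rintro ⟨i, j⟩ h
    simp only [Finset.mem_sigma, Finset.mem_Ico] at h ⊢
    omega
  · rintro ⟨i, j⟩ _; rfl
  · rintro ⟨i, j⟩ _; rfl
  · rintro ⟨i, j⟩ h
    simp only
    rw [Nat.sub_sub, Nat.sub_sub, add_comm i j]
    ring

theorem hsym_perm {S : Type} [CommRing S] {l l' : List S} (h : l.Perm l') (k : ℕ) :
    hsym l k = hsym l' k := by
  induction h generalizing k with
  | nil => rfl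
  | cons a _ ih => simp only [hsym, ih]
  | swap a b l => exact hsym_swap b a l k
  | trans _ _ ih ih' => exact (ih k).trans (ih' k)

theorem dd_perm {S : Type} [CommRing S] {l l' : List S} (h : l.Perm l') : dd N l = dd N l' := by
  rw [dd, dd, h.length_eq, hsym_perm h]

theorem hsym_map_neg {S : Type} [CommRing S] (l : List S) (k : ℕ) :
    hsym (l.map Neg.neg) k = (-1) ^ k * hsym l k := by
  induction l generalizing k with
  | nil =>
    simp only [List.map_nil, hsym]
    split_ifs with h <;> simp [h]
  | cons a l ih =>
    simp only [List.map_cons, hsym, Finset.mul_sum, ih]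
    refine Finset.sum_congr rfl fun i hi => ?_
    have h : k = i + (k - i) := by
      have := Finset.mem_range.1 hi
      omega
    rw [neg_pow a i]
    conv_rhs => rw [h, pow_add, ← h]
    ring

/-- The divided difference with two arguments has even degree `2N`. -/
theorem dd_neg_pair {S : Type} [CommRing S] (a b : S) : dd N [-a, -b] = dd N [a, b] := by
  have h := hsym_map_neg [a, b] (2 * N)
  rw [pow_mul, neg_one_sq, one_pow, one_mul] at h
  exact h

/-- The potential of the factorizations `K ⊗ T`. -/
theorem proper_potential {S : Type} [CommRing S] (hN : 1 ≤ N) (a b c d y₁ y₂ y₃ y₄ : S) :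
    (a + b + c + d) * (-(y₃ + y₄) * (y₁ + y₂ + y₄) - y₁ * y₂ + dd N [-a, c]
      + (b + d) * dd N [a, b, -c]
      - (b + d) * (a + d) * (dd N [a, -a, b, d] + dd N [a, -a, -b, d]))
    + (y₁ + y₂ + y₃ + y₄) * (a * y₁ + b * y₂ + c * y₃ - d * y₄)
    + (b + d) * ((y₃ + y₄) * (y₁ + y₄) + (c + d) * (a + d) *
      (dd N [a, b, -c, d] + dd N [a, -a, b, d] + dd N [a, -a, -b, d]))
    + (y₂ + y₄) * ((y₃ + y₄) * (a + d) + (c + d) * (y₁ + y₄))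
    = basicW N a y₁ + basicW N b y₂ + basicW N c y₃ + basicW N d y₄ := by
  -- Instances of the defining recursion which lower the number of arguments step by step from four
  -- to one. After the symmetric expressions have been identified, a linear combination of them
  -- telescopes to the four powers; the terms in `y` cancel as a polynomial identity.
  have h1 := dd_append_pair N [a, b] (-c) d (by simp; omega)
  have h2 := dd_append_pair N [a, d] b (-a) (by simp; omega)
  have h3 := dd_append_pair N [a, -a] (-b) d (by simp; omega)
  have h4 := dd_append_pair N [a] b (-c) (by simp; omega)
  have h5 := dd_append_pair N [-a] d a (by simp; omega)
  have h6 := dd_append_pair N [-a] a (-b) (by simp; omega)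
  have h7 := dd_append_pair N [] (-a) c (by simp)
  have h8 := dd_append_pair N [] a b (by simp)
  have h9 := dd_append_pair N [] (-a) d (by simp)
  simp only [List.nil_append, List.cons_append] at h1 h2 h3 h4 h5 h6 h7 h8 h9
  rw [dd_singleton, dd_singleton] at h7 h8 h9
  rw [Odd.neg_pow ⟨N, rfl⟩] at h7 h9
  have p1 : dd N [a, d, b, -a] = dd N [a, -a, b, d] := dd_perm (by
    refine List.Perm.cons _ ?_
    exact (List.reverse_perm [-a, b, d]))
  have p2 : dd N [a, d, b] = dd N [a, b, d] := dd_perm ((List.Perm.swap _ _ _).cons _)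
  have p3 : dd N [a, d, -a] = dd N [a, -a, d] := dd_perm ((List.Perm.swap _ _ _).cons _)
  have p4 : dd N [-a, d, a] = dd N [a, -a, d] := dd_perm
    ((List.Perm.cons _ (List.Perm.swap _ _ _)).trans (List.Perm.swap _ _ _))
  have p5 : dd N [-a, a, -b] = dd N [a, -a, -b] := dd_perm (List.Perm.swap _ _ _)
  have p6 : dd N [a, -c] = dd N [-a, c] := by rw [← dd_neg_pair a (-c), neg_neg]
  have p7 : dd N [-a, a] = dd N [a, -a] := dd_perm (List.Perm.swap _ _ _)
  rw [p1, p2, p3] at h2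
  rw [p4, p7] at h5
  rw [p5, p7, dd_neg_pair] at h6
  rw [p6] at h4
  simp only [basicW]
  linear_combination -(b + d) * (a + d) * h1 - (b + d) * (a + d) * h2 + (a + d) * (a + b) * h3
    + (b + d) * h4 + (a + d) * h5 + (a + d) * h6 - h7 - h8 - h9

end ProperFactorizations

/-! ### Isomorphisms of pairs of arcs with K ⊗ T -/

section ProperIsomorphisms

open MvPolynomial

variable {n N : ℕ}

/-- The hypotheses make `I` the kernel of `s`, a map into a domain, so an element with nonzero image
can be cancelled. -/
theorem mem_of_mul_mem_of_retract {m : ℕ} {I : Ideal (P m)} (s : P m →ₐ[ℚ] P m)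
    (hI : ∀ f ∈ I, s f = 0) (hx : ∀ i, xv i - s (xv i) ∈ I) (hy : ∀ i, yv i - s (yv i) ∈ I)
    {a f : P m} (ha : s a ≠ 0) (h : a * f ∈ I) : f ∈ I := by
  have h1 := hI _ h
  rw [map_mul] at h1
  have h2 := algHom_sub_mem (AlgHom.id ℚ (P m)) s hx hy f
  rwa [(mul_eq_zero.1 h1).resolve_left ha, sub_zero] at h2

/-- The common right entries of the Koszul matrix factorizations. -/
def legSeq (j : Fin 4) : Fin 4 → P 4 :=
  ![xv 0 + xv 1 + xv 2 + xv 3, yv 0 + yv 1 + yv 2 + yv 3, xv j + xv 3, yv j + yv 3]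

/-- Each initial segment consists of linear forms, so its ideal is the kernel of a substitution
which solves for some variables; the next linear form does not vanish under this substitution. -/
theorem legSeq_regular {j k l : Fin 4} (hj : j ≠ 3) (hl : l ≠ 3) (hk : k ≠ 3) (hjk : j ≠ k)
    (hjl : j ≠ l) (hkl : k ≠ l) (r : Fin 4) (f : P 4)
    (h : legSeq j r * f ∈ Ideal.span (legSeq j '' Finset.Iio r)) :
    f ∈ Ideal.span (legSeq j '' Finset.Iio r) := by
  have hall : ∀ i, i = j ∨ i = k ∨ i = l ∨ i = 3 := by omega
  have hsum : ∀ v : Fin 4 → P 4, v 0 + v 1 + v 2 + v 3 = v j + v k + v l + v 3 := by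
    intro v
    have h1 : Finset.univ = {j, k, l, (3 : Fin 4)} := by
      ext i; simpa using hall i
    rw [← Fin.sum_univ_four, h1, Finset.sum_insert, Finset.sum_insert, Finset.sum_insert,
      Finset.sum_singleton]
    · ring
    all_goals simp [hj, hk, hl, hjk, hjl, hkl]
  have hm : ∀ i < r, legSeq j i ∈ Ideal.span (legSeq j '' Finset.Iio r) := fun i hi =>
    Ideal.subset_span (Set.mem_image_of_mem _ (by simpa using hi))
  have hI : ∀ s : P 4 →ₐ[ℚ] P 4, (∀ i < r, s (legSeq j i) = 0) →
      ∀ f ∈ Ideal.span (legSeq j '' Finset.Iio r), s f = 0 := by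
    intro s hs f hf
    have : Ideal.span (legSeq j '' Finset.Iio r) ≤ RingHom.ker s := by
      rw [Ideal.span_le]
      rintro _ ⟨i, hi, rfl⟩
      exact hs i (by simpa using hi)
    exact this hf
  have e0 : legSeq j 0 = xv j + xv k + xv l + xv 3 := hsum xv
  have e1 : legSeq j 1 = yv j + yv k + yv l + yv 3 := hsum yv
  have e2 : legSeq j 2 = xv j + xv 3 := rfl
  have e3 : legSeq j 3 = yv j + yv 3 := rfl
  have hcase : r = 0 ∨ r = 1 ∨ r = 2 ∨ r = 3 := by omega
  have z : ∀ g : P 4, g - g ∈ Ideal.span (legSeq j '' Finset.Iio r) := fun g => by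
    rw [sub_self]; exact Ideal.zero_mem _
  rcases hcase with rfl | rfl | rfl | rfl
  · refine mem_of_mul_mem_of_retract (AlgHom.id ℚ _) (hI _ fun i hi => absurd hi (by simp))
      (fun i => z _) (fun i => z _) (fun h0 => ?_) h
    have h1 := congrArg (MvPolynomial.eval fun _ => (1 : ℚ)) h0
    rw [AlgHom.id_apply, e0] at h1
    norm_num [xv] at h1
  · refine mem_of_mul_mem_of_retract
      (subst (Function.update xv 3 (xv 3 - legSeq j 0)) yv) (hI _ fun i hi => ?_)
      (fun i => ?_) (fun i => ?_) (fun h0 => ?_) h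
    · obtain rfl : i = 0 := by omega
      rw [e0]
      simp [hj, hk, hl]
    · rw [subst_xv]
      by_cases hi : i = 3
      · rw [hi, Function.update_self, sub_sub_cancel]
        exact hm 0 (by decide)
      · rw [Function.update_of_ne hi]
        exact z _
    · rw [subst_yv]; exact z _
    · have h1 := congrArg (MvPolynomial.eval fun _ => (1 : ℚ)) h0
      rw [e1] at h1
      simp only [map_add, subst_yv] at h1
      norm_num [yv] at h1
  · refine mem_of_mul_mem_of_retract
      (subst (Function.update xv 3 (xv 3 - legSeq j 0)) (Function.update yv 3 (yv 3 - legSeq j 1)))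
      (hI _ fun i hi => ?_) (fun i => ?_) (fun i => ?_) (fun h0 => ?_) h
    · obtain rfl | rfl : i = 0 ∨ i = 1 := by omega
      · rw [e0]
        simp [hj, hk, hl]
      · rw [e1]
        simp [hj, hk, hl]
    · rw [subst_xv]
      by_cases hi : i = 3
      · rw [hi, Function.update_self, sub_sub_cancel]
        exact hm 0 (by decide)
      · rw [Function.update_of_ne hi]
        exact z _
    · rw [subst_yv]
      by_cases hi : i = 3
      · rw [hi, Function.update_self, sub_sub_cancel]
        exact hm 1 (by decide)
      · rw [Function.update_of_ne hi]
        exact z _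
    · refine xv_add_ne_zero (n := 4) hkl ?_
      rw [e2, e0] at h0
      simp [hj] at h0
      linear_combination -h0
  · refine mem_of_mul_mem_of_retract
      -- The two relations in `x` are solved by `x₄ = -xⱼ`, `x_l = -x_k`, and the relation in `y` is
      -- solved for `y₄`.
      (subst (Function.update (Function.update xv 3 (-xv j)) l (-xv k))
        (Function.update yv 3 (yv 3 - legSeq j 1)))
      (hI _ fun i hi => ?_) (fun i => ?_) (fun i => ?_) (fun h0 => ?_) h
    · obtain rfl | rfl | rfl : i = 0 ∨ i = 1 ∨ i = 2 := by omega
      · rw [e0]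
        simp [hj, hk, hl, hjl, hkl, hl.symm]
      · rw [e1]
        simp [hj, hk, hl]
      · rw [e2]
        simp [hj, hk, hl, hjl, hkl, hl.symm]
    · rw [subst_xv]
      by_cases hil : i = l
      · rw [hil, Function.update_self]
        have : (xv l - -xv k : P 4) = legSeq j 0 - legSeq j 2 := by rw [e0, e2]; ring
        rw [this]
        exact Ideal.sub_mem _ (hm 0 (by decide)) (hm 2 (by decide))
      rw [Function.update_of_ne hil]
      by_cases hi : i = 3
      · rw [hi, Function.update_self]
        have : (xv 3 - -xv j : P 4) = legSeq j 2 := by rw [e2]; ring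
        rw [this]
        exact hm 2 (by decide)
      · rw [Function.update_of_ne hi]
        exact z _
    · rw [subst_yv]
      by_cases hi : i = 3
      · rw [hi, Function.update_self, sub_sub_cancel]
        exact hm 1 (by decide)
      · rw [Function.update_of_ne hi]
        exact z _
    · refine yv_add_ne_zero (n := 4) hkl ?_
      rw [e3, e1] at h0
      simp [hj] at h0
      linear_combination -h0

/-- Brings the left entries of two arcs to the form `legSeq j`: the sums over all legs, and the
entries of the second arc. It serves `Γ_∥` and `Γ_=`, where leg 4 belongs to the second arc. -/
theorem kosClifford_equiv_add {a₀ a₁ a₂ a₃ b₀ b₁ b₂ b₃ : P n} :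
    (kosClifford N n).Equiv ![a₀, a₁, a₂, a₃] ![b₀, b₁, b₂, b₃]
      ![a₀ + a₂, a₁ + a₃, a₂, a₃] ![b₀, b₁, b₂ - b₀, b₃ - b₁] := by
  have h1 := (kosClifford N n).equiv_addRow ![a₀, a₁, a₂, a₃] ![b₀, b₁, b₂, b₃] (i := 2) (j := 0)
    (by decide) (t := -1) rfl
  have h2 := (kosClifford N n).equiv_addRow ![a₀ + a₂, a₁, a₂, a₃] ![b₀, b₁, b₂ - b₀, b₃] (i := 3)
    (j := 1) (by decide) (t := -1) rfl
  convert Clifford.Equiv.trans (a' := ![a₀ + a₂, a₁, a₂, a₃]) (b' := ![b₀, b₁, b₂ - b₀, b₃]) ?_ h2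
    using 1
  · funext i
    fin_cases i <;> simp
  · funext i
    fin_cases i <;> simp [sub_eq_add_neg]
  · convert h1 using 1
    · funext i
      fin_cases i <;> simp
    · funext i
      fin_cases i <;> simp [sub_eq_add_neg]

/-- The variant which keeps the entries of the first arc, for `Γ_×`, where leg 4 belongs to the arc
1–4. -/
theorem kosClifford_equiv_swap {a₀ a₁ a₂ a₃ b₀ b₁ b₂ b₃ : P n} :
    (kosClifford N n).Equiv ![a₀, a₁, a₂, a₃] ![b₀, b₁, b₂, b₃]
      ![a₀ + a₂, a₁ + a₃, a₀, a₁] ![b₂, b₃, b₀ - b₂, b₁ - b₃] := by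
  have h1 := (kosClifford N n).equiv_addRow ![a₀ + a₂, a₁ + a₃, a₂, a₃] ![b₀, b₁, b₂ - b₀, b₃ - b₁]
    (i := 0) (j := 2) (by decide) (t := 1) rfl
  have h2 := (kosClifford N n).equiv_addRow ![a₀ + a₂, a₁ + a₃, -a₀, a₃] ![b₂, b₁, b₂ - b₀, b₃ - b₁]
    (i := 1) (j := 3) (by decide) (t := 1) rfl
  -- The row additions leave the entries of the first arc with the wrong sign on both sides of the
  -- row, and a reflection changes both.
  have h3 := (kosClifford N n).equiv_negRow ![a₀ + a₂, a₁ + a₃, -a₀, -a₁]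
    ![b₂, b₃, b₂ - b₀, b₃ - b₁] 2
  have h4 := (kosClifford N n).equiv_negRow ![a₀ + a₂, a₁ + a₃, a₀, -a₁]
    ![b₂, b₃, b₀ - b₂, b₃ - b₁] 3
  have e1 : ![a₀ + a₂, a₁ + a₃, a₂, a₃] - Pi.single 2 (C (1 : ℚ) * ![a₀ + a₂, a₁ + a₃, a₂, a₃] 0)
      = ![a₀ + a₂, a₁ + a₃, -a₀, a₃] := by
    funext i; fin_cases i <;> simp
  have e1' : ![b₀, b₁, b₂ - b₀, b₃ - b₁] + Pi.single 0 (C (1 : ℚ) * ![b₀, b₁, b₂ - b₀, b₃ - b₁] 2)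
      = ![b₂, b₁, b₂ - b₀, b₃ - b₁] := by
    funext i; fin_cases i <;> simp
  have e2 : ![a₀ + a₂, a₁ + a₃, -a₀, a₃] - Pi.single 3 (C (1 : ℚ) * ![a₀ + a₂, a₁ + a₃, -a₀, a₃] 1)
      = ![a₀ + a₂, a₁ + a₃, -a₀, -a₁] := by
    funext i; fin_cases i <;> simp
  have e2' : ![b₂, b₁, b₂ - b₀, b₃ - b₁] + Pi.single 1 (C (1 : ℚ) * ![b₂, b₁, b₂ - b₀, b₃ - b₁] 3)
      = ![b₂, b₃, b₂ - b₀, b₃ - b₁] := by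
    funext i; fin_cases i <;> simp
  have e3 : ![a₀ + a₂, a₁ + a₃, -a₀, -a₁] - Pi.single 2 (2 * ![a₀ + a₂, a₁ + a₃, -a₀, -a₁] 2)
      = ![a₀ + a₂, a₁ + a₃, a₀, -a₁] := by
    funext i; fin_cases i <;> simp; try ring
  have e3' : ![b₂, b₃, b₂ - b₀, b₃ - b₁] - Pi.single 2 (2 * ![b₂, b₃, b₂ - b₀, b₃ - b₁] 2)
      = ![b₂, b₃, b₀ - b₂, b₃ - b₁] := by
    funext i; fin_cases i <;> simp; try ring
  have e4 : ![a₀ + a₂, a₁ + a₃, a₀, -a₁] - Pi.single 3 (2 * ![a₀ + a₂, a₁ + a₃, a₀, -a₁] 3)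
      = ![a₀ + a₂, a₁ + a₃, a₀, a₁] := by
    funext i; fin_cases i <;> simp; try ring
  have e4' : ![b₂, b₃, b₀ - b₂, b₃ - b₁] - Pi.single 3 (2 * ![b₂, b₃, b₀ - b₂, b₃ - b₁] 3)
      = ![b₂, b₃, b₀ - b₂, b₁ - b₃] := by
    funext i; fin_cases i <;> simp; try ring
  rw [e1, e1'] at h1
  rw [e2, e2'] at h2
  rw [e3, e3'] at h3
  rw [e4, e4'] at h4
  exact (((kosClifford_equiv_add.trans h1).trans h2).trans h3).trans h4

/-- An arc lists its `y`-row first, whereas `kos` lists the `x`-row first. -/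
theorem matIso_arcs (x₁ y₁ x₂ y₂ x₃ y₃ x₄ y₄ : P n) :
    MatIso N ((arc N x₁ y₁ x₂ y₂).tensor (arc N x₃ y₃ x₄ y₄))
      (kos N ![x₂ + x₁, y₂ + y₁, x₄ + x₃, y₄ + y₃] ![y₁ ^ 2 + dd N [-x₁, x₂], x₂ * (y₂ - y₁),
        y₃ ^ 2 + dd N [-x₃, x₄], x₄ * (y₄ - y₃)]) :=
  MatIso.tensor matIso_swap matIso_swap

theorem legSeq_equiv {j k l : Fin 4} (hj : j ≠ 3) (hl : l ≠ 3) (hk : k ≠ 3) (hjk : j ≠ k)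
    (hjl : j ≠ l) (hkl : k ≠ l) {b b' : Fin 4 → P 4}
    (hb : ∀ i, IsWH N (b i) (![4 * (N : ℤ), 2 * N + 2, 4 * N, 2 * N + 2] i))
    (hb' : ∀ i, IsWH N (b' i) (![4 * (N : ℤ), 2 * N + 2, 4 * N, 2 * N + 2] i))
    (h : ∑ i, legSeq j i * b i = ∑ i, legSeq j i * b' i) :
    (kosClifford N 4).Equiv (legSeq j) b (legSeq j) b' := by
  have hd : ∀ i, ![4 * (N : ℤ), 2 * N + 2, 4 * N, 2 * N + 2] i
      = 2 * N + 1 - (kosClifford N 4).deg i := by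
    intro i
    rw [kosClifford_deg]
    fin_cases i <;> simp <;> ring
  refine (kosClifford N 4).equiv_of_sum_eq ?_ (fun i => (hb i).cast (hd i))
    (fun i => (hb' i).cast (hd i)) (legSeq_regular hj hl hk hjk hjl hkl) h
  intro i
  rw [kosClifford_deg]
  have hx : ∀ i : Fin 4, IsWH N (xv i : P 4) (2 * N + 1 + (1 - 2 * N)) :=
    fun i => (isWH_xv i).cast (by ring)
  have hy : ∀ i : Fin 4, IsWH N (yv i : P 4) (2 * N + 1 + -1) :=
    fun i => (isWH_yv i).cast (by ring)
  fin_cases i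
  · exact (((hx 0).add (hx 1)).add (hx 2)).add (hx 3)
  · exact (((hy 0).add (hy 1)).add (hy 2)).add (hy 3)
  · exact (hx j).add (hx 3)
  · exact (hy j).add (hy 3)

theorem isWH_dd_pair (i j : Fin n) : IsWH N (dd N [-xv i, xv j] : P n) (4 * N) := by
  refine IsWH.dd ?_ (by simp) (by simp; ring)
  simp only [List.mem_cons, List.not_mem_nil, or_false, forall_eq_or_imp, forall_eq]
  exact ⟨(isWH_xv i).neg, isWH_xv j⟩

theorem isWH_yv_sq (i j : Fin n) : IsWH N (yv i * yv j : P n) (4 * N) :=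
  IsWH.cast ((isWH_yv i).mul (isWH_yv j)) (by ring)

theorem isWH_arc_left (i j : Fin n) : IsWH N (yv i ^ 2 + dd N [-xv i, xv j] : P n) (4 * N) := by
  rw [sq]
  exact (isWH_yv_sq i i).add (isWH_dd_pair i j)

theorem isWH_arc_right (i j : Fin n) :
    IsWH N (xv j * (yv j - yv i) : P n) (2 * N + 2) :=
  IsWH.cast ((isWH_xv j).mul ((isWH_yv j).sub (isWH_yv i))) (by ring)

theorem isWH_polyC (hN : 1 ≤ N) : IsWH N (polyC N) (4 * N - 4) := by
  have h : ∀ a b c d : P 4, IsWH N a 2 → IsWH N b 2 → IsWH N c 2 → IsWH N d 2 →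
      IsWH N (dd N [a, b, c, d]) (4 * N - 4) := fun a b c d ha hb hc hd => by
    refine IsWH.dd ?_ (by simp; omega) (by simp; ring)
    simp only [List.mem_cons, List.not_mem_nil, or_false, forall_eq_or_imp, forall_eq]
    exact ⟨ha, hb, hc, hd⟩
  exact ((h _ _ _ _ (isWH_xv 0) (isWH_xv 1) (isWH_xv 2).neg (isWH_xv 3)).add
    (h _ _ _ _ (isWH_xv 0) (isWH_xv 0).neg (isWH_xv 1) (isWH_xv 3))).add
    (h _ _ _ _ (isWH_xv 0) (isWH_xv 0).neg (isWH_xv 1).neg (isWH_xv 3))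

theorem isWH_polyA (hN : 1 ≤ N) : IsWH N (polyA N) (4 * N) := by
  have h4 : ∀ a b c d : P 4, IsWH N a 2 → IsWH N b 2 → IsWH N c 2 → IsWH N d 2 →
      IsWH N (dd N [a, b, c, d]) (4 * N - 4) := fun a b c d ha hb hc hd => by
    refine IsWH.dd ?_ (by simp; omega) (by simp; ring)
    simp only [List.mem_cons, List.not_mem_nil, or_false, forall_eq_or_imp, forall_eq]
    exact ⟨ha, hb, hc, hd⟩
  have h3 : IsWH N (dd N [xv 0, xv 1, -xv 2] : P 4) (4 * N - 2) := by
    refine IsWH.dd ?_ (by simp; omega) (by simp; ring)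
    simp only [List.mem_cons, List.not_mem_nil, or_false, forall_eq_or_imp, forall_eq]
    exact ⟨isWH_xv 0, isWH_xv 1, (isWH_xv 2).neg⟩
  have hx : ∀ i j : Fin 4, IsWH N (xv i + xv j : P 4) 2 := fun i j => (isWH_xv i).add (isWH_xv j)
  have hy : IsWH N (-(yv 2 + yv 3) * (yv 0 + yv 1 + yv 3) - yv 0 * yv 1 : P 4) (4 * N) :=
    (IsWH.cast (((isWH_yv 2).add (isWH_yv 3)).neg.mul
      (((isWH_yv 0).add (isWH_yv 1)).add (isWH_yv 3))) (by ring)).sub (isWH_yv_sq 0 1)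
  exact ((hy.add (isWH_dd_pair 0 2)).add (IsWH.cast ((hx 1 3).mul h3) (by ring))).sub
    (IsWH.cast (((hx 1 3).mul (hx 0 3)).mul
      ((h4 _ _ _ _ (isWH_xv 0) (isWH_xv 0).neg (isWH_xv 1) (isWH_xv 3)).add
        (h4 _ _ _ _ (isWH_xv 0) (isWH_xv 0).neg (isWH_xv 1).neg (isWH_xv 3)))) (by ring))

theorem isWH_polyB : IsWH N polyB (2 * N + 2) := by
  have h : ∀ i : Fin 4, IsWH N (xv i * yv i : P 4) (2 * N + 2) := fun i =>
    IsWH.cast ((isWH_xv i).mul (isWH_yv i)) (by ring)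
  exact (((h 0).add (h 1)).add (h 2)).sub (h 3)

/-- Pairs of homogeneous polynomials of degrees `2` and `2N`. -/
def IsWHPair (N : ℕ) (c : P n × P n) : Prop := IsWH N c.1 2 ∧ IsWH N c.2 (2 * N)

theorem isWHPair_legs (i j : Fin n) : IsWHPair N ((xv i + xv j : P n), (yv i + yv j : P n)) :=
  ⟨(isWH_xv i).add (isWH_xv j), (isWH_yv i).add (isWH_yv j)⟩

theorem isWH_proper {b c : P 4 × P 4} (hN : 1 ≤ N) (hb : IsWHPair N b) (hc : IsWHPair N c)
    (i : Fin 4) :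
    IsWH N (![polyA N, polyB, b.2 * c.2 + b.1 * c.1 * polyC N, b.2 * c.1 + b.1 * c.2] i)
      (![4 * (N : ℤ), 2 * N + 2, 4 * N, 2 * N + 2] i) := by
  have h2 : IsWH N (b.2 * c.2 + b.1 * c.1 * polyC N) (4 * N) :=
    (IsWH.cast (hb.2.mul hc.2) (by ring)).add
      (IsWH.cast ((hb.1.mul hc.1).mul (isWH_polyC hN)) (by ring))
  have h3 : IsWH N (b.2 * c.1 + b.1 * c.2) (2 * N + 2) :=
    (IsWH.cast (hb.2.mul hc.1) (by ring)).add (IsWH.cast (hb.1.mul hc.2) (by ring))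
  fin_cases i
  exacts [isWH_polyA hN, isWH_polyB, h2, h3]

theorem arc_pot_eq {S : Type} [CommRing S] (x₁ y₁ x₂ y₂ : S) :
    (y₂ + y₁) * (x₂ * (y₂ - y₁)) + (x₂ + x₁) * (y₁ ^ 2 + dd N [-x₁, x₂])
      = basicW N x₁ y₁ + basicW N x₂ y₂ := arc_pot N x₁ y₁ x₂ y₂

/-- Row operations give a pair of arcs the left entries of `K ⊗ T`, up to the order of summands. The
right entries need not agree, but the potentials do by `proper_potential`, and the left entries form
a regular sequence. -/
theorem matIso_par_vir_hor (hN : 1 ≤ N) : MatIso N (parMF N) (parK N) ∧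
    MatIso N (virMF N) (virK N) ∧ MatIso N (horMF N) (horK N) := by
  have hpot := proper_potential (S := P 4) hN (xv 0) (xv 1) (xv 2) (xv 3) (yv 0) (yv 1) (yv 2) (yv 3)
  have hK : ∀ p q r : P 4 × P 4, (commonMF N).tensor (properMF N p q r (polyC N))
      = kos N ![xv 0 + xv 1 + xv 2 + xv 3, yv 0 + yv 1 + yv 2 + yv 3, p.1, p.2]
        ![polyA N, polyB, q.2 * r.2 + q.1 * r.1 * polyC N, q.2 * r.1 + q.1 * r.2] :=
    fun _ _ _ => rfl
  have hp := isWHPair_legs (N := N) (1 : Fin 4) 3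
  have hq := isWHPair_legs (N := N) (2 : Fin 4) 3
  have hr := isWHPair_legs (N := N) (0 : Fin 4) 3
  have hpoly : polyA N = -(yv 2 + yv 3) * (yv 0 + yv 1 + yv 3) - yv 0 * yv 1 + dd N [-xv 0, xv 2]
    + (xv 1 + xv 3) * dd N [xv 0, xv 1, -xv 2]
    - (xv 1 + xv 3) * (xv 0 + xv 3)
      * (dd N [xv 0, -xv 0, xv 1, xv 3] + dd N [xv 0, -xv 0, -xv 1, xv 3]) := rfl
  have hpolC : polyC N = dd N [xv 0, xv 1, -xv 2, xv 3] + dd N [xv 0, -xv 0, xv 1, xv 3]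
    + dd N [xv 0, -xv 0, -xv 1, xv 3] := rfl
  rw [← hpoly, ← hpolC] at hpot
  have hB : polyB = xv 0 * yv 0 + xv 1 * yv 1 + xv 2 * yv 2 - xv 3 * yv 3 := rfl
  rw [← hB] at hpot
  refine ⟨?_, ?_, ?_⟩
  · refine (matIso_arcs _ _ _ _ _ _ _ _).trans ?_
    rw [parK, hK]
    refine matIso_kos (kosClifford_equiv_add.trans ?_)
    have e : (![xv 2 + xv 0 + (xv 3 + xv 1), yv 2 + yv 0 + (yv 3 + yv 1), xv 3 + xv 1,
        yv 3 + yv 1] : Fin 4 → P 4) = legSeq 1 := by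
      funext i; fin_cases i <;> simp [legSeq] <;> ring
    rw [e]
    refine legSeq_equiv (j := 1) (k := 0) (l := 2) (by decide) (by decide) (by decide) (by decide)
      (by decide) (by decide) (fun i => ?_) (isWH_proper hN hq hr) ?_
    · fin_cases i
      exacts [isWH_arc_left 0 2, isWH_arc_right 0 2, (isWH_arc_left 1 3).sub (isWH_arc_left 0 2),
        (isWH_arc_right 1 3).sub (isWH_arc_right 0 2)]
    · rw [Fin.sum_univ_four, Fin.sum_univ_four]
      simp only [legSeq, Matrix.cons_val_zero, Matrix.cons_val_one, Matrix.cons_val, qq, rr]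
      linear_combination arc_pot_eq (N := N) (xv 0 : P 4) (yv 0) (xv 2) (yv 2)
        + arc_pot_eq (N := N) (xv 1 : P 4) (yv 1) (xv 3) (yv 3) - hpot
  · refine (matIso_arcs _ _ _ _ _ _ _ _).trans ?_
    rw [virK, hK]
    refine matIso_kos (kosClifford_equiv_swap.trans ?_)
    have e : (![xv 3 + xv 0 + (xv 2 + xv 1), yv 3 + yv 0 + (yv 2 + yv 1), xv 3 + xv 0,
        yv 3 + yv 0] : Fin 4 → P 4) = legSeq 0 := by
      funext i; fin_cases i <;> simp [legSeq] <;> ring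
    rw [e]
    refine legSeq_equiv (j := 0) (k := 1) (l := 2) (by decide) (by decide) (by decide) (by decide)
      (by decide) (by decide) (fun i => ?_) (isWH_proper hN hp hq) ?_
    · fin_cases i
      exacts [isWH_arc_left 1 2, isWH_arc_right 1 2, (isWH_arc_left 0 3).sub (isWH_arc_left 1 2),
        (isWH_arc_right 0 3).sub (isWH_arc_right 1 2)]
    · rw [Fin.sum_univ_four, Fin.sum_univ_four]
      simp only [legSeq, Matrix.cons_val_zero, Matrix.cons_val_one, Matrix.cons_val, qq, pp]
      linear_combination arc_pot_eq (N := N) (xv 0 : P 4) (yv 0) (xv 3) (yv 3)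
        + arc_pot_eq (N := N) (xv 1 : P 4) (yv 1) (xv 2) (yv 2) - hpot
  · refine (matIso_arcs _ _ _ _ _ _ _ _).trans ?_
    rw [horK, hK]
    refine matIso_kos (kosClifford_equiv_add.trans ?_)
    have e : (![xv 1 + xv 0 + (xv 3 + xv 2), yv 1 + yv 0 + (yv 3 + yv 2), xv 3 + xv 2,
        yv 3 + yv 2] : Fin 4 → P 4) = legSeq 2 := by
      funext i; fin_cases i <;> simp [legSeq] <;> ring
    rw [e]
    refine legSeq_equiv (j := 2) (k := 0) (l := 1) (by decide) (by decide) (by decide) (by decide)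
      (by decide) (by decide) (fun i => ?_) (isWH_proper hN hp hr) ?_
    · fin_cases i
      exacts [isWH_arc_left 0 1, isWH_arc_right 0 1, (isWH_arc_left 2 3).sub (isWH_arc_left 0 1),
        (isWH_arc_right 2 3).sub (isWH_arc_right 0 1)]
    · rw [Fin.sum_univ_four, Fin.sum_univ_four]
      simp only [legSeq, Matrix.cons_val_zero, Matrix.cons_val_one, Matrix.cons_val, rr, pp]
      linear_combination arc_pot_eq (N := N) (xv 0 : P 4) (yv 0) (xv 1) (yv 1)
        + arc_pot_eq (N := N) (xv 2 : P 4) (yv 2) (xv 3) (yv 3) - hpot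

/-- The identifications exist. -/
theorem nonempty_identification (hN : 1 ≤ N) : Nonempty (Identification N) := by
  obtain ⟨h1, h2, h3⟩ := matIso_par_vir_hor hN
  obtain ⟨φ₁⟩ := h1.nonempty_gradedIso
  obtain ⟨φ₂⟩ := h2.nonempty_gradedIso
  obtain ⟨φ₃⟩ := h3.nonempty_gradedIso
  obtain ⟨α, hα⟩ := exists_htpyEquiv_par hN
  obtain ⟨β⟩ := nonempty_htpyEquiv_vir (N := N)
  obtain ⟨δ⟩ := nonempty_htpyEquiv_hor (N := N)
  exact ⟨⟨φ₁, φ₂, φ₃, α, β, δ, hα⟩⟩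

end ProperIsomorphisms

/-! ### The saddle morphisms are not null-homotopic -/

section Saddles

open MvPolynomial

variable {n N : ℕ}

theorem properSaddle_d {S : Type} [CommRing S] (a b c : S × S) (C : S) :
    properSaddle c C * (properMF N a b c C).d = (properMF N b a c C).d * properSaddle c C := by
  ext ⟨i, j⟩ ⟨k, l⟩
  fin_cases i <;> fin_cases j <;> fin_cases k <;> fin_cases l <;>
    simp [properSaddle, properMF, Matrix.mul_apply, Fintype.sum_prod_type, MatFact.tensor, row,
      sgn] <;> ring

/-- Two opposite saddles compose to a multiplication. Both the non-triviality of the saddles and the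
constants of the semi-closed maps are read off from it. -/
theorem properSaddle_sq {S : Type} [CommRing S] (c : S × S) (C : S) :
    properSaddle c C * properSaddle c C = (c.2 ^ 2 - c.1 ^ 2 * C) • (1 : Matrix _ _ S) := by
  ext ⟨i, j⟩ ⟨k, l⟩
  fin_cases i <;> fin_cases j <;> fin_cases k <;> fin_cases l <;>
    simp [properSaddle, Matrix.mul_apply, Fintype.sum_prod_type] <;> ring

theorem matDeg_properSaddle {a b a' b' a'' b'' c : P n × P n} {C : P n} (hc : IsWHPair N c)
    (hC : IsWH N C (4 * N - 4)) :
    MatDeg N (properMF N a b a'' C) (properMF N a' b' b'' C) 0 (2 * N) (properSaddle c C) := by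
  have h1 : IsWH N (c.2 ^ 2 - c.1 ^ 2 * C) (4 * N) :=
    IsWeightedHomogeneous.sub (IsWH.cast (hc.2.pow 2) (by simp; ring))
      (IsWH.cast ((hc.1.pow 2).mul hC) (by simp))
  have h2 : IsWH N (c.1 * C) (4 * N - 2) := IsWH.cast (hc.1.mul hC) (by ring)
  have h0 := hc.1.neg
  have h3 := hc.2
  have h3' := hc.2.neg
  have key : ∀ (i j k l : Fin 2) {f : P n} {d : ℤ} (_ : properSaddle c C (i, j) (k, l) = f)
      (_ : (![0, 1] i + ![0, 1] j : ZMod 2) = ![0, 1] k + ![0, 1] l) (_ : IsWH N f d)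
      (_ : d = ![0, 1 - 2 * (N : ℤ)] k + ![0, -1] l + 2 * N - (![0, 1 - 2 * (N : ℤ)] i + ![0, -1] j)),
      ((properMF N a' b' b'' C).par (i, j) ≠ (properMF N a b a'' C).par (k, l) + 0 →
        properSaddle c C (i, j) (k, l) = 0) ∧ IsWH N (properSaddle c C (i, j) (k, l))
        ((properMF N a b a'' C).deg (k, l) + 2 * N - (properMF N a' b' b'' C).deg (i, j)) := by
    intro i j k l f d hf hp hw hd
    refine ⟨fun h => absurd ?_ h, hf ▸ IsWH.cast hw hd⟩
    rw [add_zero]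
    exact hp
  rintro ⟨i, j⟩ ⟨k, l⟩
  fin_cases i <;> fin_cases j <;> fin_cases k <;> fin_cases l <;>
    first
    | exact ⟨fun _ => rfl, isWH_zero⟩
    | exact key _ _ _ _ rfl rfl isWH_one (by simp; try ring)
    | exact key _ _ _ _ rfl rfl h1 (by simp; ring)
    | exact key _ _ _ _ rfl rfl h2 (by simp; ring)
    | exact key _ _ _ _ rfl rfl h0 (by simp)
    | exact key _ _ _ _ rfl rfl h3 (by simp)
    | exact key _ _ _ _ rfl rfl h3' (by simp)

theorem properMF_comm {S : Type} [CommRing S] (a b c : S × S) (C : S) :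
    properMF N a b c C = properMF N a c b C := by
  simp only [properMF]
  rw [mul_comm b.2 c.2, mul_comm b.1 c.1, mul_comm b.2 c.1, mul_comm b.1 c.2, add_comm (c.1 * b.2)]

theorem saddleMatrix_d (a b c : P 4 × P 4) :
    saddleMatrix N c * ((commonMF N).tensor (properMF N a b c (polyC N))).d
      = ((commonMF N).tensor (properMF N b a c (polyC N))).d * saddleMatrix N c := by
  rw [saddleMatrix, MatFact.tensor_d, MatFact.tensor_d, mul_add, add_mul,
    ← Matrix.mul_kronecker_mul, ← Matrix.mul_kronecker_mul, ← Matrix.mul_kronecker_mul,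
    ← Matrix.mul_kronecker_mul, properSaddle_d, one_mul, one_mul, mul_one, mul_one, mul_one,
    one_mul]

theorem saddleMatrix_sq (c : P 4 × P 4) : saddleMatrix N c * saddleMatrix N c
    = (c.2 ^ 2 - c.1 ^ 2 * polyC N) • (1 : Matrix Idx Idx (P 4)) := by
  rw [saddleMatrix, ← Matrix.mul_kronecker_mul, properSaddle_sq, one_mul, Matrix.kronecker_smul,
    Matrix.one_kronecker_one]

theorem matDeg_saddleMatrix (hN : 1 ≤ N) {a b a' b' a'' b'' c : P 4 × P 4} (hc : IsWHPair N c) :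
    MatDeg N ((commonMF N).tensor (properMF N a b a'' (polyC N)))
      ((commonMF N).tensor (properMF N a' b' b'' (polyC N))) 0 (2 * N) (saddleMatrix N c) :=
  (MatDeg.one _).kronecker (matDeg_properSaddle hc (isWH_polyC hN)) rfl (zero_add _)

theorem isChain_mulVecLin {ι κ : Type} [Fintype ι] [DecidableEq ι] [Fintype κ] [DecidableEq κ]
    {M : MatFact ι (P n)} {M' : MatFact κ (P n)} {U : Matrix κ ι (P n)} (h : U * M.d = M'.d * U) :
    IsChain (X := M.toDiffMod N) (Y := M'.toDiffMod N) U.mulVecLin :=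
  (Matrix.mulVecLin_mul _ _).symm.trans ((congrArg Matrix.mulVecLin h).trans
    (Matrix.mulVecLin_mul _ _))

theorem GradedIso.symm_chain {X Y : DiffMod n} (φ : GradedIso X Y) :
    IsChain (X := Y) (Y := X) φ.equiv.symm.toLinearMap := by
  refine LinearMap.ext fun y => ?_
  apply φ.equiv.injective
  have h := LinearMap.congr_fun φ.chain (φ.equiv.symm y)
  refine (φ.equiv.apply_symm_apply _).trans ?_
  refine Eq.trans ?_ h.symm
  exact congrArg Y.d (φ.equiv.apply_symm_apply y).symm

namespace Identification

variable (c : Identification N)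

theorem chain_saddle_F : IsChain (X := parKD N) (Y := virKD N) (saddleMatrix N qq).mulVecLin := by
  refine isChain_mulVecLin ?_
  have h := saddleMatrix_d (N := N) pp rr qq
  rwa [properMF_comm pp] at h

theorem chain_saddle_H : IsChain (X := virKD N) (Y := parKD N) (saddleMatrix N qq).mulVecLin := by
  refine isChain_mulVecLin ?_
  have h := saddleMatrix_d (N := N) rr pp qq
  rwa [properMF_comm pp] at h

theorem chain_saddle_G : IsChain (X := virKD N) (Y := horKD N) (saddleMatrix N pp).mulVecLin := by
  refine isChain_mulVecLin ?_
  have h := saddleMatrix_d (N := N) rr qq pp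
  rwa [properMF_comm rr, properMF_comm qq] at h

theorem chain_saddle_G_rev : IsChain (X := horKD N) (Y := virKD N)
    (saddleMatrix N pp).mulVecLin := by
  refine isChain_mulVecLin ?_
  have h := saddleMatrix_d (N := N) qq rr pp
  rwa [properMF_comm rr, properMF_comm qq] at h

theorem F_chain : IsChain c.F := c.φvir.symm_chain.comp (chain_saddle_F.comp c.φpar.chain)

theorem H_chain : IsChain c.H := c.φpar.symm_chain.comp (chain_saddle_H.comp c.φvir.chain)

theorem G_chain : IsChain c.G := c.φhor.symm_chain.comp (chain_saddle_G.comp c.φvir.chain)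

theorem F_deg (hN : 1 ≤ N) : HasDeg 0 (2 * N) c.F :=
  c.φvir.symm_deg.comp (HasDeg.comp (matDeg_saddleMatrix hN (isWHPair_legs 2 3)).hasDeg
    c.φpar.deg rfl (zero_add _)) rfl (add_zero _)

theorem H_deg (hN : 1 ≤ N) : HasDeg 0 (2 * N) c.H :=
  c.φpar.symm_deg.comp (HasDeg.comp (matDeg_saddleMatrix hN (isWHPair_legs 2 3)).hasDeg
    c.φvir.deg rfl (zero_add _)) rfl (add_zero _)

theorem G_deg (hN : 1 ≤ N) : HasDeg 0 (2 * N) c.G :=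
  c.φhor.symm_deg.comp (HasDeg.comp (matDeg_saddleMatrix hN (isWHPair_legs 1 3)).hasDeg
    c.φvir.deg rfl (zero_add _)) rfl (add_zero _)

/-- The reverse of the saddle morphism `G`. -/
def Grev : (horD N).carrier →ₗ[P 4] (virD N).carrier :=
  c.φvir.equiv.symm.toLinearMap ∘ₗ (saddleMatrix N pp).mulVecLin ∘ₗ c.φhor.equiv.toLinearMap

theorem Grev_chain : IsChain c.Grev :=
  c.φvir.symm_chain.comp (chain_saddle_G_rev.comp c.φhor.chain)

theorem Grev_deg (hN : 1 ≤ N) : HasDeg 0 (2 * N) c.Grev :=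
  c.φvir.symm_deg.comp (HasDeg.comp (matDeg_saddleMatrix hN (isWHPair_legs 1 3)).hasDeg
    c.φhor.deg rfl (zero_add _)) rfl (add_zero _)

theorem saddle_saddle (s : P 4 × P 4) (z : Idx → P 4) :
    (saddleMatrix N s).mulVecLin ((saddleMatrix N s).mulVecLin z)
      = (s.2 ^ 2 - s.1 ^ 2 * polyC N) • z := by
  rw [Matrix.mulVecLin_apply, Matrix.mulVecLin_apply, Matrix.mulVec_mulVec, saddleMatrix_sq,
    Matrix.smul_mulVec, Matrix.one_mulVec]

theorem conj_saddle_sq {X Y Z W : DiffMod 4} (φ : GradedIso X Z) (ψ : GradedIso Y W)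
    {S : Z.carrier →ₗ[P 4] W.carrier} {T : W.carrier →ₗ[P 4] Z.carrier} {u : P 4}
    (h : ∀ z, T (S z) = u • z) (x : X.carrier) :
    (φ.equiv.symm.toLinearMap ∘ₗ T ∘ₗ ψ.equiv.toLinearMap)
      ((ψ.equiv.symm.toLinearMap ∘ₗ S ∘ₗ φ.equiv.toLinearMap) x) = u • x := by
  simp only [LinearMap.comp_apply, LinearEquiv.coe_coe, LinearEquiv.apply_symm_apply, h,
    map_smul, LinearEquiv.symm_apply_apply]

theorem F_H (z : (virD N).carrier) : c.F (c.H z) = (qq.2 ^ 2 - qq.1 ^ 2 * polyC N) • z :=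
  conj_saddle_sq c.φvir c.φpar (saddle_saddle qq) z

theorem Grev_G (z : (virD N).carrier) : c.Grev (c.G z) = (pp.2 ^ 2 - pp.1 ^ 2 * polyC N) • z :=
  conj_saddle_sq c.φvir c.φhor (saddle_saddle pp) z

end Identification

/-- A null-homotopic multiplication lies in every kernel that contains the differential. -/
theorem map_eq_zero_of_homotopic {ι : Type} [Fintype ι] [DecidableEq ι] [Nonempty ι]
    {M : MatFact ι (P n)} {S : Type} [CommRing S] (ρ : P n →+* S) (hρ : ∀ i j, ρ (M.d i j) = 0)
    {u : P n} {k : ℤ} (h : Homotopic (X := M.toDiffMod N) (Y := M.toDiffMod N) N k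
      (u • LinearMap.id) 0) : ρ u = 0 := by
  obtain ⟨h, -, e⟩ := h
  obtain ⟨i⟩ := ‹Nonempty ι›
  let H : (ι → P n) →ₗ[P n] (ι → P n) := h
  have e' : ∀ z : ι → P n, u • z - 0 = M.d.mulVec (H z) + H (M.d.mulVec z) := fun z =>
    LinearMap.congr_fun e z
  have h1 := congrArg ρ (congrFun (e' (Pi.single i 1)) i)
  have h2 : H (M.d.mulVec (Pi.single i 1)) i = ∑ j, M.d j i * H (Pi.single j 1) i := by
    conv_lhs => rw [pi_eq_sum_univ' (M.d.mulVec (Pi.single i 1)), map_sum, Finset.sum_apply]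
    refine Finset.sum_congr rfl fun j _ => ?_
    rw [map_smul, Pi.smul_apply, smul_eq_mul, Matrix.mulVec_single_one]
    rfl
  rw [Pi.add_apply, map_add, h2, sub_zero, Pi.smul_apply, Pi.single_eq_same, smul_eq_mul, mul_one,
    Matrix.mulVec, dotProduct, map_sum, map_sum] at h1
  simpa [hρ] using h1

/-- The algebra `ℚ[ε₁, ε₂] / (ε₁², ε₂²)`. -/
def TwoDual : Type := DualNumber (DualNumber ℚ)

instance : CommRing TwoDual := inferInstanceAs (CommRing (DualNumber (DualNumber ℚ)))

/-- The first square-zero element. -/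
def eps₁ : TwoDual :=
  (TrivSqZeroExt.inl (DualNumber.eps : DualNumber ℚ) : DualNumber (DualNumber ℚ))

/-- The second square-zero element. -/
def eps₂ : TwoDual := (DualNumber.eps : DualNumber (DualNumber ℚ))

theorem eps₁_sq : eps₁ * eps₁ = 0 :=
  (TrivSqZeroExt.inl_mul (DualNumber ℚ) (DualNumber.eps : DualNumber ℚ) DualNumber.eps).symm.trans
    (by rw [DualNumber.eps_mul_eps]; rfl)

theorem eps₂_sq : eps₂ * eps₂ = 0 := DualNumber.eps_mul_eps

theorem two_eps_ne_zero : 2 * (eps₁ * eps₂) ≠ 0 := by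
  intro h
  rw [two_mul] at h
  have h1 : TrivSqZeroExt.snd (TrivSqZeroExt.snd
      (TrivSqZeroExt.inl DualNumber.eps * DualNumber.eps : DualNumber (DualNumber ℚ))) = (1 : ℚ) := by
    rw [TrivSqZeroExt.snd_mul]
    simp
  have h2 : (1 : ℚ) + 1 = 0 := (congrArg₂ (· + ·) h1 h1).symm.trans (congrArg
    (fun z : DualNumber (DualNumber ℚ) => (TrivSqZeroExt.snd (TrivSqZeroExt.snd z) : ℚ)) h)
  norm_num at h2

/-- The point at which all arcs `1–4`, `2–3` become trivial. -/
def virPoint : P 4 →+* TwoDual :=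
  -- At `x = 0` and `y = (ε₁, ε₂, -ε₂, -ε₁)` the left entries of the arcs 1–4 and 2–3 vanish because
  -- their legs are opposite; the right entries vanish because `x = 0` and the squares of `ε₁`, `ε₂`
  -- are zero.
  MvPolynomial.eval₂Hom ((TrivSqZeroExt.inlHom (DualNumber ℚ) (DualNumber ℚ)).comp
    (TrivSqZeroExt.inlHom ℚ ℚ)) (Sum.elim 0 ![eps₁, eps₂, -eps₂, -eps₁])

theorem virPoint_xv (i : Fin 4) : virPoint (xv i) = 0 :=
  MvPolynomial.eval₂_X _ _ _

theorem virPoint_yv (i : Fin 4) : virPoint (yv i) = ![eps₁, eps₂, -eps₂, -eps₁] i :=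
  MvPolynomial.eval₂_X _ _ _

/-- `N ≥ 1` is needed for `w(0,0) = (2N+1)·0²ᴺ = 0`. -/
theorem arc_d_eq_zero {S : Type} [CommRing S] (hN : 1 ≤ N) {y : S} (hy : y * y = 0) :
    (arc N 0 y 0 (-y)).d = 0 := by
  have h : dd N [(0 : S), 0] = 0 := by
    rw [← neg_zero, dd_neg_neg, neg_zero, zero_pow (by omega), mul_zero]
  simp only [arc, MatFact.tensor_d, row_d, neg_zero, h, zero_mul, neg_add_cancel, add_zero, sq, hy,
    zero_smul, Matrix.zero_kronecker, Matrix.kronecker_zero]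

theorem virPoint_d (hN : 1 ≤ N) (i j : Idx) : virPoint ((virMF N).d i j) = 0 := by
  have h1 : ((arc (S := P 4) N (xv 0) (yv 0) (xv 3) (yv 3)).d).map virPoint = 0 := by
    refine (arc_d_map virPoint _ _ _ _).trans ?_
    simp only [virPoint_xv, virPoint_yv]
    exact arc_d_eq_zero hN eps₁_sq
  have h2 : ((arc (S := P 4) N (xv 1) (yv 1) (xv 2) (yv 2)).d).map virPoint = 0 := by
    refine (arc_d_map virPoint _ _ _ _).trans ?_
    simp only [virPoint_xv, virPoint_yv]
    exact arc_d_eq_zero hN eps₂_sq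
  have h1' := fun k l => congrFun (congrFun h1 k) l
  have h2' := fun k l => congrFun (congrFun h2 k) l
  simp only [Matrix.map_apply, Matrix.zero_apply] at h1' h2'
  rw [virMF, MatFact.tensor_d, Matrix.add_apply, Matrix.kroneckerMap_apply,
    Matrix.kroneckerMap_apply, map_add, map_mul, map_mul, h1', h2', zero_mul, mul_zero, add_zero]

namespace Identification

variable (c : Identification N)

theorem not_homotopic_vir (hN : 1 ≤ N) {u : P 4} (hu : virPoint u ≠ 0) {k : ℤ}
    {f : (virD N).carrier →ₗ[P 4] (virD N).carrier} (hf : ∀ z, f z = u • z) :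
    ¬ Homotopic N k f 0 := by
  intro h
  have e : f = u • LinearMap.id := LinearMap.ext hf
  rw [e] at h
  exact hu (map_eq_zero_of_homotopic virPoint (virPoint_d hN) h)

/-- The term with `C̃` disappears with `x`, and `(ε₁ + ε₂)² = 2ε₁ε₂`. -/
theorem virPoint_qq : virPoint (qq.2 ^ 2 - qq.1 ^ 2 * polyC N) ≠ 0 := by
  have h : virPoint (qq.2 ^ 2 - qq.1 ^ 2 * polyC N)
      = 2 * (eps₁ * eps₂) := by
    simp only [qq, map_sub, map_mul, map_pow, map_add, virPoint_xv, virPoint_yv, Matrix.cons_val]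
    linear_combination eps₁_sq + eps₂_sq
  rw [h]
  exact two_eps_ne_zero

theorem virPoint_pp : virPoint (pp.2 ^ 2 - pp.1 ^ 2 * polyC N) ≠ 0 := by
  have h : virPoint (pp.2 ^ 2 - pp.1 ^ 2 * polyC N)
      = -(2 * (eps₁ * eps₂)) := by
    simp only [pp, map_sub, map_mul, map_pow, map_add, virPoint_xv, virPoint_yv, Matrix.cons_val]
    linear_combination eps₁_sq + eps₂_sq
  rw [h]
  exact neg_ne_zero.2 two_eps_ne_zero

/-- If `F` or `H` were null-homotopic, so would be `F ∘ H`, a multiplication on `Γ_×` which is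
nonzero at a point where the differential vanishes. For `G` the same argument uses the saddle back
from `Γ_=`. -/
theorem isSaddle_F (hN : 1 ≤ N) : IsSaddle N c.F := by
  refine ⟨c.F_chain, c.F_deg hN, fun h => ?_⟩
  have h1 := Homotopic.comp_right h c.H_chain (c.H_deg hN) rfl
  rw [LinearMap.zero_comp] at h1
  exact not_homotopic_vir hN virPoint_qq (f := c.F ∘ₗ c.H) c.F_H h1

theorem isSaddle_H (hN : 1 ≤ N) : IsSaddle N c.H := by
  refine ⟨c.H_chain, c.H_deg hN, fun h => ?_⟩
  have h1 := Homotopic.comp_left h c.F_chain (c.F_deg hN) rfl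
  rw [LinearMap.comp_zero] at h1
  exact not_homotopic_vir hN virPoint_qq (f := c.F ∘ₗ c.H) c.F_H h1

theorem isSaddle_G (hN : 1 ≤ N) : IsSaddle N c.G := by
  refine ⟨c.G_chain, c.G_deg hN, fun h => ?_⟩
  have h1 := Homotopic.comp_left h c.Grev_chain (c.Grev_deg hN) rfl
  rw [LinearMap.comp_zero] at h1
  exact not_homotopic_vir hN virPoint_pp (f := c.Grev ∘ₗ c.G) c.Grev_G h1

end Identification

end Saddles

/-! ### The action of all legs on factorizations with two joined legs -/

section SemiClosed

open MvPolynomial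

variable {n N : ℕ} {ι κ : Type} [Fintype ι] [DecidableEq ι] [Fintype κ] [DecidableEq κ]
  {X Y Z : DiffMod 4}

theorem semi_ext {C : DiffMod 2} {f g : (semi X).carrier →ₗ[P 2] C.carrier}
    (h : ∀ m : X.carrier, f (joinMk (X := X) 1 3 m) = g (joinMk (X := X) 1 3 m)) : f = g := by
  refine LinearMap.ext fun z => ?_
  obtain ⟨m, rfl⟩ := Submodule.Quotient.mk_surjective _ z
  exact h m

theorem semiMap_comp (g : Y.carrier →ₗ[P 4] Z.carrier) (f : X.carrier →ₗ[P 4] Y.carrier) :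
    semiMap (X := X) (Y := Z) (g ∘ₗ f) = semiMap g ∘ₗ semiMap f :=
  semi_ext fun _ => rfl

theorem semiMap_isChain {f : X.carrier →ₗ[P 4] Y.carrier} (hf : IsChain f) :
    IsChain (X := semi X) (Y := semi Y) (semiMap f) :=
  semi_ext fun m => congrArg (joinMk (X := Y) 1 3) (LinearMap.congr_fun hf m)

theorem semiMap_hasDeg {f : X.carrier →ₗ[P 4] Y.carrier} {s : ZMod 2} {k : ℤ} (hf : HasDeg s k f) :
    HasDeg (X := semi X) (Y := semi Y) s k (semiMap f) := by
  rintro p a _ ⟨m, hm, rfl⟩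
  exact ⟨f m, hf p a m hm, rfl⟩

theorem semiMap_homotopic {f g : X.carrier →ₗ[P 4] Y.carrier} {k : ℤ} (h : Homotopic N k f g) :
    Homotopic (X := semi X) (Y := semi Y) N k (semiMap f) (semiMap g) := by
  obtain ⟨u, hu, e⟩ := h
  exact ⟨semiMap u, semiMap_hasDeg hu, semi_ext fun m =>
    congrArg (joinMk (X := Y) 1 3) (LinearMap.congr_fun e m)⟩

/-- The action of the polynomials in all legs on a factorization with joined legs. -/
def semiAct (X : DiffMod 4) (f : P 4) : (semi X).carrier →ₗ[P 2] (semi X).carrier :=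
  semiMap (f • LinearMap.id : X.carrier →ₗ[P 4] X.carrier)

theorem semiAct_comm (f : P 4) (g : X.carrier →ₗ[P 4] Y.carrier) :
    semiMap g ∘ₗ semiAct X f = semiAct Y f ∘ₗ semiMap g :=
  semi_ext fun m => congrArg (joinMk (X := Y) 1 3) (g.map_smul f m)

theorem semiAct_mul (f g : P 4) : semiAct X (f * g) = semiAct X f ∘ₗ semiAct X g :=
  semi_ext fun m => congrArg (joinMk (X := X) 1 3) (mul_smul f g m)

theorem semiAct_add (f g : P 4) : semiAct X (f + g) = semiAct X f + semiAct X g :=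
  semi_ext fun m => congrArg (joinMk (X := X) 1 3) (add_smul f g m)

theorem semiAct_legHom (f : P 2) : semiAct X (legHom ![0, 2] f) = f • LinearMap.id :=
  semi_ext fun _ => rfl

theorem semiAct_isChain (f : P 4) : IsChain (X := semi X) (Y := semi X) (semiAct X f) :=
  semiMap_isChain (IsChain.id.smul f)

theorem hasDeg_smul_id {M : MatFact ι (P n)} {f : P n} {k : ℤ} (hf : IsWH N f k) :
    HasDeg (X := M.toDiffMod N) (Y := M.toDiffMod N) 0 k (f • LinearMap.id) := by
  have h := ((MatDeg.one M).smul hf (zero_add k)).hasDeg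
  have e : (f • (1 : Matrix ι ι (P n))).mulVecLin = f • LinearMap.id := by
    refine LinearMap.ext fun z => ?_
    rw [Matrix.mulVecLin_apply, Matrix.smul_mulVec, Matrix.one_mulVec]
    rfl
  exact e ▸ h

theorem semiAct_hasDeg {M : MatFact Idx (P 4)} {f : P 4} {k : ℤ} (hf : IsWH N f k) :
    HasDeg (X := semi (M.toDiffMod N)) (Y := semi (M.toDiffMod N)) 0 k
      (semiAct (M.toDiffMod N) f) :=
  semiMap_hasDeg (hasDeg_smul_id hf)

theorem semiAct_eq_zero {f : P 4} (hf : f ∈ joinIdeal (1 : Fin 4) 3) : semiAct X f = 0 :=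
  semi_ext fun m => (Submodule.Quotient.mk_eq_zero _).2
    (Submodule.smul_mem_smul hf (Submodule.mem_top (x := m)))

/-- The multiplication by `a` is null-homotopic by an odd matrix. -/
def IsNullMul (N : ℕ) (M : MatFact ι (P n)) (a : P n) (k : ℤ) : Prop :=
  ∃ Θ, M.sign * Θ = -(Θ * M.sign) ∧ MatDeg N M M 1 (k - (2 * N + 1)) Θ ∧
    M.d * Θ + Θ * M.d = a • (1 : Matrix ι ι (P n))

theorem IsNullMul.row {a b : P n} {κ k : ℤ} (h : k = 2 * N + 1 + κ) :
    IsNullMul N (SaddleMF.row a b κ) a k :=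
  ⟨cre (P n), sign_row_mul_cre _ _ _, by rw [h, add_sub_cancel_left]; exact matDeg_cre,
    row_d_anti_cre _ _ _⟩

theorem IsNullMul.left {M : MatFact ι (P n)} {a : P n} {k : ℤ} (h : IsNullMul N M a k)
    (M' : MatFact κ (P n)) : IsNullMul N (M.tensor M') a k := by
  obtain ⟨Θ, h1, h2, h3⟩ := h
  refine ⟨Θ ⊗ₖ 1, ?_, h2.kronecker (MatDeg.one _) (add_zero _) (add_zero _),
    tensor_anti_left M M' h1 h3⟩
  rw [tensor_sign, ← Matrix.mul_kronecker_mul, ← Matrix.mul_kronecker_mul, h1, kronecker_neg_left,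
    mul_one, one_mul]

theorem IsNullMul.right {M' : MatFact κ (P n)} {a : P n} {k : ℤ} (h : IsNullMul N M' a k)
    (M : MatFact ι (P n)) : IsNullMul N (M.tensor M') a k := by
  obtain ⟨Θ, h1, h2, h3⟩ := h
  refine ⟨M.sign ⊗ₖ Θ, ?_, (MatDeg.sign _).kronecker h2 (zero_add _) (zero_add _),
    tensor_anti_right M M' h3⟩
  rw [tensor_sign, ← Matrix.mul_kronecker_mul, ← Matrix.mul_kronecker_mul, h1, kronecker_neg_right]

theorem isNullMul_arc_x (x₁ y₁ x₂ y₂ : P n) : IsNullMul N (arc N x₁ y₁ x₂ y₂) (x₂ + x₁) 2 :=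
  (IsNullMul.row (by ring)).right _

theorem isNullMul_arc_y (x₁ y₁ x₂ y₂ : P n) : IsNullMul N (arc N x₁ y₁ x₂ y₂) (y₂ + y₁) (2 * N) :=
  (IsNullMul.row (by ring)).left _

theorem IsNullMul.homotopic {M : MatFact ι (P n)} {a : P n} {k : ℤ} (h : IsNullMul N M a k) :
    Homotopic (X := M.toDiffMod N) (Y := M.toDiffMod N) N k (a • LinearMap.id) 0 := by
  obtain ⟨Θ, -, h2, h3⟩ := h
  refine ⟨Θ.mulVecLin, h2.hasDeg, LinearMap.ext fun (z : ι → P n) => ?_⟩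
  change a • z - 0 = M.d.mulVec (Θ.mulVec z) + Θ.mulVec (M.d.mulVec z)
  rw [Matrix.mulVec_mulVec, Matrix.mulVec_mulVec, ← Matrix.add_mulVec, h3, Matrix.smul_mulVec,
    Matrix.one_mulVec, sub_zero]

theorem IsNullMul.semiAct {M : MatFact Idx (P 4)} {a : P 4} {k : ℤ} (h : IsNullMul N M a k) :
    Homotopic N k (semiAct (M.toDiffMod N) a) 0 :=
  (semiMap_homotopic h.homotopic).trans (Homotopic.of_eq (semi_ext fun _ => rfl))

/-- Homogeneous elements of an ideal generated by null-homotopic elements are null-homotopic. -/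
theorem semiAct_null {M : MatFact Idx (P 4)} {I : Type} [Fintype I] [DecidableEq I] {a : I → P 4}
    {δ : I → ℤ} (ha : ∀ i, IsWH N (a i) (δ i))
    (hn : ∀ i, Homotopic N (δ i) (semiAct (M.toDiffMod N) (a i)) 0) {f : P 4} {k : ℤ}
    (hf : IsWH N f k) (hmem : f ∈ Ideal.span (Set.range a)) :
    Homotopic N k (semiAct (M.toDiffMod N) f) 0 := by
  rw [← Set.image_univ, ← Finset.coe_univ] at hmem
  obtain ⟨m, hm, rfl⟩ := exists_homogeneous_of_mem_span_image hf ha hmem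
  have h : ∀ s : Finset I, Homotopic N k (semiAct (M.toDiffMod N) (∑ i ∈ s, m i * a i)) 0 := by
    intro s
    induction s using Finset.induction_on with
    | empty =>
      refine Homotopic.of_eq ?_
      rw [Finset.sum_empty]
      exact semiAct_eq_zero (Ideal.zero_mem _)
    | insert i s hi ih =>
      rw [Finset.sum_insert hi, semiAct_add, semiAct_mul]
      have h1 := (hn i).comp_left (semiAct_isChain (m i)) (semiAct_hasDeg (hm i))
        (add_sub_cancel (δ i) k)
      rw [LinearMap.comp_zero] at h1
      have := h1.add ih
      rwa [add_zero] at this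
  exact h Finset.univ

theorem semiAct_sub (f g : P 4) : semiAct X (f - g) + semiAct X g = semiAct X f := by
  rw [← semiAct_add, sub_add_cancel]

/-- The null-homotopic operators on the arcs `1–4`, `2–3` with the legs 2 and 4 joined. -/
def virNull : Fin 6 → P 4 :=
  ![xv 1 + xv 3, yv 1 + yv 3, xv 3 + xv 0, yv 3 + yv 0, xv 2 + xv 1, yv 2 + yv 1]

theorem semiAct_vir_null {f : P 4} {k : ℤ} (hf : IsWH N f k)
    (hmem : f ∈ Ideal.span (Set.range virNull)) : Homotopic N k (semiAct (virD N) f) 0 := by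
  refine semiAct_null (M := virMF N) (a := virNull) (δ := ![2, 2 * N, 2, 2 * N, 2, 2 * N]) ?_ ?_ hf
    hmem
  · intro i
    fin_cases i
    exacts [(isWH_xv 1).add (isWH_xv 3), (isWH_yv 1).add (isWH_yv 3), (isWH_xv 3).add (isWH_xv 0),
      (isWH_yv 3).add (isWH_yv 0), (isWH_xv 2).add (isWH_xv 1), (isWH_yv 2).add (isWH_yv 1)]
  · intro i
    fin_cases i
    exacts [Homotopic.of_eq (semiAct_eq_zero (xv_add_mem 1 3)),
      Homotopic.of_eq (semiAct_eq_zero (yv_add_mem 1 3)),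
      ((isNullMul_arc_x _ _ _ _).left _).semiAct,
      ((isNullMul_arc_y _ _ _ _).left _).semiAct,
      ((isNullMul_arc_x _ _ _ _).right _).semiAct,
      ((isNullMul_arc_y _ _ _ _).right _).semiAct]

/-- The value of a polynomial on the arcs `1–4`, `2–3` with the legs 2 and 4 joined. -/
def virEval : P 4 →ₐ[ℚ] P 1 :=
  subst ![xv 0, xv 0, -xv 0, -xv 0] ![yv 0, yv 0, -yv 0, -yv 0]

theorem IsWH.virEval {f : P 4} {k : ℤ} (hf : IsWH N f k) : IsWH N (SaddleMF.virEval f) k := by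
  refine IsWH.subst (fun i => ?_) (fun i => ?_) hf
  · fin_cases i
    exacts [isWH_xv 0, isWH_xv 0, (isWH_xv 0).neg, (isWH_xv 0).neg]
  · fin_cases i
    exacts [isWH_yv 0, isWH_yv 0, (isWH_yv 0).neg, (isWH_yv 0).neg]

theorem legHom_legHom {k m : ℕ} (f : Fin k → Fin m) (g : Fin m → Fin n) (p : P k) :
    legHom g (legHom f p) = legHom (g ∘ f) p := by
  have : (legHom g).comp (legHom f) = legHom (g ∘ f) :=
    algHom_ext_legs (fun i => by simp [legHom_xv]) (fun i => by simp [legHom_yv])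
  exact DFunLike.congr_fun this p

theorem virEval_legHom (f : P 1) : virEval (legHom ![1] f) = f := by
  have : virEval.comp (legHom ![1]) = AlgHom.id ℚ (P 1) := by
    refine algHom_ext_legs (fun i => ?_) (fun i => ?_) <;>
      fin_cases i <;> simp [virEval, legHom_xv, legHom_yv]
  exact DFunLike.congr_fun this f

/-- On the joined `Γ_×` the relations `x₄ = -x₂`, `x₄ = -x₁`, `x₃ = -x₂` hold up to homotopy, and
likewise for `y`. So every leg acts like leg 1 with the signs `+, +, -, -`. -/
theorem sub_virEval_mem (f : P 4) :
    f - legHom ![0] (virEval f) ∈ Ideal.span (Set.range virNull) := by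
  have hm : ∀ i, virNull i ∈ Ideal.span (Set.range virNull) := fun i =>
    Ideal.subset_span (Set.mem_range_self i)
  have key : ∀ (v : Fin 4 → P 4), v 1 + v 3 ∈ Ideal.span (Set.range virNull) →
      v 3 + v 0 ∈ Ideal.span (Set.range virNull) → v 2 + v 1 ∈ Ideal.span (Set.range virNull) →
      ∀ i : Fin 4, v i - ![v 0, v 0, -v 0, -v 0] i ∈ Ideal.span (Set.range virNull) := by
    intro v h1 h2 h3 i
    fin_cases i
    · simp
    · have : v 1 - v 0 = (v 1 + v 3) - (v 3 + v 0) := by ring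
      exact this ▸ Ideal.sub_mem _ h1 h2
    · have : v 2 - -v 0 = (v 2 + v 1) - (v 1 + v 3) + (v 3 + v 0) := by ring
      exact this ▸ Ideal.add_mem _ (Ideal.sub_mem _ h3 h1) h2
    · have : v 3 - -v 0 = v 3 + v 0 := by ring
      exact this ▸ h2
  refine algHom_sub_mem (AlgHom.id ℚ (P 4)) ((legHom ![0]).comp virEval) (fun i => ?_) (fun i => ?_) f
  · have e : ((legHom (![0] : Fin 1 → Fin 4)).comp virEval) (xv i : P 4) = ![xv 0, xv 0, -xv 0, -xv 0] i := by
      fin_cases i <;> simp [virEval, legHom_xv]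
    rw [e]
    exact key xv (hm 0) (hm 2) (hm 4) i
  · have e : ((legHom (![0] : Fin 1 → Fin 4)).comp virEval) (yv i : P 4) = ![yv 0, yv 0, -yv 0, -yv 0] i := by
      fin_cases i <;> simp [virEval, legHom_yv]
    rw [e]
    exact key yv (hm 1) (hm 3) (hm 5) i

theorem semiAct_vir {f : P 4} {k : ℤ} (hf : IsWH N f k) : Homotopic N k (semiAct (virD N) f)
    ((legHom ![0] (virEval f) : P 2) • LinearMap.id) := by
  have h := semiAct_vir_null (hf.sub (IsWH.legHom ![0] hf.virEval)) (sub_virEval_mem f)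
  have h1 := h.add (Homotopic.refl (semiAct (virD N) (legHom ![0] (virEval f))))
  rw [semiAct_sub, zero_add] at h1
  refine h1.trans (Homotopic.of_eq ?_)
  rw [← semiAct_legHom, legHom_legHom,
    show (![0, 2] : Fin 2 → Fin 4) ∘ (![0] : Fin 1 → Fin 2) = ![0] by decide]

theorem semiAct_vir_legHom {f : P 1} {k : ℤ} (hf : IsWH N f k) :
    Homotopic N k (semiAct (virD N) (legHom ![1] f)) ((legHom ![0] f : P 2) • LinearMap.id) := by
  have h := semiAct_vir (IsWH.legHom ![1] hf)
  rwa [virEval_legHom] at h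

/-- On the joined `Γ_=` the middle leg acts as minus leg 1, opposite to its action on the joined
`Γ_×`. This sign forces `G'` to vanish. -/
theorem semiAct_hor_xv : Homotopic N 2 (semiAct (horD N) (xv 1)) (-(xv 0 : P 2) • LinearMap.id) := by
  have h : Homotopic N 2 (semiAct (horD N) (xv 1 + xv 0)) 0 :=
    ((isNullMul_arc_x _ _ _ _).left _).semiAct
  have h1 := h.add (Homotopic.refl (semiAct (horD N) (legHom ![0, 2] (-xv 0))))
  rw [← semiAct_add, zero_add, semiAct_legHom] at h1
  convert h1 using 2
  rw [map_neg, legHom_xv]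
  simp

theorem semiAct_hor_yv :
    Homotopic N (2 * N) (semiAct (horD N) (yv 1)) (-(yv 0 : P 2) • LinearMap.id) := by
  have h : Homotopic N (2 * N) (semiAct (horD N) (yv 1 + yv 0)) 0 :=
    ((isNullMul_arc_y _ _ _ _).left _).semiAct
  have h1 := h.add (Homotopic.refl (semiAct (horD N) (legHom ![0, 2] (-yv 0))))
  rw [← semiAct_add, zero_add, semiAct_legHom] at h1
  convert h1 using 2
  rw [map_neg, legHom_yv]
  simp

end SemiClosed

/-! ### How the semi-closed saddles carry the variables of the middle leg -/

section SemiClosedSaddles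

open MvPolynomial

variable {n N : ℕ}

theorem weight_nonneg (s : Fin n ⊕ Fin n →₀ ℕ) : 0 ≤ Finsupp.weight (wt N n) s := by
  rw [Finsupp.weight_apply]
  refine Finset.sum_nonneg fun i _ => nsmul_nonneg ?_ _
  rcases i with i | i <;> simp [wt]

theorem IsWH.eq_zero_of_neg {f : P n} {k : ℤ} (hf : IsWH N f k) (hk : k < 0) : f = 0 := by
  ext s
  by_contra h
  rw [coeff_zero] at h
  have := weight_nonneg (N := N) s
  rw [hf h] at this
  omega

/-- For `N ≥ 1` all variables have positive degree. -/
theorem IsWH.eq_C (hN : 1 ≤ N) {f : P n} (hf : IsWH N f 0) : ∃ r : ℚ, f = C r := by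
  refine ⟨coeff 0 f, ?_⟩
  ext s
  rw [coeff_C]
  split_ifs with hs
  · rw [hs]
  · by_contra h
    have h1 := hf h
    rw [Finsupp.weight_apply, Finsupp.sum, Finset.sum_eq_zero_iff_of_nonneg] at h1
    · refine hs (Finsupp.ext fun i => ?_).symm
      by_contra hi
      have h2 := h1 i (Finsupp.mem_support_iff.2 hi)
      rw [nsmul_eq_mul, mul_eq_zero] at h2
      rcases h2 with h2 | h2
      · exact hi (by exact_mod_cast h2)
      · rcases i with i | i
        · simp [wt] at h2
        · simp [wt] at h2
          omega
    · intro i _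
      refine nsmul_nonneg ?_ _
      rcases i with i | i <;> simp [wt]

/-- By the resolution of the identity, a map out of `arc ⊗ Unk` is the sum of its restrictions to
basis vectors composed with homogeneous contractions, which are chain maps. -/
theorem arcUnk_homotopic (hN : 1 ≤ N) {Z : DiffMod 2} {g g' : (arcUnk N).carrier →ₗ[P 2] Z.carrier}
    {k : ℤ} (h : ∀ i, Homotopic N (jacDeg N i - 2 * N + k) (g ∘ₗ tens N (unkBasis hN i))
      (g' ∘ₗ tens N (unkBasis hN i))) : Homotopic N k g g' := by
  have e : ∀ g : (arcUnk N).carrier →ₗ[P 2] Z.carrier, g = ∑ i,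
      (g ∘ₗ tens N (unkBasis hN i)) ∘ₗ contract N ((unkBasis hN).coord i) := by
    intro g
    refine LinearMap.ext fun t => ?_
    conv_lhs => rw [arcUnk_eq_sum (unkBasis hN) t, map_sum]
    rw [LinearMap.sum_apply]
    rfl
  rw [e g, e g']
  exact Homotopic.sum _ fun i _ => (h i).comp_right (contract_isChain _)
    (contract_coord_hasDeg hN i) (by ring)

theorem into_arcUnk_eq_sum (hN : 1 ≤ N) {Z : DiffMod 2}
    (g : Z.carrier →ₗ[P 2] (arcUnk N).carrier) : g = ∑ i,
      tens N (unkBasis hN i) ∘ₗ contract N ((unkBasis hN).coord i) ∘ₗ g := by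
  refine LinearMap.ext fun t => ?_
  conv_lhs => rw [arcUnk_eq_sum (unkBasis hN) (g t)]
  rw [LinearMap.sum_apply]
  rfl

theorem glue_smul (f : P 1) (v : (arcD N).carrier) : glue N ((legHom ![0] f : P 2) • v)
    = semiAct (parD N) (legHom ![1] f) ∘ₗ glue N v := by
  refine LinearMap.ext fun (m : Fin 2 × Fin 2 → P 2) => ?_
  refine congrArg (joinMk (X := parD N) 1 3) (funext fun ij => ?_)
  change legHom ![0, 2] (m ij.1)
      * legHom ![1, 3] (legHom ![0] f * (show Fin 2 × Fin 2 → P 2 from v) ij.2)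
    = legHom ![1] f * (legHom ![0, 2] (m ij.1)
      * legHom ![1, 3] ((show Fin 2 × Fin 2 → P 2 from v) ij.2))
  rw [map_mul, legHom_legHom, show (![1, 3] : Fin 2 → Fin 4) ∘ (![0] : Fin 1 → Fin 2) = ![1] by decide]
  ring

section Abstract

variable {A A' U X V : DiffMod n} {k l j r : ℤ} {f : P n}

/-- An operator `x` on the source of `s` is carried through `s` to `v`, and `v` is homotopic to a
scalar. So twisting the input by `x` multiplies the whole composite by that scalar. -/
theorem homotopic_comp_smul {b : V.carrier →ₗ[P n] A.carrier} {s : X.carrier →ₗ[P n] V.carrier}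
    {a : U.carrier →ₗ[P n] X.carrier} {x : X.carrier →ₗ[P n] X.carrier}
    {v : V.carrier →ₗ[P n] V.carrier} {t t' : A.carrier →ₗ[P n] U.carrier}
    (hb : IsChain b) (hbd : HasDeg 0 0 b) (hs : IsChain s) (hsd : HasDeg 0 l s)
    (ha : IsChain a) (had : HasDeg 0 0 a) (ht : IsChain t) (htd : HasDeg 0 j t)
    (h : Homotopic (X := A) (Y := X) N (k + j) (a ∘ₗ t') (x ∘ₗ a ∘ₗ t)) (hx : s ∘ₗ x = v ∘ₗ s)
    (hv : Homotopic (X := V) (Y := V) N k v (f • LinearMap.id)) (hr : r = k + j + l) :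
    Homotopic (X := A) (Y := A) N r ((b ∘ₗ s ∘ₗ a) ∘ₗ t') (f • ((b ∘ₗ s ∘ₗ a) ∘ₗ t)) := by
  subst hr
  have h1 := h.comp_left hs hsd rfl
  have h2 := hv.comp_right (hs.comp (ha.comp ht)) (HasDeg.comp hsd (HasDeg.comp had htd rfl rfl) rfl
    rfl) (l := k + j + l) (by ring)
  have e : s ∘ₗ x ∘ₗ a ∘ₗ t = v ∘ₗ s ∘ₗ a ∘ₗ t := congrArg (· ∘ₗ (a ∘ₗ t)) hx
  rw [e] at h1
  refine ((h1.trans h2).comp_left hb hbd (add_zero _)).trans (Homotopic.of_eq ?_)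
  exact LinearMap.ext fun m => b.map_smul f _

/-- The dual of `homotopic_comp_smul`: the operator acts on the output of `s` and is carried back to
its source, where it is a scalar. -/
theorem homotopic_smul_comp {g : U.carrier →ₗ[P n] A.carrier} {α : V.carrier →ₗ[P n] U.carrier}
    {s : X.carrier →ₗ[P n] V.carrier} {a : A'.carrier →ₗ[P n] X.carrier}
    {g' : U.carrier →ₗ[P n] A.carrier}
    {x : X.carrier →ₗ[P n] X.carrier} {v : V.carrier →ₗ[P n] V.carrier}
    (hg : IsChain g) (hgd : HasDeg 0 l g) (hα : IsChain α) (hαd : HasDeg 0 0 α)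
    (hs : IsChain s) (hsd : HasDeg 0 j s)
    (ha : IsChain a) (had : HasDeg 0 0 a)
    (h : Homotopic (X := V) (Y := A) N (k + l) (g' ∘ₗ α) (g ∘ₗ α ∘ₗ v)) (hx : s ∘ₗ x = v ∘ₗ s)
    (hv : Homotopic (X := X) (Y := X) N k x (f • LinearMap.id)) (hr : r = k + l + j) :
    Homotopic (X := A') (Y := A) N r (g' ∘ₗ (α ∘ₗ s ∘ₗ a)) (f • (g ∘ₗ (α ∘ₗ s ∘ₗ a))) := by
  subst hr
  have h1 := h.comp_right (hs.comp ha) (HasDeg.comp hsd had rfl (zero_add _)) rfl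
  have h2 := (hv.comp_right ha had (add_zero _)).comp_left (hg.comp (hα.comp hs))
    (HasDeg.comp hgd (HasDeg.comp hαd hsd rfl rfl) rfl rfl) (l := k + l + j) (by ring)
  have e : (g ∘ₗ α ∘ₗ v) ∘ₗ s ∘ₗ a = (g ∘ₗ α ∘ₗ s) ∘ₗ x ∘ₗ a :=
    (congrArg (fun t => g ∘ₗ α ∘ₗ t ∘ₗ a) hx).symm
  rw [e] at h1
  refine h1.trans (h2.trans (Homotopic.of_eq ?_))
  exact LinearMap.ext fun m => (g ∘ₗ α ∘ₗ s).map_smul f _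

end Abstract

namespace Identification

variable (c : Identification N)

/-- Here the condition `α_cycle` enters: the class of `f` times the top generator and the top class
itself correspond to glued cycles, and gluing turns the factor `f` into the action of the middle
leg. -/
theorem α_inv_topCls {f : P 1} {k : ℤ} (hf : IsWH N f k) : Homotopic N (k + -(2 * N))
    (c.α.inv ∘ₗ tens N ((legHom ![0] f : P 2) • topCls N))
    (semiAct (parD N) (legHom ![1] f) ∘ₗ c.α.inv ∘ₗ tens N (topCls N)) := by
  have hz : ((arcD N).join 0 1).d (joinMk 0 1 ((legHom ![0] f : P 2) • topGen)) = 0 := by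
    refine (((arcD N).join 0 1).d.map_smul (legHom ![0] f : P 2) (joinMk 0 1 topGen)).trans ?_
    rw [topGen_cycle, smul_zero]
  have h1 := c.α_cycle (k - 2 * N) ((legHom ![0] f : P 2) • topGen)
    (isWH_mem_topGen _ (IsWH.legHom _ hf)) hz
  have h2 := c.α_cycle (-(2 * N)) topGen (by
    have := isWH_mem_topGen (N := N) (1 : P 2) isWH_one
    rwa [one_smul, zero_sub] at this) (topGen_cycle N)
  exact (h1.trans (Homotopic.of_eq (glue_smul f topGen))).trans (h2.symm.comp_left (semiAct_isChain _) (semiAct_hasDeg (IsWH.legHom _ hf))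
    (by ring))

theorem F'_chain : IsChain c.F' := c.β.hom_chain.comp ((semiMap_isChain c.F_chain).comp c.α.inv_chain)

theorem H'_chain : IsChain c.H' := c.α.hom_chain.comp ((semiMap_isChain c.H_chain).comp c.β.inv_chain)

theorem G'_chain : IsChain c.G' := c.δ.hom_chain.comp ((semiMap_isChain c.G_chain).comp c.β.inv_chain)

theorem F'_deg (hN : 1 ≤ N) : HasDeg 0 (2 * N) c.F' :=
  c.β.hom_deg.comp (HasDeg.comp (semiMap_hasDeg (c.F_deg hN)) c.α.inv_deg rfl (zero_add _)) rfl
    (add_zero _)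

theorem H'_deg (hN : 1 ≤ N) : HasDeg 0 (2 * N) c.H' :=
  c.α.hom_deg.comp (HasDeg.comp (semiMap_hasDeg (c.H_deg hN)) c.β.inv_deg rfl (zero_add _)) rfl
    (add_zero _)

theorem G'_deg (hN : 1 ≤ N) : HasDeg 0 (2 * N) c.G' :=
  c.δ.hom_deg.comp (HasDeg.comp (semiMap_hasDeg (c.G_deg hN)) c.β.inv_deg rfl (zero_add _)) rfl
    (add_zero _)

/-- `F` moves the factor `f` from the middle leg of `Γ_∥` to the middle leg of `Γ_×`, where it acts
like leg 1. So `F'` is determined by its value on the top class. -/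
theorem F'_topCls (hN : 1 ≤ N) {f : P 1} {k : ℤ} (hf : IsWH N f k) :
    Homotopic N k (c.F' ∘ₗ tens N ((legHom ![0] f : P 2) • topCls N))
      ((legHom ![0] f : P 2) • (c.F' ∘ₗ tens N (topCls N))) := by
  exact homotopic_comp_smul c.β.hom_chain c.β.hom_deg (semiMap_isChain c.F_chain)
    (semiMap_hasDeg (c.F_deg hN)) c.α.inv_chain c.α.inv_deg (tens_isChain N _)
    (tens_hasDeg topCls_mem) (c.α_inv_topCls hf) (semiAct_comm _ c.F) (semiAct_vir_legHom hf)
    (by ring)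

/-- Exchanging a polynomial on the unknot space against the one in the leg 1. -/
theorem contract_α (hN : 1 ≤ N) {f : P 1} {k l : ℤ} (hf : IsWH N f k) {φ ψ : Unk N →ₗ[ℚ] ℚ}
    (hψ : HasDeg 0 l (contract N ψ))
    (hφ : ∀ g : P 1, φ ((legHom ![0] g : P 2) • topCls N)
      = ψ ((legHom ![0] (f * g) : P 2) • topCls N)) :
    Homotopic N (k + l) (contract N φ ∘ₗ c.α.hom)
      (contract N ψ ∘ₗ c.α.hom ∘ₗ semiAct (parD N) (legHom ![1] f)) := by
  have hα : IsChain (contract N ψ ∘ₗ c.α.hom) := (contract_isChain ψ).comp c.α.hom_chain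
  have hαd : HasDeg 0 l (contract N ψ ∘ₗ c.α.hom) := hψ.comp c.α.hom_deg rfl (zero_add _)
  -- Tested on the basis of `Unk`: both `f` times a basis monomial and the monomial itself are
  -- carried through `α.inv` by `α_inv_topCls`.
  have key : Homotopic N (k + l) (contract N φ)
      ((contract N ψ ∘ₗ c.α.hom ∘ₗ semiAct (parD N) (legHom ![1] f)) ∘ₗ c.α.inv) := by
    refine arcUnk_homotopic hN fun i => ?_
    rw [unkBasis_apply]
    have hg := isWH_jacMon (N := N) i
    have h1 := (c.α_inv_topCls hg).comp_left ((hα.comp (semiAct_isChain (legHom ![1] f))))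
      (hαd.comp (semiAct_hasDeg (IsWH.legHom _ hf)) rfl rfl) (l := jacDeg N i - 2 * N + (k + l))
      rfl
    have h2 := (c.α_inv_topCls (hf.mul hg)).comp_left hα hαd
      (l := jacDeg N i - 2 * N + (k + l)) (by ring)
    have h3 := (c.α.hom_inv.comp_right (tens_isChain N _) (tens_hasDeg
      (smul_topCls_mem (hf.mul hg))) rfl).comp_left (contract_isChain ψ) hψ
      (l := jacDeg N i - 2 * N + (k + l)) (by ring)
    rw [map_mul (legHom ![1]), semiAct_mul] at h2
    simp only [LinearMap.comp_assoc, LinearMap.id_comp] at h1 h2 h3 ⊢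
    refine Homotopic.trans (Homotopic.of_eq ?_) ((h3.symm.trans h2).trans h1.symm)
    refine LinearMap.ext fun m => ?_
    exact congrArg (· • m) (hφ (jacMon N i))
  have h4 := key.comp_right c.α.hom_chain c.α.hom_deg (add_zero _)
  have h5 := c.α.inv_hom.comp_left (hα.comp (semiAct_isChain (legHom ![1] f)))
    (hαd.comp (semiAct_hasDeg (IsWH.legHom _ hf)) rfl rfl) (zero_add _)
  simp only [LinearMap.comp_assoc, LinearMap.comp_id] at h4 h5
  exact h4.trans h5

/-- The counterpart of `F'_topCls`: if `φ` is `ψ` composed with multiplication by `f`, the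
`φ`-component of `H'` is `f` in leg 1 times its `ψ`-component. -/
theorem contract_H' (hN : 1 ≤ N) {f : P 1} {k l : ℤ} (hf : IsWH N f k) {φ ψ : Unk N →ₗ[ℚ] ℚ}
    (hψ : HasDeg 0 l (contract N ψ))
    (hφ : ∀ g : P 1, φ ((legHom ![0] g : P 2) • topCls N)
      = ψ ((legHom ![0] (f * g) : P 2) • topCls N)) :
    Homotopic N (k + l + 2 * N) (contract N φ ∘ₗ c.H')
      ((legHom ![0] f : P 2) • (contract N ψ ∘ₗ c.H')) := by
  exact homotopic_smul_comp (contract_isChain ψ) hψ c.α.hom_chain c.α.hom_deg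
    (semiMap_isChain c.H_chain) (semiMap_hasDeg (c.H_deg hN)) c.β.inv_chain c.β.inv_deg
    (c.contract_α hN hf hψ hφ) (semiAct_comm _ c.H) (semiAct_vir_legHom hf) rfl

end Identification

end SemiClosedSaddles

section Constants

open MvPolynomial

variable {n N : ℕ}

/-! ### Coordinates of products in the Jacobi algebra -/

/-- Multiplication by `x²ᴺ⁻ⁱ` moves `xⁱ` to the socle. Hence every coordinate is the socle
coordinate of a product with an element of the dual basis, which is the Frobenius pairing. -/
theorem jacCoord_inl (i : Fin (2 * N + 1)) (f : P 1) : jacCoord N (Sum.inl i) f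
    = jacCoord N (Sum.inl (Fin.last (2 * N))) (xv 0 ^ (2 * N - i) * f) := by
  have : jacCoord N (Sum.inl i) = jacCoord N (Sum.inl (Fin.last (2 * N)))
      ∘ₗ LinearMap.mulLeft ℚ (xv 0 ^ (2 * N - i)) := by
    refine legOne_ext fun a b => ?_
    rw [LinearMap.comp_apply, LinearMap.mulLeft_apply, ← mul_assoc, ← pow_add, jacCoord_pow,
      jacCoord_pow]
    have hi := i.2
    have h1 : (2 * N - i + a = 2 * N) ↔ a = i := by omega
    have h2 : (2 * N - i + a = 0) ↔ a = 0 ∧ (i : ℕ) = 2 * N := by omega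
    simp only [jacCoeff, Fin.val_last, h1, h2]
    congr 1
    by_cases h3 : a = 0 <;> by_cases h4 : b = 2 <;> simp [h3, h4]
  exact LinearMap.congr_fun this f

/-- The normalization comes from `y·y = -(2N+1)x²ᴺ`. -/
theorem jacCoord_inr (f : P 1) : jacCoord N (Sum.inr ()) f
    = jacCoord N (Sum.inl (Fin.last (2 * N))) (C (-(2 * N + 1 : ℚ)⁻¹) * yv 0 * f) := by
  have hN : (2 * N + 1 : ℚ) ≠ 0 := by positivity
  have : jacCoord N (Sum.inr ()) = (-(2 * N + 1 : ℚ)⁻¹) • (jacCoord N (Sum.inl (Fin.last (2 * N)))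
      ∘ₗ LinearMap.mulLeft ℚ (yv 0)) := by
    refine legOne_ext fun a b => ?_
    rw [LinearMap.smul_apply, LinearMap.comp_apply, LinearMap.mulLeft_apply,
      show (yv 0 * (xv 0 ^ a * yv 0 ^ b) : P 1) = xv 0 ^ a * yv 0 ^ (b + 1) by ring, jacCoord_pow,
      jacCoord_pow]
    by_cases h : a = 0 ∧ b = 1
    · simp [jacCoeff, h]
      field_simp
      ring
    · simp [jacCoeff, h]
  rw [mul_assoc, ← smul_eq_C_mul, map_smul, this]
  rfl

/-- An element annihilated by `x` and `y` in the Jacobi algebra is a multiple of `x²ᴺ`. -/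
theorem mem_jacIdeal_of_mul_mem (hN : 1 ≤ N) {f : P 1} {k : ℤ} (hf : IsWH N f k) (hk : k ≠ 4 * N)
    (hx : xv 0 * f ∈ jacIdeal N) (hy : yv 0 * f ∈ jacIdeal N) : f ∈ jacIdeal N := by
  rw [mem_jacIdeal_iff hN]
  rintro (i | i)
  · rcases Nat.eq_zero_or_pos (2 * N - i) with h | h
    · refine jacCoord_eq_zero_of_isWH hf fun e => hk (e.trans ?_)
      have := i.2
      simp only [jacDeg, Sum.elim_inl]
      omega
    · obtain ⟨j, hj⟩ := Nat.exists_eq_add_of_lt h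
      rw [zero_add] at hj
      rw [jacCoord_inl, hj, pow_succ, mul_assoc]
      exact jacCoord_eq_zero_of_mem hN (Ideal.mul_mem_left _ _ hx)
  · rw [jacCoord_inr, mul_assoc]
    exact jacCoord_eq_zero_of_mem hN (Ideal.mul_mem_left _ _ hy)

/-- The generators of the Jacobian ideal have degrees `2N+2` and `4N`, both above `2N`. -/
theorem eq_zero_of_mem_jacIdeal (hN : 1 ≤ N) {f : P 1} (hf : IsWH N f (2 * N))
    (h : f ∈ jacIdeal N) : f = 0 := by
  rw [jacIdeal_eq] at h
  obtain ⟨g, g', hg, hg', rfl⟩ := exists_homogeneous_of_mem_span_pair hf isWH_jac₁ isWH_jac₂ h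
  rw [hg.eq_zero_of_neg (by omega), hg'.eq_zero_of_neg (by omega), mul_zero, mul_zero, add_zero]

theorem jacCoord_xx : jacCoord N (Sum.inl (Fin.last (2 * N))) (xv 0 ^ (2 * N)) = 1 := by
  have := jacCoord_pow (N := N) (Sum.inl (Fin.last (2 * N))) (2 * N) 0
  rw [pow_zero, mul_one] at this
  simpa [jacCoeff] using this

theorem jacCoord_yy : jacCoord N (Sum.inl (Fin.last (2 * N))) (yv 0 ^ 2) = -(2 * N + 1) := by
  have := jacCoord_pow (N := N) (Sum.inl (Fin.last (2 * N))) 0 2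
  rw [pow_zero, one_mul] at this
  simpa [jacCoeff] using this

/-! ### The square of the saddle morphisms -/

theorem hsym_pair_self {S : Type} [CommRing S] (x : S) (k : ℕ) :
    hsym [x, x] k = (k + 1 : S) * x ^ k := by
  rw [hsym, Finset.sum_congr rfl fun i hi => ?_, Finset.sum_const, Finset.card_range, nsmul_eq_mul]
  · push_cast; rfl
  · rw [hsym_singleton, ← pow_add, Nat.add_sub_cancel' (Finset.mem_range_succ_iff.1 hi)]

theorem two_mul_hsym_triple_self {S : Type} [CommRing S] (x : S) (k : ℕ) :
    2 * hsym [x, x, x] k = (k + 1 : S) * (k + 2) * x ^ k := by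
  have h : ∀ k : ℕ, 2 * ∑ i ∈ Finset.range (k + 1), (((k - i : ℕ) : S) + 1)
      = (k + 1 : S) * (k + 2) := by
    intro k
    induction k with
    | zero => simp
    | succ k ih =>
      rw [Finset.sum_range_succ', mul_add]
      simp only [Nat.add_sub_add_right]
      rw [ih]
      push_cast [Nat.sub_zero]
      ring
  rw [← h, hsym, mul_assoc, Finset.sum_mul]
  congr 1
  refine Finset.sum_congr rfl fun i hi => ?_
  rw [hsym_pair_self, mul_left_comm, ← pow_add,
    Nat.add_sub_cancel' (Finset.mem_range_succ_iff.1 hi)]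

theorem dd_triple_neg {S : Type} [CommRing S] (hN : 1 ≤ N) (x : S) :
    dd N [-x, -x, -x] = -dd N [x, x, x] := by
  have h := hsym_map_neg [x, x, x] (2 * N - 1)
  have : Odd (2 * N - 1) := ⟨N - 1, by omega⟩
  rw [this.neg_one_pow, neg_one_mul] at h
  exact h

theorem dd_triple_self {S : Type} [CommRing S] (hN : 1 ≤ N) (x : S) :
    2 * (x * dd N [x, x, x]) = 2 * N * (2 * N + 1) * x ^ (2 * N) := by
  have h := two_mul_hsym_triple_self x (2 * N - 1)
  obtain ⟨M, rfl⟩ := Nat.exists_eq_add_of_le hN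
  have e : 2 * (1 + M) - 1 = 2 * M + 1 := by omega
  have e' : dd (1 + M) [x, x, x] = hsym [x, x, x] (2 * (1 + M) - 1) := by
    rw [dd]; congr 1
  rw [e] at h e'
  rw [e', mul_left_comm, h]
  push_cast
  ring

/-- The value of the square of a saddle morphism on the joined virtual crossing. -/
theorem virEval_sq (hN : 1 ≤ N) : virEval (qq.2 ^ 2 - qq.1 ^ 2 * polyC N)
    = 4 * ((yv 0 : P 1) ^ 2 - (N : P 1) * (2 * (N : P 1) + 1) * (xv 0 : P 1) ^ (2 * N)) := by
  have hdd : ∀ l : List (P 4), virEval (dd N l) = dd N (l.map virEval) :=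
    fun l => map_dd virEval.toRingHom l
  have hx0 : virEval (xv 0) = xv 0 := subst_xv _ _ _
  have hx1 : virEval (xv 1) = xv 0 := subst_xv _ _ _
  have hx2 : virEval (xv 2) = -xv 0 := subst_xv _ _ _
  have hx3 : virEval (xv 3) = -xv 0 := subst_xv _ _ _
  have hy2 : virEval (yv 2) = -yv 0 := subst_yv _ _ _
  have hy3 : virEval (yv 3) = -yv 0 := subst_yv _ _ _
  simp only [qq, polyC, map_sub, map_mul, map_pow, map_add, hdd, List.map_cons, List.map_nil,
    map_neg, hx0, hx1, hx2, hx3, hy2, hy3, neg_neg]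
  generalize (yv 0 : P 1) = y
  generalize (xv 0 : P 1) = x
  -- The three four-fold differences in `C̃` have the arguments `±x` and telescope: `2xC̃ = w(x,x,x)
  -- - w(-x,-x,-x) = 2w(x,x,x)`.
  have h1 := dd_append_pair N [x, x] x (-x) (by simp; omega)
  have h2 := dd_append_pair N [x, -x] x (-x) (by simp; omega)
  have h3 := dd_append_pair N [-x, -x] x (-x) (by simp; omega)
  simp only [List.cons_append, List.nil_append] at h1 h2 h3
  have e1 : dd N [x, -x, x] = dd N [x, x, -x] := dd_perm (.cons _ (.swap _ _ _))
  have e2 : dd N [-x, -x, x] = dd N [x, -x, -x] :=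
    dd_perm ((List.Perm.cons _ (.swap _ _ _)).trans (.swap _ _ _))
  have e3 : dd N [-x, -x, x, -x] = dd N [x, -x, -x, -x] :=
    dd_perm ((List.Perm.cons _ (.swap _ _ _)).trans (.swap _ _ _))
  have e4 := dd_triple_self hN x
  have e5 := dd_triple_neg hN x
  linear_combination (-2 * x) * (h1 + h2 + h3 + e1 + e2 - e5) - 2 * e4 + 4 * x ^ 2 * e3

end Constants

/-! ### The semi-closed saddles up to homotopy -/

section SemiClosedFormulas

open MvPolynomial

variable {n N : ℕ}

section Abstract

variable {A U X V : DiffMod n} {k l j r : ℤ} {f g : P n}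

theorem Homotopic.smul_of_hasDeg {u v : X.carrier →ₗ[P n] A.carrier} (h : Homotopic N k u v)
    (hf : HasDeg (X := A) (Y := A) 0 j (f • LinearMap.id)) (hl : k + j = l) :
    Homotopic (X := X) (Y := A) N l (f • u) (f • v) := by
  have := h.comp_left (IsChain.id.smul f) hf hl
  exact this

theorem HasDeg.smul_of_hasDeg {u : X.carrier →ₗ[P n] A.carrier} {s : ZMod 2} (h : HasDeg s k u)
    (hf : HasDeg (X := A) (Y := A) 0 j (f • LinearMap.id)) (hl : k + j = l) :
    HasDeg s l (f • u) := by
  have := hf.comp h (add_zero s) hl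
  exact this

/-- The equivalence in the middle cancels against its inverse, and the outer one conjugates a scalar
into itself. -/
theorem homotopic_conj {b : V.carrier →ₗ[P n] A.carrier} {b' : A.carrier →ₗ[P n] V.carrier}
    {s : X.carrier →ₗ[P n] V.carrier} {t : V.carrier →ₗ[P n] X.carrier}
    {a' : U.carrier →ₗ[P n] X.carrier} {a : X.carrier →ₗ[P n] U.carrier}
    {v : V.carrier →ₗ[P n] V.carrier}
    (hb : IsChain b) (hbd : HasDeg 0 0 b) (hb' : IsChain b') (hbd' : HasDeg 0 0 b')
    (hs : IsChain s) (hsd : HasDeg 0 l s) (ht : IsChain t) (htd : HasDeg 0 j t)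
    (haa : Homotopic (X := X) (Y := X) N 0 (a' ∘ₗ a) LinearMap.id)
    (hbb : Homotopic (X := A) (Y := A) N 0 (b ∘ₗ b') LinearMap.id) (hst : s ∘ₗ t = v)
    (hv : Homotopic (X := V) (Y := V) N k v (f • LinearMap.id))
    (hf : HasDeg (X := A) (Y := A) 0 k (f • LinearMap.id)) (hk : l + j = k) :
    Homotopic (X := A) (Y := A) N k ((b ∘ₗ s ∘ₗ a') ∘ₗ (a ∘ₗ t ∘ₗ b')) (f • LinearMap.id) := by
  subst hst
  have h1 := (haa.comp_right (ht.comp hb') (HasDeg.comp htd hbd' rfl (zero_add _))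
    (zero_add _)).comp_left (hb.comp hs) (HasDeg.comp hbd hsd rfl (add_zero _)) (l := k)
    (by omega)
  have h2 := (hv.comp_right hb' hbd' (add_zero _)).comp_left hb hbd (add_zero _)
  have h3 := hbb.smul_of_hasDeg hf (zero_add _)
  refine (Homotopic.of_eq ?_).trans (h1.trans ((Homotopic.of_eq ?_).trans (h2.trans
    ((Homotopic.of_eq ?_).trans h3))))
  · rfl
  · rfl
  · exact LinearMap.ext fun m => b.map_smul f _

/-- If one variable acts by `f` on the source of `s` and by `g` on its target, then `f` and `g`
times the composite are homotopic. For `f = -g` this kills twice the multiple by `f`. -/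
theorem homotopic_exchange {b : V.carrier →ₗ[P n] A.carrier} {s : X.carrier →ₗ[P n] V.carrier}
    {a : U.carrier →ₗ[P n] X.carrier} {x : X.carrier →ₗ[P n] X.carrier}
    {v : V.carrier →ₗ[P n] V.carrier}
    (hb : IsChain b) (hbd : HasDeg 0 0 b) (hs : IsChain s) (hsd : HasDeg 0 l s)
    (ha : IsChain a) (had : HasDeg 0 0 a) (hx : s ∘ₗ x = v ∘ₗ s)
    (hxf : Homotopic (X := X) (Y := X) N k x (f • LinearMap.id))
    (hvg : Homotopic (X := V) (Y := V) N k v (g • LinearMap.id)) (hr : r = k + l) :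
    Homotopic (X := U) (Y := A) N r (f • (b ∘ₗ s ∘ₗ a)) (g • (b ∘ₗ s ∘ₗ a)) := by
  subst hr
  have h1 := (hxf.comp_right ha had (add_zero _)).comp_left (hb.comp hs)
    (HasDeg.comp hbd hsd rfl (add_zero _)) rfl
  have h2 := (hvg.comp_right (hs.comp ha) (HasDeg.comp hsd had rfl (zero_add _)) rfl).comp_left hb
    hbd (add_zero _)
  have e : (b ∘ₗ s) ∘ₗ x ∘ₗ a = b ∘ₗ v ∘ₗ s ∘ₗ a := congrArg (fun g => b ∘ₗ g ∘ₗ a) hx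
  rw [e] at h1
  refine (Homotopic.of_eq ?_).trans (h1.symm.trans (h2.trans (Homotopic.of_eq ?_)))
  · exact LinearMap.ext fun m => ((b ∘ₗ s).map_smul f _).symm
  · exact LinearMap.ext fun m => b.map_smul g _

theorem comp_smul_smul_id (t : X.carrier →ₗ[P n] A.carrier) (f g : P n) :
    t ∘ₗ (f • g • LinearMap.id) = g • f • t := by
  refine LinearMap.ext fun m => ?_
  change t (f • g • m) = g • f • t m
  rw [map_smul, map_smul, smul_comm]

end Abstract

theorem legHom_C {m : ℕ} (f : Fin m → Fin n) (r : ℚ) : legHom f (C r) = C r := rename_C _ r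

theorem mapM_tens (b : Module.Basis (Fin (2 * N + 1) ⊕ Unit) ℚ (Unk N))
    (i : Fin (2 * N + 1) ⊕ Unit) :
    mapM N b ∘ₗ tens N (b i) = (legHom ![0] (jacMon N i) : P 2) • LinearMap.id := by
  refine LinearMap.ext fun m => ?_
  have h : ∀ j, contract N (b.coord j) (tens N (b i) m) = if j = i then m else 0 := by
    intro j
    refine (contract_tens _ m (b i)).trans ?_
    rw [Module.Basis.coord_apply, Module.Basis.repr_self, Finsupp.single_apply]
    by_cases e : i = j
    · subst e; simp
    · rw [if_neg e, if_neg (Ne.symm e), zero_smul]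
  change mapM N b (tens N (b i) m) = (legHom ![0] (jacMon N i) : P 2) • m
  simp only [mapM, LinearMap.add_apply, LinearMap.sum_apply, LinearMap.smul_apply, h]
  rcases i with i | i
  · rw [Finset.sum_eq_single i]
    · simp [jacMon]
    · intro j _ hj
      rw [if_neg (fun e => hj (Sum.inl_injective e)), smul_zero]
    · simp
  · rw [Finset.sum_eq_zero (fun j _ => by rw [if_neg (by simp), smul_zero])]
    simp [jacMon]

/-- The dual basis of the Jacobi algebra with respect to the functional `(x²ᴺ)*`. -/
def jacDualMon (N : ℕ) : Fin (2 * N + 1) ⊕ Unit → P 1 :=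
  Sum.elim (fun i => xv 0 ^ (2 * N - i)) (fun _ => C (-(2 * N + 1 : ℚ)⁻¹) * yv 0)

theorem isWH_jacDualMon (i : Fin (2 * N + 1) ⊕ Unit) :
    IsWH N (jacDualMon N i) (4 * N - jacDeg N i) := by
  rcases i with i | i
  · refine IsWH.cast ((isWH_xv 0).pow _) ?_
    have := i.2
    simp only [jacDeg, Sum.elim_inl, nsmul_eq_mul]
    omega
  · exact IsWH.cast ((isWH_C _).mul (isWH_yv 0)) (by simp only [jacDeg, Sum.elim_inr]; ring)

theorem jacCoord_eq_jacDualMon (i : Fin (2 * N + 1) ⊕ Unit) (f : P 1) : jacCoord N i f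
    = jacCoord N (Sum.inl (Fin.last (2 * N))) (jacDualMon N i * f) := by
  rcases i with i | i
  · exact jacCoord_inl i f
  · exact jacCoord_inr f

/-- The copairing of `(x²ᴺ)*`. The trace of the statement is `-1/(2(2N+1))` times this functional,
so its copairing differs by the inverse of that factor. -/
theorem sum_tens_jacDualMon (hN : 1 ≤ N) : ∑ i, (legHom ![0] (jacDualMon N i) : P 2) •
    tens N (unkBasis hN i) = (C (-(2 * (2 * N + 1) : ℚ)⁻¹) : P 2) • mapD N (topCls N) := by
  have h2 : (C (-(2 * (2 * N + 1) : ℚ)⁻¹) * 2 : P 2) = C (-(2 * N + 1 : ℚ)⁻¹) := by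
    rw [← map_ofNat C 2, ← C_mul]
    congr 1
    have : (2 * N + 1 : ℚ) ≠ 0 := by positivity
    field_simp
  have h3 : (C (-(2 * N + 1 : ℚ)⁻¹) : P 2) * (2 * (N : P 2) + 1) = -1 := by
    have e : (2 * (N : P 2) + 1) = C (2 * N + 1 : ℚ) := by
      rw [map_add, map_mul, map_ofNat, map_natCast, map_one]
    rw [e, ← C_mul, neg_mul, inv_mul_cancel₀ (by positivity)]
    simp
  rw [mapD, smul_smul, h2, smul_sub, smul_smul (C _) (2 * (N : P 2) + 1), h3, neg_one_smul, sub_neg_eq_add,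
    Fintype.sum_sum_type, add_comm, Finset.univ_unique, Finset.sum_singleton, smul_smul]
  congr 1
  · rw [unkBasis_apply]
    simp [jacDualMon, jacMon]
  · rw [← Finset.sum_range_reflect, Finset.sum_range]
    refine Finset.sum_congr rfl fun i _ => ?_
    have hi := i.2
    have e1 : 2 * N + 1 - 1 - (i : ℕ) = 2 * N - i := by omega
    have e2 : 2 * N - (2 * N - (i : ℕ)) = i := by omega
    rw [unkBasis_apply, e1, e2]
    simp [jacDualMon, jacMon]

/-- The handle element of the Frobenius algebra: each of the `2N+1` summands with powers of `x`
contributes `x²ᴺ`, which accounts for the square. -/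
theorem mapM_mapD (hN : 1 ≤ N) : mapM N (unkBasis hN) ∘ₗ mapD N (topCls N)
    = (2 * (yv 0 ^ 2 - (2 * (N : P 2) + 1) ^ 2 * xv 0 ^ (2 * N)) : P 2) • LinearMap.id := by
  have hy : mapM N (unkBasis hN) ∘ₗ tens N ((yv 0 : P 2) • topCls N) = (yv 0 : P 2) • LinearMap.id := by
    have h := mapM_tens (unkBasis hN) (Sum.inr ())
    rw [unkBasis_apply] at h
    simp only [jacMon, Sum.elim_inr, legHom_yv] at h
    exact h
  have hx : ∀ i ∈ Finset.range (2 * N + 1), mapM N (unkBasis hN) ∘ₗ tens N ((xv 0 : P 2) ^ i • topCls N)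
      = (xv 0 : P 2) ^ i • LinearMap.id := by
    intro i hi
    have h := mapM_tens (unkBasis hN) (Sum.inl ⟨i, Finset.mem_range.1 hi⟩)
    rw [unkBasis_apply] at h
    simp only [jacMon, Sum.elim_inl, legHom_xv, map_pow] at h
    exact h
  refine LinearMap.ext fun m => ?_
  have hy' := LinearMap.congr_fun hy m
  have hx' := fun i hi => LinearMap.congr_fun (hx i hi) m
  change mapM N (unkBasis hN) (mapD N (topCls N) m)
    = (2 * (yv 0 ^ 2 - (2 * (N : P 2) + 1) ^ 2 * xv 0 ^ (2 * N)) : P 2) • m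
  simp only [LinearMap.comp_apply, LinearMap.smul_apply, LinearMap.id_apply] at hy' hx'
  simp only [mapD, LinearMap.smul_apply, LinearMap.sub_apply, LinearMap.sum_apply, map_smul, map_sub,
    map_sum, hy']
  rw [Finset.sum_congr rfl fun i hi => by
    rw [hx' (2 * N - i) (Finset.mem_range.2 (by omega)), smul_smul, ← pow_add,
      Nat.add_sub_cancel' (Finset.mem_range_succ_iff.1 hi)]]
  rw [Finset.sum_const, Finset.card_range, ← Nat.cast_smul_eq_nsmul (P 2), smul_smul, smul_smul, smul_smul,
    ← sub_smul, smul_smul]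
  congr 1
  push_cast
  ring

theorem mapM_eq_sum (b : Module.Basis (Fin (2 * N + 1) ⊕ Unit) ℚ (Unk N)) : mapM N b
    = ∑ i, (legHom ![0] (jacMon N i) : P 2) • contract N (b.coord i) := by
  rw [Fintype.sum_sum_type, Finset.univ_unique (α := Unit), Finset.sum_singleton, mapM]
  simp [jacMon]

theorem mapM_isChain (b : Module.Basis (Fin (2 * N + 1) ⊕ Unit) ℚ (Unk N)) :
    IsChain (mapM N b) := by
  rw [mapM_eq_sum]
  exact IsChain.sum _ fun i _ => (contract_isChain _).smul _

theorem mapM_hasDeg (hN : 1 ≤ N) : HasDeg 0 (2 * N) (mapM N (unkBasis hN)) := by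
  rw [mapM_eq_sum]
  exact HasDeg.sum _ fun i _ => (contract_coord_hasDeg hN i).smul_of_hasDeg
    (hasDeg_smul_id (M := arc N (xv 0 : P 2) (yv 0) (xv 1) (yv 1))
      (IsWH.legHom ![0] (isWH_jacMon i))) (by ring)

/-- Closing the arc and reducing modulo the Jacobian ideal makes every entry of its differential
zero, so a null-homotopic multiplication becomes zero there. -/
theorem mem_jacIdeal_of_homotopic {f : P 2} {k : ℤ}
    (h : Homotopic (X := arcD N) (Y := arcD N) N k (f • LinearMap.id) 0) :
    closeHom f ∈ jacIdeal N := by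
  refine Ideal.Quotient.eq_zero_iff_mem.1 (map_eq_zero_of_homotopic
    (M := arc N (xv 0 : P 2) (yv 0) (xv 1) (yv 1))
    ((Ideal.Quotient.mk (jacIdeal N)).comp closeHom.toRingHom) (fun i j => ?_) h)
  refine Ideal.Quotient.eq_zero_iff_mem.2 ?_
  have h1 := closeHom_arc_mulVec (N := N) (Pi.single j 1)
  simp only [Matrix.mulVec_single_one, Matrix.col_apply] at h1
  obtain ⟨e1, e2, e3, e4⟩ := h1
  obtain ⟨i, i'⟩ := i
  fin_cases i <;> fin_cases i'
  · exact e1 ▸ zero_mem _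
  · exact e2 ▸ Ideal.mul_mem_right _ _ jac₂_mem
  · exact e3 ▸ Ideal.mul_mem_right _ _ jac₁_mem
  · exact e4 ▸ sub_mem (Ideal.mul_mem_right _ _ jac₁_mem) (Ideal.mul_mem_right _ _ jac₂_mem)

theorem closeHom_sub_mem_of_homotopic {f g : P 2} {k : ℤ} (h : Homotopic (X := arcD N) (Y := arcD N)
    N k (f • LinearMap.id) (g • LinearMap.id)) : closeHom f - closeHom g ∈ jacIdeal N := by
  obtain ⟨u, hu, e⟩ := h
  rw [← map_sub]
  exact mem_jacIdeal_of_homotopic ⟨u, hu, by rw [sub_zero, sub_smul]; exact e⟩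

namespace Identification

variable (c : Identification N)

/-- On the top class, of degree `-2N`, the map `F'` is an endomorphism of the arc of degree 0, hence
a constant; `F'_topCls` transports this constant to all basis vectors. -/
theorem exists_F'_homotopic (hN : 1 ≤ N) : ∃ r : ℚ,
    Homotopic N (2 * N) c.F' ((C r : P 2) • mapM N (unkBasis hN)) := by
  obtain ⟨f, hf, h⟩ := arc_end (c.F'_chain.comp (tens_isChain N (topCls N)))
    ((c.F'_deg hN).comp (tens_hasDeg topCls_mem) rfl (by ring : -(2 * (N : ℤ)) + 2 * N = 0))
  obtain ⟨r, rfl⟩ := hf.eq_C hN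
  refine ⟨r, arcUnk_homotopic hN fun i => ?_⟩
  have h1 := c.F'_topCls hN (isWH_jacMon i)
  have h2 := h.smul_of_hasDeg (hasDeg_smul_id (IsWH.legHom ![0] (isWH_jacMon i)))
    (zero_add (jacDeg N i))
  rw [sub_add_cancel]
  have e : ((C r : P 2) • mapM N (unkBasis hN)) ∘ₗ tens N (unkBasis hN i)
      = (C r : P 2) • (legHom ![0] (jacMon N i) : P 2) • LinearMap.id :=
    congrArg ((C r : P 2) • ·) (mapM_tens (unkBasis hN) i)
  rw [e, unkBasis_apply]
  refine h1.trans (h2.trans (Homotopic.of_eq ?_))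
  rw [smul_comm, legHom_C]

/-- The socle coordinate of `H'` is an endomorphism of the arc of degree 0, hence a constant;
`contract_H'` gives the other coordinates as multiples by the dual basis, and these add up to the
copairing. -/
theorem exists_H'_homotopic (hN : 1 ≤ N) : ∃ r : ℚ,
    Homotopic N (2 * N) c.H' ((C r : P 2) • mapD N (topCls N)) := by
  have hψ := contract_coord_hasDeg hN (Sum.inl (Fin.last (2 * N)))
  have hj : jacDeg N (Sum.inl (Fin.last (2 * N))) = 4 * N := by
    simp only [jacDeg, Sum.elim_inl, Fin.val_last]
    push_cast
    ring
  rw [hj] at hψ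
  obtain ⟨f, hf, h⟩ := arc_end ((contract_isChain _).comp c.H'_chain)
    (hψ.comp (c.H'_deg hN) rfl (by ring : 2 * (N : ℤ) + -(4 * N - 2 * N) = 0))
  obtain ⟨r, rfl⟩ := hf.eq_C hN
  rw [legHom_C] at h
  refine ⟨r * (-(2 * (2 * N + 1) : ℚ)⁻¹), ?_⟩
  rw [C_mul, mul_smul, ← sum_tens_jacDualMon hN, into_arcUnk_eq_sum hN c.H', Finset.smul_sum]
  refine Homotopic.sum _ fun i _ => ?_
  have h1 := c.contract_H' hN (isWH_jacDualMon i) hψ (φ := (unkBasis hN).coord i) (fun g => by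
    rw [unkBasis_coord, unkBasis_coord, jacCoord_eq_jacDualMon])
  have h2 := h.smul_of_hasDeg (hasDeg_smul_id (IsWH.legHom ![0] (isWH_jacDualMon i)))
    (l := 4 * N - jacDeg N i + -(4 * N - 2 * N) + 2 * N) (by ring)
  have h3 := (h1.trans h2).comp_left (tens_isChain N (unkBasis hN i))
    (tens_hasDeg (unkBasis_mem hN i)) (l := 2 * N) (by ring)
  exact h3.trans (Homotopic.of_eq (comp_smul_smul_id _ _ _))

theorem F'_H' (hN : 1 ≤ N) : Homotopic N (4 * N) (c.F' ∘ₗ c.H')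
    ((legHom ![0] (4 * ((yv 0 : P 1) ^ 2 - (N : P 1) * (2 * (N : P 1) + 1) * (xv 0 : P 1) ^ (2 * N))) : P 2)
      • LinearMap.id) := by
  have hu : IsWH N (qq.2 ^ 2 - qq.1 ^ 2 * polyC N) (4 * N) := by
    have hq : IsWHPair N qq := isWHPair_legs 2 3
    exact (IsWH.cast (hq.2.pow 2) (by simp; ring)).sub
      (IsWH.cast ((hq.1.pow 2).mul (isWH_polyC hN)) (by simp))
  have h := semiAct_vir hu
  rw [virEval_sq hN] at h
  have hst : semiMap c.F ∘ₗ semiMap c.H = semiAct (virD N) (qq.2 ^ 2 - qq.1 ^ 2 * polyC N) :=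
    (semiMap_comp _ _).symm.trans (congrArg semiMap (LinearMap.ext c.F_H))
  exact homotopic_conj c.β.hom_chain c.β.hom_deg c.β.inv_chain c.β.inv_deg
    (semiMap_isChain c.F_chain) (semiMap_hasDeg (c.F_deg hN)) (semiMap_isChain c.H_chain)
    (semiMap_hasDeg (c.H_deg hN)) c.α.inv_hom c.β.hom_inv hst h
    (hasDeg_smul_id (IsWH.legHom _ (virEval_sq hN ▸ hu.virEval))) (by ring)

/-- Write `G'` as multiplication by `f` of degree `2N`. The opposite signs of the middle leg on
`Γ_×` and `Γ_=` give `2xf` and `2yf` in the Jacobian ideal. So `f` is in the socle, which sits in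
degree `4N`; hence `f` is in the ideal, and by degree it is zero. -/
theorem G'_homotopic (hN : 1 ≤ N) : Homotopic N (2 * N) c.G' 0 := by
  obtain ⟨f, hf, h⟩ := arc_end c.G'_chain (c.G'_deg hN)
  have key : ∀ {v : P 1} {k : ℤ} (hv : IsWH N v k)
      (h1 : Homotopic N k (semiAct (horD N) (legHom ![1] v)) (-(legHom ![0] v : P 2) • LinearMap.id)),
      v * f ∈ jacIdeal N := by
    intro v k hv h1
    have h2 := homotopic_exchange c.δ.hom_chain c.δ.hom_deg (semiMap_isChain c.G_chain)
      (semiMap_hasDeg (c.G_deg hN)) c.β.inv_chain c.β.inv_deg (semiAct_comm _ c.G)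
      (semiAct_vir_legHom hv) h1 rfl
    have h3 := h.smul_of_hasDeg (hasDeg_smul_id (IsWH.legHom ![0] hv)) (add_comm _ _)
    have h4 := h.smul_of_hasDeg (hasDeg_smul_id (IsWH.legHom ![0] hv).neg) (add_comm _ _)
    have h5 := (h3.symm.trans (h2.trans h4)).add (Homotopic.refl
      ((legHom ![0] v : P 2) • (legHom ![0] f : P 2) • LinearMap.id))
    have h6 : Homotopic (X := arcD N) (Y := arcD N) N (k + 2 * N)
        ((legHom ![0] (2 * (v * f)) : P 2) • LinearMap.id) 0 := by
      refine (Homotopic.of_eq ?_).trans (h5.trans (Homotopic.of_eq ?_))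
      · rw [map_mul, map_mul, map_ofNat, two_mul, add_smul, mul_smul]
      · rw [neg_smul, neg_add_cancel]
    have h7 := mem_jacIdeal_of_homotopic h6
    rw [closeHom_legHom] at h7
    have h8 := Ideal.mul_mem_left _ (C (1 / 2 : ℚ)) h7
    rwa [← mul_assoc, ← map_ofNat C 2, ← C_mul, show (1 / 2 * 2 : ℚ) = 1 by norm_num, C_1,
      one_mul] at h8
  have hx := key (isWH_xv 0) (by rw [legHom_xv, legHom_xv]; exact semiAct_hor_xv)
  have hy := key (isWH_yv 0) (by rw [legHom_yv, legHom_yv]; exact semiAct_hor_yv)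
  have hf0 := eq_zero_of_mem_jacIdeal hN hf (mem_jacIdeal_of_mul_mem hN hf (by omega) hx hy)
  rw [hf0, map_zero, zero_smul] at h
  exact h

/-- The semi-closed saddle morphisms, up to a common scalar. -/
theorem exists_semiClosed (hN : 1 ≤ N) : ∃ r : ℚ, r ≠ 0 ∧
    Homotopic N (2 * N) c.F' ((C r⁻¹ : P 2) • mapM N (unkBasis hN)) ∧
    Homotopic N (2 * N) c.H' ((C r : P 2) • mapD N (topCls N)) := by
  obtain ⟨a, ha⟩ := c.exists_F'_homotopic hN
  obtain ⟨r, hr⟩ := c.exists_H'_homotopic hN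
  suffices h : a * r = 1 by
    refine ⟨r, right_ne_zero_of_mul_eq_one h, ?_, hr⟩
    rwa [← eq_inv_of_mul_eq_one_left h]
  have hX : HasDeg 0 (2 * N) ((C a : P 2) • mapM N (unkBasis hN)) := (mapM_hasDeg hN).smul_of_hasDeg
    (hasDeg_smul_id (M := arc N (xv 0 : P 2) (yv 0) (xv 1) (yv 1)) (isWH_C a)) (add_zero _)
  have h1 := (ha.comp_right c.H'_chain (c.H'_deg hN) rfl).trans
    (hr.comp_left ((mapM_isChain _).smul _) hX rfl)
  have h2 : ((C a : P 2) • mapM N (unkBasis hN)) ∘ₗ ((C r : P 2) • mapD N (topCls N))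
      = (C (a * r) : P 2) • (mapM N (unkBasis hN) ∘ₗ mapD N (topCls N)) := by
    rw [C_mul, mul_smul, LinearMap.smul_comp, LinearMap.comp_smul]
  rw [h2, mapM_mapD, smul_smul, show 2 * (N : ℤ) + 2 * N = 4 * N by ring] at h1
  have h3 := closeHom_sub_mem_of_homotopic ((c.F'_H' hN).symm.trans h1)
  rw [closeHom_legHom] at h3
  have h4 : (4 * ((yv 0 : P 1) ^ 2 - (N : P 1) * (2 * (N : P 1) + 1) * (xv 0 : P 1) ^ (2 * N)))
      - closeHom (C (a * r) * (2 * (yv 0 ^ 2 - (2 * (N : P 2) + 1) ^ 2 * xv 0 ^ (2 * N))))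
      = (4 - 2 * (a * r)) • (yv 0 : P 1) ^ 2
        + (-4 * (N * (2 * N + 1)) + 2 * (a * r) * (2 * N + 1) ^ 2) • (xv 0 : P 1) ^ (2 * N) := by
    have hC : closeHom (C (a * r)) = C (a * r) := closeHom.commutes _
    have hx : closeHom (xv 0) = xv 0 := closeHom_xv 0
    have hy : closeHom (yv 0) = yv 0 := closeHom_yv 0
    simp only [map_mul, map_sub, map_pow, map_add, map_ofNat, map_natCast, map_one, hx, hy, smul_eq_C_mul,
      map_neg]
    rw [← map_mul closeHom, ← C_mul, hC]
    simp only [map_mul]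
    ring
  rw [h4] at h3
  -- Modulo `y² = -(2N+1)x²ᴺ` both composites become `-4(N+1)(2N+1)x²ᴺ`, one of them with the factor
  -- `a * r`; the socle coordinate compares them.
  have h5 := jacCoord_eq_zero_of_mem hN (i := Sum.inl (Fin.last (2 * N))) h3
  rw [map_add, map_smul, map_smul, jacCoord_xx, jacCoord_yy, smul_eq_mul, smul_eq_mul] at h5
  have h6 : (4 * (N + 1) * (2 * N + 1) : ℚ) ≠ 0 := by positivity
  refine mul_left_cancel₀ h6 ?_
  linear_combination h5

end Identification

end SemiClosedFormulas

/-! ### The Frobenius structure of the Jacobi algebra -/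

section Frobenius

open MvPolynomial

variable {N : ℕ}

theorem algebraMap_two_mul_add_one (B : Type) [CommRing B] [Algebra ℚ B] :
    algebraMap ℚ B (2 * N + 1) = 2 * N + 1 := by
  rw [map_add, map_mul, map_ofNat, map_natCast, map_one]

section Abstract

variable {A : Type} [CommRing A] [Algebra ℚ A]

/-- The image of the unit under the comultiplication. -/
def copairing (N : ℕ) (x y : A) : A ⊗[ℚ] A := 2 * (y ⊗ₜ[ℚ] y - (2 * N + 1) *
  ∑ i ∈ Finset.range (2 * N + 1), (x ^ i) ⊗ₜ[ℚ] (x ^ (2 * N - i)))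

theorem copairing_eq (x y : A) : copairing N x y = (2 : ℚ) • (y ⊗ₜ[ℚ] y - (2 * N + 1 : ℚ) •
    ∑ i ∈ Finset.range (2 * N + 1), (x ^ i) ⊗ₜ[ℚ] (x ^ (2 * N - i))) := by
  rw [copairing, Algebra.smul_def, Algebra.smul_def, algebraMap_two_mul_add_one, map_ofNat]

theorem tmul_one_mul_copairing (x y a : A) : (a ⊗ₜ[ℚ] 1) * copairing N x y
    = (2 : ℚ) • ((a * y) ⊗ₜ[ℚ] y - (2 * N + 1 : ℚ) •
      ∑ i ∈ Finset.range (2 * N + 1), (a * x ^ i) ⊗ₜ[ℚ] (x ^ (2 * N - i))) := by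
  rw [copairing_eq, mul_smul_comm, mul_sub, mul_smul_comm, Finset.mul_sum]
  simp only [Algebra.TensorProduct.tmul_mul_tmul, one_mul]

variable {x y : A}

/-- Multiplication by `x` on either side kills `y ⊗ y` and one end of the sum, and what remains is
the same shifted sum. -/
theorem left_mul_copairing (hxy : x * y = 0) (hx : x ^ (2 * N + 1) = 0) :
    (x ⊗ₜ[ℚ] 1) * copairing N x y = (1 ⊗ₜ[ℚ] x) * copairing N x y := by
  have h1 : (x ⊗ₜ[ℚ] (1 : A)) * ∑ i ∈ Finset.range (2 * N + 1), (x ^ i) ⊗ₜ[ℚ] (x ^ (2 * N - i))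
      = ∑ i ∈ Finset.range (2 * N), (x ^ (i + 1)) ⊗ₜ[ℚ] (x ^ (2 * N - i)) := by
    rw [Finset.sum_range_succ, mul_add, Algebra.TensorProduct.tmul_mul_tmul, ← pow_succ', hx,
      TensorProduct.zero_tmul, add_zero, Finset.mul_sum]
    refine Finset.sum_congr rfl fun i _ => ?_
    rw [Algebra.TensorProduct.tmul_mul_tmul, ← pow_succ', one_mul]
  have h2 : ((1 : A) ⊗ₜ[ℚ] x) * ∑ i ∈ Finset.range (2 * N + 1), (x ^ i) ⊗ₜ[ℚ] (x ^ (2 * N - i))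
      = ∑ i ∈ Finset.range (2 * N), (x ^ (i + 1)) ⊗ₜ[ℚ] (x ^ (2 * N - i)) := by
    rw [Finset.sum_range_succ', mul_add, Algebra.TensorProduct.tmul_mul_tmul, Nat.sub_zero,
      ← pow_succ' x (2 * N), hx, TensorProduct.tmul_zero, add_zero, Finset.mul_sum]
    refine Finset.sum_congr rfl fun i hi => ?_
    have hi' := Finset.mem_range.1 hi
    rw [Algebra.TensorProduct.tmul_mul_tmul, ← pow_succ', one_mul]
    congr 2
    omega
  have h3 : (x ⊗ₜ[ℚ] (1 : A)) * (y ⊗ₜ[ℚ] y) = 0 := by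
    rw [Algebra.TensorProduct.tmul_mul_tmul, hxy, TensorProduct.zero_tmul]
  have h4 : ((1 : A) ⊗ₜ[ℚ] x) * (y ⊗ₜ[ℚ] y) = 0 := by
    rw [Algebra.TensorProduct.tmul_mul_tmul, hxy, TensorProduct.tmul_zero]
  rw [copairing]
  linear_combination 2 * h3 - 2 * h4 - 2 * (2 * N + 1) * h1 + 2 * (2 * N + 1) * h2

/-- Multiplication by `y` leaves one end term of the sum, and `y²` turns `y ⊗ y` into the end term
which survives on the other side. -/
theorem right_mul_copairing (hxy : x * y = 0)
    (hyy : y * y = -(2 * (N : A) + 1) * x ^ (2 * N)) :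
    (y ⊗ₜ[ℚ] 1) * copairing N x y = (1 ⊗ₜ[ℚ] y) * copairing N x y := by
  have hyx : ∀ i, 1 ≤ i → y * x ^ i = 0 := by
    intro i hi
    obtain ⟨j, rfl⟩ := Nat.exists_eq_add_of_le' hi
    rw [pow_succ', ← mul_assoc, mul_comm (y), hxy, zero_mul]
  have h1 : (y ⊗ₜ[ℚ] (1 : A)) * ∑ i ∈ Finset.range (2 * N + 1), (x ^ i) ⊗ₜ[ℚ] (x ^ (2 * N - i))
      = y ⊗ₜ[ℚ] (x ^ (2 * N)) := by
    rw [Finset.mul_sum, Finset.sum_range_succ', Finset.sum_eq_zero, zero_add,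
      Algebra.TensorProduct.tmul_mul_tmul, pow_zero, mul_one, one_mul, Nat.sub_zero]
    intro i _
    rw [Algebra.TensorProduct.tmul_mul_tmul, hyx _ (by omega), TensorProduct.zero_tmul]
  have h2 : ((1 : A) ⊗ₜ[ℚ] y) * ∑ i ∈ Finset.range (2 * N + 1), (x ^ i) ⊗ₜ[ℚ] (x ^ (2 * N - i))
      = (x ^ (2 * N)) ⊗ₜ[ℚ] y := by
    rw [Finset.mul_sum, Finset.sum_range_succ, Finset.sum_eq_zero, zero_add,
      Algebra.TensorProduct.tmul_mul_tmul, Nat.sub_self, pow_zero, mul_one, one_mul]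
    intro i hi
    have := Finset.mem_range.1 hi
    rw [Algebra.TensorProduct.tmul_mul_tmul, hyx _ (by omega), TensorProduct.tmul_zero]
  have e : (-(2 * (N : A) + 1)) * x ^ (2 * N) = (-(2 * N + 1 : ℚ)) • x ^ (2 * N) := by
    rw [Algebra.smul_def, map_neg, algebraMap_two_mul_add_one]
  have e' : algebraMap ℚ (A ⊗[ℚ] A) (-(2 * N + 1 : ℚ)) = -(2 * N + 1) := by
    rw [map_neg, algebraMap_two_mul_add_one]
  have h3 : (y ⊗ₜ[ℚ] (1 : A)) * (y ⊗ₜ[ℚ] y)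
      = -(2 * N + 1) * ((x ^ (2 * N)) ⊗ₜ[ℚ] y) := by
    rw [Algebra.TensorProduct.tmul_mul_tmul, hyy, e, one_mul, ← TensorProduct.smul_tmul',
      Algebra.smul_def, e']
  have h4 : ((1 : A) ⊗ₜ[ℚ] y) * (y ⊗ₜ[ℚ] y)
      = -(2 * N + 1) * (y ⊗ₜ[ℚ] (x ^ (2 * N))) := by
    rw [Algebra.TensorProduct.tmul_mul_tmul, hyy, e, one_mul, TensorProduct.tmul_smul,
      Algebra.smul_def, e']
  rw [copairing]
  linear_combination 2 * h3 - 2 * h4 - 2 * (2 * N + 1) * h1 + 2 * (2 * N + 1) * h2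

theorem mul_copairing (hxy : x * y = 0)
    (hyy : y * y = -(2 * (N : A) + 1) * x ^ (2 * N)) (hx : x ^ (2 * N + 1) = 0)
    {a : A} (ha : a ∈ Algebra.adjoin ℚ {x, y}) :
    (a ⊗ₜ[ℚ] 1) * copairing N x y = (1 ⊗ₜ[ℚ] a) * copairing N x y := by
  induction ha using Algebra.adjoin_induction with
  | mem a ha =>
    rcases ha with rfl | rfl
    · exact left_mul_copairing hxy hx
    · exact right_mul_copairing hxy hyy
  | algebraMap r => rw [Algebra.algebraMap_eq_smul_one, TensorProduct.smul_tmul]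
  | add a b _ _ ha hb =>
    rw [TensorProduct.add_tmul, TensorProduct.tmul_add, add_mul, add_mul, ha, hb]
  | mul a b _ _ ha hb =>
    have hl : (a * b) ⊗ₜ[ℚ] (1 : A) = (a ⊗ₜ[ℚ] (1 : A)) * (b ⊗ₜ[ℚ] (1 : A)) := by
      rw [Algebra.TensorProduct.tmul_mul_tmul, one_mul]
    have hr : (1 : A) ⊗ₜ[ℚ] (a * b) = ((1 : A) ⊗ₜ[ℚ] a) * ((1 : A) ⊗ₜ[ℚ] b) := by
      rw [Algebra.TensorProduct.tmul_mul_tmul, one_mul]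
    rw [hl, hr, mul_assoc, hb, mul_left_comm, ha]
    ring

/-- The bimodule property reduces to symmetry of the copairing under the generators `x`, `y`. In the
counit identities only the summand with `x²ᴺ` under the trace survives, with coefficient
`-2(2N+1)·(-1/(2(2N+1))) = 1`. -/
theorem comul_counit (hxy : x * y = 0)
    (hyy : y * y = -(2 * (N : A) + 1) * x ^ (2 * N)) (hx : x ^ (2 * N + 1) = 0)
    (ha : ∀ a, a ∈ Algebra.adjoin ℚ {x, y}) {tr : A →ₗ[ℚ] ℚ}
    (hy : tr y = 0) (hp : ∀ i < 2 * N, tr (x ^ i) = 0)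
    (ht : tr (x ^ (2 * N)) = -1 / (2 * (2 * N + 1))) :
    (∀ a b : A, ((a * b) ⊗ₜ[ℚ] 1) * copairing N x y
      = (a ⊗ₜ[ℚ] 1) * ((b ⊗ₜ[ℚ] 1) * copairing N x y)) ∧
    (∀ a b : A, ((a * b) ⊗ₜ[ℚ] 1) * copairing N x y
      = ((a ⊗ₜ[ℚ] 1) * copairing N x y) * (1 ⊗ₜ[ℚ] b)) ∧
    (∀ a, TensorProduct.lid ℚ A (LinearMap.rTensor A tr ((a ⊗ₜ[ℚ] 1) * copairing N x y)) = a) ∧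
    (∀ a, TensorProduct.rid ℚ A (LinearMap.lTensor A tr ((a ⊗ₜ[ℚ] 1) * copairing N x y)) = a) := by
  have hq : (2 * N + 1 : ℚ) ≠ 0 := by positivity
  have hq' : -((2 : ℚ) * (2 * N + 1) * (-1 / (2 * (2 * N + 1)))) = 1 := by field_simp
  have hl : ∀ a b : A, (a * b) ⊗ₜ[ℚ] (1 : A) = (a ⊗ₜ[ℚ] (1 : A)) * (b ⊗ₜ[ℚ] (1 : A)) := by
    intro a b
    rw [Algebra.TensorProduct.tmul_mul_tmul, one_mul]
  have hm : ∀ a : A, (a ⊗ₜ[ℚ] 1) * copairing N x y = (1 ⊗ₜ[ℚ] a) * copairing N x y :=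
    fun a => mul_copairing hxy hyy hx (ha a)
  refine ⟨fun a b => ?_, fun a b => ?_, fun a => ?_, fun a => ?_⟩
  · rw [hl, mul_assoc]
  · rw [hl, mul_assoc, hm b]
    ring
  · rw [hm, copairing_eq, mul_smul_comm, mul_sub, mul_smul_comm, Finset.mul_sum]
    simp only [Algebra.TensorProduct.tmul_mul_tmul, one_mul, map_smul, map_sub, map_sum,
      LinearMap.rTensor_tmul, TensorProduct.lid_tmul, hy]
    rw [Finset.sum_eq_single (2 * N) (fun i hi hi' => by
      rw [hp i (by have := Finset.mem_range.1 hi; omega), zero_smul]) (by simp), ht, Nat.sub_self,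
      pow_zero, mul_one, zero_smul, zero_sub, smul_neg, smul_smul, smul_smul, ← neg_smul, hq',
      one_smul]
  · rw [tmul_one_mul_copairing]
    simp only [map_smul, map_sub, map_sum, LinearMap.lTensor_tmul, TensorProduct.rid_tmul, hy]
    rw [Finset.sum_eq_single 0 (fun i hi hi' => by
      rw [hp _ (by have := Finset.mem_range.1 hi; omega), zero_smul]) (by simp),
      Nat.sub_zero, ht, pow_zero, mul_one, zero_smul, zero_sub, smul_neg, smul_smul, smul_smul,
      ← neg_smul, hq', one_smul]

end Abstract

theorem jx_mul_jy : jx N * jy N = 0 := by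
  rw [jx, jy, ← map_mul, jac_xy]

theorem jy_mul_jy : jy N * jy N = -(2 * (N : Jac N) + 1) * jx N ^ (2 * N) := by
  rw [jx, jy, ← map_mul, ← pow_two, jac_yy, map_pow]

theorem jx_pow : jx N ^ (2 * N + 1) = 0 := by
  rw [jx, ← map_pow, jac_x_pow]

theorem mem_adjoin_jx_jy (a : Jac N) : a ∈ Algebra.adjoin ℚ {jx N, jy N} := by
  obtain ⟨f, rfl⟩ := Ideal.Quotient.mk_surjective a
  induction f using MvPolynomial.induction_on with
  | C r => exact Subalgebra.algebraMap_mem _ r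
  | add f g hf hg => rw [map_add]; exact add_mem hf hg
  | mul_X f v hf =>
    rw [map_mul]
    refine mul_mem hf (Algebra.subset_adjoin ?_)
    rcases v with i | i
    · rw [Subsingleton.elim i 0]; exact .inl rfl
    · rw [Subsingleton.elim i 0]; exact .inr rfl

theorem comul_apply (a : Jac N) : comul N a = (2 : ℚ) • ((a * jy N) ⊗ₜ[ℚ] jy N - (2 * N + 1 : ℚ) •
    ∑ i ∈ Finset.range (2 * N + 1), (a * jx N ^ i) ⊗ₜ[ℚ] (jx N ^ (2 * N - i))) :=
  tmul_one_mul_copairing (jx N) (jy N) a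

/-- The trace of the Jacobi algebra. -/
def jacTrace (hN : 1 ≤ N) : Jac N →ₗ[ℚ] ℚ :=
  (-1 / (2 * (2 * N + 1)) : ℚ) • jacDual hN (Sum.inl (Fin.last (2 * N)))

theorem jacTrace_pow (hN : 1 ≤ N) (i : ℕ) : jacTrace hN (jx N ^ i)
    = if i = 2 * N then (-1 / (2 * (2 * N + 1)) : ℚ) else 0 := by
  have h := jacCoord_pow (N := N) (Sum.inl (Fin.last (2 * N))) i 0
  rw [pow_zero, mul_one] at h
  rw [jacTrace, LinearMap.smul_apply, jx, ← map_pow, jacDual_mk, h]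
  by_cases hi : i = 2 * N <;> simp [jacCoeff, hi]

theorem jacTrace_jy (hN : 1 ≤ N) : jacTrace hN (jy N) = 0 := by
  have h := jacCoord_pow (N := N) (Sum.inl (Fin.last (2 * N))) 0 1
  rw [pow_zero, one_mul, pow_one] at h
  rw [jacTrace, LinearMap.smul_apply, jy, jacDual_mk, h]
  simp [jacCoeff]

theorem isFrobeniusTrace_jacTrace (hN : 1 ≤ N) : IsFrobeniusTrace N (jacTrace hN) := by
  refine ⟨fun i hi => ?_, jacTrace_jy hN, ?_⟩
  · rw [jacTrace_pow, if_neg (by omega)]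
  · rw [jacTrace_pow, if_pos rfl]

theorem isFrobeniusComul_comul (hN : 1 ≤ N) : IsFrobeniusComul (jacTrace hN) (comul N) :=
  comul_counit jx_mul_jy jy_mul_jy jx_pow mem_adjoin_jx_jy (jacTrace_jy hN)
    (isFrobeniusTrace_jacTrace hN).1 (isFrobeniusTrace_jacTrace hN).2.2

end Frobenius

/-! ### Passage to homology -/

section Closed

open MvPolynomial

variable {N : ℕ}

section Abstract

variable {X Y Z : DiffMod 2}

theorem homology_ext {V : Type} {f g : (X.join 0 1).Homology → V}
    (h : ∀ (m : X.carrier) (hm : (X.join 0 1).d (joinMk 0 1 m) = 0),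
      f ((X.join 0 1).cls (joinMk 0 1 m) hm) = g ((X.join 0 1).cls (joinMk 0 1 m) hm)) :
    f = g := by
  funext a
  obtain ⟨⟨z, hz⟩, rfl⟩ := Submodule.Quotient.mk_surjective _ a
  obtain ⟨m, rfl⟩ := Submodule.Quotient.mk_surjective _ z
  exact h m hz

theorem closedMap_add {f g : X.carrier →ₗ[P 2] Y.carrier} (hf : IsChain f) (hg : IsChain g)
    (a : (X.join 0 1).Homology) :
    closedMap (f + g) (hf.add hg) a = closedMap f hf a + closedMap g hg a :=
  congrFun (homology_ext (f := closedMap (f + g) (hf.add hg))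
    (g := fun a => closedMap f hf a + closedMap g hg a) fun _ _ => rfl) a

theorem closedMap_smul {f : X.carrier →ₗ[P 2] Y.carrier} (hf : IsChain f) (r : P 2)
    (a : (X.join 0 1).Homology) :
    closedMap (r • f) (hf.smul r) a = r • closedMap f hf a :=
  congrFun (homology_ext (f := closedMap (r • f) (hf.smul r))
    (g := fun a => r • closedMap f hf a) fun _ _ => rfl) a

theorem closedMap_zero (h : IsChain (X := X) (Y := Y) 0) : closedMap (X := X) (Y := Y) 0 h = 0 :=
  LinearMap.ext fun a => congrFun (homology_ext (f := closedMap (X := X) (Y := Y) 0 h)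
    (g := fun _ => 0) fun _ _ => rfl) a

theorem closedMap_id (a : (X.join 0 1).Homology) :
    closedMap (X := X) (Y := X) LinearMap.id IsChain.id a = a :=
  congrFun (homology_ext (f := closedMap (X := X) (Y := X) LinearMap.id IsChain.id)
    (g := fun a => a) fun _ _ => rfl) a

theorem closedMap_comp {g : Y.carrier →ₗ[P 2] Z.carrier} {f : X.carrier →ₗ[P 2] Y.carrier}
    (hg : IsChain g) (hf : IsChain f) (a : (X.join 0 1).Homology) :
    closedMap (X := X) (Y := Z) (g ∘ₗ f) (hg.comp hf) a = closedMap g hg (closedMap f hf a) :=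
  congrFun (homology_ext (f := closedMap (X := X) (Y := Z) (g ∘ₗ f) (hg.comp hf))
    (g := fun a => closedMap g hg (closedMap f hf a)) fun _ _ => rfl) a

theorem closedMap_congr {f g : X.carrier →ₗ[P 2] Y.carrier} (h : f = g) (hf : IsChain f) 
    (hg : IsChain g) : closedMap f hf = closedMap g hg := by
  subst h
  rfl

theorem closedMap_sum {ι : Type} (s : Finset ι) {f : ι → X.carrier →ₗ[P 2] Y.carrier}
    (hf : ∀ i, IsChain (f i)) (a : (X.join 0 1).Homology) :
    closedMap (∑ i ∈ s, f i) (IsChain.sum s fun i _ => hf i) a = ∑ i ∈ s, closedMap (f i) (hf i) a := by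
  classical
  induction s using Finset.induction_on with
  | empty => exact LinearMap.congr_fun (closedMap_zero _) a
  | insert i s hi ih =>
    rw [Finset.sum_insert (f := fun i => closedMap (f i) (hf i) a) hi, ← ih, ← closedMap_add]
    exact LinearMap.congr_fun (closedMap_congr (Finset.sum_insert hi) _ _) a

/-- On a cycle of the joined factorization the term `u ∘ d` of the homotopy vanishes, and the other
one is a boundary. -/
theorem closedMap_eq_of_homotopic {f g : X.carrier →ₗ[P 2] Y.carrier} {k : ℤ}
    (h : Homotopic N k f g) (hf : IsChain f) (hg : IsChain g) : closedMap f hf = closedMap g hg := by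
  obtain ⟨u, -, e⟩ := h
  refine LinearMap.ext fun a => congrFun (homology_ext (f := closedMap f hf)
    (g := closedMap g hg) fun m hm => ?_) a
  refine (Submodule.Quotient.eq _).2 ⟨joinMap 0 1 u (joinMk 0 1 m), ?_⟩
  have h1 := congrArg (joinMk (X := Y) 0 1) (LinearMap.congr_fun e m)
  have h2 : joinMk (X := Y) 0 1 (u (X.d m)) = 0 := by
    have := congrArg (joinMap 0 1 u) hm
    rw [map_zero] at this
    exact this
  have h3 : joinMk (X := Y) 0 1 (f m) - joinMk 0 1 (g m)
      = joinMk 0 1 (Y.d (u m)) + joinMk 0 1 (u (X.d m)) := h1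
  rw [h2, add_zero] at h3
  exact h3.symm

end Abstract

theorem kunneth_tmul (a c : Unk N) :
    kunneth N (a ⊗ₜ[ℚ] c) = closedMap (tens N c) (tens_isChain N c) a := rfl

/-- The inverse of the Künneth map. -/
def kunnethInv (hN : 1 ≤ N) (u : ((arcUnk N).join 0 1).Homology) : Unk N ⊗[ℚ] Unk N :=
  ∑ i, closedMap (contract N ((unkBasis hN).coord i)) (contract_isChain _) u ⊗ₜ[ℚ] unkBasis hN i

theorem closedMap_contract_tens (f : Unk N →ₗ[ℚ] ℚ) (a c : Unk N) :
    closedMap (contract N f) (contract_isChain f) (closedMap (tens N c) (tens_isChain N c) a)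
      = f c • a := by
  have h : contract N f ∘ₗ tens N c = (C (f c) : P 2) • LinearMap.id := LinearMap.ext fun m =>
    (contract_tens f m c).trans (algebraMap_smul_carrier (X := arcD N) (f c) m).symm
  rw [← closedMap_comp, closedMap_congr h _ (IsChain.id.smul (C (f c))),
    closedMap_smul IsChain.id, closedMap_id]
  exact algebraMap_smul (P 2) (f c) a

/-- The unknot space has a finite basis, so the resolution of the identity of `arc ⊗ Unk` passes to
homology and shows that the contractions with the dual basis invert the map. -/
theorem kunneth_bijective (hN : 1 ≤ N) : Function.Bijective (kunneth N) := by
  have hinv : ∀ t, kunnethInv hN (kunneth N t) = t := by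
    intro t
    induction t with
    | zero => simp [kunnethInv]
    | add t t' h h' =>
      conv_rhs => rw [← h, ← h']
      simp only [kunnethInv, map_add, TensorProduct.add_tmul, Finset.sum_add_distrib]
    | tmul a c =>
      rw [kunneth_tmul, kunnethInv]
      simp only [closedMap_contract_tens, TensorProduct.smul_tmul]
      rw [← TensorProduct.tmul_sum]
      congr 1
      exact (unkBasis hN).sum_repr c
  refine ⟨Function.LeftInverse.injective hinv, fun u => ⟨kunnethInv hN u, ?_⟩⟩
  rw [kunnethInv, map_sum]
  simp only [kunneth_tmul, ← closedMap_comp]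
  rw [← closedMap_sum]
  refine Eq.trans ?_ (closedMap_id u)
  refine LinearMap.congr_fun (closedMap_congr (LinearMap.ext fun t => ?_) _ _) u
  rw [LinearMap.sum_apply]
  exact (arcUnk_eq_sum (unkBasis hN) t).symm

/-! ### The scaled identification of the unknot space with the Jacobi algebra -/

variable (hN : 1 ≤ N) {r : ℚ} (hr : r ≠ 0)

/-- The isomorphism of the Jacobi algebra with the unknot space that sends `1` to `r` times the top
class. -/
def unkScaled : Jac N ≃ₗ[ℚ] Unk N := unkEquiv hN ≪≫ₗ LinearEquiv.smulOfNeZero ℚ (Unk N) r hr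

theorem unkScaled_mk (f : P 1) : unkScaled hN hr (Ideal.Quotient.mk (jacIdeal N) f)
    = (legHom ![0] f : P 2) • (r • topCls N) := by
  rw [smul_comm]
  rfl

theorem unkScaled_mul (f : P 1) (a : Jac N) :
    unkScaled hN hr (a * Ideal.Quotient.mk (jacIdeal N) f)
      = (legHom ![0] f : P 2) • unkScaled hN hr a := by
  obtain ⟨g, rfl⟩ := Ideal.Quotient.mk_surjective a
  rw [← map_mul, unkScaled_mk, unkScaled_mk, mul_comm, map_mul, mul_smul]

/-- The basis of the unknot space made of the multiples of `r` times the top class. -/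
def unkScaledBasis : Module.Basis (Fin (2 * N + 1) ⊕ Unit) ℚ (Unk N) :=
  (jacBasis hN).map (unkScaled hN hr)

theorem unkScaledBasis_apply (i : Fin (2 * N + 1) ⊕ Unit) : unkScaledBasis hN hr i
    = (legHom ![0] (jacMon N i) : P 2) • (r • topCls N) := by
  rw [unkScaledBasis, Module.Basis.map_apply, jacBasis_apply, unkScaled_mk]

theorem unkScaledBasis_coord (i : Fin (2 * N + 1) ⊕ Unit) :
    (unkScaledBasis hN hr).coord i = r⁻¹ • (unkBasis hN).coord i := by
  refine (unkScaledBasis hN hr).ext fun j => ?_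
  have h : unkScaledBasis hN hr j = r • unkBasis hN j := by
    rw [unkScaledBasis_apply, unkBasis_apply, smul_comm]
  rw [Module.Basis.coord_apply, Module.Basis.repr_self, h, LinearMap.smul_apply, map_smul,
    Module.Basis.coord_apply, Module.Basis.repr_self, smul_eq_mul, smul_eq_mul,
    inv_mul_cancel_left₀ hr]

theorem contract_smul (s : ℚ) (f : Unk N →ₗ[ℚ] ℚ) :
    contract N (s • f) = (C s : P 2) • contract N f := by
  refine LinearMap.ext fun t => ?_
  induction t using TensorProduct.induction_on with
  | zero => exact (contract N (s • f)).map_zero.trans ((C s : P 2) • contract N f).map_zero.symm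
  | add t t' h h' =>
    exact ((contract N (s • f)).map_add t t').trans ((congrArg₂ (· + ·) h h').trans
      (((C s : P 2) • contract N f).map_add t t').symm)
  | tmul m c =>
    refine (contract_tmul (s • f) m c).trans (Eq.trans ?_
      (congrArg ((C s : P 2) • ·) (contract_tmul f m c)).symm)
    refine Eq.trans ?_ (algebraMap_smul_carrier (X := arcD N) s _).symm
    rw [LinearMap.smul_apply, smul_eq_mul, mul_smul]

/-- The multiplication scales inversely with the generator because it uses the dual basis, while
`mapD_smul` scales directly; so one choice of generator absorbs both reciprocal scalars. -/
theorem mapM_unkScaledBasis :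
    mapM N (unkScaledBasis hN hr) = (C r⁻¹ : P 2) • mapM N (unkBasis hN) := by
  simp only [mapM_eq_sum, unkScaledBasis_coord, contract_smul, Finset.smul_sum]
  exact Finset.sum_congr rfl fun i _ => smul_comm _ _ _

theorem mapD_smul (s : ℚ) (e : Unk N) : mapD N (s • e) = (C s : P 2) • mapD N e := by
  have h : ∀ f : P 2, tens N (f • s • e) = (C s : P 2) • tens N (f • e) := fun f => by
    rw [smul_comm, tens_smul]
  simp only [mapD, h, smul_sub, smul_smul, Finset.smul_sum]
  congr 1
  · congr 1; ring
  · refine Finset.sum_congr rfl fun i _ => ?_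
    congr 1; ring

theorem closedMap_mapM (u : Jac N ⊗[ℚ] Jac N) :
    closedMap (mapM N (unkScaledBasis hN hr)) (mapM_isChain _)
        (kunneth N (TensorProduct.map (unkScaled hN hr).toLinearMap (unkScaled hN hr).toLinearMap u))
      = unkScaled hN hr (LinearMap.mul' ℚ (Jac N) u) := by
  induction u with
  | zero => simp only [map_zero]
  | add u v hu hv => simp only [map_add, hu, hv]
  | tmul a b =>
    rw [← (jacBasis hN).sum_repr b]
    simp only [TensorProduct.tmul_sum, TensorProduct.tmul_smul, map_sum, map_smul]
    refine Finset.sum_congr rfl fun i _ => ?_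
    rw [LinearMap.map_smul_of_tower]
    congr 1
    rw [TensorProduct.map_tmul, kunneth_tmul, LinearMap.mul'_apply, jacBasis_apply, unkScaled_mul]
    have h := mapM_tens (unkScaledBasis hN hr) i
    rw [unkScaledBasis_apply, ← unkScaled_mk hN hr] at h
    rw [LinearEquiv.coe_coe, ← closedMap_comp, closedMap_congr h _ (IsChain.id.smul _),
      closedMap_smul IsChain.id, closedMap_id]

theorem mapD_eq (e : Unk N) : mapD N e = (2 : P 2) • ((yv 0 : P 2) • tens N ((yv 0 : P 2) • e)
    + (-(2 * N + 1) : P 2) • ∑ i ∈ Finset.range (2 * N + 1),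
        (xv 0 : P 2) ^ i • tens N ((xv 0 : P 2) ^ (2 * N - i) • e)) := by
  rw [mapD, neg_smul, sub_eq_add_neg]

theorem mapD_isChain (e : Unk N) : IsChain (mapD N e) := by
  rw [mapD_eq]
  exact (((tens_isChain N _).smul _).add ((IsChain.sum _ fun i _ =>
    (tens_isChain N _).smul _).smul _)).smul _

theorem closedMap_mapD (a : Jac N) :
    closedMap (mapD N (r • topCls N)) (mapD_isChain _) (unkScaled hN hr a)
      = kunneth N (TensorProduct.map (unkScaled hN hr).toLinearMap (unkScaled hN hr).toLinearMap
          (comul N a)) := by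
  have hc : ∀ f c : Unk N, ∀ g : P 2, g • closedMap (tens N c) (tens_isChain N c) f = kunneth N ((g • f) ⊗ₜ[ℚ] c) :=
    fun f c g => ((closedMap (tens N c) (tens_isChain N c)).map_smul g f).symm
  have hx : ∀ i : ℕ, unkScaled hN hr (jx N ^ i) = (xv 0 : P 2) ^ i • (r • topCls N) := fun i => by
    rw [jx, ← map_pow, unkScaled_mk, map_pow, legHom_xv]; rfl
  have hy : unkScaled hN hr (jy N) = (yv 0 : P 2) • (r • topCls N) := by
    rw [jy, unkScaled_mk, legHom_yv]; rfl
  have hax : ∀ i : ℕ, unkScaled hN hr (a * jx N ^ i) = (xv 0 : P 2) ^ i • unkScaled hN hr a := fun i => by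
    rw [jx, ← map_pow, unkScaled_mul, map_pow, legHom_xv]; rfl
  have hay : unkScaled hN hr (a * jy N) = (yv 0 : P 2) • unkScaled hN hr a := by
    rw [jy, unkScaled_mul, legHom_yv]; rfl
  have h2 : ∀ z : ((arcUnk N).join 0 1).Homology, (2 : P 2) • z = (2 : ℚ) • z := fun z => by
    rw [← algebraMap_smul (P 2) (2 : ℚ) z, map_ofNat]
  have hn : ∀ z : ((arcUnk N).join 0 1).Homology,
      (-(2 * N + 1) : P 2) • z = -((2 * N + 1 : ℚ) • z) := fun z => by
    rw [neg_smul, ← algebraMap_smul (P 2) (2 * N + 1 : ℚ) z, algebraMap_two_mul_add_one]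
  have h0 := tens_isChain N ((yv 0 : P 2) • (r • topCls N))
  have hs : ∀ i : ℕ, IsChain ((xv 0 : P 2) ^ i • tens N ((xv 0 : P 2) ^ (2 * N - i) • (r • topCls N))) :=
    fun i => (tens_isChain N _).smul _
  have hS := IsChain.sum (Finset.range (2 * N + 1)) fun i _ => hs i
  rw [closedMap_congr (mapD_eq _) _ (((h0.smul _).add (hS.smul _)).smul _),
    closedMap_smul ((h0.smul _).add (hS.smul _)), closedMap_add (h0.smul _) (hS.smul _),
    closedMap_smul h0, closedMap_smul hS, closedMap_sum _ hs, comul_apply, h2, hn, ← sub_eq_add_neg]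
  simp only [closedMap_smul (tens_isChain N _), hc, map_smul, map_sub, map_sum,
    TensorProduct.map_tmul, LinearEquiv.coe_coe, hx, hy, hax, hay]

end Closed

/-! ### Assembly of the theorem -/

section Main

open MvPolynomial

variable {N : ℕ}

theorem smul_topCls_rat_mem (r : ℚ) : r • topCls N ∈ unkGr N 0 (-(2 * N)) :=
  Submodule.smul_mem _ r topCls_mem

theorem closedMap_eq_zero_of_homotopic {X Y : DiffMod 2} {f : X.carrier →ₗ[P 2] Y.carrier} {k : ℤ}
    (h : Homotopic N k f 0) (hf : IsChain f) : closedMap f hf = 0 :=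
  (closedMap_eq_of_homotopic h hf (by exact LinearMap.ext fun _ => (map_zero Y.d).symm)).trans
    (closedMap_zero _)

end Main

end SaddleMF

end

theorem mainTheorem1 (N : ℕ) (hN : 1 ≤ N) :
    Nonempty (SaddleMF.Identification N) ∧
    (∃ tr : SaddleMF.Jac N →ₗ[ℚ] ℚ, SaddleMF.IsFrobeniusTrace N tr ∧
      SaddleMF.IsFrobeniusComul tr (SaddleMF.comul N)) ∧
    Function.Bijective (SaddleMF.kunneth N) ∧
    ∀ c : SaddleMF.Identification N,
      SaddleMF.IsSaddle N c.F ∧ SaddleMF.IsSaddle N c.H ∧ SaddleMF.IsSaddle N c.G ∧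
      ∃ (e : SaddleMF.Unk N)
        (b : Module.Basis (Fin (2 * N + 1) ⊕ Unit) ℚ (SaddleMF.Unk N)),
        e ∈ SaddleMF.unkGr N 0 (-(2 * N)) ∧
        (∀ i : Fin (2 * N + 1), b (Sum.inl i) = (SaddleMF.xv 0 : SaddleMF.P 2) ^ (i : ℕ) • e) ∧
        b (Sum.inr ()) = (SaddleMF.yv 0 : SaddleMF.P 2) • e ∧
        SaddleMF.Homotopic N (2 * N) c.F' (SaddleMF.mapM N b) ∧
        SaddleMF.Homotopic N (2 * N) c.H' (SaddleMF.mapD N e) ∧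
        SaddleMF.Homotopic N (2 * N) c.G' 0 ∧
        ∃ (hF : SaddleMF.IsChain c.F') (hH : SaddleMF.IsChain c.H')
          (hG : SaddleMF.IsChain c.G') (κ : SaddleMF.Jac N ≃ₗ[ℚ] SaddleMF.Unk N),
          (∀ f : SaddleMF.P 1,
            κ (Ideal.Quotient.mk (SaddleMF.jacIdeal N) f) = (SaddleMF.legHom ![0] f : SaddleMF.P 2) • e) ∧
          (∀ u : SaddleMF.Jac N ⊗[ℚ] SaddleMF.Jac N,
            SaddleMF.closedMap c.F' hF
                (SaddleMF.kunneth N (TensorProduct.map κ.toLinearMap κ.toLinearMap u))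
              = κ (LinearMap.mul' ℚ (SaddleMF.Jac N) u)) ∧
          (∀ a : SaddleMF.Jac N,
            SaddleMF.closedMap c.H' hH (κ a)
              = SaddleMF.kunneth N
                  (TensorProduct.map κ.toLinearMap κ.toLinearMap (SaddleMF.comul N a))) ∧
          SaddleMF.closedMap c.G' hG = 0 := by
  refine ⟨SaddleMF.nonempty_identification hN, ⟨SaddleMF.jacTrace hN,
    SaddleMF.isFrobeniusTrace_jacTrace hN, SaddleMF.isFrobeniusComul_comul hN⟩,
    SaddleMF.kunneth_bijective hN, fun c => ⟨c.isSaddle_F hN, c.isSaddle_H hN, c.isSaddle_G hN, ?_⟩⟩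
  -- The element `e` is `r` times the top class, with the scalar `r` that occurs in `H'`; the scalar
  -- of `F'` is its inverse.
  obtain ⟨r, hr, hF, hH⟩ := c.exists_semiClosed hN
  have hG := c.G'_homotopic hN
  rw [← SaddleMF.mapM_unkScaledBasis hN hr] at hF
  rw [← SaddleMF.mapD_smul] at hH
  refine ⟨r • SaddleMF.topCls N, SaddleMF.unkScaledBasis hN hr, SaddleMF.smul_topCls_rat_mem r,
    fun i => ?_, ?_, hF, hH, hG, c.F'_chain, c.H'_chain, c.G'_chain, SaddleMF.unkScaled hN hr,
    SaddleMF.unkScaled_mk hN hr, fun u => ?_, fun a => ?_,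
    SaddleMF.closedMap_eq_zero_of_homotopic hG _⟩
  · rw [SaddleMF.unkScaledBasis_apply]
    simp [SaddleMF.jacMon]
  · rw [SaddleMF.unkScaledBasis_apply]
    simp [SaddleMF.jacMon]
  · rw [SaddleMF.closedMap_eq_of_homotopic hF c.F'_chain (SaddleMF.mapM_isChain _)]
    exact SaddleMF.closedMap_mapM hN hr u
  · rw [SaddleMF.closedMap_eq_of_homotopic hH c.H'_chain (SaddleMF.mapD_isChain _)]
    exact SaddleMF.closedMap_mapD hN hr a
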